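/- Let $g\ge 6$, let $H$ be a $\mathbb{Q}$-vector space of dimension $2g$ with a symplectic form $(\ \cdot\ )$, and let $\mathrm{Sp}$ be the group of linear automorphisms of $H$ preserving the form. *Hairy Lie graphs.* A hairy Lie graph with $k$ ordered trees consists of $k$ unitrivalent trees, numbered from $1$ to $k$, each with at least one trivalent vertex and with a cyclic orientation at every trivalent vertex, together with $r$ directed "dotted" edges joining $r$ disjoint pairs of univalent vertices, and a colouring by elements of $H$ of the remaining univalent vertices (the leaves). Its Lie degree $n$ is the number of trivalent vertices. Let $C_{k,r}(n)$ be the $\mathbb{Q}$-vector space spanned by the isomorphism classes of these graphs modulo the AS and IHX relations, multilinearity in the colours, and the relation that reversing a dotted edge gives a minus sign. $\mathrm{Sp}$ acts on it through the colours. Put $\mathfrak{h}(n)=C_{1,0}(n)$. *The map $\beta$.* Let $\beta\colon C_{k,r}(n)\to C_{k-1,r-1}(n)$ send a graph, whose dotted edges between the first two trees are directed from the first to the second, to the sum over all these dotted edges of the graph obtained by changing that edge to a solid one (the new tree comes first, followed by the others in their order). Put $$\widetilde\Omega_r(n)=C_{1,r}(n)\big/\beta^{\,n-1}\big(C_{n,r+n-1}(n)\big).$$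 *The traces.* Let $\mathrm{Tr}_r\colon \mathfrak{h}(n)\to C_{1,r}(n)$ send a coloured tree to the sum over all sets of $r$ disjoint unordered pairs of its leaves of the graph in which every chosen pair is joined by a dotted edge, multiplied by $\prod (x\cdot y)$ over the added edges, where $x$ and $y$ are the colours of the initial and the terminal point of the edge. Let $\widetilde{\mathrm{Tr}}_r\colon\mathfrak{h}(n)\to\widetilde\Omega_r(n)$ be its composition with the projection. For $0\le k\le g$ let $[1^k]_{\mathrm{Sp}}$ be the irreducible $\mathrm{Sp}$-module with highest weight the Young diagram with one column of length $k$, i.e. the submodule of $\Lambda^kH$ spanned by the elements $x_1\wedge\dots\wedge x_k$ with $(x_i\cdot x_j)=0$ for all $i,j$; $[0]_{\mathrm{Sp}}=\mathbb{Q}$ is the case $k=0$. **Proposition.** The image of $\mathfrak{h}(6)\cap\operatorname{Ker}\widetilde{\mathrm{Tr}}_1$ under $\widetilde{\mathrm{Tr}}_2\colon \mathfrak{h}(6)\to\widetilde\Omega_2(6)$ contains $[1^4]_{\mathrm{Sp}}\oplus[1^2]_{\mathrm{Sp}}\oplus[0]_{\mathrm{Sp}}$; that is, there is an injective $\mathrm{Sp}$-equivariant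 linear map from $[1^4]_{\mathrm{Sp}}\oplus[1^2]_{\mathrm{Sp}}\oplus[0]_{\mathrm{Sp}}$ to $\widetilde\Omega_2(6)$ whose range lies in this image. -/

import Mathlib

set_option linter.unusedSectionVars false

namespace HairyLie

/-- Planar rooted binary trees with leaves labelled by natural numbers: the rooted trees from which
unitrivalent trees with cyclically oriented vertices are glued. The root is the free end of an
edge, and at the vertex `node A B` the cyclic order is `(A, B, root)`. -/
inductive RTree : Type
  | leaf (i : ℕ) : RTree
  | node (A B : RTree) : RTree

namespace RTree

/-- The leaves, from left to right. -/
def legs : RTree → List ℕ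
  | leaf i => [i]
  | node A B => A.legs ++ B.legs

/-- The number of trivalent vertices. -/
def numTri : RTree → ℕ
  | leaf _ => 0
  | node A B => A.numTri + B.numTri + 1

/-- Relabelling of the leaves. -/
def map (f : ℕ → ℕ) : RTree → RTree
  | leaf i => leaf (f i)
  | node A B => node (A.map f) (B.map f)

/-- `A.subst i S`: graft the root of `S` onto the leaves of `A` labelled `i`. -/
def subst : RTree → ℕ → RTree → RTree
  | leaf j, i, S => if j = i then S else leaf j
  | node A B, i, S => node (A.subst i S) (B.subst i S)

/-- `A.reroot i C`: glue the roots of `A` and `C` together, remove the leaf `i` of `A`,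
and take the edge that ended there as the new root. All cyclic orders are kept. -/
def reroot : RTree → ℕ → RTree → RTree
  | leaf _, _, C => C
  | node A B, i, C => if i ∈ A.legs then A.reroot i (node B C) else B.reroot i (node C A)

theorem reroot_legs (A : RTree) (i : ℕ) (C : RTree) (h : i ∈ A.legs) :
    (i :: (A.reroot i C).legs).Perm (A.legs ++ C.legs) := by
  induction A generalizing C with
  | leaf j =>
    simp only [legs, List.mem_singleton] at h
    subst h
    simp [reroot, legs]
  | node A B ihA ihB =>
    unfold reroot
    split_ifs with hA
    · refine (ihA _ hA).trans ?_
      simp [legs]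
    · have hB : i ∈ B.legs := by simpa [legs, hA] using h
      refine (ihB _ hB).trans ?_
      simp only [legs, ← Multiset.coe_eq_coe, ← Multiset.coe_add]
      abel

theorem reroot_numTri (A : RTree) (i : ℕ) (C : RTree) :
    (A.reroot i C).numTri = A.numTri + C.numTri := by
  induction A generalizing C with
  | leaf j => simp [reroot, numTri]
  | node A B ihA ihB =>
    unfold reroot
    split_ifs with hA
    · rw [ihA]; simp only [numTri]; omega
    · rw [ihB]; simp only [numTri]; omega

theorem subst_of_notMem (A : RTree) (i : ℕ) (S : RTree) (h : i ∉ A.legs) : A.subst i S = A := by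
  induction A with
  | leaf j =>
    simp only [legs, List.mem_singleton] at h
    simp [subst, Ne.symm h]
  | node A B ihA ihB =>
    simp only [legs, List.mem_append, not_or] at h
    simp [subst, ihA h.1, ihB h.2]

theorem map_legs (f : ℕ → ℕ) (A : RTree) : (A.map f).legs = A.legs.map f := by
  induction A with
  | leaf j => rfl
  | node A B ihA ihB => simp [map, legs, ihA, ihB]

theorem map_numTri (f : ℕ → ℕ) (A : RTree) : (A.map f).numTri = A.numTri := by
  induction A with
  | leaf j => rfl
  | node A B ihA ihB => simp [map, numTri, ihA, ihB]

theorem map_reroot (σ : Equiv.Perm ℕ) (A : RTree) (i : ℕ) (C : RTree) :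
    (A.reroot i C).map σ = (A.map σ).reroot (σ i) (C.map σ) := by
  induction A generalizing C with
  | leaf j => rfl
  | node A B ihA ihB =>
    simp only [map, reroot, map_legs, List.mem_map, σ.injective.eq_iff, exists_eq_right]
    split_ifs with h
    · simp [ihA, map]
    · simp [ihB, map]

end RTree

/-- A unitrivalent tree with cyclically oriented trivalent vertices and labelled univalent
vertices, cut open at the midpoint of one of its edges into two rooted trees. Its presentations
that differ by the position of the cut are identified in `Rel` (`swap` and `rot`). -/
structure JTree : Type where
  fst : RTree
  snd : RTree

namespace JTree

/-- The labels of the univalent vertices. -/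
def legs (T : JTree) : List ℕ := T.fst.legs ++ T.snd.legs

/-- The number of trivalent vertices. -/
def numTri (T : JTree) : ℕ := T.fst.numTri + T.snd.numTri

/-- Relabelling of the univalent vertices. -/
def map (f : ℕ → ℕ) (T : JTree) : JTree := ⟨T.fst.map f, T.snd.map f⟩

/-- The rooted tree obtained by removing the univalent vertex `i`; the root is the free end
of the edge that ended at `i`. -/
def cutAt (T : JTree) (i : ℕ) : RTree :=
  if i ∈ T.fst.legs then T.fst.reroot i T.snd else T.snd.reroot i T.fst

/-- The tree obtained from two trees by connecting the edge of `T` ending at the univalent vertex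
`i` and the edge of `U` ending at the univalent vertex `j` to a single edge. -/
def join (T : JTree) (i : ℕ) (U : JTree) (j : ℕ) : JTree := ⟨T.cutAt i, U.cutAt j⟩

theorem cutAt_legs (T : JTree) (i : ℕ) (h : i ∈ T.legs) :
    (i :: (T.cutAt i).legs).Perm T.legs := by
  unfold cutAt legs
  split_ifs with hA
  · exact RTree.reroot_legs _ _ _ hA
  · have hB : i ∈ T.snd.legs := by simpa [legs, hA] using h
    exact (RTree.reroot_legs _ _ _ hB).trans List.perm_append_comm

theorem cutAt_numTri (T : JTree) (i : ℕ) : (T.cutAt i).numTri = T.numTri := by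
  unfold cutAt numTri
  split_ifs
  · exact RTree.reroot_numTri _ _ _
  · rw [RTree.reroot_numTri]; omega

theorem join_legs (T : JTree) (i : ℕ) (U : JTree) (j : ℕ) (hi : i ∈ T.legs) (hj : j ∈ U.legs) :
    (i :: j :: (T.join i U j).legs).Perm (T.legs ++ U.legs) := by
  have h := (cutAt_legs T i hi).append (cutAt_legs U j hj)
  refine List.Perm.trans ?_ h
  simp only [join, legs, ← Multiset.coe_eq_coe, ← Multiset.coe_add, ← Multiset.cons_coe,
    ← Multiset.singleton_add]
  abel

theorem join_numTri (T : JTree) (i : ℕ) (U : JTree) (j : ℕ) :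
    (T.join i U j).numTri = T.numTri + U.numTri := by
  simp [join, numTri, cutAt_numTri]

theorem map_legs (f : ℕ → ℕ) (T : JTree) : (T.map f).legs = T.legs.map f := by
  simp [map, legs, RTree.map_legs]

theorem map_numTri (f : ℕ → ℕ) (T : JTree) : (T.map f).numTri = T.numTri := by
  simp [map, numTri, RTree.map_numTri]

theorem map_cutAt (σ : Equiv.Perm ℕ) (T : JTree) (i : ℕ) :
    (T.cutAt i).map σ = (T.map σ).cutAt (σ i) := by
  simp only [cutAt, map, RTree.map_legs, List.mem_map, σ.injective.eq_iff, exists_eq_right]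
  split_ifs <;> exact RTree.map_reroot _ _ _ _

theorem map_join (σ : Equiv.Perm ℕ) (T : JTree) (i : ℕ) (U : JTree) (j : ℕ) :
    (T.join i U j).map σ = (T.map σ).join (σ i) (U.map σ) (σ j) := by
  simp only [join, ← map_cutAt]
  rfl

end JTree

/-- The set of endpoints of a set of directed edges. -/
def endpoints (D : Finset (ℕ × ℕ)) : Finset ℕ := D.image Prod.fst ∪ D.image Prod.snd

/-- The edges in `D` are not loops and have no endpoint in common. -/
def IsMatching (D : Finset (ℕ × ℕ)) : Prop :=
  (∀ e ∈ D, e.1 ≠ e.2) ∧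
    ∀ e ∈ D, ∀ f ∈ D, e ≠ f → e.1 ≠ f.1 ∧ e.1 ≠ f.2 ∧ e.2 ≠ f.1 ∧ e.2 ≠ f.2

/-- The data of a hairy Lie graph: a list of trees (their numbering is the order in the list), a
set of directed edges, the dotted edges, between univalent vertices, and a colouring of the
univalent vertices by elements of `H`. Only the colours of the leaves, i.e. of the univalent
vertices that are not on a dotted edge, have a meaning; see `Rel.color`. -/
structure Graph (H : Type*) where
  trees : List JTree
  dots : Finset (ℕ × ℕ)
  color : ℕ → H

namespace Graph

variable {H : Type*}

/-- The univalent vertices of all trees. -/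
def legs (X : Graph H) : List ℕ := X.trees.flatMap JTree.legs

/-- The leaves: the univalent vertices that are not on a dotted edge. -/
def hairs (X : Graph H) : Finset ℕ := X.legs.toFinset \ endpoints X.dots

/-- The Lie degree: the total number of trivalent vertices. -/
def lieDegree (X : Graph H) : ℕ := (X.trees.map JTree.numTri).sum

/-- `X` is a hairy Lie graph: distinct univalent vertices have distinct labels, every tree has a
trivalent vertex, and the dotted edges join pairwise distinct univalent vertices. -/
structure IsHairy (X : Graph H) : Prop where
  nodup : X.legs.Nodup
  tri : ∀ T ∈ X.trees, 1 ≤ T.numTri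
  matching : IsMatching X.dots
  sub : endpoints X.dots ⊆ X.legs.toFinset

/-- Relabelling of the univalent vertices. -/
def relabel (σ : Equiv.Perm ℕ) (X : Graph H) : Graph H :=
  ⟨X.trees.map (JTree.map σ), X.dots.image (Prod.map σ σ), X.color ∘ σ.symm⟩

/-- Application of a map to the colours. -/
def recolor {H' : Type*} (φ : H → H') (X : Graph H) : Graph H' := ⟨X.trees, X.dots, φ ∘ X.color⟩

theorem isHairy_recolor {H' : Type*} {φ : H → H'} {X : Graph H} (hX : X.IsHairy) : (X.recolor φ).IsHairy :=
  ⟨hX.nodup, hX.tri, hX.matching, hX.sub⟩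

end Graph

noncomputable section

variable {H H' : Type*} [AddCommGroup H] [Module ℚ H] [AddCommGroup H'] [Module ℚ H']

/-- The defining relations between hairy Lie graphs with ordered trees. -/
inductive Rel : (Graph H →₀ ℚ) → Prop
  /-- A tree may be cut at any edge: exchange of the two halves. -/
  | swap (l₁ l₂ : List JTree) (D : Finset (ℕ × ℕ)) (c : ℕ → H) (A B : RTree)
      (h : Graph.IsHairy ⟨l₁ ++ ⟨A, B⟩ :: l₂, D, c⟩) :
      Rel (.single ⟨l₁ ++ ⟨A, B⟩ :: l₂, D, c⟩ 1 - .single ⟨l₁ ++ ⟨B, A⟩ :: l₂, D, c⟩ 1)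
  /-- A tree may be cut at any edge: moving the cut past a trivalent vertex with cyclic
  order `(A, B, C)`. -/
  | rot (l₁ l₂ : List JTree) (D : Finset (ℕ × ℕ)) (c : ℕ → H) (A B C : RTree)
      (h : Graph.IsHairy ⟨l₁ ++ ⟨.node A B, C⟩ :: l₂, D, c⟩) :
      Rel (.single ⟨l₁ ++ ⟨.node A B, C⟩ :: l₂, D, c⟩ 1
        - .single ⟨l₁ ++ ⟨A, .node B C⟩ :: l₂, D, c⟩ 1)
  /-- The AS relation. -/
  | antisymm (l₁ l₂ : List JTree) (D : Finset (ℕ × ℕ)) (c : ℕ → H) (A B C : RTree)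
      (h : Graph.IsHairy ⟨l₁ ++ ⟨.node A B, C⟩ :: l₂, D, c⟩) :
      Rel (.single ⟨l₁ ++ ⟨.node A B, C⟩ :: l₂, D, c⟩ 1
        + .single ⟨l₁ ++ ⟨.node B A, C⟩ :: l₂, D, c⟩ 1)
  /-- The IHX relation. -/
  | ihx (l₁ l₂ : List JTree) (D : Finset (ℕ × ℕ)) (c : ℕ → H) (A B C E : RTree)
      (h : Graph.IsHairy ⟨l₁ ++ ⟨.node (.node A B) C, E⟩ :: l₂, D, c⟩) :
      Rel (.single ⟨l₁ ++ ⟨.node (.node A B) C, E⟩ :: l₂, D, c⟩ 1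
        + .single ⟨l₁ ++ ⟨.node (.node B C) A, E⟩ :: l₂, D, c⟩ 1
        + .single ⟨l₁ ++ ⟨.node (.node C A) B, E⟩ :: l₂, D, c⟩ 1)
  /-- Additivity in the colour of a leaf. -/
  | add (l : List JTree) (D : Finset (ℕ × ℕ)) (c : ℕ → H) (i : ℕ) (x y : H)
      (h : Graph.IsHairy ⟨l, D, c⟩) (hi : i ∈ Graph.hairs ⟨l, D, c⟩) :
      Rel (.single ⟨l, D, Function.update c i (x + y)⟩ 1
        - .single ⟨l, D, Function.update c i x⟩ 1 - .single ⟨l, D, Function.update c i y⟩ 1)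
  /-- Homogeneity in the colour of a leaf. -/
  | smul (l : List JTree) (D : Finset (ℕ × ℕ)) (c : ℕ → H) (i : ℕ) (a : ℚ) (x : H)
      (h : Graph.IsHairy ⟨l, D, c⟩) (hi : i ∈ Graph.hairs ⟨l, D, c⟩) :
      Rel (.single ⟨l, D, Function.update c i (a • x)⟩ 1
        - a • .single ⟨l, D, Function.update c i x⟩ 1)
  /-- Only the colours of the leaves count. -/
  | color (l : List JTree) (D : Finset (ℕ × ℕ)) (c d : ℕ → H) (h : Graph.IsHairy ⟨l, D, c⟩)
      (hcd : ∀ i ∈ Graph.hairs ⟨l, D, c⟩, c i = d i) :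
      Rel (.single ⟨l, D, c⟩ 1 - .single ⟨l, D, d⟩ 1)
  /-- Switching the direction of a dotted edge gives a minus sign. -/
  | flip (l : List JTree) (D : Finset (ℕ × ℕ)) (c : ℕ → H) (e : ℕ × ℕ)
      (h : Graph.IsHairy ⟨l, D, c⟩) (he : e ∈ D) :
      Rel (.single ⟨l, D, c⟩ 1 + .single ⟨l, insert e.swap (D.erase e), c⟩ 1)
  /-- Isomorphic graphs are identified: the labels of the univalent vertices are only names. -/
  | relabel (σ : Equiv.Perm ℕ) (X : Graph H) (h : X.IsHairy) :
      Rel (.single X 1 - .single (X.relabel σ) 1)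

variable (H) in
/-- The space of linear combinations of hairy Lie graphs with ordered trees, modulo the relations.
Only the subspaces `C H k r n` spanned by genuine hairy Lie graphs are used. -/
abbrev HLG : Type _ := (Graph H →₀ ℚ) ⧸ Submodule.span ℚ {z : Graph H →₀ ℚ | Rel z}

/-- The class of a graph. -/
def of (X : Graph H) : HLG H := Submodule.Quotient.mk (Finsupp.single X 1)

/-- A linear map defined on graphs that respects the relations. -/
def lift {M : Type*} [AddCommGroup M] [Module ℚ M] (F : Graph H → M)
    (hF : ∀ z : Graph H →₀ ℚ, Rel z → Finsupp.linearCombination ℚ F z = 0) : HLG H →ₗ[ℚ] M :=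
  Submodule.liftQ _ (Finsupp.linearCombination ℚ F) (by
    rw [Submodule.span_le]
    exact fun z hz => hF z hz)

@[simp] theorem lift_of {M : Type*} [AddCommGroup M] [Module ℚ M] (F : Graph H → M)
    (hF : ∀ z : Graph H →₀ ℚ, Rel z → Finsupp.linearCombination ℚ F z = 0) (X : Graph H) :
    lift F hF (of X) = F X := by
  simp [lift, of, Submodule.liftQ_apply]

theorem hom_ext {M : Type*} [AddCommGroup M] [Module ℚ M] {f g : HLG H →ₗ[ℚ] M}
    (h : ∀ X, f (of X) = g (of X)) : f = g := by
  apply Submodule.linearMap_qext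
  ext X
  simpa [of] using h X

theorem rel_zero {z : Graph H →₀ ℚ} (hz : Rel z) :
    Finsupp.linearCombination ℚ (of (H := H)) z = 0 := by
  have : Finsupp.linearCombination ℚ (of (H := H)) =
      (Submodule.span ℚ {z : Graph H →₀ ℚ | Rel z}).mkQ := by
    ext X; simp [of]
  rw [this]
  exact (Submodule.Quotient.mk_eq_zero _).2 (Submodule.subset_span hz)

variable (H) in
/-- The space of hairy Lie graphs with `k` ordered trees, `r` dotted edges and Lie degree `n`.
For `k = 1` the ordering is no condition. -/
def C (k r n : ℕ) : Submodule ℚ (HLG H) :=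
  Submodule.span ℚ (of '' {X | X.IsHairy ∧ X.trees.length = k ∧ X.dots.card = r ∧
    X.lieDegree = n})

variable (H) in
/-- The degree `n` part of the Lie algebra of symplectic derivations: linear combinations of
`H`-labelled tree-shaped Jacobi diagrams with `n` trivalent vertices. -/
abbrev frakH (n : ℕ) : Submodule ℚ (HLG H) := C H 1 0 n

/-! Functoriality in the colours -/

theorem recolor_rel (φ : H →ₗ[ℚ] H') (z : Graph H →₀ ℚ) (hz : Rel z) :
    Finsupp.linearCombination ℚ (fun X => of (X.recolor φ)) z = 0 := by
  cases hz with
  | swap l₁ l₂ D c A B h =>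
    simpa [Graph.recolor] using rel_zero (Rel.swap l₁ l₂ D (φ ∘ c) A B (Graph.isHairy_recolor (φ := φ) h))
  | rot l₁ l₂ D c A B C h =>
    simpa [Graph.recolor] using rel_zero (Rel.rot l₁ l₂ D (φ ∘ c) A B C (Graph.isHairy_recolor (φ := φ) h))
  | antisymm l₁ l₂ D c A B C h =>
    simpa [Graph.recolor] using
      rel_zero (Rel.antisymm l₁ l₂ D (φ ∘ c) A B C (Graph.isHairy_recolor (φ := φ) h))
  | ihx l₁ l₂ D c A B C E h =>
    simpa [Graph.recolor] using
      rel_zero (Rel.ihx l₁ l₂ D (φ ∘ c) A B C E (Graph.isHairy_recolor (φ := φ) h))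
  | add l D c i x y h hi =>
    simpa [Graph.recolor, Function.comp_update] using
      rel_zero (Rel.add l D (φ ∘ c) i (φ x) (φ y) (Graph.isHairy_recolor (φ := φ) h) hi)
  | smul l D c i a x h hi =>
    simpa [Graph.recolor, Function.comp_update] using
      rel_zero (Rel.smul l D (φ ∘ c) i a (φ x) (Graph.isHairy_recolor (φ := φ) h) hi)
  | color l D c d h hcd =>
    simpa [Graph.recolor] using
      rel_zero (Rel.color l D (φ ∘ c) (φ ∘ d) (Graph.isHairy_recolor (φ := φ) h)
        (fun i hi => congrArg φ (hcd i hi)))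
  | flip l D c e h he =>
    simpa [Graph.recolor] using
      rel_zero (Rel.flip l D (φ ∘ c) e (Graph.isHairy_recolor (φ := φ) h) he)
  | relabel σ X h =>
    simpa [Graph.recolor, Graph.relabel, Function.comp_assoc] using
      rel_zero (Rel.relabel σ (X.recolor φ) (Graph.isHairy_recolor (φ := φ) h))

/-- A linear map of `H` acts on all colours of a hairy Lie graph. -/
def mapHLG (φ : H →ₗ[ℚ] H') : HLG H →ₗ[ℚ] HLG H' :=
  lift (fun X => of (X.recolor φ)) (recolor_rel φ)

@[simp] theorem mapHLG_of (φ : H →ₗ[ℚ] H') (X : Graph H) :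
    mapHLG φ (of X) = of (X.recolor φ) := lift_of _ _ _

theorem mapHLG_mem_C (φ : H →ₗ[ℚ] H') {k r n : ℕ} {x : HLG H} (hx : x ∈ C H k r n) :
    mapHLG φ x ∈ C H' k r n := by
  have : C H k r n ≤ (C H' k r n).comap (mapHLG φ) := by
    refine Submodule.span_le.2 ?_
    rintro _ ⟨X, ⟨hX, h1, h2, h3⟩, rfl⟩
    simp only [SetLike.mem_coe, Submodule.mem_comap, mapHLG_of]
    exact Submodule.subset_span ⟨_, ⟨Graph.isHairy_recolor hX, h1, h2, h3⟩, rfl⟩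
  exact this hx

end

section

variable {H : Type*}

theorem mem_endpoints {D : Finset (ℕ × ℕ)} {i : ℕ} :
    i ∈ endpoints D ↔ ∃ e ∈ D, e.1 = i ∨ e.2 = i := by
  simp only [endpoints, Finset.mem_union, Finset.mem_image]
  constructor
  · rintro (⟨e, he, h⟩ | ⟨e, he, h⟩)
    · exact ⟨e, he, .inl h⟩
    · exact ⟨e, he, .inr h⟩
  · rintro ⟨e, he, h | h⟩
    · exact .inl ⟨e, he, h⟩
    · exact .inr ⟨e, he, h⟩

theorem IsMatching.mono {D D' : Finset (ℕ × ℕ)} (h : IsMatching D) (hD : D' ⊆ D) :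
    IsMatching D' :=
  ⟨fun e he => h.1 e (hD he), fun e he f hf => h.2 e (hD he) f (hD hf)⟩

theorem endpoints_mono {D D' : Finset (ℕ × ℕ)} (hD : D' ⊆ D) : endpoints D' ⊆ endpoints D :=
  Finset.union_subset_union (Finset.image_subset_image hD) (Finset.image_subset_image hD)

theorem endpoints_erase {D : Finset (ℕ × ℕ)} (h : IsMatching D) {e : ℕ × ℕ} (he : e ∈ D) :
    endpoints (D.erase e) = endpoints D \ {e.1, e.2} := by
  ext i
  simp only [mem_endpoints, Finset.mem_erase, Finset.mem_sdiff, Finset.mem_insert,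
    Finset.mem_singleton, not_or]
  constructor
  · rintro ⟨f, ⟨hfe, hf⟩, hi⟩
    have := h.2 f hf e he hfe
    refine ⟨⟨f, hf, hi⟩, ?_, ?_⟩ <;> rcases hi with rfl | rfl <;> tauto
  · rintro ⟨⟨f, hf, hi⟩, h1, h2⟩
    refine ⟨f, ⟨?_, hf⟩, hi⟩
    rintro rfl
    rcases hi with rfl | rfl <;> tauto

theorem endpoints_flip {D : Finset (ℕ × ℕ)} {e : ℕ × ℕ} (he : e ∈ D) :
    endpoints (insert e.swap (D.erase e)) = endpoints D := by
  ext i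
  simp only [mem_endpoints, Finset.mem_insert, Finset.mem_erase]
  constructor
  · rintro ⟨f, rfl | ⟨_, hf⟩, hi⟩
    · exact ⟨e, he, hi.symm⟩
    · exact ⟨f, hf, hi⟩
  · rintro ⟨f, hf, hi⟩
    by_cases hfe : f = e
    · subst hfe
      exact ⟨f.swap, .inl rfl, hi.symm⟩
    · exact ⟨f, .inr ⟨hfe, hf⟩, hi⟩

theorem IsMatching.flip {D : Finset (ℕ × ℕ)} (h : IsMatching D) {e : ℕ × ℕ} (he : e ∈ D) :
    IsMatching (insert e.swap (D.erase e)) := by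
  constructor
  · intro f hf
    simp only [Finset.mem_insert, Finset.mem_erase] at hf
    rcases hf with rfl | ⟨_, hf⟩
    · exact (h.1 e he).symm
    · exact h.1 f hf
  · intro f hf k hk hfk
    simp only [Finset.mem_insert, Finset.mem_erase] at hf hk
    rcases hf with rfl | ⟨hfe, hf⟩ <;> rcases hk with rfl | ⟨hke, hk⟩
    · exact absurd rfl hfk
    · have := h.2 e he k hk (Ne.symm hke)
      simp only [Prod.fst_swap, Prod.snd_swap]
      tauto
    · have := h.2 f hf e he hfe
      simp only [Prod.fst_swap, Prod.snd_swap]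
      tauto
    · exact h.2 f hf k hk hfk

theorem IsMatching.swap_notMem {D : Finset (ℕ × ℕ)} (h : IsMatching D) {e : ℕ × ℕ} (he : e ∈ D) :
    e.swap ∉ D := by
  intro hs
  by_cases hh : e.swap = e
  · have h1 : e.2 = e.1 := congrArg Prod.fst hh
    exact h.1 e he h1.symm
  · exact (h.2 _ hs _ he hh).2.1 rfl

namespace Graph

/-- Replacing a tree by one with the same univalent vertices. -/
theorem IsHairy.replace {l₁ l₂ : List JTree} {D : Finset (ℕ × ℕ)} {c d : ℕ → H} {T T' : JTree}
    (h : IsHairy ⟨l₁ ++ T :: l₂, D, c⟩) (hp : T'.legs.Perm T.legs) (hn : T'.numTri = T.numTri) :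
    IsHairy ⟨l₁ ++ T' :: l₂, D, d⟩ := by
  have hp' : (legs (H := H) ⟨l₁ ++ T' :: l₂, D, d⟩).Perm (legs (H := H) ⟨l₁ ++ T :: l₂, D, c⟩) := by
    simp only [legs, List.flatMap_append, List.flatMap_cons]
    exact List.Perm.append_left _ (List.Perm.append_right _ hp)
  refine ⟨hp'.nodup_iff.2 h.nodup, ?_, h.matching, ?_⟩
  · intro U hU
    simp only [List.mem_append, List.mem_cons] at hU
    rcases hU with hU | rfl | hU
    · exact h.tri U (by simp [hU])
    · rw [hn]; exact h.tri T (by simp)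
    · exact h.tri U (by simp [hU])
  · rw [List.toFinset_eq_of_perm _ _ hp']; exact h.sub

theorem IsHairy.flip {l : List JTree} {D : Finset (ℕ × ℕ)} {c : ℕ → H} (h : IsHairy ⟨l, D, c⟩)
    {e : ℕ × ℕ} (he : e ∈ D) : IsHairy ⟨l, insert e.swap (D.erase e), c⟩ :=
  ⟨h.nodup, h.tri, h.matching.flip he, (endpoints_flip he).trans_subset h.sub⟩

/-- Connecting the first two trees along a dotted edge. -/
theorem IsHairy.join {T U : JTree} {l : List JTree} {D : Finset (ℕ × ℕ)} {c : ℕ → H}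
    (h : IsHairy ⟨T :: U :: l, D, c⟩) {e : ℕ × ℕ} (he : e ∈ D) {i j : ℕ} (hi : i ∈ T.legs)
    (hj : j ∈ U.legs) (hij : (i, j) = e ∨ (j, i) = e) :
    IsHairy ⟨T.join i U j :: l, D.erase e, c⟩ ∧
      hairs (H := H) ⟨T.join i U j :: l, D.erase e, c⟩ = hairs (H := H) ⟨T :: U :: l, D, c⟩ := by
  have hp : (i :: j :: (legs (H := H) ⟨T.join i U j :: l, D.erase e, c⟩)).Perm
      (legs (H := H) ⟨T :: U :: l, D, c⟩) := by
    simp only [legs, List.flatMap_cons, ← List.append_assoc, ← List.cons_append]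
    exact List.Perm.append_right _ (JTree.join_legs T i U j hi hj)
  have hnd := hp.nodup_iff.2 h.nodup
  have hnd' := hnd
  rw [List.nodup_cons, List.nodup_cons] at hnd'
  have he' : ({e.1, e.2} : Finset ℕ) = {i, j} := by
    rcases hij with rfl | rfl
    · rfl
    · exact Finset.pair_comm _ _
  have hends := endpoints_erase h.matching he
  rw [he'] at hends
  have hL : (legs (H := H) ⟨T :: U :: l, D, c⟩).toFinset =
      insert i (insert j (legs (H := H) ⟨T.join i U j :: l, D.erase e, c⟩).toFinset) := by
    rw [← List.toFinset_eq_of_perm _ _ hp]; simp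
  have hi' : i ∉ (legs (H := H) ⟨T.join i U j :: l, D.erase e, c⟩) :=
    fun hh => hnd'.1 (List.mem_cons_of_mem _ hh)
  have hj' := hnd'.2.1
  have hsub := h.sub
  have hie : i ∈ endpoints D := mem_endpoints.2 ⟨e, he, by rcases hij with rfl | rfl <;> simp⟩
  have hje : j ∈ endpoints D := mem_endpoints.2 ⟨e, he, by rcases hij with rfl | rfl <;> simp⟩
  refine ⟨⟨hnd'.2.2, ?_, h.matching.mono (Finset.erase_subset _ _), ?_⟩, ?_⟩
  · intro V hV
    rcases List.mem_cons.1 hV with rfl | hV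
    · rw [JTree.join_numTri]
      exact le_add_right (h.tri T (by simp))
    · exact h.tri V (by simp [hV])
  · change endpoints (D.erase e) ⊆ _
    rw [hends]
    intro k hk
    simp only [Finset.mem_sdiff, Finset.mem_insert, Finset.mem_singleton, not_or] at hk
    have := hsub hk.1
    rw [hL] at this
    simpa [hk.2.1, hk.2.2] using this
  · ext k
    simp only [hairs, Finset.mem_sdiff, hends, hL, Finset.mem_insert, Finset.mem_singleton, not_and,
      not_or, not_not, List.mem_toFinset]
    constructor
    · rintro ⟨h1, h2⟩
      refine ⟨.inr (.inr h1), fun h3 => ?_⟩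
      by_cases hki : k = i
      · subst hki; exact hi' h1
      · have := h2 h3 hki
        subst this; exact hj' h1
    · rintro ⟨h1, h2⟩
      rcases h1 with rfl | rfl | h1
      · exact absurd hie h2
      · exact absurd hje h2
      · exact ⟨h1, fun h3 => absurd h3 h2⟩

end Graph

end

noncomputable section

variable {H H' : Type*} [AddCommGroup H] [Module ℚ H] [AddCommGroup H'] [Module ℚ H']

/-- The contribution of the dotted edge `e` to `β` of the graph with trees `T, U, l`: if `e` joins
`T` and `U`, then, after directing it from `T` to `U`, it is changed to a solid edge. -/
def betaTerm (T U : JTree) (l : List JTree) (D : Finset (ℕ × ℕ)) (c : ℕ → H) (e : ℕ × ℕ) : HLG H :=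
  if e.1 ∈ T.legs ∧ e.2 ∈ U.legs then of ⟨T.join e.1 U e.2 :: l, D.erase e, c⟩
  else if e.1 ∈ U.legs ∧ e.2 ∈ T.legs then -of ⟨T.join e.2 U e.1 :: l, D.erase e, c⟩
  else 0

/-- The map `β` on graphs. -/
def betaGraph (X : Graph H) : HLG H :=
  match X.trees with
  | T :: U :: l => ∑ e ∈ X.dots, betaTerm T U l X.dots X.color e
  | _ => 0

theorem of_swap {l₁ l₂ : List JTree} {D : Finset (ℕ × ℕ)} {c : ℕ → H} {A B : RTree}
    (h : Graph.IsHairy ⟨l₁ ++ ⟨A, B⟩ :: l₂, D, c⟩) :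
    of ⟨l₁ ++ ⟨A, B⟩ :: l₂, D, c⟩ = of ⟨l₁ ++ ⟨B, A⟩ :: l₂, D, c⟩ := by
  simpa [sub_eq_zero] using rel_zero (Rel.swap l₁ l₂ D c A B h)

theorem of_rot {l₁ l₂ : List JTree} {D : Finset (ℕ × ℕ)} {c : ℕ → H} {A B C : RTree}
    (h : Graph.IsHairy ⟨l₁ ++ ⟨.node A B, C⟩ :: l₂, D, c⟩) :
    of ⟨l₁ ++ ⟨.node A B, C⟩ :: l₂, D, c⟩ = of ⟨l₁ ++ ⟨A, .node B C⟩ :: l₂, D, c⟩ := by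
  simpa [sub_eq_zero] using rel_zero (Rel.rot l₁ l₂ D c A B C h)

theorem of_flip {l : List JTree} {D : Finset (ℕ × ℕ)} {c : ℕ → H} {e : ℕ × ℕ}
    (h : Graph.IsHairy ⟨l, D, c⟩) (he : e ∈ D) :
    of ⟨l, insert e.swap (D.erase e), c⟩ = -of ⟨l, D, c⟩ := by
  have := rel_zero (Rel.flip l D c e h he)
  simp only [map_add, Finsupp.linearCombination_single, one_smul] at this
  exact (neg_eq_of_add_eq_zero_right this).symm

theorem of_color {l : List JTree} {D : Finset (ℕ × ℕ)} {c d : ℕ → H}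
    (h : Graph.IsHairy ⟨l, D, c⟩) (hcd : ∀ i ∈ Graph.hairs ⟨l, D, c⟩, c i = d i) :
    of ⟨l, D, c⟩ = of ⟨l, D, d⟩ := by
  simpa [sub_eq_zero] using rel_zero (Rel.color l D c d h hcd)

theorem of_relabel (σ : Equiv.Perm ℕ) {X : Graph H} (h : X.IsHairy) : of (X.relabel σ) = of X := by
  have := rel_zero (Rel.relabel σ X h)
  simp only [map_sub, Finsupp.linearCombination_single, one_smul, sub_eq_zero] at this
  exact this.symm

/-- Grafting is the same as rerooting, up to the position of the cut. -/
theorem of_reroot {l : List JTree} {D : Finset (ℕ × ℕ)} {c : ℕ → H} (i : ℕ) (S A B : RTree)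
    (hi : i ∈ A.legs) (hnd : A.legs.Nodup)
    (h : Graph.IsHairy ⟨⟨A.reroot i B, S⟩ :: l, D, c⟩) :
    Graph.IsHairy ⟨⟨A.subst i S, B⟩ :: l, D, c⟩ ∧
      of ⟨⟨A.reroot i B, S⟩ :: l, D, c⟩ = of ⟨⟨A.subst i S, B⟩ :: l, D, c⟩ := by
  induction A generalizing B with
  | leaf j =>
    simp only [RTree.legs, List.mem_singleton] at hi
    subst hi
    simp only [RTree.reroot, RTree.subst, if_true] at h ⊢
    refine ⟨h.replace (l₁ := []) ?_ ?_, of_swap (l₁ := []) h⟩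
    · simp only [JTree.legs]; exact List.perm_append_comm
    · simp only [JTree.numTri]; omega
  | node A₁ A₂ ih₁ ih₂ =>
    simp only [RTree.legs, List.nodup_append] at hnd
    unfold RTree.reroot at h ⊢
    by_cases h₁ : i ∈ A₁.legs
    · have h₂ : i ∉ A₂.legs := fun hh => hnd.2.2 i h₁ i hh rfl
      rw [if_pos h₁] at h ⊢
      obtain ⟨hv, heq⟩ := ih₁ _ h₁ hnd.1 h
      rw [heq, RTree.subst, RTree.subst_of_notMem A₂ i S h₂]
      have hv' : Graph.IsHairy ⟨[] ++ ⟨.node (A₁.subst i S) A₂, B⟩ :: l, D, c⟩ := by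
        refine hv.replace (l₁ := []) ?_ ?_
        · simp [JTree.legs, RTree.legs]
        · simp only [JTree.numTri, RTree.numTri]; omega
      exact ⟨hv', (of_rot hv').symm⟩
    · have h₂ : i ∈ A₂.legs := by simpa [RTree.legs, h₁] using hi
      rw [if_neg h₁] at h ⊢
      obtain ⟨hv, heq⟩ := ih₂ _ h₂ hnd.2.1 h
      rw [heq, RTree.subst, RTree.subst_of_notMem A₁ i S h₁]
      have hv1 : Graph.IsHairy ⟨[] ++ ⟨.node B A₁, A₂.subst i S⟩ :: l, D, c⟩ := by
        refine hv.replace (l₁ := []) ?_ ?_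
        · simp only [JTree.legs, RTree.legs]; exact List.perm_append_comm
        · simp only [JTree.numTri, RTree.numTri]; omega
      have hv2 : Graph.IsHairy ⟨[] ++ ⟨B, .node A₁ (A₂.subst i S)⟩ :: l, D, c⟩ := by
        refine hv1.replace (l₁ := []) ?_ ?_
        · simp [JTree.legs, RTree.legs]
        · simp only [JTree.numTri, RTree.numTri]; omega
      have hv3 : Graph.IsHairy ⟨[] ++ ⟨.node A₁ (A₂.subst i S), B⟩ :: l, D, c⟩ := by
        refine hv2.replace (l₁ := []) ?_ ?_
        · simp only [JTree.legs, RTree.legs]; exact List.perm_append_comm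
        · simp only [JTree.numTri, RTree.numTri]; omega
      exact ⟨hv3, (of_swap (l₁ := []) hv).trans ((of_rot hv1).trans (of_swap hv2))⟩

theorem join_comm {T U : JTree} {l : List JTree} {D : Finset (ℕ × ℕ)} {c : ℕ → H} {i j : ℕ}
    (h : Graph.IsHairy ⟨T.join i U j :: l, D, c⟩) :
    of ⟨T.join i U j :: l, D, c⟩ = of ⟨U.join j T i :: l, D, c⟩ :=
  of_swap (l₁ := []) h

/-- Joining `T` to `U` is grafting a rooted tree onto a leaf of `T`. -/
theorem of_join {T U : JTree} {l : List JTree} {D : Finset (ℕ × ℕ)} {c : ℕ → H} {i j : ℕ}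
    (hi : i ∈ T.legs) (hnd : T.legs.Nodup) (h : Graph.IsHairy ⟨T.join i U j :: l, D, c⟩) :
    Graph.IsHairy ⟨⟨T.fst.subst i (U.cutAt j), T.snd.subst i (U.cutAt j)⟩ :: l, D, c⟩ ∧
    of ⟨T.join i U j :: l, D, c⟩ =
      of ⟨⟨T.fst.subst i (U.cutAt j), T.snd.subst i (U.cutAt j)⟩ :: l, D, c⟩ := by
  obtain ⟨A, B⟩ := T
  simp only [JTree.legs, List.nodup_append] at hnd
  simp only [JTree.join, JTree.cutAt.eq_1 ⟨A, B⟩] at h ⊢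
  by_cases hA : i ∈ A.legs
  · have hB : i ∉ B.legs := fun hh => hnd.2.2 i hA i hh rfl
    rw [if_pos hA] at h ⊢
    rw [RTree.subst_of_notMem B i _ hB]
    exact of_reroot i _ A B hA hnd.1 h
  · have hB : i ∈ B.legs := by simpa [JTree.legs, hA] using hi
    rw [if_neg hA] at h ⊢
    rw [RTree.subst_of_notMem A i _ hA]
    obtain ⟨hv, heq⟩ := of_reroot i _ B A hB hnd.2.1 h
    refine ⟨hv.replace (l₁ := []) ?_ ?_, heq.trans (of_swap (l₁ := []) hv)⟩
    · simp only [JTree.legs]; exact List.perm_append_comm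
    · simp only [JTree.numTri]; omega

theorem legs_nodup_fst {T U : JTree} {l : List JTree} {D : Finset (ℕ × ℕ)} {c : ℕ → H}
    (h : Graph.IsHairy ⟨T :: U :: l, D, c⟩) : T.legs.Nodup := by
  have := h.nodup
  simp only [Graph.legs, List.flatMap_cons] at this
  exact this.of_append_left

theorem legs_disjoint {T U : JTree} {l : List JTree} {D : Finset (ℕ × ℕ)} {c : ℕ → H}
    (h : Graph.IsHairy ⟨T :: U :: l, D, c⟩) {i : ℕ} (hi : i ∈ T.legs) : i ∉ U.legs := by
  have := h.nodup
  simp only [Graph.legs, List.flatMap_cons, List.nodup_append] at this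
  exact fun hh => this.2.2 i hi i (by simp [hh]) rfl

/-- Exchanging the first two trees changes the sign of `β`. -/
theorem betaTerm_comm {T U : JTree} {l : List JTree} {D : Finset (ℕ × ℕ)} {c : ℕ → H}
    (h : Graph.IsHairy ⟨T :: U :: l, D, c⟩) {e : ℕ × ℕ} (he : e ∈ D) :
    betaTerm T U l D c e = -betaTerm U T l D c e := by
  unfold betaTerm
  by_cases h1 : e.1 ∈ T.legs ∧ e.2 ∈ U.legs
  · have h2 : ¬(e.1 ∈ U.legs ∧ e.2 ∈ T.legs) := fun h2 => legs_disjoint h h1.1 h2.1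
    rw [if_pos h1, if_neg h2, if_pos h1, neg_neg]
    exact join_comm (h.join he h1.1 h1.2 (.inl rfl)).1
  · by_cases h2 : e.1 ∈ U.legs ∧ e.2 ∈ T.legs
    · rw [if_neg h1, if_pos h2, if_pos h2]
      rw [join_comm (h.join he h2.2 h2.1 (.inr rfl)).1]
    · rw [if_neg h1, if_neg h2, if_neg h2, if_neg h1, neg_zero]

theorem isHairy_exchange {T U : JTree} {l : List JTree} {D : Finset (ℕ × ℕ)} {c : ℕ → H}
    (h : Graph.IsHairy ⟨T :: U :: l, D, c⟩) : Graph.IsHairy ⟨U :: T :: l, D, c⟩ := by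
  have hp : (Graph.legs (H := H) ⟨U :: T :: l, D, c⟩).Perm
      (Graph.legs (H := H) ⟨T :: U :: l, D, c⟩) := by
    simp only [Graph.legs, List.flatMap_cons, ← List.append_assoc]
    exact List.Perm.append_right _ List.perm_append_comm
  refine ⟨hp.nodup_iff.2 h.nodup, fun V hV => h.tri V ?_, h.matching, ?_⟩
  · simp only [List.mem_cons] at hV ⊢; tauto
  · rw [List.toFinset_eq_of_perm _ _ hp]; exact h.sub

theorem betaGraph_comm {T U : JTree} {l : List JTree} {D : Finset (ℕ × ℕ)} {c : ℕ → H}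
    (h : Graph.IsHairy ⟨T :: U :: l, D, c⟩) :
    betaGraph ⟨T :: U :: l, D, c⟩ = -betaGraph ⟨U :: T :: l, D, c⟩ := by
  simp only [betaGraph, ← Finset.sum_neg_distrib]
  exact Finset.sum_congr rfl fun e he => betaTerm_comm h he

/-- A single formula for the contribution of an edge. -/
theorem betaTerm_subst {T U : JTree} {l : List JTree} {D : Finset (ℕ × ℕ)} {c : ℕ → H}
    (h : Graph.IsHairy ⟨T :: U :: l, D, c⟩) {e : ℕ × ℕ} (he : e ∈ D) :
    (∃ (S : RTree) (i : ℕ) (s : ℚ), ∀ T' : JTree, T'.legs.Perm T.legs → T'.numTri = T.numTri →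
      Graph.IsHairy ⟨⟨T'.fst.subst i S, T'.snd.subst i S⟩ :: l, D.erase e, c⟩ ∧
      betaTerm T' U l D c e =
        s • of ⟨⟨T'.fst.subst i S, T'.snd.subst i S⟩ :: l, D.erase e, c⟩) ∨
    ∀ T' : JTree, T'.legs.Perm T.legs → betaTerm T' U l D c e = 0 := by
  by_cases h1 : e.1 ∈ T.legs ∧ e.2 ∈ U.legs
  · refine .inl ⟨U.cutAt e.2, e.1, 1, fun T' hp hn => ?_⟩
    have h' : Graph.IsHairy ⟨T' :: U :: l, D, c⟩ := h.replace (l₁ := []) hp hn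
    have hj := (h'.join he (hp.mem_iff.2 h1.1) h1.2 (.inl rfl)).1
    obtain ⟨hv, heq⟩ := of_join (hp.mem_iff.2 h1.1) (legs_nodup_fst h') hj
    refine ⟨hv, ?_⟩
    rw [betaTerm, if_pos ⟨hp.mem_iff.2 h1.1, h1.2⟩, one_smul, heq]
  · by_cases h2 : e.1 ∈ U.legs ∧ e.2 ∈ T.legs
    · refine .inl ⟨U.cutAt e.1, e.2, -1, fun T' hp hn => ?_⟩
      have h' : Graph.IsHairy ⟨T' :: U :: l, D, c⟩ := h.replace (l₁ := []) hp hn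
      have hj := (h'.join he (hp.mem_iff.2 h2.2) h2.1 (.inr rfl)).1
      obtain ⟨hv, heq⟩ := of_join (hp.mem_iff.2 h2.2) (legs_nodup_fst h') hj
      refine ⟨hv, ?_⟩
      rw [betaTerm, if_neg (by rwa [hp.mem_iff]), if_pos ⟨h2.1, hp.mem_iff.2 h2.2⟩, heq, neg_smul,
        one_smul]
    · refine .inr fun T' hp => ?_
      rw [betaTerm, if_neg (by rwa [hp.mem_iff]), if_neg (by rwa [hp.mem_iff])]

end

noncomputable section

variable {H H' : Type*} [AddCommGroup H] [Module ℚ H] [AddCommGroup H'] [Module ℚ H']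

theorem betaGraph_tree {k : ℕ} (q : Fin k → ℚ) (T : Fin k → JTree) (T₀ : JTree)
    (hp : ∀ a, (T a).legs.Perm T₀.legs) (hn : ∀ a, (T a).numTri = T₀.numTri)
    (hrel : ∀ (l₁ l₂ : List JTree) (D : Finset (ℕ × ℕ)) (c : ℕ → H),
      Graph.IsHairy ⟨l₁ ++ T₀ :: l₂, D, c⟩ → ∑ a, q a • of ⟨l₁ ++ T a :: l₂, D, c⟩ = 0)
    (hsub : ∀ (i : ℕ) (S : RTree) (l₂ : List JTree) (D : Finset (ℕ × ℕ)) (c : ℕ → H),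
      Graph.IsHairy ⟨⟨T₀.fst.subst i S, T₀.snd.subst i S⟩ :: l₂, D, c⟩ →
      ∑ a, q a • of ⟨⟨(T a).fst.subst i S, (T a).snd.subst i S⟩ :: l₂, D, c⟩ = 0)
    (l₁ l₂ : List JTree) (D : Finset (ℕ × ℕ)) (c : ℕ → H)
    (h : Graph.IsHairy ⟨l₁ ++ T₀ :: l₂, D, c⟩) :
    ∑ a, q a • betaGraph ⟨l₁ ++ T a :: l₂, D, c⟩ = 0 := by
  have main : ∀ (U : JTree) (l : List JTree), Graph.IsHairy ⟨T₀ :: U :: l, D, c⟩ →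
      ∑ a, q a • betaGraph ⟨T a :: U :: l, D, c⟩ = 0 := by
    intro U l h
    simp only [betaGraph, Finset.smul_sum]
    rw [Finset.sum_comm]
    refine Finset.sum_eq_zero fun e he => ?_
    rcases betaTerm_subst h he with ⟨S, i, s, hS⟩ | hS
    · rw [Finset.sum_congr rfl fun a _ => by rw [(hS (T a) (hp a) (hn a)).2, smul_comm],
        ← Finset.smul_sum, hsub i S l _ c (hS T₀ (List.Perm.refl _) rfl).1, smul_zero]
    · exact Finset.sum_eq_zero fun a _ => by rw [hS (T a) (hp a), smul_zero]
  match l₁, h with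
  | [], h =>
    match l₂, h with
    | [], h => simp [betaGraph]
    | U :: l, h => exact main U l h
  | [V], h =>
    have h0 := isHairy_exchange h
    have hc : ∀ a, betaGraph (H := H) ⟨[V] ++ T a :: l₂, D, c⟩ =
        -betaGraph ⟨T a :: V :: l₂, D, c⟩ := fun a =>
      betaGraph_comm (isHairy_exchange (h0.replace (l₁ := []) (hp a) (hn a)))
    simp only [hc, smul_neg, Finset.sum_neg_distrib, main V l₂ h0, neg_zero]
  | V :: W :: l, h =>
    simp only [betaGraph, Finset.smul_sum, List.cons_append]
    rw [Finset.sum_comm]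
    refine Finset.sum_eq_zero fun e he => ?_
    unfold betaTerm
    by_cases h1 : e.1 ∈ V.legs ∧ e.2 ∈ W.legs
    · simp only [if_pos h1]
      exact hrel (V.join e.1 W e.2 :: l) l₂ _ c (Graph.IsHairy.join h he h1.1 h1.2 (.inl rfl)).1
    · by_cases h2 : e.1 ∈ W.legs ∧ e.2 ∈ V.legs
      · simp only [if_neg h1, if_pos h2, smul_neg, Finset.sum_neg_distrib, neg_eq_zero]
        exact hrel (V.join e.2 W e.1 :: l) l₂ _ c (Graph.IsHairy.join h he h2.2 h2.1 (.inr rfl)).1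
      · simp [if_neg h1, if_neg h2]

theorem betaTerm_form {T U : JTree} {l : List JTree} {D : Finset (ℕ × ℕ)} {c : ℕ → H}
    (h : Graph.IsHairy ⟨T :: U :: l, D, c⟩) {e : ℕ × ℕ} (he : e ∈ D) :
    (∃ (l' : List JTree) (s : ℚ), Graph.IsHairy ⟨l', D.erase e, c⟩ ∧
      Graph.hairs (H := H) ⟨l', D.erase e, c⟩ = Graph.hairs (H := H) ⟨T :: U :: l, D, c⟩ ∧
      l'.length = l.length + 1 ∧
      (l'.map JTree.numTri).sum = ((T :: U :: l).map JTree.numTri).sum ∧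
      ∀ d : ℕ → H, betaTerm T U l D d e = s • of ⟨l', D.erase e, d⟩) ∨
    ∀ d : ℕ → H, betaTerm T U l D d e = 0 := by
  by_cases h1 : e.1 ∈ T.legs ∧ e.2 ∈ U.legs
  · obtain ⟨hv, hh⟩ := h.join he h1.1 h1.2 (.inl rfl)
    refine .inl ⟨_, 1, hv, hh, rfl, ?_, fun d => by rw [betaTerm, if_pos h1, one_smul]⟩
    simp [JTree.join_numTri, add_assoc]
  · by_cases h2 : e.1 ∈ U.legs ∧ e.2 ∈ T.legs
    · obtain ⟨hv, hh⟩ := h.join he h2.2 h2.1 (.inr rfl)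
      refine .inl ⟨_, -1, hv, hh, rfl, ?_, fun d => by
        rw [betaTerm, if_neg h1, if_pos h2, neg_smul, one_smul]⟩
      simp [JTree.join_numTri, add_assoc]
    · exact .inr fun d => by rw [betaTerm, if_neg h1, if_neg h2]

theorem betaTerm_flip {T U : JTree} {l : List JTree} {D : Finset (ℕ × ℕ)} {c : ℕ → H}
    (h : Graph.IsHairy ⟨T :: U :: l, D, c⟩) {e f : ℕ × ℕ} (he : e ∈ D) (hf : f ∈ D.erase e) :
    betaTerm T U l (insert e.swap (D.erase e)) c f = -betaTerm T U l D c f := by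
  have hf' := Finset.mem_erase.1 hf
  have hsw := h.matching.swap_notMem he
  have hD : (insert e.swap (D.erase e)).erase f = insert e.swap ((D.erase f).erase e) := by
    rw [Finset.erase_insert_of_ne (by rintro rfl; exact hsw hf'.2), Finset.erase_right_comm]
  have hm : e ∈ D.erase f := Finset.mem_erase.2 ⟨hf'.1.symm, he⟩
  unfold betaTerm
  by_cases h1 : f.1 ∈ T.legs ∧ f.2 ∈ U.legs
  · rw [if_pos h1, if_pos h1, hD, of_flip (h.join hf'.2 h1.1 h1.2 (.inl rfl)).1 hm]
  · by_cases h2 : f.1 ∈ U.legs ∧ f.2 ∈ T.legs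
    · rw [if_neg h1, if_pos h2, if_neg h1, if_pos h2, hD,
        of_flip (h.join hf'.2 h2.2 h2.1 (.inr rfl)).1 hm]
    · rw [if_neg h1, if_neg h2, if_neg h1, if_neg h2, neg_zero]

theorem betaTerm_flip_self {T U : JTree} {l : List JTree} {D : Finset (ℕ × ℕ)} {c : ℕ → H}
    (h : Graph.IsHairy ⟨T :: U :: l, D, c⟩) {e : ℕ × ℕ} (he : e ∈ D) :
    betaTerm T U l (insert e.swap (D.erase e)) c e.swap = -betaTerm T U l D c e := by
  have hsw : e.swap ∉ D.erase e := fun hh =>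
    h.matching.swap_notMem he (Finset.mem_of_mem_erase hh)
  unfold betaTerm
  rw [Finset.erase_insert hsw]
  simp only [Prod.fst_swap, Prod.snd_swap]
  by_cases h1 : e.1 ∈ T.legs ∧ e.2 ∈ U.legs
  · have h2 : ¬(e.2 ∈ T.legs ∧ e.1 ∈ U.legs) := fun h2 => legs_disjoint h h1.1 h2.2
    rw [if_neg h2, if_pos h1.symm, if_pos h1]
  · have h1' : ¬(e.2 ∈ U.legs ∧ e.1 ∈ T.legs) := fun hh => h1 hh.symm
    by_cases h2 : e.1 ∈ U.legs ∧ e.2 ∈ T.legs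
    · rw [if_pos h2.symm, if_neg h1, if_pos h2, neg_neg]
    · have h2' : ¬(e.2 ∈ T.legs ∧ e.1 ∈ U.legs) := fun hh => h2 hh.symm
      rw [if_neg h2', if_neg h1', if_neg h1, if_neg h2, neg_zero]

theorem prodMap_injective (σ : Equiv.Perm ℕ) : Function.Injective (Prod.map σ σ) :=
  σ.injective.prodMap σ.injective

theorem betaTerm_relabel (σ : Equiv.Perm ℕ) {T U : JTree} {l : List JTree} {D : Finset (ℕ × ℕ)}
    {c : ℕ → H} (h : Graph.IsHairy ⟨T :: U :: l, D, c⟩) {e : ℕ × ℕ} (he : e ∈ D) :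
    betaTerm (T.map σ) (U.map σ) (l.map (JTree.map σ)) (D.image (Prod.map σ σ)) (c ∘ σ.symm)
      (Prod.map σ σ e) = betaTerm T U l D c e := by
  unfold betaTerm
  simp only [JTree.map_legs, List.mem_map, Prod.map_fst, Prod.map_snd, σ.injective.eq_iff,
    exists_eq_right, ← Finset.image_erase (prodMap_injective σ), ← JTree.map_join]
  by_cases h1 : e.1 ∈ T.legs ∧ e.2 ∈ U.legs
  · rw [if_pos h1, if_pos h1, ← of_relabel σ (h.join he h1.1 h1.2 (.inl rfl)).1]
    rfl
  · by_cases h2 : e.1 ∈ U.legs ∧ e.2 ∈ T.legs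
    · rw [if_neg h1, if_pos h2, if_neg h1, if_pos h2,
        ← of_relabel σ (h.join he h2.2 h2.1 (.inr rfl)).1]
      rfl
    · rw [if_neg h1, if_neg h2, if_neg h1, if_neg h2]

/-- `β` respects the relations. -/
theorem betaGraph_rel (z : Graph H →₀ ℚ) (hz : Rel z) :
    Finsupp.linearCombination ℚ (betaGraph (H := H)) z = 0 := by
  cases hz with
  | swap l₁ l₂ D c A B h =>
    have := betaGraph_tree (H := H) ![1, -1] ![⟨A, B⟩, ⟨B, A⟩] ⟨A, B⟩
      (by simpa [Fin.forall_fin_two, JTree.legs] using List.perm_append_comm)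
      (by simp [Fin.forall_fin_two, JTree.numTri, add_comm])
      (fun l₁ l₂ D c h => by
        simpa [sub_eq_add_neg] using rel_zero (Rel.swap l₁ l₂ D c A B h))
      (fun i S l₂ D c h => by
        simpa [sub_eq_add_neg] using rel_zero (Rel.swap [] l₂ D c _ _ h)) l₁ l₂ D c h
    simpa [sub_eq_add_neg] using this
  | rot l₁ l₂ D c A B C h =>
    have := betaGraph_tree (H := H) ![1, -1] ![⟨.node A B, C⟩, ⟨A, .node B C⟩] ⟨.node A B, C⟩
      (by simp [Fin.forall_fin_two, JTree.legs, RTree.legs])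
      (by
        simp only [Fin.forall_fin_two, JTree.numTri, RTree.numTri, Matrix.cons_val_zero,
          Matrix.cons_val_one, true_and]
        omega)
      (fun l₁ l₂ D c h => by
        simpa [sub_eq_add_neg] using rel_zero (Rel.rot l₁ l₂ D c A B C h))
      (fun i S l₂ D c h => by
        simpa [sub_eq_add_neg, RTree.subst] using rel_zero (Rel.rot [] l₂ D c _ _ _ h)) l₁ l₂ D c h
    simpa [sub_eq_add_neg] using this
  | antisymm l₁ l₂ D c A B C h =>
    have := betaGraph_tree (H := H) ![1, 1] ![⟨.node A B, C⟩, ⟨.node B A, C⟩] ⟨.node A B, C⟩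
      (by
        simp only [Fin.forall_fin_two, JTree.legs, RTree.legs, Matrix.cons_val_zero,
          Matrix.cons_val_one, List.Perm.refl, true_and]
        exact List.Perm.append_right _ List.perm_append_comm)
      (by
        simp only [Fin.forall_fin_two, JTree.numTri, RTree.numTri, Matrix.cons_val_zero,
          Matrix.cons_val_one, true_and]
        omega)
      (fun l₁ l₂ D c h => by
        simpa using rel_zero (Rel.antisymm l₁ l₂ D c A B C h))
      (fun i S l₂ D c h => by
        simpa [RTree.subst] using rel_zero (Rel.antisymm [] l₂ D c _ _ _ h)) l₁ l₂ D c h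
    simpa using this
  | ihx l₁ l₂ D c A B C E h =>
    have := betaGraph_tree (H := H) ![1, 1, 1] ![⟨.node (.node A B) C, E⟩, ⟨.node (.node B C) A, E⟩,
        ⟨.node (.node C A) B, E⟩] ⟨.node (.node A B) C, E⟩
      (by
        intro a
        fin_cases a <;>
        · simp only [JTree.legs, RTree.legs, Fin.zero_eta, Fin.mk_one, Fin.reduceFinMk,
            Matrix.cons_val, ← Multiset.coe_eq_coe, ← Multiset.coe_add]
          try abel)
      (by
        intro a
        fin_cases a <;>
        · simp only [JTree.numTri, RTree.numTri, Fin.zero_eta, Fin.mk_one, Fin.reduceFinMk,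
            Matrix.cons_val]
          try omega)
      (fun l₁ l₂ D c h => by
        simpa [Fin.sum_univ_three] using rel_zero (Rel.ihx l₁ l₂ D c A B C E h))
      (fun i S l₂ D c h => by
        simpa [Fin.sum_univ_three, RTree.subst] using rel_zero (Rel.ihx [] l₂ D c _ _ _ _ h))
      l₁ l₂ D c h
    simpa [Fin.sum_univ_three] using this
  | add l D c i x y h hi =>
    simp only [map_sub, Finsupp.linearCombination_single, one_smul]
    match l, h, hi with
    | [], h, hi => simp [betaGraph]
    | [_], h, hi => simp [betaGraph]
    | T :: U :: l, h, hi =>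
      simp only [betaGraph, ← Finset.sum_sub_distrib]
      refine Finset.sum_eq_zero fun e he => ?_
      rcases betaTerm_form h he with ⟨l', s, hv, hh, -, -, hs⟩ | hs
      · have := rel_zero (Rel.add l' _ c i x y hv (hh ▸ hi))
        simp only [map_sub, Finsupp.linearCombination_single, one_smul] at this
        rw [hs, hs, hs, ← smul_sub, ← smul_sub, this, smul_zero]
      · simp [hs]
  | smul l D c i a x h hi =>
    simp only [map_sub, map_smul, Finsupp.linearCombination_single, one_smul]
    match l, h, hi with
    | [], h, hi => simp [betaGraph]
    | [_], h, hi => simp [betaGraph]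
    | T :: U :: l, h, hi =>
      simp only [betaGraph, Finset.smul_sum, ← Finset.sum_sub_distrib]
      refine Finset.sum_eq_zero fun e he => ?_
      rcases betaTerm_form h he with ⟨l', s, hv, hh, -, -, hs⟩ | hs
      · have := rel_zero (Rel.smul l' _ c i a x hv (hh ▸ hi))
        simp only [map_sub, map_smul, Finsupp.linearCombination_single, one_smul] at this
        rw [hs, hs, smul_comm, ← smul_sub, this, smul_zero]
      · simp [hs]
  | color l D c d h hcd =>
    simp only [map_sub, Finsupp.linearCombination_single, one_smul]
    match l, h, hcd with
    | [], h, hi => simp [betaGraph]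
    | [_], h, hi => simp [betaGraph]
    | T :: U :: l, h, hi =>
      simp only [betaGraph, ← Finset.sum_sub_distrib]
      refine Finset.sum_eq_zero fun e he => ?_
      rcases betaTerm_form h he with ⟨l', s, hv, hh, -, -, hs⟩ | hs
      · rw [hs, hs, of_color hv (hh ▸ hi), sub_self]
      · simp [hs]
  | flip l D c e h he =>
    simp only [map_add, Finsupp.linearCombination_single, one_smul]
    match l, h with
    | [], h => simp [betaGraph]
    | [_], h => simp [betaGraph]
    | T :: U :: l, h =>
      have hsw : e.swap ∉ D.erase e := fun hh =>
        h.matching.swap_notMem he (Finset.mem_of_mem_erase hh)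
      simp only [betaGraph]
      rw [Finset.sum_insert hsw, betaTerm_flip_self h he,
        Finset.sum_congr rfl fun f hf => betaTerm_flip h he hf, Finset.sum_neg_distrib,
        ← Finset.add_sum_erase _ _ he]
      abel
  | relabel σ X h =>
    simp only [map_sub, Finsupp.linearCombination_single, one_smul, sub_eq_zero]
    obtain ⟨l, D, c⟩ := X
    match l, h with
    | [], h => simp [betaGraph, Graph.relabel]
    | [_], h => simp [betaGraph, Graph.relabel]
    | T :: U :: l, h =>
      simp only [betaGraph, Graph.relabel, List.map_cons]
      rw [Finset.sum_image (prodMap_injective σ).injOn]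
      exact Finset.sum_congr rfl fun e he => (betaTerm_relabel σ h he).symm

/-- The map `β`, which connects the first two trees along a dotted edge in all possible ways. -/
def beta : HLG H →ₗ[ℚ] HLG H := lift betaGraph betaGraph_rel

@[simp] theorem beta_of (X : Graph H) : beta (of X) = betaGraph X := lift_of _ _ _

theorem beta_mem_C {k r n : ℕ} {x : HLG H} (hx : x ∈ C H (k + 2) (r + 1) n) :
    beta x ∈ C H (k + 1) r n := by
  have : C H (k + 2) (r + 1) n ≤ (C H (k + 1) r n).comap beta := by
    refine Submodule.span_le.2 ?_
    rintro _ ⟨⟨l, D, c⟩, ⟨hX, h1, h2, h3⟩, rfl⟩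
    simp only [SetLike.mem_coe, Submodule.mem_comap, beta_of]
    match l, hX, h1, h3 with
    | T :: U :: l, hX, h1, h3 =>
      refine Submodule.sum_mem _ fun e he => ?_
      rcases betaTerm_form hX he with ⟨l', s, hv, -, hlen, htri, hs⟩ | hs
      · simp only at he
        rw [hs]
        refine Submodule.smul_mem _ _ (Submodule.subset_span ⟨_, ⟨hv, ?_, ?_, ?_⟩, rfl⟩)
        · simp only [List.length_cons] at h1 ⊢; omega
        · simp only at h2 ⊢
          rw [Finset.card_erase_of_mem he, h2]; rfl
        · exact htri.trans h3
      · rw [hs]; exact Submodule.zero_mem _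
  exact this hx

theorem mapHLG_betaGraph (φ : H →ₗ[ℚ] H') (X : Graph H) :
    mapHLG φ (betaGraph X) = betaGraph (X.recolor φ) := by
  obtain ⟨l, D, c⟩ := X
  match l with
  | [] => simp [betaGraph, Graph.recolor]
  | [_] => simp [betaGraph, Graph.recolor]
  | T :: U :: l =>
    simp only [betaGraph, Graph.recolor, map_sum]
    refine Finset.sum_congr rfl fun e _ => ?_
    unfold betaTerm
    split_ifs <;> simp [Graph.recolor]

theorem mapHLG_beta (φ : H →ₗ[ℚ] H') (x : HLG H) : mapHLG φ (beta x) = beta (mapHLG φ x) := by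
  have : mapHLG φ ∘ₗ beta = beta ∘ₗ mapHLG φ := hom_ext fun X => by
    simp [mapHLG_betaGraph]
  exact LinearMap.congr_fun this x

end

instance : DecidablePred IsMatching := fun D => by unfold IsMatching; infer_instance

/-- The ways of choosing `r` disjoint unordered pairs in `s`. Each pair is written with its smaller
element first. -/
def matchings (r : ℕ) (s : Finset ℕ) : Finset (Finset (ℕ × ℕ)) :=
  ((s ×ˢ s).powersetCard r).filter fun M => IsMatching M ∧ ∀ e ∈ M, e.1 < e.2

theorem mem_matchings {r : ℕ} {s : Finset ℕ} {M : Finset (ℕ × ℕ)} :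
    M ∈ matchings r s ↔
      ((∀ e ∈ M, e.1 ∈ s ∧ e.2 ∈ s) ∧ M.card = r) ∧ IsMatching M ∧ ∀ e ∈ M, e.1 < e.2 := by
  simp [matchings, Finset.mem_powersetCard, Finset.subset_iff]

/-- Directing a pair from its smaller to its larger element. -/
def orient (e : ℕ × ℕ) : ℕ × ℕ := if e.1 < e.2 then e else e.swap

theorem orient_eq (e : ℕ × ℕ) : orient e = e ∨ orient e = e.swap := by
  unfold orient; split_ifs <;> simp

theorem orient_lt {e : ℕ × ℕ} (he : e.1 ≠ e.2) : (orient e).1 < (orient e).2 := by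
  unfold orient; split_ifs with h
  · exact h
  · simp only [Prod.fst_swap, Prod.snd_swap]; omega

theorem orient_swap {e : ℕ × ℕ} (he : e.1 ≠ e.2) : orient e.swap = orient e := by
  unfold orient
  simp only [Prod.fst_swap, Prod.snd_swap, Prod.swap_swap]
  split_ifs <;> first | rfl | omega

theorem orient_relabel (σ : Equiv.Perm ℕ) {e : ℕ × ℕ} (he : e.1 < e.2) :
    orient (Prod.map σ.symm σ.symm (orient (Prod.map σ σ e))) = e := by
  have h0 : Prod.map σ.symm σ.symm (Prod.map σ σ e) = e := by ext <;> simp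
  rcases orient_eq (Prod.map σ σ e) with h | h <;> rw [h]
  · rw [h0, orient, if_pos he]
  · have h1 : Prod.map σ.symm σ.symm (Prod.map σ σ e).swap = e.swap := by ext <;> simp
    rw [h1, orient_swap he.ne, orient, if_pos he]

/-- Relabelling of a set of pairs. -/
def relabelPairs (σ : Equiv.Perm ℕ) (M : Finset (ℕ × ℕ)) : Finset (ℕ × ℕ) :=
  (M.image (Prod.map σ σ)).image orient

theorem relabelPairs_symm (σ : Equiv.Perm ℕ) {M : Finset (ℕ × ℕ)} (hM : ∀ e ∈ M, e.1 < e.2) :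
    relabelPairs σ.symm (relabelPairs σ M) = M := by
  simp only [relabelPairs, Finset.image_image]
  conv_rhs => rw [← Finset.image_id (s := M)]
  exact Finset.image_congr fun e he => orient_relabel σ (hM e he)

theorem orient_injOn (σ : Equiv.Perm ℕ) {M : Finset (ℕ × ℕ)} (hM : ∀ e ∈ M, e.1 < e.2) :
    Set.InjOn orient (M.image (Prod.map σ σ) : Finset (ℕ × ℕ)) := by
  intro a ha b hb hab
  simp only [Finset.coe_image, Set.mem_image, Finset.mem_coe] at ha hb
  obtain ⟨a, ha, rfl⟩ := ha
  obtain ⟨b, hb, rfl⟩ := hb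
  rw [← orient_relabel σ (hM a ha), ← orient_relabel σ (hM b hb), hab]

theorem IsMatching.image (σ : Equiv.Perm ℕ) {M : Finset (ℕ × ℕ)} (hM : IsMatching M) :
    IsMatching (M.image (Prod.map σ σ)) := by
  constructor
  · intro e he
    obtain ⟨e, he2, rfl⟩ := Finset.mem_image.1 he
    simpa using hM.1 e he2
  · intro e he f hf hef
    obtain ⟨e, he2, rfl⟩ := Finset.mem_image.1 he
    obtain ⟨f, hf2, rfl⟩ := Finset.mem_image.1 hf
    simpa using hM.2 e he2 f hf2 (fun hh => hef (hh ▸ rfl))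

theorem IsMatching.orient {M : Finset (ℕ × ℕ)} (hM : IsMatching M) :
    IsMatching (M.image orient) := by
  constructor
  · intro e he
    obtain ⟨e, he2, rfl⟩ := Finset.mem_image.1 he
    exact (orient_lt (hM.1 e he2)).ne
  · intro e he f hf hef
    obtain ⟨e, he2, rfl⟩ := Finset.mem_image.1 he
    obtain ⟨f, hf2, rfl⟩ := Finset.mem_image.1 hf
    have := hM.2 e he2 f hf2 (fun hh => hef (hh ▸ rfl))
    rcases orient_eq e with h1 | h1 <;> rcases orient_eq f with h2 | h2 <;> rw [h1, h2] <;>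
      (try simp only [Prod.fst_swap, Prod.snd_swap]) <;> tauto

theorem relabelPairs_mem (σ : Equiv.Perm ℕ) {r : ℕ} {s : Finset ℕ} {M : Finset (ℕ × ℕ)}
    (hM : M ∈ matchings r s) : relabelPairs σ M ∈ matchings r (s.image σ) := by
  rw [mem_matchings] at hM ⊢
  obtain ⟨⟨h1, h2⟩, h3, h4⟩ := hM
  refine ⟨⟨?_, ?_⟩, (h3.image σ).orient, ?_⟩
  · intro e he
    simp only [relabelPairs, Finset.mem_image] at he
    obtain ⟨_, ⟨e, he, rfl⟩, rfl⟩ := he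
    have := h1 e he
    rcases orient_eq (Prod.map σ σ e) with h | h <;> rw [h] <;> simp [this]
  · rw [relabelPairs, Finset.card_image_of_injOn (orient_injOn σ h4),
      Finset.card_image_of_injective _ (prodMap_injective σ), h2]
  · intro e he
    simp only [relabelPairs, Finset.mem_image] at he
    obtain ⟨_, ⟨e, he, rfl⟩, rfl⟩ := he
    exact orient_lt (by simpa using h3.1 e he)

namespace Graph

variable {H : Type*}

theorem endpoints_union (D M : Finset (ℕ × ℕ)) :
    endpoints (D ∪ M) = endpoints D ∪ endpoints M := by
  ext i
  simp only [mem_endpoints, Finset.mem_union, or_and_right, exists_or]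

theorem hairs_union (l : List JTree) (D M : Finset (ℕ × ℕ)) (c : ℕ → H) :
    hairs (H := H) ⟨l, D ∪ M, c⟩ = hairs (H := H) ⟨l, D, c⟩ \ endpoints M := by
  ext i
  simp only [hairs, endpoints_union, Finset.mem_sdiff, Finset.mem_union, not_or, legs]
  tauto

theorem endpoints_subset_of_mem {r : ℕ} {s : Finset ℕ} {M : Finset (ℕ × ℕ)}
    (hM : M ∈ matchings r s) : endpoints M ⊆ s := by
  intro i hi
  obtain ⟨e, he, rfl | rfl⟩ := mem_endpoints.1 hi
  · exact ((mem_matchings.1 hM).1.1 e he).1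
  · exact ((mem_matchings.1 hM).1.1 e he).2

/-- Adding dotted edges between leaves. -/
theorem IsHairy.union {l : List JTree} {D : Finset (ℕ × ℕ)} {c : ℕ → H} (h : IsHairy ⟨l, D, c⟩)
    {r : ℕ} {M : Finset (ℕ × ℕ)} (hM : M ∈ matchings r (hairs ⟨l, D, c⟩)) :
    IsHairy ⟨l, D ∪ M, c⟩ ∧ Disjoint D M := by
  have hend := endpoints_subset_of_mem hM
  have hdis : ∀ e ∈ D, ∀ f ∈ M, e.1 ≠ f.1 ∧ e.1 ≠ f.2 ∧ e.2 ≠ f.1 ∧ e.2 ≠ f.2 := by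
    intro e he f hf
    have h1 := hend (mem_endpoints.2 ⟨f, hf, .inl rfl⟩)
    have h2 := hend (mem_endpoints.2 ⟨f, hf, .inr rfl⟩)
    have h3 : e.1 ∈ endpoints D := mem_endpoints.2 ⟨e, he, .inl rfl⟩
    have h4 : e.2 ∈ endpoints D := mem_endpoints.2 ⟨e, he, .inr rfl⟩
    simp only [hairs, Finset.mem_sdiff] at h1 h2
    refine ⟨fun hh => h1.2 (hh ▸ h3), fun hh => h2.2 (hh ▸ h3), fun hh => h1.2 (hh ▸ h4),
      fun hh => h2.2 (hh ▸ h4)⟩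
  refine ⟨⟨h.nodup, h.tri, ⟨?_, ?_⟩, ?_⟩, ?_⟩
  · intro e he
    rcases Finset.mem_union.1 he with he | he
    · exact h.matching.1 e he
    · exact (mem_matchings.1 hM).2.1.1 e he
  · intro e he f hf hef
    rcases Finset.mem_union.1 he with he | he <;> rcases Finset.mem_union.1 hf with hf | hf
    · exact h.matching.2 e he f hf hef
    · exact hdis e he f hf
    · have := hdis f hf e he
      exact ⟨this.1.symm, this.2.2.1.symm, this.2.1.symm, this.2.2.2.symm⟩
    · exact (mem_matchings.1 hM).2.1.2 e he f hf hef
  · change endpoints (D ∪ M) ⊆ _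
    rw [endpoints_union]
    exact Finset.union_subset h.sub (hend.trans Finset.sdiff_subset)
  · rw [Finset.disjoint_left]
    exact fun e he hf => (hdis e he e hf).1 rfl

theorem hairs_relabel (σ : Equiv.Perm ℕ) (X : Graph H) : (X.relabel σ).hairs = X.hairs.image σ := by
  have h1 : (X.relabel σ).legs = X.legs.map σ := by
    simp only [legs, relabel, List.map_flatMap, List.flatMap_map]
    congr 1; funext T; exact JTree.map_legs σ T
  have h2 : endpoints (X.relabel σ).dots = (endpoints X.dots).image σ := by
    simp only [endpoints, relabel, Finset.image_union, Finset.image_image]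
    rfl
  rw [hairs, hairs, h2, h1, Finset.image_sdiff _ _ σ.injective]
  congr 1
  ext; simp

theorem isHairy_relabel (σ : Equiv.Perm ℕ) {X : Graph H} (h : X.IsHairy) :
    (X.relabel σ).IsHairy := by
  have h1 : (X.relabel σ).legs = X.legs.map σ := by
    simp only [legs, relabel, List.map_flatMap, List.flatMap_map]
    congr 1; funext T; exact JTree.map_legs σ T
  have h2 : endpoints (X.relabel σ).dots = (endpoints X.dots).image σ := by
    simp only [endpoints, relabel, Finset.image_union, Finset.image_image]
    rfl
  refine ⟨?_, ?_, h.matching.image σ, ?_⟩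
  · rw [h1]; exact h.nodup.map σ.injective
  · intro T hT
    obtain ⟨T, hT2, rfl⟩ := List.mem_map.1 hT
    rw [JTree.map_numTri]; exact h.tri T hT2
  · rw [h2, h1]
    intro i hi
    obtain ⟨i, hi2, rfl⟩ := Finset.mem_image.1 hi
    have := h.sub hi2
    simpa using this

end Graph

noncomputable section

variable {H H' : Type*} [AddCommGroup H] [Module ℚ H] [AddCommGroup H'] [Module ℚ H']

/-- The product of the values of the form on the pairs of colours in `M`. -/
def weight (ω : LinearMap.BilinForm ℚ H) (c : ℕ → H) (M : Finset (ℕ × ℕ)) : ℚ :=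
  ∏ e ∈ M, ω (c e.1) (c e.2)

/-- The sum over all ways of adding `r` dotted edges between leaves of a graph, where each added
edge contributes as a factor the value of the form on the colours of its endpoints. -/
def traceGraph (ω : LinearMap.BilinForm ℚ H) (r : ℕ) (X : Graph H) : HLG H :=
  ∑ M ∈ matchings r X.hairs, weight ω X.color M • of ⟨X.trees, X.dots ∪ M, X.color⟩

/-- Changing the direction of added edges does not change their contribution. -/
theorem weight_orient {ω : LinearMap.BilinForm ℚ H} (hω : ω.IsAlt) (l : List JTree) (c : ℕ → H)
    (M D : Finset (ℕ × ℕ)) (hdis : Disjoint D M) (h : Graph.IsHairy ⟨l, D ∪ M, c⟩)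
    (hinj : Set.InjOn orient (M : Set (ℕ × ℕ))) :
    weight ω c (M.image orient) • of ⟨l, D ∪ M.image orient, c⟩ =
      weight ω c M • of ⟨l, D ∪ M, c⟩ := by
  unfold weight
  rw [Finset.prod_image hinj]
  clear hinj
  induction M using Finset.induction_on generalizing D with
  | empty => simp
  | insert e M he ih =>
    rw [Finset.disjoint_insert_right] at hdis
    rw [Finset.prod_insert he, Finset.prod_insert he, Finset.image_insert,
      Finset.union_insert, ← Finset.insert_union]
    have heM : e ∈ D ∪ insert e M := by simp
    rcases orient_eq e with hE | hE
    · rw [hE]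
      have h' : Graph.IsHairy ⟨l, insert e D ∪ M, c⟩ := by
        rwa [Finset.insert_union, ← Finset.union_insert]
      rw [mul_smul, ih (insert e D) (Finset.disjoint_insert_left.2 ⟨he, hdis.2⟩) h', mul_smul,
        Finset.union_insert, Finset.insert_union]
    · have hD : insert e.swap ((D ∪ insert e M).erase e) = insert e.swap D ∪ M := by
        rw [Finset.union_insert, Finset.erase_insert (by simp [he, hdis.1]), Finset.insert_union]
      have h' : Graph.IsHairy ⟨l, insert e.swap D ∪ M, c⟩ := hD ▸ h.flip heM
      have hsw := h.matching.swap_notMem heM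
      have hswM : e.swap ∉ M := fun hh => hsw (by simp [hh])
      rw [hE, mul_smul, ih (insert e.swap D) (Finset.disjoint_insert_left.2 ⟨hswM, hdis.2⟩) h',
        ← hD, of_flip h heM, mul_smul, Prod.fst_swap, Prod.snd_swap, ← hω.neg_eq (c e.1) (c e.2),
        smul_neg, smul_neg, neg_smul, neg_neg]

theorem hairs_congr {l l' : List JTree} {D : Finset (ℕ × ℕ)} {c d : ℕ → H}
    (hp : (Graph.legs (H := H) ⟨l', D, d⟩).Perm (Graph.legs (H := H) ⟨l, D, c⟩)) :
    Graph.hairs (H := H) ⟨l', D, d⟩ = Graph.hairs (H := H) ⟨l, D, c⟩ := by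
  simp only [Graph.hairs, List.toFinset_eq_of_perm _ _ hp]

theorem traceGraph_tree (ω : LinearMap.BilinForm ℚ H) (r : ℕ) {k : ℕ} (q : Fin k → ℚ)
    (T : Fin k → JTree) (T₀ : JTree) (hp : ∀ a, (T a).legs.Perm T₀.legs)
    (l₁ l₂ : List JTree) (D : Finset (ℕ × ℕ)) (c : ℕ → H)
    (hrel : ∀ D : Finset (ℕ × ℕ),
      Graph.IsHairy ⟨l₁ ++ T₀ :: l₂, D, c⟩ → ∑ a, q a • of ⟨l₁ ++ T a :: l₂, D, c⟩ = 0)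
    (h : Graph.IsHairy ⟨l₁ ++ T₀ :: l₂, D, c⟩) :
    ∑ a, q a • traceGraph ω r ⟨l₁ ++ T a :: l₂, D, c⟩ = 0 := by
  have hh : ∀ a, Graph.hairs (H := H) ⟨l₁ ++ T a :: l₂, D, c⟩ =
      Graph.hairs (H := H) ⟨l₁ ++ T₀ :: l₂, D, c⟩ := fun a => hairs_congr (by
    simp only [Graph.legs, List.flatMap_append, List.flatMap_cons]
    exact List.Perm.append_left _ (List.Perm.append_right _ (hp a)))
  simp only [traceGraph, hh, Finset.smul_sum]
  rw [Finset.sum_comm]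
  refine Finset.sum_eq_zero fun M hM => ?_
  simp only [smul_comm (_ : ℚ) (weight ω c M)]
  rw [← Finset.smul_sum, hrel _ (h.union hM).1, smul_zero]

theorem weight_congr (ω : LinearMap.BilinForm ℚ H) {c d : ℕ → H} {M : Finset (ℕ × ℕ)}
    (hcd : ∀ i ∈ endpoints M, c i = d i) : weight ω c M = weight ω d M := by
  refine Finset.prod_congr rfl fun e he => ?_
  rw [hcd _ (mem_endpoints.2 ⟨e, he, .inl rfl⟩), hcd _ (mem_endpoints.2 ⟨e, he, .inr rfl⟩)]

theorem weight_linear (ω : LinearMap.BilinForm ℚ H) (c : ℕ → H) {M : Finset (ℕ × ℕ)}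
    (hM : IsMatching M) {i : ℕ} (hi : i ∈ endpoints M) :
    ∃ L : H →ₗ[ℚ] ℚ, ∀ x, weight ω (Function.update c i x) M = L x := by
  obtain ⟨e, he, hei⟩ := mem_endpoints.1 hi
  have hrest : ∀ x, weight ω (Function.update c i x) (M.erase e) = weight ω c (M.erase e) := by
    refine fun x => weight_congr ω fun j hj => Function.update_of_ne ?_ _ _
    rw [endpoints_erase hM he, Finset.mem_sdiff] at hj
    rintro rfl
    rcases hei with rfl | rfl <;> simp at hj
  have hsplit : ∀ x, weight ω (Function.update c i x) M =
      ω (Function.update c i x e.1) (Function.update c i x e.2) * weight ω c (M.erase e) :=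
    fun x => by rw [← hrest x]; exact (Finset.mul_prod_erase _ _ he).symm
  have hne := hM.1 e he
  rcases hei with rfl | rfl
  · refine ⟨weight ω c (M.erase e) • ω.flip (c e.2), fun x => ?_⟩
    rw [hsplit, Function.update_self, Function.update_of_ne hne.symm]
    simp [mul_comm]
  · refine ⟨weight ω c (M.erase e) • ω (c e.1), fun x => ?_⟩
    rw [hsplit, Function.update_self, Function.update_of_ne hne]
    simp [mul_comm]

/-- The contribution of `M` is linear in the colours of the leaves. -/
theorem traceTerm_linear (ω : LinearMap.BilinForm ℚ H) {r : ℕ} {l : List JTree}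
    {D : Finset (ℕ × ℕ)} {c : ℕ → H} {i : ℕ} (h : Graph.IsHairy ⟨l, D, c⟩)
    (hi : i ∈ Graph.hairs ⟨l, D, c⟩) {M : Finset (ℕ × ℕ)}
    (hM : M ∈ matchings r (Graph.hairs ⟨l, D, c⟩)) :
    ∃ L : H →ₗ[ℚ] HLG H, ∀ x, weight ω (Function.update c i x) M •
      of ⟨l, D ∪ M, Function.update c i x⟩ = L x := by
  have hv := (h.union hM).1
  by_cases hiM : i ∈ endpoints M
  · obtain ⟨L, hL⟩ := weight_linear ω c (mem_matchings.1 hM).2.1 hiM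
    refine ⟨L.smulRight (of ⟨l, D ∪ M, c⟩), fun x => ?_⟩
    rw [hL, LinearMap.smulRight_apply]
    congr 1
    refine (of_color hv fun j hj => ?_).symm
    rw [Graph.hairs_union, Finset.mem_sdiff] at hj
    exact (Function.update_of_ne (fun hh => hj.2 (by rw [hh]; exact hiM)) _ _).symm
  · have hi' : i ∈ Graph.hairs ⟨l, D ∪ M, c⟩ := by
      rw [Graph.hairs_union, Finset.mem_sdiff]; exact ⟨hi, hiM⟩
    have hw : ∀ x, weight ω (Function.update c i x) M = weight ω c M := fun x =>
      weight_congr ω fun j hj => Function.update_of_ne (fun hh => hiM (by rw [← hh]; exact hj)) _ _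
    refine ⟨weight ω c M •
      { toFun := fun x => of ⟨l, D ∪ M, Function.update c i x⟩
        map_add' := fun x y => ?_
        map_smul' := fun a x => ?_ }, fun x => by rw [hw]; rfl⟩
    · have := rel_zero (Rel.add l _ c i x y hv hi')
      simp only [map_sub, Finsupp.linearCombination_single, one_smul] at this
      rw [← sub_eq_zero, ← sub_sub]; exact this
    · have := rel_zero (Rel.smul l _ c i a x hv hi')
      simp only [map_sub, map_smul, Finsupp.linearCombination_single, one_smul] at this
      exact sub_eq_zero.1 this

/-- The trace respects the relations. -/
theorem traceGraph_rel {ω : LinearMap.BilinForm ℚ H} (hω : ω.IsAlt) (r : ℕ) (z : Graph H →₀ ℚ)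
    (hz : Rel z) : Finsupp.linearCombination ℚ (traceGraph ω r) z = 0 := by
  cases hz with
  | swap l₁ l₂ D c A B h =>
    have := traceGraph_tree ω r ![1, -1] ![⟨A, B⟩, ⟨B, A⟩] ⟨A, B⟩
      (by simpa [Fin.forall_fin_two, JTree.legs] using List.perm_append_comm) l₁ l₂ D c
      (fun D h => by simpa [sub_eq_add_neg] using rel_zero (Rel.swap l₁ l₂ D c A B h)) h
    simpa [sub_eq_add_neg] using this
  | rot l₁ l₂ D c A B C h =>
    have := traceGraph_tree ω r ![1, -1] ![⟨.node A B, C⟩, ⟨A, .node B C⟩] ⟨.node A B, C⟩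
      (by simp [Fin.forall_fin_two, JTree.legs, RTree.legs]) l₁ l₂ D c
      (fun D h => by simpa [sub_eq_add_neg] using rel_zero (Rel.rot l₁ l₂ D c A B C h)) h
    simpa [sub_eq_add_neg] using this
  | antisymm l₁ l₂ D c A B C h =>
    have := traceGraph_tree ω r ![1, 1] ![⟨.node A B, C⟩, ⟨.node B A, C⟩] ⟨.node A B, C⟩
      (by
        simp only [Fin.forall_fin_two, JTree.legs, RTree.legs, Matrix.cons_val_zero,
          Matrix.cons_val_one, List.Perm.refl, true_and]
        exact List.Perm.append_right _ List.perm_append_comm) l₁ l₂ D c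
      (fun D h => by simpa using rel_zero (Rel.antisymm l₁ l₂ D c A B C h)) h
    simpa using this
  | ihx l₁ l₂ D c A B C E h =>
    have := traceGraph_tree ω r ![1, 1, 1] ![⟨.node (.node A B) C, E⟩, ⟨.node (.node B C) A, E⟩,
        ⟨.node (.node C A) B, E⟩] ⟨.node (.node A B) C, E⟩
      (by
        intro a
        fin_cases a <;>
        · simp only [JTree.legs, RTree.legs, Fin.zero_eta, Fin.mk_one, Fin.reduceFinMk,
            Matrix.cons_val, ← Multiset.coe_eq_coe, ← Multiset.coe_add]
          try abel) l₁ l₂ D c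
      (fun D h => by
        simpa [Fin.sum_univ_three] using rel_zero (Rel.ihx l₁ l₂ D c A B C E h)) h
    simpa [Fin.sum_univ_three] using this
  | add l D c i x y h hi =>
    simp only [map_sub, Finsupp.linearCombination_single, one_smul]
    have hh : ∀ x, Graph.hairs (H := H) ⟨l, D, Function.update c i x⟩ =
      Graph.hairs (H := H) ⟨l, D, c⟩ := fun _ => rfl
    simp only [traceGraph, hh, ← Finset.sum_sub_distrib]
    refine Finset.sum_eq_zero fun M hM => ?_
    obtain ⟨L, hL⟩ := traceTerm_linear ω h hi hM
    rw [hL, hL, hL, map_add]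
    abel
  | smul l D c i a x h hi =>
    simp only [map_sub, map_smul, Finsupp.linearCombination_single, one_smul]
    have hh : ∀ x, Graph.hairs (H := H) ⟨l, D, Function.update c i x⟩ =
      Graph.hairs (H := H) ⟨l, D, c⟩ := fun _ => rfl
    simp only [traceGraph, hh, Finset.smul_sum, ← Finset.sum_sub_distrib]
    refine Finset.sum_eq_zero fun M hM => ?_
    obtain ⟨L, hL⟩ := traceTerm_linear ω h hi hM
    rw [hL, hL, map_smul, sub_self]
  | color l D c d h hcd =>
    simp only [map_sub, Finsupp.linearCombination_single, one_smul]
    have hh : Graph.hairs (H := H) ⟨l, D, d⟩ = Graph.hairs (H := H) ⟨l, D, c⟩ := rfl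
    simp only [traceGraph, hh, ← Finset.sum_sub_distrib]
    refine Finset.sum_eq_zero fun M hM => ?_
    rw [weight_congr ω fun i hi => hcd i (Graph.endpoints_subset_of_mem hM hi),
      of_color (h.union hM).1 fun i hi => hcd i ?_, sub_self]
    rw [Graph.hairs_union, Finset.mem_sdiff] at hi
    exact hi.1
  | flip l D c e h he =>
    simp only [map_add, Finsupp.linearCombination_single, one_smul]
    have hh : Graph.hairs (H := H) ⟨l, insert e.swap (D.erase e), c⟩ =
        Graph.hairs (H := H) ⟨l, D, c⟩ := by
      simp only [Graph.hairs, endpoints_flip he]; rfl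
    simp only [traceGraph, hh, ← Finset.sum_add_distrib]
    refine Finset.sum_eq_zero fun M hM => ?_
    obtain ⟨hv, hd⟩ := h.union hM
    have heM : e ∉ M := Finset.disjoint_left.1 hd he
    have hD : insert e.swap (D.erase e) ∪ M = insert e.swap ((D ∪ M).erase e) := by
      rw [Finset.erase_union_distrib, Finset.erase_eq_of_notMem heM, Finset.insert_union]
    rw [hD, of_flip hv (Finset.mem_union_left _ he), smul_neg, add_neg_cancel]
  | relabel σ X h =>
    simp only [map_sub, Finsupp.linearCombination_single, one_smul, sub_eq_zero]
    obtain ⟨l, D, c⟩ := X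
    unfold traceGraph
    rw [Graph.hairs_relabel]
    refine Finset.sum_nbij' (relabelPairs σ) (relabelPairs σ.symm) (fun M hM => relabelPairs_mem σ hM)
      (fun M hM => ?_) (fun M hM => relabelPairs_symm σ (mem_matchings.1 hM).2.2)
      (fun M hM => ?_) (fun M hM => ?_)
    · have := relabelPairs_mem σ.symm hM
      rwa [Finset.image_image, Equiv.symm_comp_self, Finset.image_id] at this
    · have := relabelPairs_symm σ.symm (mem_matchings.1 hM).2.2
      rwa [Equiv.symm_symm] at this
    · obtain ⟨hv, hd⟩ := h.union hM
      have hv' := Graph.isHairy_relabel σ hv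
      simp only [Graph.relabel, Finset.image_union] at hv' ⊢
      rw [relabelPairs, weight_orient hω _ _ _ _
        ((Finset.disjoint_image (prodMap_injective σ)).2 hd) hv'
        (orient_injOn σ (mem_matchings.1 hM).2.2)]
      have hr := of_relabel σ hv
      simp only [Graph.relabel, Finset.image_union] at hr
      rw [hr]
      congr 1
      unfold weight
      rw [Finset.prod_image (prodMap_injective σ).injOn]
      simp

/-- The map `Tr_r` on the space of hairy Lie graphs, for an alternating form. -/
def trace (ω : LinearMap.BilinForm ℚ H) (hω : ω.IsAlt) (r : ℕ) : HLG H →ₗ[ℚ] HLG H :=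
  lift (traceGraph ω r) (traceGraph_rel hω r)

@[simp] theorem trace_of (ω : LinearMap.BilinForm ℚ H) (hω : ω.IsAlt) (r : ℕ) (X : Graph H) :
    trace ω hω r (of X) = traceGraph ω r X := lift_of _ _ _

theorem trace_mem_C (ω : LinearMap.BilinForm ℚ H) (hω : ω.IsAlt) (r : ℕ) {k s n : ℕ} {x : HLG H}
    (hx : x ∈ C H k s n) : trace ω hω r x ∈ C H k (s + r) n := by
  have : C H k s n ≤ (C H k (s + r) n).comap (trace ω hω r) := by
    refine Submodule.span_le.2 ?_
    rintro _ ⟨⟨l, D, c⟩, ⟨hX, h1, h2, h3⟩, rfl⟩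
    simp only [SetLike.mem_coe, Submodule.mem_comap, trace_of]
    refine Submodule.sum_mem _ fun M hM => ?_
    obtain ⟨hv, hd⟩ := hX.union hM
    refine Submodule.smul_mem _ _ (Submodule.subset_span ⟨_, ⟨hv, h1, ?_, h3⟩, rfl⟩)
    simp only at h2 ⊢
    rw [Finset.card_union_of_disjoint hd, h2, (mem_matchings.1 hM).1.2]
  exact this hx

end

noncomputable section

variable (H : Type*) [AddCommGroup H] [Module ℚ H]

variable {H} in
theorem beta_pow_mem_C {m r n : ℕ} {x : HLG H} (hx : x ∈ C H (m + 1) (r + m) n) :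
    (beta ^ m) x ∈ C H 1 r n := by
  induction m generalizing x with
  | zero => simpa using hx
  | succ m ih =>
    rw [pow_succ, Module.End.mul_apply]
    exact ih (beta_mem_C hx)

/-- The image of `β ^ (n - 1)`, from the space of `n` ordered tripods with `r + n - 1` dotted edges
to the space of trees of Lie degree `n` with `r` dotted edges. -/
def betaImage (r n : ℕ) : Submodule ℚ (HLG H) := (C H n (r + n - 1) n).map (beta ^ (n - 1))

/-- `β ^ (n - 1)` indeed takes values in the space of trees of degree `n` with `r` dotted edges. -/
theorem betaImage_le {r n : ℕ} (hn : 1 ≤ n) : betaImage H r n ≤ C H 1 r n := by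
  obtain ⟨m, rfl⟩ := Nat.exists_eq_add_of_le' hn
  rintro _ ⟨x, hx, rfl⟩
  exact beta_pow_mem_C hx

/-- The `r`-loop part in Lie degree `n`: the space of trees of Lie degree `n` with `r` dotted edges
modulo the image of `β ^ (n - 1)`. -/
abbrev Omega (r n : ℕ) : Type _ := C H 1 r n ⧸ (betaImage H r n).submoduleOf (C H 1 r n)

variable {H}

/-- The `r`-loop trace from the degree `n` part of `𝔥` to the `r`-loop part in degree `n`. -/
def loopTrace (ω : LinearMap.BilinForm ℚ H) (hω : ω.IsAlt) (r n : ℕ) :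
    frakH H n →ₗ[ℚ] Omega H r n :=
  ((betaImage H r n).submoduleOf (C H 1 r n)).mkQ ∘ₗ
    (trace ω hω r).restrict fun x (hx : x ∈ C H 1 0 n) => by
      simpa using trace_mem_C ω hω r hx

/-- The symplectic group of the form `ω`. -/
def Sp (ω : LinearMap.BilinForm ℚ H) : Subgroup (H ≃ₗ[ℚ] H) where
  carrier := {φ | ∀ x y, ω (φ x) (φ y) = ω x y}
  one_mem' := fun _ _ => rfl
  mul_mem' := fun {φ ψ} hφ hψ x y => (hφ (ψ x) (ψ y)).trans (hψ x y)
  inv_mem' := fun {φ} hφ x y => by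
    rw [← hφ]
    change ω (φ (φ.symm x)) (φ (φ.symm y)) = _
    simp

/-- The action of the symplectic group on the space of hairy Lie graphs through the colours. -/
def hlgRep (ω : LinearMap.BilinForm ℚ H) : Representation ℚ (Sp ω) (HLG H) where
  toFun φ := mapHLG (φ : H ≃ₗ[ℚ] H).toLinearMap
  map_one' := hom_ext fun X => by rw [mapHLG_of]; rfl
  map_mul' φ ψ := hom_ext fun X => by
    rw [Module.End.mul_apply, mapHLG_of, mapHLG_of, mapHLG_of]
    rfl

/-- The space of trees of Lie degree `n` with `r` dotted edges, as a representation. -/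
def treeRep (ω : LinearMap.BilinForm ℚ H) (r n : ℕ) : Representation ℚ (Sp ω) (C H 1 r n) :=
  (hlgRep ω).subrepresentation (C H 1 r n) fun _ _ hx => mapHLG_mem_C _ hx

theorem betaImage_stable (φ : H →ₗ[ℚ] H) {r n : ℕ} {x : HLG H} (hx : x ∈ betaImage H r n) :
    mapHLG φ x ∈ betaImage H r n := by
  obtain ⟨y, hy, rfl⟩ := hx
  refine ⟨mapHLG φ y, mapHLG_mem_C φ hy, ?_⟩
  have : ∀ m (y : HLG H), (beta ^ m) (mapHLG φ y) = mapHLG φ ((beta ^ m) y) := by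
    intro m
    induction m with
    | zero => simp
    | succ m ih =>
      intro y
      rw [pow_succ, Module.End.mul_apply, Module.End.mul_apply, ← mapHLG_beta, ih]
  exact this _ y

/-- The `r`-loop part in Lie degree `n`, as a representation of the symplectic group. -/
def omegaRep (ω : LinearMap.BilinForm ℚ H) (r n : ℕ) : Representation ℚ (Sp ω) (Omega H r n) :=
  (treeRep ω r n).quotient ((betaImage H r n).submoduleOf (C H 1 r n))
    fun _ _ hx => betaImage_stable _ hx

/-- The `k`-th exterior power of `H`, as a representation of the symplectic group. -/
def extRep (ω : LinearMap.BilinForm ℚ H) (k : ℕ) : Representation ℚ (Sp ω) (⋀[ℚ]^k H) where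
  toFun φ := exteriorPower.map k (φ : H ≃ₗ[ℚ] H).toLinearMap
  map_one' := exteriorPower.map_id
  map_mul' φ ψ := by
    rw [Module.End.mul_eq_comp, ← exteriorPower.map_comp]
    rfl

/-- The span of the products `x₁ ∧ ⋯ ∧ x_k` of pairwise orthogonal vectors. If `ω` is symplectic,
then its group acts transitively on the linearly independent such tuples, so this is the
subrepresentation of `⋀^k H` generated by the highest weight vector `a₁ ∧ ⋯ ∧ a_k` for a symplectic
basis `a₁, …, a_g, b₁, …, b_g` with `k ≤ g`. -/
def fundSpace (ω : LinearMap.BilinForm ℚ H) (k : ℕ) : Submodule ℚ (⋀[ℚ]^k H) :=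
  Submodule.span ℚ {t | ∃ x : Fin k → H, (∀ i j, ω (x i) (x j) = 0) ∧
    t = exteriorPower.ιMulti ℚ k x}

theorem extRep_mem (ω : LinearMap.BilinForm ℚ H) (k : ℕ) (φ : Sp ω) :
    fundSpace ω k ≤ (fundSpace ω k).comap (extRep ω k φ) := by
  refine Submodule.span_le.2 ?_
  rintro _ ⟨x, hx, rfl⟩
  refine Submodule.subset_span ⟨(φ : H ≃ₗ[ℚ] H) ∘ x, fun i j => ?_, ?_⟩
  · exact (φ.2 (x i) (x j)).trans (hx i j)
  · exact exteriorPower.map_apply_ιMulti (φ : H ≃ₗ[ℚ] H).toLinearMap x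

/-- The irreducible representation `[1^k]` of the symplectic group, i.e. the one with highest weight
the Young diagram with a single column of length `k`; for `k = 0` it is the trivial one. -/
def fundRep (ω : LinearMap.BilinForm ℚ H) (k : ℕ) : Representation ℚ (Sp ω) (fundSpace ω k) :=
  (extRep ω k).subrepresentation (fundSpace ω k) (extRep_mem ω k)

end

end HairyLie

/-!
The three irreducible summands are reached by trees of degree 6 whose eight leaves carry isotropic
vectors and `m = 2, 3, 4` pairs of dual vectors `e`, `e*`, summed over all choices of `m` different
hyperbolic planes and alternated in the isotropic vectors (`coreElement`; the trees are `coreTrees`).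
Only the dual pairs contribute to the traces, so `Tr_r` of such an element is the sum of the same trees
with `r` of the pairs replaced by dotted edges (`trace_coreElement_one`, `trace_coreElement_two`).

*One loop.* Modulo the image of `β ^ 5`, a tree with one dotted edge depends only on the cyclic word of
the hairs along the path between its ends (`slide_mem`, `treeOf_one_rotate`), so the vanishing of the
one-loop trace is a finite identity between words (`colorSum_oneLoopTrees_mem`).

*Two loops, range.* The two-loop trace is a multilinear map `twoLoopMap` of the four hairs, with the
invariant element `∑ e ⊗ e*` inserted `m - 2` times, except that the planes in the sum are different
from each other and from those of the isotropic vectors. The terms with coinciding planes vanish modulo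
the image of `β ^ 5`, by explicit relations that come from attaching tripods (`twoLoopMap_coincidence`).
So one may sum over a whole symplectic basis (`isTwoLoopTrace_zero`, `_one`, `_two`), the result is
independent of the basis (`IsDualPair.contract_eq`), and `bottomMap` is an equivariant map on
`[1^4] ⊕ [1^2] ⊕ [0]` with values in the required image.

*Two loops, injectivity.* A functional on trees with two dotted edges is obtained by expanding the
tree as a commutator in the free algebra and applying a function `loopWord` of cyclic words, that is
alternating in the hairs. It vanishes on the image of `β ^ 5`: for this one takes off the tripods one
by one (`killsTripods_of`, `killsTripods_hairHom`), which reduces the claim to finitely many identities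
for `loopWord`. Through linear forms `φ` on the colours it becomes a functional `detector φ` on the
graphs over `H`, with `detector φ ∘ twoLoopMap` a nonzero multiple of the determinant of `φ`. Contracting
also `φ` with `∑ e ⊗ e*` isolates first the summand `[0]`, then `[1^2]`, then `[1^4]`
(`eq_zero_of_relation`), as contractions of isotropic vectors are zero.
-/

set_option linter.unusedSectionVars false

noncomputable section

namespace HairyLie

/-! ### Functions on trees that respect the AS and IHX relations -/

/-- A function on trees with values in an abelian group that does not depend on the position of the
cut and satisfies the AS and IHX relations. -/
structure IsTreeFun {M : Type*} [AddCommGroup M] (G : JTree → M) : Prop where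
  swap : ∀ A B, G ⟨A, B⟩ = G ⟨B, A⟩
  rot : ∀ A B C, G ⟨.node A B, C⟩ = G ⟨A, .node B C⟩
  antisymm : ∀ A B C, G ⟨.node A B, C⟩ = -G ⟨.node B A, C⟩
  ihx : ∀ A B C E, G ⟨.node (.node A B) C, E⟩ + G ⟨.node (.node B C) A, E⟩
    + G ⟨.node (.node C A) B, E⟩ = 0

/-- The value of the linear extension of `f` at a formal linear combination of words. -/
def wordSum {M : Type*} [AddCommGroup M] (f : List ℕ → M) (L : List (ℤ × List ℕ)) : M :=
  (L.map fun p => p.1 • f p.2).sum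

/-- The product of formal linear combinations of words. -/
def mulWords (L L' : List (ℤ × List ℕ)) : List (ℤ × List ℕ) :=
  L.flatMap fun p => L'.map fun q => (p.1 * q.1, p.2 ++ q.2)

/-- The negative of a formal linear combination of words. -/
def negWords (L : List (ℤ × List ℕ)) : List (ℤ × List ℕ) := L.map fun p => (-p.1, p.2)

namespace RTree

/-- The expansion of a rooted tree as an iterated commutator of its leaves. -/
def words : RTree → List (ℤ × List ℕ)
  | leaf i => [(1, [i])]
  | node A B => mulWords A.words B.words ++ negWords (mulWords B.words A.words)

/-- The left-normed bracket of `X` and the letters of a word. -/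
def comb (X : RTree) : List ℕ → RTree
  | [] => X
  | i :: w => comb (node X (leaf i)) w

/-- Whether `i` is a leaf, as a Boolean function that evaluates fast. -/
def hasLeg (i : ℕ) : RTree → Bool
  | leaf j => Nat.beq j i
  | node A B => A.hasLeg i || B.hasLeg i

lemma hasLeg_iff {i : ℕ} {A : RTree} : A.hasLeg i = true ↔ i ∈ A.legs := by
  induction A with
  | leaf j =>
    rw [hasLeg, Nat.beq_eq, legs, List.mem_singleton]
    exact eq_comm
  | node A B ihA ihB => simp only [hasLeg, legs, Bool.or_eq_true, List.mem_append, ihA, ihB]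

/-- The coefficients of a rooted tree with a leaf `s` with respect to the left-normed brackets
that start with `s`. -/
def firstWords (s : ℕ) : RTree → List (ℤ × List ℕ)
  | leaf _ => [(1, [])]
  | node A B =>
    bif A.hasLeg s then mulWords (A.firstWords s) B.words
    else negWords (mulWords (B.firstWords s) A.words)

lemma comb_append (X : RTree) (u v : List ℕ) : X.comb (u ++ v) = (X.comb u).comb v := by
  induction u generalizing X with
  | nil => rfl
  | cons i u ih => exact ih _

lemma comb_legs (X : RTree) (w : List ℕ) : (X.comb w).legs = X.legs ++ w := by
  induction w generalizing X with
  | nil => simp [comb]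
  | cons i w ih => simp [comb, ih, legs]

lemma comb_numTri (X : RTree) (w : List ℕ) : (X.comb w).numTri = X.numTri + w.length := by
  induction w generalizing X with
  | nil => simp [comb]
  | cons i w ih => simp [comb, ih, numTri]; omega

end RTree

section

variable {M N : Type*} [AddCommGroup M] [AddCommGroup N]

lemma wordSum_append (f : List ℕ → M) (L L' : List (ℤ × List ℕ)) :
    wordSum f (L ++ L') = wordSum f L + wordSum f L' := by
  simp [wordSum]

lemma wordSum_cons (f : List ℕ → M) (p : ℤ × List ℕ) (L : List (ℤ × List ℕ)) :
    wordSum f (p :: L) = p.1 • f p.2 + wordSum f L := by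
  simp [wordSum]

@[simp] lemma wordSum_nil (f : List ℕ → M) : wordSum f [] = 0 := rfl

lemma wordSum_neg (f : List ℕ → M) (L : List (ℤ × List ℕ)) :
    wordSum f (negWords L) = -wordSum f L := by
  induction L with
  | nil => simp [wordSum, negWords]
  | cons p L ih =>
    rw [negWords, List.map_cons, wordSum_cons, wordSum_cons, neg_add, ← ih]
    simp [negWords]

lemma wordSum_mul (f : List ℕ → M) (L L' : List (ℤ × List ℕ)) :
    wordSum f (mulWords L L') = wordSum (fun u => wordSum (fun v => f (u ++ v)) L') L := by
  induction L with
  | nil => simp [wordSum, mulWords]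
  | cons p L ih =>
    rw [mulWords, List.flatMap_cons, wordSum_append, wordSum_cons, ← ih, mulWords]
    congr 1
    simp only [wordSum, List.map_map, List.smul_sum]
    simp [Function.comp_def, mul_smul]

lemma wordSum_congr {f g : List ℕ → M} (L : List (ℤ × List ℕ))
    (h : ∀ p ∈ L, f p.2 = g p.2) : wordSum f L = wordSum g L := by
  unfold wordSum
  congr 1
  exact List.map_congr_left fun p hp => by rw [h p hp]

lemma map_wordSum {F : Type*} [FunLike F M N] [AddMonoidHomClass F M N] (φ : F) (f : List ℕ → M)
    (L : List (ℤ × List ℕ)) : φ (wordSum f L) = wordSum (fun u => φ (f u)) L := by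
  induction L with
  | nil => simp
  | cons p L ih => simp [wordSum_cons, ih]

lemma RTree.words_perm {A : RTree} {p : ℤ × List ℕ} (hp : p ∈ A.words) : p.2.Perm A.legs := by
  induction A generalizing p with
  | leaf i => simp only [words, List.mem_singleton] at hp; subst hp; exact List.Perm.refl _
  | node A B ihA ihB =>
    simp only [words, mulWords, negWords, List.mem_append, List.mem_flatMap, List.mem_map] at hp
    rcases hp with ⟨a, ha, b, hb, rfl⟩ | ⟨_, ⟨b, hb, a, ha, rfl⟩, rfl⟩
    · exact (ihA ha).append (ihB hb)
    · exact ((ihB hb).append (ihA ha)).trans List.perm_append_comm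

lemma RTree.firstWords_perm {s : ℕ} {A : RTree} (hs : s ∈ A.legs) {p : ℤ × List ℕ}
    (hp : p ∈ A.firstWords s) : (s :: p.2).Perm A.legs := by
  induction A generalizing p with
  | leaf i =>
    simp only [firstWords, legs, List.mem_singleton] at hp hs
    subst hp hs; exact List.Perm.refl _
  | node A B ihA ihB =>
    unfold firstWords at hp
    simp only [Bool.cond_eq_ite, hasLeg_iff] at hp
    split_ifs at hp with h
    · simp only [mulWords, List.mem_flatMap, List.mem_map] at hp
      obtain ⟨a, ha, b, hb, rfl⟩ := hp
      exact (ihA h ha).append (words_perm hb)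
    · simp only [negWords, mulWords, List.mem_flatMap, List.mem_map] at hp
      obtain ⟨_, ⟨b, hb, a, ha, rfl⟩, rfl⟩ := hp
      have h' : s ∈ B.legs := by simpa [legs, h] using hs
      exact ((ihB h' hb).append (words_perm ha)).trans List.perm_append_comm

namespace IsTreeFun

variable {G : JTree → M}

lemma comp (hG : IsTreeFun G) (φ : M →+ N) : IsTreeFun fun T => φ (G T) where
  swap A B := by rw [hG.swap]
  rot A B C := by rw [hG.rot]
  antisymm A B C := by rw [hG.antisymm, map_neg]
  ihx A B C E := by rw [← map_add, ← map_add, hG.ihx, map_zero]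

/-- A tree with a leaf `i` may be cut next to this leaf. -/
lemma reroot (hG : IsTreeFun G) {i : ℕ} {A : RTree} (C : RTree) (hi : i ∈ A.legs) :
    G ⟨A.reroot i C, .leaf i⟩ = G ⟨A, C⟩ := by
  induction A generalizing C with
  | leaf j =>
    simp only [RTree.legs, List.mem_singleton] at hi
    subst hi
    exact hG.swap _ _
  | node A B ihA ihB =>
    unfold RTree.reroot
    split_ifs with h
    · rw [ihA _ h, hG.rot]
    · have h' : i ∈ B.legs := by simpa [RTree.legs, h] using hi
      rw [ihB _ h', hG.swap, hG.rot, hG.swap]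

lemma cutAt (hG : IsTreeFun G) {i : ℕ} {T : JTree} (hi : i ∈ T.legs) :
    G ⟨T.cutAt i, .leaf i⟩ = G T := by
  unfold JTree.cutAt
  split_ifs with h
  · exact hG.reroot _ h
  · have h' : i ∈ T.snd.legs := by simpa [JTree.legs, h] using hi
    rw [hG.reroot _ h', hG.swap]

lemma antisymm_fst (hG : IsTreeFun G) (A B C E : RTree) :
    G ⟨.node (.node A B) C, E⟩ = -G ⟨.node (.node B A) C, E⟩ := by
  rw [hG.rot, hG.antisymm, ← hG.rot (.node B A)]

/-- The Jacobi identity: bracketing with a tree is the commutator of bracketing with its halves. -/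
lemma jacobi (hG : IsTreeFun G) (X A B E : RTree) : G ⟨.node X (.node A B), E⟩ =
    G ⟨.node (.node X A) B, E⟩ - G ⟨.node (.node X B) A, E⟩ := by
  have h := hG.ihx A B X E
  rw [hG.antisymm (.node A B), hG.antisymm_fst B X] at h
  rw [← sub_eq_zero, ← neg_eq_zero, ← h]
  abel

lemma expand_words (hG : IsTreeFun G) (X B E : RTree) :
    G ⟨.node X B, E⟩ = wordSum (fun u => G ⟨X.comb u, E⟩) B.words := by
  induction B generalizing X E with
  | leaf i => simp [RTree.words, wordSum, RTree.comb]
  | node A B ihA ihB =>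
    have key : ∀ A B : RTree,
        (∀ X E, G ⟨.node X A, E⟩ = wordSum (fun u => G ⟨X.comb u, E⟩) A.words) →
        (∀ X E, G ⟨.node X B, E⟩ = wordSum (fun u => G ⟨X.comb u, E⟩) B.words) →
        G ⟨.node (.node X A) B, E⟩ =
          wordSum (fun u => G ⟨X.comb u, E⟩) (mulWords A.words B.words) := by
      intro A B hA hB
      rw [hG.rot, hA, wordSum_mul]
      refine wordSum_congr _ fun p _ => ?_
      rw [← hG.rot, hB]
      simp only [RTree.comb_append]
    rw [hG.jacobi, RTree.words, wordSum_append, wordSum_neg, ← key A B ihA ihB, ← key B A ihB ihA]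
    abel

lemma expand_firstWords (hG : IsTreeFun G) {s : ℕ} (A : RTree) (E : RTree) (hs : s ∈ A.legs) :
    G ⟨A, E⟩ = wordSum (fun u => G ⟨RTree.comb (.leaf s) u, E⟩) (A.firstWords s) := by
  induction A generalizing E with
  | leaf j =>
    simp only [RTree.legs, List.mem_singleton] at hs
    subst hs
    simp [RTree.firstWords, wordSum, RTree.comb]
  | node A B ihA ihB =>
    unfold RTree.firstWords
    simp only [Bool.cond_eq_ite, RTree.hasLeg_iff]
    split_ifs with h
    · rw [hG.rot, ihA _ h, wordSum_mul]
      refine wordSum_congr _ fun p _ => ?_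
      rw [← hG.rot, hG.expand_words]
      simp only [RTree.comb_append]
    · have h' : s ∈ B.legs := by simpa [RTree.legs, h] using hs
      rw [hG.antisymm, hG.rot, ihB _ h', wordSum_neg, wordSum_mul]
      congr 1
      refine wordSum_congr _ fun p _ => ?_
      rw [← hG.rot, hG.expand_words]
      simp only [RTree.comb_append]

/-- Every tree with two distinguished leaves is a combination of trees in which all other leaves
are attached along the path between these two. -/
lemma expand (hG : IsTreeFun G) {s e : ℕ} {T : JTree} (he : e ∈ T.legs)
    (hs : s ∈ (T.cutAt e).legs) :
    G T = wordSum (fun u => G ⟨RTree.comb (.leaf s) u, .leaf e⟩) ((T.cutAt e).firstWords s) := by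
  rw [← hG.cutAt he, hG.expand_firstWords _ _ hs]

end IsTreeFun

/-! ### Trees inside a graph -/

section

variable {H : Type*} [AddCommGroup H] [Module ℚ H]

lemma isHairy_replace_iff {l : List JTree} {D : Finset (ℕ × ℕ)} {c : ℕ → H} {T T' : JTree}
    (hp : T'.legs.Perm T.legs) (hn : T'.numTri = T.numTri) :
    Graph.IsHairy ⟨T' :: l, D, c⟩ ↔ Graph.IsHairy ⟨T :: l, D, c⟩ :=
  ⟨fun h => Graph.IsHairy.replace (l₁ := []) h hp.symm hn.symm,
    fun h => Graph.IsHairy.replace (l₁ := []) h hp hn⟩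

open Classical in
/-- The class of a graph as a function of its first tree, extended by zero to the trees that do
not give a hairy Lie graph. -/
def treeOf (l : List JTree) (D : Finset (ℕ × ℕ)) (c : ℕ → H) (T : JTree) : HLG H :=
  if Graph.IsHairy ⟨T :: l, D, c⟩ then of ⟨T :: l, D, c⟩ else 0

lemma treeOf_eq {l : List JTree} {D : Finset (ℕ × ℕ)} {c : ℕ → H} {T : JTree}
    (h : Graph.IsHairy ⟨T :: l, D, c⟩) : treeOf l D c T = of ⟨T :: l, D, c⟩ := if_pos h

lemma isTreeFun_treeOf (l : List JTree) (D : Finset (ℕ × ℕ)) (c : ℕ → H) :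
    IsTreeFun (treeOf l D c) where
  swap A B := by
    have hiff := isHairy_replace_iff (l := l) (D := D) (c := c) (T := ⟨A, B⟩) (T' := ⟨B, A⟩)
      List.perm_append_comm (add_comm _ _)
    unfold treeOf
    by_cases h : Graph.IsHairy ⟨⟨A, B⟩ :: l, D, c⟩
    · rw [if_pos h, if_pos (hiff.2 h)]; exact of_swap (l₁ := []) h
    · rw [if_neg h, if_neg (mt hiff.1 h)]
  rot A B C := by
    have hiff := isHairy_replace_iff (l := l) (D := D) (c := c) (T := ⟨.node A B, C⟩)
      (T' := ⟨A, .node B C⟩) (by simp [JTree.legs, RTree.legs])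
      (by simp only [JTree.numTri, RTree.numTri]; omega)
    unfold treeOf
    by_cases h : Graph.IsHairy ⟨⟨.node A B, C⟩ :: l, D, c⟩
    · rw [if_pos h, if_pos (hiff.2 h)]; exact of_rot (l₁ := []) h
    · rw [if_neg h, if_neg (mt hiff.1 h)]
  antisymm A B C := by
    have hiff := isHairy_replace_iff (l := l) (D := D) (c := c) (T := ⟨.node A B, C⟩)
      (T' := ⟨.node B A, C⟩) (List.Perm.append_right _ List.perm_append_comm)
      (by simp only [JTree.numTri, RTree.numTri]; omega)
    unfold treeOf
    by_cases h : Graph.IsHairy ⟨⟨.node A B, C⟩ :: l, D, c⟩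
    · rw [if_pos h, if_pos (hiff.2 h), eq_neg_iff_add_eq_zero]
      simpa using rel_zero (Rel.antisymm [] l D c A B C h)
    · rw [if_neg h, if_neg (mt hiff.1 h), neg_zero]
  ihx A B C E := by
    have h1 := isHairy_replace_iff (l := l) (D := D) (c := c) (T := ⟨.node (.node A B) C, E⟩)
      (T' := ⟨.node (.node B C) A, E⟩) (by
        simp only [JTree.legs, RTree.legs, ← Multiset.coe_eq_coe, ← Multiset.coe_add]; abel)
      (by simp only [JTree.numTri, RTree.numTri]; omega)
    have h2 := isHairy_replace_iff (l := l) (D := D) (c := c) (T := ⟨.node (.node A B) C, E⟩)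
      (T' := ⟨.node (.node C A) B, E⟩) (by
        simp only [JTree.legs, RTree.legs, ← Multiset.coe_eq_coe, ← Multiset.coe_add]; abel)
      (by simp only [JTree.numTri, RTree.numTri]; omega)
    unfold treeOf
    by_cases h : Graph.IsHairy ⟨⟨.node (.node A B) C, E⟩ :: l, D, c⟩
    · rw [if_pos h, if_pos (h1.2 h), if_pos (h2.2 h)]
      simpa using rel_zero (Rel.ihx [] l D c A B C E h)
    · rw [if_neg h, if_neg (mt h1.1 h), if_neg (mt h2.1 h)]; simp

end

end

/-! ### Decomposing a tree into tripods -/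

section

variable {H : Type*} [AddCommGroup H] [Module ℚ H]

lemma wordSum_mem {M : Type*} [AddCommGroup M] [Module ℚ M] (S : Submodule ℚ M)
    {f : List ℕ → M} {L : List (ℤ × List ℕ)} (h : ∀ p ∈ L, f p.2 ∈ S) : wordSum f L ∈ S := by
  refine S.toAddSubgroup.list_sum_mem fun x hx => ?_
  obtain ⟨p, hp, rfl⟩ := List.mem_map.1 hx
  exact S.toAddSubgroup.zsmul_mem (h p hp) _

lemma RTree.length_legs (A : RTree) : A.legs.length = A.numTri + 1 := by
  induction A with
  | leaf i => rfl
  | node A B ihA ihB => simp only [legs, List.length_append, ihA, ihB, numTri]; omega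

lemma JTree.length_legs (T : JTree) : T.legs.length = T.numTri + 2 := by
  simp only [legs, List.length_append, RTree.length_legs, numTri]; omega

/-- A subspace that contains all graphs in which the first tree is a caterpillar contains all
graphs. -/
lemma mem_of_comb (S : Submodule ℚ (HLG H)) {T : JTree} {l : List JTree} {D : Finset (ℕ × ℕ)}
    {c : ℕ → H} (h : Graph.IsHairy ⟨T :: l, D, c⟩)
    (hS : ∀ s w e, (s :: (w ++ [e])).Perm T.legs →
      of ⟨⟨RTree.comb (.leaf s) w, .leaf e⟩ :: l, D, c⟩ ∈ S) : of ⟨T :: l, D, c⟩ ∈ S := by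
  have hlen := T.length_legs
  obtain ⟨e, he⟩ : ∃ e, e ∈ T.legs :=
    List.exists_mem_of_length_pos (by omega)
  have hperm := T.cutAt_legs e he
  obtain ⟨s, hs⟩ : ∃ s, s ∈ (T.cutAt e).legs :=
    List.exists_mem_of_length_pos (by rw [RTree.length_legs]; omega)
  rw [← treeOf_eq h, (isTreeFun_treeOf l D c).expand he hs]
  refine wordSum_mem S fun p hp => ?_
  have hp' : (s :: (p.2 ++ [e])).Perm T.legs := by
    refine List.Perm.trans ?_ hperm
    refine List.Perm.trans ?_ (List.Perm.cons e (RTree.firstWords_perm hs hp))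
    rw [← List.cons_append]
    exact List.perm_append_comm
  have hh : Graph.IsHairy ⟨⟨RTree.comb (.leaf s) p.2, .leaf e⟩ :: l, D, c⟩ := by
    refine (isHairy_replace_iff ?_ ?_).2 h
    · simpa [JTree.legs, RTree.comb_legs, RTree.legs] using hp'
    · have := hp'.length_eq
      simp only [List.length_cons, List.length_append, List.length_nil] at this
      simp only [JTree.numTri, RTree.comb_numTri, RTree.numTri] at hlen ⊢
      omega
  rw [treeOf_eq hh]
  exact hS _ _ _ hp'

lemma endpoints_insert (e : ℕ × ℕ) (D : Finset (ℕ × ℕ)) :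
    endpoints (insert e D) = {e.1, e.2} ∪ endpoints D := by
  ext i
  simp only [mem_endpoints, Finset.mem_insert, Finset.mem_union, Finset.mem_singleton]
  constructor
  · rintro ⟨f, rfl | hf, hi⟩
    · left; rcases hi with rfl | rfl <;> simp
    · exact .inr ⟨f, hf, hi⟩
  · rintro (h | ⟨f, hf, hi⟩)
    · exact ⟨e, .inl rfl, by rcases h with rfl | rfl <;> simp⟩
    · exact ⟨f, .inr hf, hi⟩

lemma IsMatching.insert {D : Finset (ℕ × ℕ)} (h : IsMatching D) {i j : ℕ} (hij : i ≠ j)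
    (hi : i ∉ endpoints D) (hj : j ∉ endpoints D) : IsMatching (insert (i, j) D) := by
  have h1 : ∀ e ∈ D, e.1 ≠ i ∧ e.2 ≠ i ∧ e.1 ≠ j ∧ e.2 ≠ j := by
    intro e he
    refine ⟨?_, ?_, ?_, ?_⟩ <;> rintro rfl
    · exact hi (mem_endpoints.2 ⟨e, he, .inl rfl⟩)
    · exact hi (mem_endpoints.2 ⟨e, he, .inr rfl⟩)
    · exact hj (mem_endpoints.2 ⟨e, he, .inl rfl⟩)
    · exact hj (mem_endpoints.2 ⟨e, he, .inr rfl⟩)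
  constructor
  · intro e he
    rcases Finset.mem_insert.1 he with rfl | he
    · exact hij
    · exact h.1 e he
  · intro e he f hf hef
    rcases Finset.mem_insert.1 he with rfl | he <;> rcases Finset.mem_insert.1 hf with rfl | hf
    · exact absurd rfl hef
    · have := h1 f hf; exact ⟨this.1.symm, this.2.1.symm, this.2.2.1.symm, this.2.2.2.symm⟩
    · have := h1 e he; exact ⟨this.1, this.2.2.1, this.2.1, this.2.2.2⟩
    · exact h.2 e he f hf hef

lemma endpoints_subset_legs {l : List JTree} {D : Finset (ℕ × ℕ)} {c : ℕ → H}
    (h : Graph.IsHairy ⟨l, D, c⟩) {i : ℕ} (hi : i ∈ endpoints D) :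
    i ∈ l.flatMap JTree.legs := by
  simpa [Graph.legs] using h.sub hi

lemma betaGraph_cons (T U : JTree) (l : List JTree) (D : Finset (ℕ × ℕ)) (c : ℕ → H) :
    betaGraph ⟨T :: U :: l, D, c⟩ = ∑ e ∈ D, betaTerm T U l D c e := rfl

/-- Splitting off the tripod at the end of a caterpillar, by a new dotted edge `(i, j)`. -/
lemma beta_split {s z e i j : ℕ} {w : List ℕ} {l : List JTree} {D : Finset (ℕ × ℕ)} {c : ℕ → H}
    (hw : w ≠ [])
    (h : Graph.IsHairy ⟨⟨RTree.comb (.leaf s) (w ++ [z]), .leaf e⟩ :: l, D, c⟩)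
    (hD : ∀ f ∈ D, ¬(f.1 ∈ s :: (w ++ [z, e]) ∧ f.2 ∈ s :: (w ++ [z, e]))) (hij : i ≠ j)
    (hi : i ∉ s :: (w ++ [z, e]) ++ l.flatMap JTree.legs)
    (hj : j ∉ s :: (w ++ [z, e]) ++ l.flatMap JTree.legs) :
    Graph.IsHairy ⟨⟨RTree.comb (.leaf s) w, .leaf i⟩ :: ⟨.node (.leaf z) (.leaf e), .leaf j⟩ :: l,
      insert (i, j) D, c⟩ ∧
    beta (of ⟨⟨RTree.comb (.leaf s) w, .leaf i⟩ :: ⟨.node (.leaf z) (.leaf e), .leaf j⟩ :: l,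
      insert (i, j) D, c⟩) = of ⟨⟨RTree.comb (.leaf s) (w ++ [z]), .leaf e⟩ :: l, D, c⟩ := by
  have hlegs : Graph.legs (H := H) ⟨⟨RTree.comb (.leaf s) (w ++ [z]), .leaf e⟩ :: l, D, c⟩ =
      s :: (w ++ [z, e]) ++ l.flatMap JTree.legs := by
    simp [Graph.legs, JTree.legs, RTree.comb_legs, RTree.legs]
  have hnd := h.nodup
  rw [hlegs] at hnd
  have hsub : ∀ k ∈ endpoints D, k ∈ s :: (w ++ [z, e]) ++ l.flatMap JTree.legs := by
    intro k hk
    have := h.sub hk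
    rwa [hlegs, List.mem_toFinset] at this
  have hiD : i ∉ endpoints D := fun hh => hi (hsub i hh)
  have hjD : j ∉ endpoints D := fun hh => hj (hsub j hh)
  have hlegs' : Graph.legs (H := H) ⟨⟨RTree.comb (.leaf s) w, .leaf i⟩ ::
      ⟨.node (.leaf z) (.leaf e), .leaf j⟩ :: l, insert (i, j) D, c⟩ =
      s :: (w ++ [i, z, e, j]) ++ l.flatMap JTree.legs := by
    simp [Graph.legs, JTree.legs, RTree.comb_legs, RTree.legs]
  have hperm : (s :: (w ++ [i, z, e, j]) ++ l.flatMap JTree.legs).Perm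
      (i :: j :: (s :: (w ++ [z, e]) ++ l.flatMap JTree.legs)) := by
    have h1 : s :: (w ++ [i, z, e, j]) ++ l.flatMap JTree.legs =
      [s] ++ w ++ [i] ++ [z, e] ++ [j] ++ l.flatMap JTree.legs := by simp
    have h2 : i :: j :: (s :: (w ++ [z, e]) ++ l.flatMap JTree.legs) =
      [i] ++ [j] ++ [s] ++ w ++ [z, e] ++ l.flatMap JTree.legs := by simp
    rw [h1, h2]
    simp only [← Multiset.coe_eq_coe, ← Multiset.coe_add]
    abel
  have hnot : (i, j) ∉ D := fun hh => hiD (mem_endpoints.2 ⟨_, hh, .inl rfl⟩)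
  refine ⟨⟨?_, ?_, h.matching.insert hij hiD hjD, ?_⟩, ?_⟩
  · rw [hlegs', hperm.nodup_iff, List.nodup_cons, List.nodup_cons]
    refine ⟨?_, hj, hnd⟩
    intro hh
    rcases List.mem_cons.1 hh with rfl | hh
    · exact hij rfl
    · exact hi hh
  · intro V hV
    simp only [List.mem_cons] at hV
    rcases hV with rfl | rfl | hV
    · simp only [JTree.numTri, RTree.comb_numTri, RTree.numTri]
      have := List.length_pos_iff.2 hw
      omega
    · simp [JTree.numTri, RTree.numTri]
    · exact h.tri V (by simp [hV])
  · change endpoints (insert (i, j) D) ⊆ _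
    rw [endpoints_insert, hlegs', List.toFinset_eq_of_perm _ _ hperm]
    intro k hk
    simp only [Finset.mem_union, Finset.mem_insert, Finset.mem_singleton] at hk
    rw [List.mem_toFinset]
    rcases hk with (rfl | rfl) | hk
    · simp
    · simp
    · exact List.mem_cons_of_mem _ (List.mem_cons_of_mem _ (hsub k hk))
  · rw [beta_of, betaGraph_cons, Finset.sum_insert hnot, Finset.sum_eq_zero, add_zero]
    · have hi' : i ∉ s :: w := fun hh => hi (by
        simp only [List.mem_cons] at hh; simp only [List.mem_append, List.mem_cons]; tauto)
      have hj' : j ∉ [z, e] := fun hh => hj (by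
        simp only [List.mem_cons, List.not_mem_nil, or_false] at hh
        simp only [List.mem_append, List.mem_cons]; tauto)
      rw [betaTerm, if_pos]
      · have hjoin : JTree.join ⟨RTree.comb (.leaf s) w, .leaf i⟩ i
            ⟨.node (.leaf z) (.leaf e), .leaf j⟩ j =
            ⟨RTree.comb (.leaf s) w, .node (.leaf z) (.leaf e)⟩ := by
          rw [JTree.join, JTree.cutAt, JTree.cutAt, if_neg, if_neg]
          · rfl
          · simpa [RTree.legs] using hj'
          · simpa [RTree.comb_legs, RTree.legs] using hi'
        rw [hjoin, Finset.erase_insert hnot]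
        rw [RTree.comb_append] at h ⊢
        exact (of_rot (l₁ := []) h).symm
      · simp [JTree.legs, RTree.comb_legs, RTree.legs]
    · intro f hf
      have h1 : f.1 ∈ s :: (w ++ [z, e]) ++ l.flatMap JTree.legs :=
        hsub _ (mem_endpoints.2 ⟨f, hf, .inl rfl⟩)
      have h2 : f.2 ∈ s :: (w ++ [z, e]) ++ l.flatMap JTree.legs :=
        hsub _ (mem_endpoints.2 ⟨f, hf, .inr rfl⟩)
      have h3 : f.1 ≠ i ∧ f.1 ≠ j ∧ f.2 ≠ i ∧ f.2 ≠ j :=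
        ⟨fun hh => hi (hh ▸ h1), fun hh => hj (hh ▸ h1), fun hh => hi (hh ▸ h2),
          fun hh => hj (hh ▸ h2)⟩
      have h4 := hD f hf
      simp only [List.mem_cons, List.mem_append, List.not_mem_nil, or_false] at h4
      rw [betaTerm, if_neg, if_neg]
      all_goals
        simp only [JTree.legs, RTree.comb_legs, RTree.legs, List.mem_append, List.mem_cons,
          List.not_mem_nil, or_false]
        tauto

lemma exists_two_fresh (L : List ℕ) : ∃ i j, i ≠ j ∧ i ∉ L ∧ j ∉ L := by
  obtain ⟨i, hi⟩ := Infinite.exists_notMem_finset L.toFinset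
  obtain ⟨j, hj⟩ := Infinite.exists_notMem_finset (insert i L.toFinset)
  simp only [Finset.mem_insert, List.mem_toFinset, not_or] at hi hj
  exact ⟨i, j, Ne.symm hj.1, hi, hj.2⟩

/-- A graph whose first tree has no dotted edge with both ends on it is the image under `β` of
graphs in which this tree is decomposed into tripods. -/
lemma mem_map_beta_pow (m : ℕ) {T : JTree} {l : List JTree} {D : Finset (ℕ × ℕ)} {c : ℕ → H}
    (h : Graph.IsHairy ⟨T :: l, D, c⟩) (hT : T.numTri = m + 1)
    (hD : ∀ e ∈ D, ¬(e.1 ∈ T.legs ∧ e.2 ∈ T.legs)) :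
    of ⟨T :: l, D, c⟩ ∈ (C H (m + 1 + l.length) (D.card + m)
      (m + 1 + (l.map JTree.numTri).sum)).map (beta ^ m) := by
  induction m generalizing T l D with
  | zero =>
    refine ⟨_, Submodule.subset_span ⟨_, ⟨h, ?_, rfl, ?_⟩, rfl⟩, by simp⟩
    · simp; omega
    · simp [Graph.lieDegree, hT]
  | succ m ih =>
    refine mem_of_comb _ h fun s w e hp => ?_
    have hlen := hp.length_eq
    rw [JTree.length_legs, hT] at hlen
    simp only [List.length_cons, List.length_append, List.length_nil] at hlen
    obtain ⟨w, z, rfl⟩ : ∃ w' z, w = w' ++ [z] := by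
      refine ⟨w.dropLast, w.getLast ?_, (List.dropLast_append_getLast _).symm⟩
      rintro rfl
      simp at hlen
    have hw : w ≠ [] := by
      rintro rfl
      simp at hlen
    simp only [List.length_append, List.length_cons, List.length_nil] at hlen
    have hp' : (s :: (w ++ [z, e])).Perm T.legs := by simpa using hp
    have hh : Graph.IsHairy ⟨⟨RTree.comb (.leaf s) (w ++ [z]), .leaf e⟩ :: l, D, c⟩ := by
      refine (isHairy_replace_iff ?_ ?_).2 h
      · simpa [JTree.legs, RTree.comb_legs, RTree.legs] using hp'
      · simp only [hT, JTree.numTri.eq_1 ⟨_, _⟩, RTree.comb_numTri, RTree.numTri,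
          List.length_append, List.length_cons, List.length_nil]
        omega
    obtain ⟨i, j, hij, hi, hj⟩ :=
      exists_two_fresh (s :: (w ++ [z, e]) ++ l.flatMap JTree.legs)
    obtain ⟨hv, hb⟩ := beta_split hw hh
      (fun f hf => by simpa only [hp'.mem_iff] using hD f hf) hij hi hj
    have hend : ∀ k ∈ endpoints D, k ≠ i ∧ k ≠ j := by
      intro k hk
      have := endpoints_subset_legs h hk
      rw [List.flatMap_cons, List.mem_append, ← hp'.mem_iff, ← List.mem_append] at this
      exact ⟨fun hh => hi (hh ▸ this), fun hh => hj (hh ▸ this)⟩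
    have hnot : (i, j) ∉ D := fun hh => (hend i (mem_endpoints.2 ⟨_, hh, .inl rfl⟩)).1 rfl
    obtain ⟨y, hy, hyb⟩ := ih hv (by
        simp only [JTree.numTri, RTree.comb_numTri, RTree.numTri]; omega) (by
      intro f hf
      have hj' : j ∉ s :: w := fun hh => hj (by
        simp only [List.mem_cons] at hh; simp only [List.mem_append, List.mem_cons]; tauto)
      simp only [JTree.legs, RTree.comb_legs, RTree.legs, List.mem_append, List.mem_cons,
        List.not_mem_nil, or_false] at hj' ⊢
      rcases Finset.mem_insert.1 hf with rfl | hf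
      · rintro ⟨-, hh⟩
        simp only at hh
        rcases hh with hh | hh
        · exact hj' hh
        · exact hij hh.symm
      · have h1 := hend _ (mem_endpoints.2 ⟨f, hf, .inl rfl⟩)
        have h2 := hend _ (mem_endpoints.2 ⟨f, hf, .inr rfl⟩)
        have h3 := hD f hf
        simp only [← hp'.mem_iff, List.mem_cons, List.mem_append] at h3
        tauto)
    refine ⟨y, ?_, ?_⟩
    · rw [Finset.card_insert_of_notMem hnot] at hy
      have e1 : m + 1 + 1 + l.length =
          m + 1 + (⟨.node (.leaf z) (.leaf e), .leaf j⟩ :: l : List JTree).length := by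
        simp only [List.length_cons]; omega
      have e2 : D.card + (m + 1) = D.card + 1 + m := by omega
      have e3 : m + 1 + 1 + (l.map JTree.numTri).sum = m + 1 +
          ((⟨.node (.leaf z) (.leaf e), .leaf j⟩ :: l : List JTree).map JTree.numTri).sum := by
        simp only [List.map_cons, List.sum_cons, JTree.numTri, RTree.numTri]; omega
      rw [e1, e2, e3]
      exact hy
    · rw [pow_succ', Module.End.mul_apply, hyb, hb]

/-- If all trees but the first are tripods and no dotted edge has both ends on the first tree,
then the iterated `β` of the graph lies in the image of the graphs of tripods. -/
lemma beta_pow_mem_betaImage {m k r n : ℕ} {T : JTree} {l : List JTree} {D : Finset (ℕ × ℕ)}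
    {c : ℕ → H} (h : Graph.IsHairy ⟨T :: l, D, c⟩) (hT : T.numTri = m + 1)
    (hD : ∀ e ∈ D, ¬(e.1 ∈ T.legs ∧ e.2 ∈ T.legs)) (hl : l.length = k)
    (htri : (l.map JTree.numTri).sum = k) (hr : D.card = r + k) (hn : n = m + 1 + k) :
    (beta ^ k) (of ⟨T :: l, D, c⟩) ∈ betaImage H r n := by
  obtain ⟨y, hy, hyb⟩ := mem_map_beta_pow m h hT hD
  refine ⟨y, ?_, ?_⟩
  · subst hn
    rw [hl, htri, hr] at hy
    rw [show r + (m + 1 + k) - 1 = r + k + m by omega]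
    exact hy
  · rw [← hyb, ← Module.End.mul_apply, ← pow_add]
    congr 2
    omega

end

/-! ### Substitution of rooted trees for leaves -/

namespace RTree

/-- Simultaneous substitution of rooted trees for the leaves. -/
def bind (ρ : ℕ → RTree) : RTree → RTree
  | leaf i => ρ i
  | node A B => node (A.bind ρ) (B.bind ρ)

lemma bind_congr {ρ ρ' : ℕ → RTree} {A : RTree} (h : ∀ i ∈ A.legs, ρ i = ρ' i) :
    A.bind ρ = A.bind ρ' := by
  induction A with
  | leaf i => exact h i (by simp [legs])
  | node A B ihA ihB =>
    simp only [legs, List.mem_append] at h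
    simp only [bind, ihA fun i hi => h i (.inl hi), ihB fun i hi => h i (.inr hi)]

lemma bind_bind (ρ ρ' : ℕ → RTree) (A : RTree) :
    (A.bind ρ).bind ρ' = A.bind fun i => (ρ i).bind ρ' := by
  induction A with
  | leaf i => rfl
  | node A B ihA ihB => simp only [bind, ihA, ihB]

lemma subst_eq_bind (A : RTree) (i : ℕ) (S : RTree) :
    A.subst i S = A.bind fun j => if j = i then S else leaf j := by
  induction A with
  | leaf j => rfl
  | node A B ihA ihB => simp only [subst, bind, ihA, ihB]

lemma map_eq_bind (f : ℕ → ℕ) (A : RTree) : A.map f = A.bind fun j => leaf (f j) := by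
  induction A with
  | leaf j => rfl
  | node A B ihA ihB => simp only [map, bind, ihA, ihB]

lemma bind_leaf (A : RTree) : A.bind leaf = A := by
  induction A with
  | leaf j => rfl
  | node A B ihA ihB => simp only [bind, ihA, ihB]

lemma mem_legs_bind {ρ : ℕ → RTree} {A : RTree} {j : ℕ} :
    j ∈ (A.bind ρ).legs ↔ ∃ i ∈ A.legs, j ∈ (ρ i).legs := by
  induction A with
  | leaf i => simp [bind, legs]
  | node A B ihA ihB => simp only [bind, legs, List.mem_append, ihA, ihB, or_and_right, exists_or]

instance decEq : DecidableEq RTree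
  | leaf i, leaf j => decidable_of_iff (i = j) ⟨fun h => h ▸ rfl, fun h => by injection h⟩
  | leaf _, node _ _ => isFalse (by simp)
  | node _ _, leaf _ => isFalse (by simp)
  | node A B, node A' B' =>
    @decidable_of_iff _ (A = A' ∧ B = B') (by simp)
      (@instDecidableAnd _ _ (decEq A A') (decEq B B'))

end RTree

namespace JTree

/-- Simultaneous substitution of rooted trees for the univalent vertices. -/
def bind (ρ : ℕ → RTree) (T : JTree) : JTree := ⟨T.fst.bind ρ, T.snd.bind ρ⟩

/-- Grafting a rooted tree onto a univalent vertex. -/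
def subst (T : JTree) (i : ℕ) (S : RTree) : JTree := ⟨T.fst.subst i S, T.snd.subst i S⟩

lemma bind_congr {ρ ρ' : ℕ → RTree} {T : JTree} (h : ∀ i ∈ T.legs, ρ i = ρ' i) :
    T.bind ρ = T.bind ρ' := by
  simp only [legs, List.mem_append] at h
  simp only [bind, RTree.bind_congr fun i hi => h i (.inl hi),
    RTree.bind_congr fun i hi => h i (.inr hi)]

lemma mem_legs_bind {ρ : ℕ → RTree} {T : JTree} {j : ℕ} :
    j ∈ (T.bind ρ).legs ↔ ∃ i ∈ T.legs, j ∈ (ρ i).legs := by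
  simp only [legs, bind, List.mem_append, RTree.mem_legs_bind, or_and_right, exists_or]

lemma bind_bind (ρ ρ' : ℕ → RTree) (T : JTree) :
    (T.bind ρ).bind ρ' = T.bind fun i => (ρ i).bind ρ' := by
  simp only [bind, RTree.bind_bind]

lemma subst_eq_bind (T : JTree) (i : ℕ) (S : RTree) :
    T.subst i S = T.bind fun j => if j = i then S else .leaf j := by
  simp only [subst, bind, RTree.subst_eq_bind]

lemma map_eq_bind (f : ℕ → ℕ) (T : JTree) : T.map f = T.bind fun j => .leaf (f j) := by
  simp only [map, bind, RTree.map_eq_bind]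

lemma bind_leaf (T : JTree) : T.bind .leaf = T := by
  simp only [bind, RTree.bind_leaf]

lemma map_map (f f' : ℕ → ℕ) (T : JTree) : (T.map f).map f' = T.map fun i => f' (f i) := by
  simp only [map_eq_bind, bind_bind, RTree.bind]

end JTree

section

variable {H : Type*} [AddCommGroup H] [Module ℚ H]

lemma relabel_symm_relabel (σ : Equiv.Perm ℕ) (X : Graph H) :
    (X.relabel σ).relabel σ.symm = X := by
  obtain ⟨l, D, c⟩ := X
  simp only [Graph.relabel, List.map_map, Finset.image_image]
  congr 1
  · conv_rhs => rw [← List.map_id l]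
    refine List.map_congr_left fun T _ => ?_
    simp only [Function.comp, JTree.map_map, Equiv.symm_apply_apply, id]
    rw [JTree.map_eq_bind]
    exact JTree.bind_leaf T
  · conv_rhs => rw [← Finset.image_id (s := D)]
    refine Finset.image_congr fun e _ => ?_
    ext <;> simp
  · ext; simp

lemma isHairy_relabel_iff (σ : Equiv.Perm ℕ) (X : Graph H) :
    (X.relabel σ).IsHairy ↔ X.IsHairy :=
  ⟨fun h => by
    have := Graph.isHairy_relabel σ.symm h
    rwa [relabel_symm_relabel] at this, Graph.isHairy_relabel σ⟩

lemma isHairy_color {l : List JTree} {D : Finset (ℕ × ℕ)} {c : ℕ → H} (d : ℕ → H)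
    (h : Graph.IsHairy ⟨l, D, c⟩) : Graph.IsHairy ⟨l, D, d⟩ := ⟨h.nodup, h.tri, h.matching, h.sub⟩

/-- Relabelling in a graph with one tree. -/
lemma treeOf_map (σ : Equiv.Perm ℕ) {D D' : Finset (ℕ × ℕ)} {c d : ℕ → H} (T : JTree)
    (hD : D.image (Prod.map σ σ) = D')
    (hc : ∀ i ∈ T.legs, i ∉ endpoints D → c i = d (σ i)) :
    treeOf [] D' d (T.map σ) = treeOf [] D c T := by
  subst hD
  have hiff : Graph.IsHairy ⟨[T.map σ], D.image (Prod.map σ σ), d⟩ ↔ Graph.IsHairy ⟨[T], D, c⟩ := by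
    rw [← isHairy_relabel_iff σ ⟨[T], D, c⟩]
    exact ⟨isHairy_color _, isHairy_color _⟩
  unfold treeOf
  by_cases h : Graph.IsHairy ⟨[T], D, c⟩
  · rw [if_pos h, if_pos (hiff.2 h), ← of_relabel σ h]
    refine of_color (hiff.2 h) fun i hi => ?_
    have h1 := Graph.hairs_relabel σ ⟨[T], D, c⟩
    have h2 : i ∈ Graph.hairs (Graph.relabel σ ⟨[T], D, c⟩) := hi
    rw [h1, Finset.mem_image] at h2
    obtain ⟨i, hi', rfl⟩ := h2
    simp only [Graph.hairs, Finset.mem_sdiff, List.mem_toFinset] at hi'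
    simp only [Function.comp, Equiv.symm_apply_apply]
    exact (hc i (by simpa [Graph.legs] using hi'.1) hi'.2).symm
  · rw [if_neg h, if_neg (mt hiff.1 h)]

lemma treeOf_bind (σ : Equiv.Perm ℕ) {D D' : Finset (ℕ × ℕ)} (c : ℕ → H) {T : JTree}
    {L : List ℕ} (hT : T.legs.Perm L) {ρ ρ' : ℕ → RTree}
    (hD : D.image (Prod.map σ σ) = D') (hρ : ∀ i ∈ L, (ρ i).map σ = ρ' i)
    (hσ : ∀ i ∈ L, ∀ j ∈ (ρ i).legs, j ∉ endpoints D → σ j = j) :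
    treeOf [] D c (T.bind ρ) = treeOf [] D' c (T.bind ρ') := by
  rw [← treeOf_map σ (d := c) _ hD]
  · rw [JTree.map_eq_bind, JTree.bind_bind]
    congr 1
    refine JTree.bind_congr fun i hi => ?_
    rw [← hρ i (hT.mem_iff.1 hi), RTree.map_eq_bind]
  · intro j hj hj'
    obtain ⟨i, hi, hj⟩ := JTree.mem_legs_bind.1 hj
    rw [hσ i (hT.mem_iff.1 hi) j hj hj']

lemma isHairy_of_perm {l : List JTree} {D : Finset (ℕ × ℕ)} {c : ℕ → H} (L : List ℕ)
    (hp : (l.flatMap JTree.legs).Perm L) (hL : L.Nodup) (ht : ∀ T ∈ l, 1 ≤ T.numTri)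
    (hD : IsMatching D) (hsub : endpoints D ⊆ L.toFinset) : Graph.IsHairy ⟨l, D, c⟩ :=
  ⟨hp.nodup_iff.2 hL, ht, hD, by
    rw [Graph.legs, List.toFinset_eq_of_perm _ _ hp]; exact hsub⟩

/-- The term of `β` that connects the second tree to the univalent vertex `i` of the first. -/
lemma betaTerm_eq_treeOf {T U : JTree} {l : List JTree} {D : Finset (ℕ × ℕ)} {c : ℕ → H}
    (h : Graph.IsHairy ⟨T :: U :: l, D, c⟩) {i j : ℕ} (he : (i, j) ∈ D) (hi : i ∈ T.legs)
    (hj : j ∈ U.legs) :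
    betaTerm T U l D c (i, j) = treeOf l (D.erase (i, j)) c (T.subst i (U.cutAt j)) := by
  have hnd : T.legs.Nodup := by
    have := h.nodup
    simp only [Graph.legs, List.flatMap_cons, List.nodup_append] at this
    exact this.1
  obtain ⟨h1, -⟩ := h.join he hi hj (.inl rfl)
  obtain ⟨h2, h3⟩ := of_join hi hnd h1
  rw [betaTerm, if_pos ⟨hi, hj⟩, h3, JTree.subst, treeOf_eq h2]

lemma IsHairy.subst {T U : JTree} {l : List JTree} {D : Finset (ℕ × ℕ)} {c : ℕ → H}
    (h : Graph.IsHairy ⟨T :: U :: l, D, c⟩) {i j : ℕ} (he : (i, j) ∈ D) (hi : i ∈ T.legs)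
    (hj : j ∈ U.legs) : Graph.IsHairy ⟨T.subst i (U.cutAt j) :: l, D.erase (i, j), c⟩ := by
  have hnd : T.legs.Nodup := by
    have := h.nodup
    simp only [Graph.legs, List.flatMap_cons, List.nodup_append] at this
    exact this.1
  exact (of_join hi hnd (h.join he hi hj (.inl rfl)).1).1

lemma betaTerm_eq_zero {T U : JTree} {l : List JTree} {D : Finset (ℕ × ℕ)} {c : ℕ → H}
    {i j : ℕ} (h1 : ¬(i ∈ T.legs ∧ j ∈ U.legs)) (h2 : ¬(i ∈ U.legs ∧ j ∈ T.legs)) :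
    betaTerm T U l D c (i, j) = 0 := by
  rw [betaTerm, if_neg h1, if_neg h2]

/-- The tripod with univalent vertices `x, y, z` in this cyclic order. -/
def tripod (x y z : ℕ) : JTree := ⟨.node (.leaf x) (.leaf y), .leaf z⟩

lemma tripod_cut₁ (x y z : ℕ) : (tripod x y z).cutAt x = .node (.leaf y) (.leaf z) := by
  simp [tripod, JTree.cutAt, RTree.reroot, RTree.legs]

lemma tripod_cut₂ {x y : ℕ} (z : ℕ) (h : y ≠ x) :
    (tripod x y z).cutAt y = .node (.leaf z) (.leaf x) := by
  simp [tripod, JTree.cutAt, RTree.reroot, RTree.legs, h]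

lemma tripod_cut₃ {x y z : ℕ} (hx : z ≠ x) (hy : z ≠ y) :
    (tripod x y z).cutAt z = .node (.leaf x) (.leaf y) := by
  simp [tripod, JTree.cutAt, RTree.reroot, RTree.legs, hx, hy]

@[simp] lemma tripod_legs (x y z : ℕ) : (tripod x y z).legs = [x, y, z] := rfl

@[simp] lemma tripod_numTri (x y z : ℕ) : (tripod x y z).numTri = 1 := rfl

/-- A permutation of the natural numbers that is given by a list of transpositions. -/
def swaps (L : List (ℕ × ℕ)) : Equiv.Perm ℕ := (L.map fun p => Equiv.swap p.1 p.2).prod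

/-! ### Relations in the image of `β` -/

/-- The substitution that replaces the univalent vertices in a list. -/
def graft (L : List (ℕ × RTree)) (i : ℕ) : RTree := (L.lookup i).getD (.leaf i)

lemma subst_eq_graft (T : JTree) (i : ℕ) (S : RTree) : T.subst i S = T.bind (graft [(i, S)]) := by
  rw [JTree.subst_eq_bind]
  refine JTree.bind_congr fun j _ => ?_
  by_cases h : j = i
  · simp [graft, List.lookup, h]
  · have : (j == i) = false := by simpa using h
    simp [graft, List.lookup, h, this]

/-- The one-loop relation from a tripod with one hair: the hair may be moved from one end of the
dotted edge to the other. -/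
lemma slide_mem {T : JTree} (hT : T.legs.Perm [8, 9, 2, 3, 4, 5, 6]) (c : ℕ → H) :
    treeOf [] {(0, 1)} c (T.bind
        (graft [(8, .node (.leaf 1) (.leaf 7)), (9, .leaf 0)])) +
      treeOf [] {(0, 1)} c (T.bind
        (graft [(9, .node (.leaf 7) (.leaf 1)), (8, .leaf 0)])) ∈ betaImage H 1 6 := by
  have hn : T.numTri = 4 + 1 := by
    have := hT.length_eq; rw [JTree.length_legs] at this; simpa using this
  have hmem : ∀ i, i ∈ T.legs ↔ i ∈ [8, 9, 2, 3, 4, 5, 6] := fun i => hT.mem_iff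
  have h : Graph.IsHairy ⟨T :: [tripod 10 11 7], {(8, 10), (9, 11)}, c⟩ := by
    refine isHairy_of_perm ([8, 9, 2, 3, 4, 5, 6] ++ [10, 11, 7]) ?_ (by decide) ?_ (by decide)
      (by decide)
    · simpa only [List.flatMap_cons, List.flatMap_nil, List.append_nil, tripod_legs] using
        hT.append_right _
    · simp [hn]
  have hb := beta_pow_mem_betaImage (r := 1) (n := 6) (k := 1) h hn (by simp [hmem]) rfl rfl
    (by decide) rfl
  rw [pow_one, beta_of, betaGraph_cons, Finset.sum_insert (by decide),
    Finset.sum_singleton,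
    betaTerm_eq_treeOf h (i := 8) (j := 10) (by decide) (by simp [hmem]) (by simp),
    betaTerm_eq_treeOf h (i := 9) (j := 11) (by decide) (by simp [hmem]) (by simp),
    tripod_cut₁, tripod_cut₂ _ (by decide),
    subst_eq_graft, subst_eq_graft] at hb
  convert hb using 2
  · exact (treeOf_bind (swaps [(9, 0), (11, 1)]) c hT (by decide) (by decide) (by decide)).symm
  · exact (treeOf_bind (swaps [(8, 0), (10, 1)]) c hT (by decide) (by decide) (by decide)).symm

/-- The two-loop relation from a tripod without hairs. -/
lemma tripod_mem {T : JTree} (hT : T.legs.Perm [8, 9, 10, 4, 5, 6, 7]) (c : ℕ → H) :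
    treeOf [] {(0, 1), (2, 3)} c (T.bind
        (graft [(8, .node (.leaf 1) (.leaf 3)), (9, .leaf 0), (10, .leaf 2)])) +
      treeOf [] {(0, 1), (2, 3)} c (T.bind
        (graft [(9, .node (.leaf 3) (.leaf 1)), (8, .leaf 0), (10, .leaf 2)])) +
      treeOf [] {(0, 1), (2, 3)} c (T.bind
        (graft [(10, .node (.leaf 1) (.leaf 3)), (8, .leaf 0), (9, .leaf 2)])) ∈ betaImage H 2 6 := by
  have hn : T.numTri = 4 + 1 := by
    have := hT.length_eq; rw [JTree.length_legs] at this; simpa using this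
  have hmem : ∀ i, i ∈ T.legs ↔ i ∈ [8, 9, 10, 4, 5, 6, 7] := fun i => hT.mem_iff
  have h : Graph.IsHairy ⟨T :: [tripod 11 12 13], {(8, 11), (9, 12), (10, 13)}, c⟩ := by
    refine isHairy_of_perm ([8, 9, 10, 4, 5, 6, 7] ++ [11, 12, 13]) ?_ (by decide) ?_ (by decide)
      (by decide)
    · simpa only [List.flatMap_cons, List.flatMap_nil, List.append_nil, tripod_legs] using
        hT.append_right _
    · simp [hn]
  have hb := beta_pow_mem_betaImage (r := 2) (n := 6) (k := 1) h hn (by simp [hmem]) rfl rfl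
    (by decide) rfl
  rw [pow_one, beta_of, betaGraph_cons, Finset.sum_insert (by decide), Finset.sum_insert (by decide),
    Finset.sum_singleton,
    betaTerm_eq_treeOf h (i := 8) (j := 11) (by decide) (by simp [hmem]) (by simp),
    betaTerm_eq_treeOf h (i := 9) (j := 12) (by decide) (by simp [hmem]) (by simp),
    betaTerm_eq_treeOf h (i := 10) (j := 13) (by decide) (by simp [hmem]) (by simp),
    tripod_cut₁, tripod_cut₂ _ (by decide), tripod_cut₃ (by decide) (by decide),
    subst_eq_graft, subst_eq_graft, subst_eq_graft, ← add_assoc] at hb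
  convert hb using 2
  · congr 1
    · exact (treeOf_bind (swaps [(9, 0), (12, 1), (10, 2), (13, 3)]) c hT (by decide) (by decide) (by decide)).symm
    · exact (treeOf_bind (swaps [(8, 0), (11, 1), (10, 2), (13, 3)]) c hT (by decide) (by decide) (by decide)).symm
  · exact (treeOf_bind (swaps [(8, 0), (11, 1), (9, 2), (12, 3)]) c hT (by decide)
      (by decide) (by decide)).symm

/-- The value of `β` on a tree and a tripod that are joined by two dotted edges. -/
lemma beta_two {V : JTree} {c : ℕ → H} {i j x y z p q : ℕ}
    (h : Graph.IsHairy ⟨[V, tripod x y z], {(i, x), (j, y), (p, q)}, c⟩) (hi : i ∈ V.legs)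
    (hj : j ∈ V.legs) (hxy : x ≠ y) (hpV : p ∉ (tripod x y z).legs)
    (hqV : q ∉ (tripod x y z).legs) :
    beta (of ⟨[V, tripod x y z], {(i, x), (j, y), (p, q)}, c⟩) =
      treeOf [] {(j, y), (p, q)} c (V.bind (graft [(i, .node (.leaf y) (.leaf z))])) +
      treeOf [] {(i, x), (p, q)} c (V.bind (graft [(j, .node (.leaf z) (.leaf x))])) := by
  simp only [tripod_legs, List.mem_cons, List.not_mem_nil, or_false, not_or] at hpV hqV
  have h1 : (i, x) ∉ ({(j, y), (p, q)} : Finset (ℕ × ℕ)) := by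
    simp only [Finset.mem_insert, Finset.mem_singleton, Prod.mk.injEq]; tauto
  have h2 : (j, y) ∉ ({(p, q)} : Finset (ℕ × ℕ)) := by
    simp only [Finset.mem_singleton, Prod.mk.injEq]; tauto
  have h3 : ({(i, x), (j, y), (p, q)} : Finset (ℕ × ℕ)).erase (j, y) = {(i, x), (p, q)} := by
    rw [Finset.insert_comm]
    refine Finset.erase_insert ?_
    simp only [Finset.mem_insert, Finset.mem_singleton, Prod.mk.injEq]; tauto
  rw [beta_of, betaGraph_cons, Finset.sum_insert h1, Finset.sum_insert h2, Finset.sum_singleton,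
    betaTerm_eq_treeOf h (by simp) hi (by simp),
    betaTerm_eq_treeOf h (by simp) hj (by simp),
    betaTerm_eq_zero (i := p) (by simp; tauto) (by simp; tauto),
    tripod_cut₁, tripod_cut₂ _ hxy.symm, subst_eq_graft, subst_eq_graft, Finset.erase_insert h1,
    h3, add_zero]

/-- The two-loop relation from two tripods with one hair each that are attached to the same tree. -/
lemma tripod_pair_mem {T : JTree} (hT : T.legs.Perm [8, 9, 10, 11, 4, 5]) (c : ℕ → H) :
    treeOf [] {(0, 1), (2, 3)} c (T.bind
        (graft [(8, .node (.leaf 1) (.leaf 6)), (9, .leaf 0), (10, .node (.leaf 3) (.leaf 7)), (11, .leaf 2)])) +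
      treeOf [] {(0, 1), (2, 3)} c (T.bind
        (graft [(8, .node (.leaf 1) (.leaf 6)), (9, .leaf 0), (11, .node (.leaf 7) (.leaf 3)), (10, .leaf 2)])) +
      treeOf [] {(0, 1), (2, 3)} c (T.bind
        (graft [(9, .node (.leaf 6) (.leaf 1)), (8, .leaf 0), (10, .node (.leaf 3) (.leaf 7)), (11, .leaf 2)])) +
      treeOf [] {(0, 1), (2, 3)} c (T.bind
        (graft [(9, .node (.leaf 6) (.leaf 1)), (8, .leaf 0), (11, .node (.leaf 7) (.leaf 3)), (10, .leaf 2)])) ∈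
      betaImage H 2 6 := by
  have hn : T.numTri = 3 + 1 := by
    have := hT.length_eq; rw [JTree.length_legs] at this; simpa using this
  have hmem : ∀ i, i ∈ T.legs ↔ i ∈ [8, 9, 10, 11, 4, 5] := fun i => hT.mem_iff
  have h : Graph.IsHairy ⟨T :: [tripod 12 13 6, tripod 14 15 7],
      {(8, 12), (9, 13), (10, 14), (11, 15)}, c⟩ := by
    refine isHairy_of_perm ([8, 9, 10, 11, 4, 5] ++ ([12, 13, 6] ++ [14, 15, 7])) ?_ (by decide) ?_
      (by decide) (by decide)
    · simpa only [List.flatMap_cons, List.flatMap_nil, List.append_nil, tripod_legs] using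
        hT.append_right _
    · simp [hn]
  have hb := beta_pow_mem_betaImage (r := 2) (n := 6) (k := 2) h hn (by simp [hmem]) rfl rfl
    (by decide) rfl
  have e0 : ({(8, 12), (9, 13), (10, 14), (11, 15)} : Finset (ℕ × ℕ)).erase (8, 12) = {(10, 14), (11, 15), (9, 13)} := by decide
  have e1 : ({(8, 12), (9, 13), (10, 14), (11, 15)} : Finset (ℕ × ℕ)).erase (9, 13) = {(10, 14), (11, 15), (8, 12)} := by decide
  have h0 := IsHairy.subst h (i := 8) (j := 12) (by decide) (by simp [hmem]) (by simp)
  rw [tripod_cut₁, subst_eq_graft, e0] at h0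
  have h1 := IsHairy.subst h (i := 9) (j := 13) (by decide) (by simp [hmem]) (by simp)
  rw [tripod_cut₂ _ (by decide), subst_eq_graft, e1] at h1
  rw [pow_two, Module.End.mul_apply, beta_of, betaGraph_cons, Finset.sum_insert (by decide),
    Finset.sum_insert (by decide), Finset.sum_insert (by decide), Finset.sum_singleton,
    betaTerm_eq_treeOf h (i := 8) (j := 12) (by decide) (by simp [hmem]) (by simp),
    tripod_cut₁, subst_eq_graft,
    betaTerm_eq_treeOf h (i := 9) (j := 13) (by decide) (by simp [hmem]) (by simp),
    tripod_cut₂ _ (by decide), subst_eq_graft,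
    betaTerm_eq_zero (i := 10) (j := 14) (by simp [hmem]) (by simp [hmem]),
    betaTerm_eq_zero (i := 11) (j := 15) (by simp [hmem]) (by simp [hmem]),
    e0, e1, add_zero, add_zero, map_add, treeOf_eq h0, treeOf_eq h1,
    beta_two h0 (by rw [JTree.mem_legs_bind]; simp only [hmem]; decide)
      (by rw [JTree.mem_legs_bind]; simp only [hmem]; decide) (by decide) (by decide) (by decide),
    beta_two h1 (by rw [JTree.mem_legs_bind]; simp only [hmem]; decide)
      (by rw [JTree.mem_legs_bind]; simp only [hmem]; decide) (by decide) (by decide) (by decide),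
    JTree.bind_bind, JTree.bind_bind, JTree.bind_bind, JTree.bind_bind, ← add_assoc] at hb
  convert hb using 2
  · congr 1
    · congr 1
      · exact (treeOf_bind (swaps [(9, 0), (13, 1), (11, 2), (15, 3)]) c hT (by decide)
          (by decide) (by decide)).symm
      · exact (treeOf_bind (swaps [(9, 0), (13, 1), (10, 2), (14, 3)]) c hT (by decide)
          (by decide) (by decide)).symm
    · exact (treeOf_bind (swaps [(8, 0), (12, 1), (11, 2), (15, 3)]) c hT (by decide) (by decide) (by decide)).symm
  · exact (treeOf_bind (swaps [(8, 0), (12, 1), (10, 2), (14, 3)]) c hT (by decide)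
      (by decide) (by decide)).symm

/-- The two-loop relation from two tripods that are joined by a dotted edge. -/
lemma tripod_chain_mem {T : JTree} (hT : T.legs.Perm [8, 9, 10, 4, 5, 6]) (c : ℕ → H) :
    treeOf [] {(0, 1), (2, 3)} c (T.bind
        (graft [(8, .node (.leaf 1) (.node (.leaf 3) (.leaf 7))), (9, .leaf 0), (10, .leaf 2)])) +
      treeOf [] {(0, 1), (2, 3)} c (T.bind
        (graft [(8, .node (.leaf 1) (.leaf 2)), (9, .leaf 0), (10, .node (.leaf 7) (.leaf 3))])) +
      treeOf [] {(0, 1), (2, 3)} c (T.bind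
        (graft [(9, .node (.node (.leaf 3) (.leaf 7)) (.leaf 1)), (8, .leaf 0), (10, .leaf 2)])) +
      treeOf [] {(0, 1), (2, 3)} c (T.bind
        (graft [(9, .node (.leaf 2) (.leaf 1)), (8, .leaf 0), (10, .node (.leaf 7) (.leaf 3))])) ∈
      betaImage H 2 6 := by
  have hn : T.numTri = 3 + 1 := by
    have := hT.length_eq; rw [JTree.length_legs] at this; simpa using this
  have hmem : ∀ i, i ∈ T.legs ↔ i ∈ [8, 9, 10, 4, 5, 6] := fun i => hT.mem_iff
  have h : Graph.IsHairy ⟨T :: [tripod 11 12 13, tripod 14 15 7],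
      {(8, 11), (9, 12), (13, 14), (10, 15)}, c⟩ := by
    refine isHairy_of_perm ([8, 9, 10, 4, 5, 6] ++ ([11, 12, 13] ++ [14, 15, 7])) ?_ (by decide) ?_
      (by decide) (by decide)
    · simpa only [List.flatMap_cons, List.flatMap_nil, List.append_nil, tripod_legs] using
        hT.append_right _
    · simp [hn]
  have hb := beta_pow_mem_betaImage (r := 2) (n := 6) (k := 2) h hn (by simp [hmem]) rfl rfl
    (by decide) rfl
  have e0 : ({(8, 11), (9, 12), (13, 14), (10, 15)} : Finset (ℕ × ℕ)).erase (8, 11) = {(13, 14), (10, 15), (9, 12)} := by decide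
  have e1 : ({(8, 11), (9, 12), (13, 14), (10, 15)} : Finset (ℕ × ℕ)).erase (9, 12) = {(13, 14), (10, 15), (8, 11)} := by decide
  have h0 := IsHairy.subst h (i := 8) (j := 11) (by decide) (by simp [hmem]) (by simp)
  rw [tripod_cut₁, subst_eq_graft, e0] at h0
  have h1 := IsHairy.subst h (i := 9) (j := 12) (by decide) (by simp [hmem]) (by simp)
  rw [tripod_cut₂ _ (by decide), subst_eq_graft, e1] at h1
  rw [pow_two, Module.End.mul_apply, beta_of, betaGraph_cons, Finset.sum_insert (by decide),
    Finset.sum_insert (by decide), Finset.sum_insert (by decide), Finset.sum_singleton,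
    betaTerm_eq_treeOf h (i := 8) (j := 11) (by decide) (by simp [hmem]) (by simp),
    tripod_cut₁, subst_eq_graft,
    betaTerm_eq_treeOf h (i := 9) (j := 12) (by decide) (by simp [hmem]) (by simp),
    tripod_cut₂ _ (by decide), subst_eq_graft,
    betaTerm_eq_zero (i := 13) (j := 14) (by simp [hmem]) (by simp [hmem]),
    betaTerm_eq_zero (i := 10) (j := 15) (by simp [hmem]) (by simp [hmem]),
    e0, e1, add_zero, add_zero, map_add, treeOf_eq h0, treeOf_eq h1,
    beta_two h0 (by rw [JTree.mem_legs_bind]; simp only [hmem]; decide)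
      (by rw [JTree.mem_legs_bind]; simp only [hmem]; decide) (by decide) (by decide) (by decide),
    beta_two h1 (by rw [JTree.mem_legs_bind]; simp only [hmem]; decide)
      (by rw [JTree.mem_legs_bind]; simp only [hmem]; decide) (by decide) (by decide) (by decide),
    JTree.bind_bind, JTree.bind_bind, JTree.bind_bind, JTree.bind_bind, ← add_assoc] at hb
  convert hb using 2
  · congr 1
    · congr 1
      · exact (treeOf_bind (swaps [(9, 0), (12, 1), (10, 2), (15, 3)]) c hT (by decide)
          (by decide) (by decide)).symm
      · exact (treeOf_bind (swaps [(9, 0), (12, 1), (13, 2), (14, 3)]) c hT (by decide)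
          (by decide) (by decide)).symm
    · exact (treeOf_bind (swaps [(8, 0), (11, 1), (10, 2), (15, 3)]) c hT (by decide) (by decide) (by decide)).symm
  · exact (treeOf_bind (swaps [(8, 0), (11, 1), (13, 2), (14, 3)]) c hT (by decide)
      (by decide) (by decide)).symm

end

/-! ### Verification of linear relations between trees -/

section

variable {M : Type*} [AddCommGroup M]

/-- The value of the linear extension of `G` at a formal linear combination of trees. -/
def treeSum (G : JTree → M) (L : List (ℤ × JTree)) : M := (L.map fun p => p.1 • G p.2).sum

@[simp] lemma treeSum_nil (G : JTree → M) : treeSum G [] = 0 := rfl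

lemma treeSum_cons (G : JTree → M) (p : ℤ × JTree) (L : List (ℤ × JTree)) :
    treeSum G (p :: L) = p.1 • G p.2 + treeSum G L := by
  simp [treeSum]

lemma treeSum_append (G : JTree → M) (L L' : List (ℤ × JTree)) :
    treeSum G (L ++ L') = treeSum G L + treeSum G L' := by
  simp [treeSum]

/-- The transposition of `a` and `b`. -/
def transp (a b i : ℕ) : ℕ := bif Nat.beq i a then b else bif Nat.beq i b then a else i

lemma transp_eq_swap (a b : ℕ) : transp a b = Equiv.swap a b := by
  ext i
  simp only [transp, Bool.cond_eq_ite, Nat.beq_eq, Equiv.swap_apply_def]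

/-- The transposition of the pairs `(2a, 2a + 1)` and `(2b, 2b + 1)`. -/
def pairTransp (a b i : ℕ) : ℕ := transp (2 * a + 1) (2 * b + 1) (transp (2 * a) (2 * b) i)

/-- A comparator: if `fst` comes after `snd` in a word, then `f` is applied to the letters, at the
cost of the factor `sign`. -/
structure Comparator : Type where
  fst : ℕ
  snd : ℕ
  sign : ℤ
  f : ℕ → ℕ

/-- Whether the letter `b` occurs in a word before any occurrence of `a`. -/
def precedes (b a : ℕ) : List ℕ → Bool
  | [] => false
  | i :: u => bif Nat.beq i b then true else bif Nat.beq i a then false else precedes b a u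

/-- Whether the leaves of a tree are labelled by `0, …, 7`. -/
def wellFormed (T : JTree) : Bool :=
  Nat.beq T.legs.length 8 && [0, 1, 2, 3, 4, 5, 6, 7].all fun a => T.legs.any fun i => Nat.beq i a

lemma legs_perm_of_wellFormed {T : JTree} (h : wellFormed T = true) :
    T.legs.Perm [1, 0, 2, 3, 4, 5, 6, 7] := by
  simp only [wellFormed, Bool.and_eq_true, Nat.beq_eq, List.all_eq_true, List.any_eq_true,
    exists_eq_right] at h
  have h1 : [0, 1, 2, 3, 4, 5, 6, 7].Subperm T.legs :=
    List.subperm_of_subset (by decide) fun a ha => h.2 a ha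
  exact (h1.perm_of_length_le (by simp [h.1])).symm.trans (List.Perm.swap 1 0 _)

/-- The sign of the reversal of a word between the ends of a dotted edge. -/
def reverseSign : List ℕ → ℤ
  | [] => -1
  | _ :: u => Int.neg (reverseSign u)

lemma reverseSign_eq (u : List ℕ) : reverseSign u = (-1) ^ (u.length + 1) := by
  induction u with
  | nil => rfl
  | cons a u ih =>
    rw [reverseSign, List.length_cons, pow_succ _ (u.length + 1), ← ih]
    change -reverseSign u = _
    ring

/-- `RTree.reroot`, with a Boolean membership test. -/
def RTree.fastReroot : RTree → ℕ → RTree → RTree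
  | leaf _, _, C => C
  | node A B, i, C =>
    bif A.hasLeg i then A.fastReroot i (node B C) else B.fastReroot i (node C A)

lemma RTree.fastReroot_eq (A : RTree) (i : ℕ) (C : RTree) :
    A.fastReroot i C = A.reroot i C := by
  induction A generalizing C with
  | leaf j => rfl
  | node A B ihA ihB =>
    simp only [fastReroot, reroot, Bool.cond_eq_ite, hasLeg_iff, ihA, ihB]

/-- `JTree.cutAt`, with a Boolean membership test. -/
def JTree.fastCutAt (T : JTree) (i : ℕ) : RTree :=
  bif T.fst.hasLeg i then T.fst.fastReroot i T.snd else T.snd.fastReroot i T.fst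

lemma JTree.fastCutAt_eq (T : JTree) (i : ℕ) : T.fastCutAt i = T.cutAt i := by
  simp only [fastCutAt, cutAt, Bool.cond_eq_ite, RTree.hasLeg_iff, RTree.fastReroot_eq]

/-- The action of a comparator on a word with a coefficient. -/
def Comparator.apply (N : Comparator) (p : ℤ × List ℕ) : ℤ × List ℕ :=
  bif precedes N.snd N.fst p.2 then (Int.mul N.sign p.1, p.2.map N.f) else p

/-- The words that are obtained from a word by reversal and, if `rot` holds, by rotation. -/
def wordOrbit (rot : Bool) (u : List ℕ) : List (ℤ × List ℕ) :=
  (if rot then List.range u.length else [0]).flatMap fun k =>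
    [(1, u.rotate k), (reverseSign u, (u.rotate k).reverse)]

/-- The expansion of a formal linear combination of trees into caterpillars between `0` and `1`,
symmetrised over the relabellings `E` and the word operations, and normalised by the
comparators `N`. -/
def expandTrees (E : List (ℤ × (ℕ → ℕ))) (rot : Bool) (N : List Comparator)
    (L : List (ℤ × JTree)) : List (ℤ × List ℕ) :=
  L.flatMap fun p => E.flatMap fun q => ((p.2.map q.2).fastCutAt 1).firstWords 0 |>.flatMap fun a =>
    (wordOrbit rot a.2).map fun b => N.foldl (fun x n => n.apply x)
      (Int.mul p.1 (Int.mul q.1 (Int.mul a.1 b.1)), b.2)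

/-- The sum of the coefficients. -/
def coeffSum : List (ℤ × List ℕ) → ℤ
  | [] => 0
  | p :: L => Int.add p.1 (coeffSum L)

/-- The terms whose word starts with `a`, with this letter removed. -/
def startingWith (a : ℕ) : List (ℤ × List ℕ) → List (ℤ × List ℕ)
  | [] => []
  | (_, []) :: L => startingWith a L
  | (k, b :: u) :: L => bif Nat.beq b a then (k, u) :: startingWith a L else startingWith a L

/-- Whether all words have a first letter that is less than `n`. -/
def startsBelow (n : ℕ) : List (ℤ × List ℕ) → Bool
  | [] => true
  | (_, []) :: _ => false
  | (_, b :: _) :: L => Nat.blt b n && startsBelow n L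

/-- Whether all words are empty. -/
def allNil : List (ℤ × List ℕ) → Bool
  | [] => true
  | (_, []) :: L => allNil L
  | (_, _ :: _) :: _ => false

/-- Whether a formal linear combination of words of length `n` with letters less than `8` is
zero. -/
def vanishes : ℕ → List (ℤ × List ℕ) → Bool
  | 0, L => allNil L && (coeffSum L == 0)
  | n + 1, L => L.isEmpty || (startsBelow 8 L &&
      [0, 1, 2, 3, 4, 5, 6, 7].all fun a => vanishes n (startingWith a L))

lemma wordSum_of_startsBelow (f : List ℕ → M) (L : List (ℤ × List ℕ)) (n : ℕ)
    (h : startsBelow n L = true) : wordSum f L = ∑ a ∈ Finset.range n,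
      wordSum (fun u => f (a :: u)) (startingWith a L) := by
  induction L with
  | nil => simp [startingWith]
  | cons p L ih =>
    obtain ⟨k, u⟩ := p
    match u, h with
    | b :: u, h =>
      simp only [startsBelow, Bool.and_eq_true, Nat.blt_eq] at h
      rw [wordSum_cons, ih h.2, ← Finset.add_sum_erase _ _ (Finset.mem_range.2 h.1),
        ← Finset.add_sum_erase _ _ (Finset.mem_range.2 h.1), ← add_assoc]
      congr 1
      · simp [startingWith, wordSum_cons]
      · refine Finset.sum_congr rfl fun a ha => ?_
        have : b ≠ a := (Finset.ne_of_mem_erase ha).symm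
        simp [startingWith, this, Bool.cond_eq_ite]

lemma wordSum_of_allNil (f : List ℕ → M) (L : List (ℤ × List ℕ)) (h : allNil L = true) :
    wordSum f L = coeffSum L • f [] := by
  induction L with
  | nil => simp [coeffSum]
  | cons p L ih =>
    obtain ⟨k, u⟩ := p
    match u, h with
    | [], h =>
      rw [wordSum_cons, ih h, coeffSum, ← add_smul]
      rfl

lemma wordSum_eq_zero_of_vanishes (f : List ℕ → M) (n : ℕ) (L : List (ℤ × List ℕ))
    (h : vanishes n L = true) : wordSum f L = 0 := by
  induction n generalizing f L with
  | zero =>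
    simp only [vanishes, Bool.and_eq_true, beq_iff_eq] at h
    rw [wordSum_of_allNil f L h.1, h.2, zero_smul]
  | succ n ih =>
    simp only [vanishes, Bool.or_eq_true, Bool.and_eq_true, List.all_eq_true,
      List.isEmpty_iff] at h
    rcases h with rfl | ⟨h1, h2⟩
    · simp
    · rw [wordSum_of_startsBelow f L 8 h1]
      exact Finset.sum_eq_zero fun a ha =>
        ih _ _ (h2 a (by have := Finset.mem_range.1 ha; interval_cases a <;> simp))

lemma wordSum_flatMap {α : Type*} (f : List ℕ → M) (L : List α) (g : α → List (ℤ × List ℕ)) :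
    wordSum f (L.flatMap g) = (L.map fun a => wordSum f (g a)).sum := by
  induction L with
  | nil => rfl
  | cons a L ih => rw [List.flatMap_cons, wordSum_append, ih, List.map_cons, List.sum_cons]

lemma IsTreeFun.comb_reverse {G : JTree → M} (hG : IsTreeFun G) (s e : ℕ) (u : List ℕ) :
    G ⟨RTree.comb (.leaf s) u, .leaf e⟩ =
      (-1 : ℤ) ^ u.length • G ⟨RTree.comb (.leaf e) u.reverse, .leaf s⟩ := by
  have key : ∀ (u : List ℕ) (X : RTree) (E : RTree), G ⟨X.comb u, E⟩ =
      (-1 : ℤ) ^ u.length • G ⟨E.comb u.reverse, X⟩ := by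
    intro u
    induction u with
    | nil => intro X E; simp [RTree.comb, hG.swap X E]
    | cons a u ih =>
      intro X E
      have h : ∀ Y, G ⟨Y, .node X (.leaf a)⟩ = -G ⟨.node Y (.leaf a), X⟩ := by
        intro Y
        rw [hG.swap Y, hG.antisymm, hG.rot, hG.swap, hG.rot, hG.swap]
      rw [RTree.comb, ih, h, List.reverse_cons, RTree.comb_append, List.length_cons, pow_succ]
      simp [RTree.comb]
  exact key u _ _

lemma list_sum_map_const {α : Type*} {l : List α} {f : α → M} {v : M} (h : ∀ x ∈ l, f x = v) :
    (l.map f).sum = l.length • v := by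
  rw [List.map_congr_left h, List.map_const', List.sum_replicate]

lemma Comparator.smul_apply {W : List ℕ → M} {N : Comparator}
    (hN : ∀ u : List ℕ, W (u.map N.f) = N.sign • W u) (h1 : N.sign * N.sign = 1)
    (p : ℤ × List ℕ) : (N.apply p).1 • W (N.apply p).2 = p.1 • W p.2 := by
  unfold Comparator.apply
  cases precedes N.snd N.fst p.2
  · rfl
  · rw [Bool.cond_true, hN, smul_smul]
    change (N.sign * p.1 * N.sign) • _ = _
    rw [mul_right_comm, h1, one_mul]

lemma smul_foldl_apply {W : List ℕ → M} {N : List Comparator}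
    (hN : ∀ n ∈ N, ∀ u : List ℕ, W (u.map n.f) = n.sign • W u)
    (h1 : ∀ n ∈ N, n.sign * n.sign = 1) (p : ℤ × List ℕ) :
    (N.foldl (fun x n => n.apply x) p).1 • W (N.foldl (fun x n => n.apply x) p).2 =
      p.1 • W p.2 := by
  induction N generalizing p with
  | nil => rfl
  | cons n N ih =>
    rw [List.foldl_cons, ih (fun m hm => hN m (List.mem_cons_of_mem _ hm))
      (fun m hm => h1 m (List.mem_cons_of_mem _ hm)),
      Comparator.smul_apply (hN n (by simp)) (h1 n (by simp))]

lemma RTree.map_comb (f : ℕ → ℕ) (X : RTree) (u : List ℕ) :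
    (X.comb u).map f = (X.map f).comb (u.map f) := by
  induction u generalizing X with
  | nil => rfl
  | cons a u ih => simp [RTree.comb, ih, RTree.map]

/-- A formal linear combination of trees whose normalised expansion vanishes is mapped to zero by
every function on trees with the corresponding symmetries. -/
lemma treeSum_eq_zero [Module ℚ M] {G : JTree → M} (hG : IsTreeFun G)
    (E : List (ℤ × (ℕ → ℕ))) (rot : Bool) (N : List Comparator) (L : List (ℤ × JTree))
    (hE : ∀ q ∈ E, ∀ T, G (T.map q.2) = q.1 • G T) (hE1 : ∀ q ∈ E, q.1 * q.1 = 1) (hE0 : E ≠ [])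
    (hflip : ∀ T : JTree, G (T.map (transp 0 1)) = -G T)
    (hrot : rot = true → ∀ u : List ℕ, u.Perm [2, 3, 4, 5, 6, 7] → ∀ k,
      G ⟨RTree.comb (.leaf 0) (u.rotate k), .leaf 1⟩ = G ⟨RTree.comb (.leaf 0) u, .leaf 1⟩)
    (hN : ∀ n ∈ N, ∀ T, G (T.map n.f) = n.sign • G T)
    (hN1 : ∀ n ∈ N, n.sign * n.sign = 1 ∧ n.f 0 = 0 ∧ n.f 1 = 1)
    (hL : ∀ p ∈ L, ∀ q ∈ E, wellFormed (p.2.map q.2) = true)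
    (h : vanishes 6 (expandTrees E rot N L) = true) : treeSum G L = 0 := by
  set W : List ℕ → M := fun u => G ⟨RTree.comb (.leaf 0) u, .leaf 1⟩ with hW
  have hWmap : ∀ n ∈ N, ∀ u : List ℕ, W (u.map n.f) = n.sign • W u := by
    intro n hn u
    rw [hW, ← hN n hn]
    simp only [JTree.map, RTree.map_comb, RTree.map, (hN1 n hn).2.1, (hN1 n hn).2.2]
  have hWrev : ∀ u : List ℕ, 0 ∉ u → 1 ∉ u → ((-1 : ℤ) ^ (u.length + 1)) • W u.reverse = W u := by
    intro u h0 h1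
    have h2 := hflip ⟨RTree.comb (.leaf 1) u.reverse, .leaf 0⟩
    have h3 : u.reverse.map (transp 0 1) = u.reverse := by
      conv_rhs => rw [← List.map_id u.reverse]
      refine List.map_congr_left fun i hi => ?_
      have hi' := List.mem_reverse.1 hi
      rw [transp_eq_swap, Equiv.swap_apply_of_ne_of_ne (fun hh : i = 0 => h0 (hh ▸ hi'))
        (fun hh : i = 1 => h1 (hh ▸ hi')), id]
    simp only [JTree.map, RTree.map_comb, RTree.map, h3] at h2
    have h4 := hG.comb_reverse 0 1 u
    rw [← neg_eq_iff_eq_neg] at h2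
    rw [← h2] at h4
    rw [show transp 0 1 1 = 0 from rfl, show transp 0 1 0 = 1 from rfl] at h4
    simp only [hW, h4, pow_succ]
    simp
  have horb : ∀ u : List ℕ, u.Perm [2, 3, 4, 5, 6, 7] →
      (∀ b ∈ wordOrbit rot u, b.1 • W b.2 = W u) ∧
        (wordOrbit rot u).length = 2 * (if rot then 6 else 1) := by
    intro u hu
    have hrot' : ∀ k ∈ (if rot then List.range u.length else [0]), W (u.rotate k) = W u := by
      intro k hk
      cases rot with
      | true => exact hrot rfl u hu k
      | false =>
        have : k = 0 := by simpa using hk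
        rw [this, List.rotate_zero]
    constructor
    · intro b hb
      simp only [wordOrbit, List.mem_flatMap, List.mem_cons, List.not_mem_nil, or_false] at hb
      obtain ⟨k, hk, rfl | rfl⟩ := hb
      · rw [one_smul, hrot' k hk]
      · have := hWrev (u.rotate k)
        rw [List.length_rotate, ← reverseSign_eq] at this
        rw [this, hrot' k hk]
        · rw [List.mem_rotate, hu.mem_iff]; decide
        · rw [List.mem_rotate, hu.mem_iff]; decide
    · have := hu.length_eq
      cases rot <;> simp [wordOrbit, this]
  set m := 2 * (if rot then 6 else 1) with hm
  have key : wordSum W (expandTrees E rot N L) = (E.length * m) • treeSum G L := by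
    rw [expandTrees, wordSum_flatMap, treeSum, List.smul_sum, List.map_map]
    congr 1
    refine List.map_congr_left fun p hp => ?_
    rw [wordSum_flatMap, list_sum_map_const (v := m • p.1 • G p.2)]
    · simp [mul_smul]
    · intro q hq
      have hwf := hL p hp q hq
      have hlegs := legs_perm_of_wellFormed hwf
      have h1 : 1 ∈ (p.2.map q.2).legs := hlegs.mem_iff.2 (by simp)
      have hcut : ((p.2.map q.2).cutAt 1).legs.Perm [0, 2, 3, 4, 5, 6, 7] :=
        ((JTree.cutAt_legs _ _ h1).trans hlegs).cons_inv
      have h0 : 0 ∈ ((p.2.map q.2).cutAt 1).legs := hcut.mem_iff.2 (by simp)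
      have hperm : ∀ a ∈ ((p.2.map q.2).cutAt 1).firstWords 0, a.2.Perm [2, 3, 4, 5, 6, 7] :=
        fun a ha => ((RTree.firstWords_perm h0 ha).trans hcut).cons_inv
      rw [JTree.fastCutAt_eq]
      rw [wordSum_flatMap]
      have hexp := hG.expand h1 h0
      have : ∀ a ∈ ((p.2.map q.2).cutAt 1).firstWords 0,
          wordSum W ((wordOrbit rot a.2).map fun b => N.foldl (fun x n => n.apply x)
            (Int.mul p.1 (Int.mul q.1 (Int.mul a.1 b.1)), b.2)) =
            (m • (p.1 * q.1)) • a.1 • W a.2 := by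
        intro a ha
        obtain ⟨ho, hlen⟩ := horb a.2 (hperm a ha)
        rw [wordSum, List.map_map, list_sum_map_const (v := (p.1 * q.1) • a.1 • W a.2), hlen,
          smul_assoc]
        intro b hb
        simp only [Function.comp]
        rw [smul_foldl_apply hWmap fun n hn => (hN1 n hn).1]
        change (p.1 * (q.1 * (a.1 * b.1))) • W b.2 = _
        simp only [mul_smul, ho b hb]
      rw [List.map_congr_left this]
      have h3 : (List.map (fun a : ℤ × List ℕ => (m • (p.1 * q.1)) • a.1 • W a.2)
          (((p.2.map q.2).cutAt 1).firstWords 0)).sum =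
          (m • (p.1 * q.1)) • G (p.2.map q.2) := by
        rw [hexp, wordSum, List.smul_sum, List.map_map]
        rfl
      rw [h3, hE q hq, smul_assoc, mul_smul p.1, smul_smul q.1, hE1 q hq, one_smul]
  rw [wordSum_eq_zero_of_vanishes W 6 _ h] at key
  have hne : ((E.length * m : ℕ) : ℚ) ≠ 0 := by
    rw [Nat.cast_ne_zero]
    refine Nat.mul_ne_zero (by simpa using hE0) ?_
    rw [hm]; split_ifs <;> decide
  have h5 : ((E.length * m : ℕ) : ℚ) • treeSum G L = 0 := by
    rw [Nat.cast_smul_eq_nsmul, ← key]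
  exact (smul_eq_zero.1 h5).resolve_left hne

end

/-! ### The trees with vanishing one-loop trace -/

/-- The tree from which all elements of the kernel of the one-loop trace are built. The leaves with dual
colours are `0, 1`, then `2, 3`, and so on. -/
def baseTree : JTree :=
  ⟨.node (.leaf 0) (.node (.node (.node (.leaf 1) (.leaf 2)) (.leaf 4)) (.node (.leaf 3) (.node (.leaf 5) (.leaf 6)))), .leaf 7⟩

/-- The tree that has to be added to `baseTree` if all leaves are contracted, for the
terms of the one-loop trace to cancel. -/
def corrTree : JTree :=
  ⟨.node (.leaf 0) (.node (.node (.node (.node (.node (.leaf 1) (.leaf 6)) (.leaf 4)) (.leaf 2)) (.leaf 3)) (.leaf 5)), .leaf 7⟩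

/-- The trees with `m` pairs of dual colours. -/
def coreTrees (m : ℕ) : List JTree := if m = 4 then [baseTree, corrTree] else [baseTree]

/-- The trees in which one of the first `m` pairs has been relabelled as the pair `(0, 1)`. -/
def oneLoopTrees (m : ℕ) : List (ℤ × JTree) :=
  (List.range m).flatMap fun i => (coreTrees m).map fun T => (1, T.map (pairTransp 0 i))

/-- The trees in which two of the first `m` pairs have been relabelled as the pairs `(0, 1)` and
`(2, 3)`. -/
def twoLoopTrees (m : ℕ) : List (ℤ × JTree) :=
  (List.range m).flatMap fun j => (List.range j).flatMap fun i =>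
    (coreTrees m).map fun T => (1, (T.map (pairTransp 0 i)).map (pairTransp 1 j))

/-- Comparators that sort the `m - 1` pairs other than `(0, 1)` and the remaining leaves. -/
def oneLoopNetwork : ℕ → List Comparator
  | 2 => [⟨2, 3, -1, transp 2 3⟩, ⟨4, 5, -1, transp 4 5⟩, ⟨5, 6, -1, transp 5 6⟩, ⟨6, 7, -1, transp 6 7⟩, ⟨4, 5, -1, transp 4 5⟩, ⟨5, 6, -1, transp 5 6⟩, ⟨4, 5, -1, transp 4 5⟩]
  | 3 => [⟨2, 3, -1, transp 2 3⟩, ⟨4, 5, -1, transp 4 5⟩, ⟨2, 4, 1, pairTransp 1 2⟩, ⟨6, 7, -1, transp 6 7⟩]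
  | 4 => [⟨2, 3, -1, transp 2 3⟩, ⟨4, 5, -1, transp 4 5⟩, ⟨6, 7, -1, transp 6 7⟩, ⟨2, 4, 1, pairTransp 1 2⟩, ⟨4, 6, 1, pairTransp 2 3⟩, ⟨2, 4, 1, pairTransp 1 2⟩]
  | _ => []

lemma oneLoopTrees_vanish : ∀ m ∈ [2, 3, 4],
    vanishes 6 (expandTrees [(1, id)] true (oneLoopNetwork m) (oneLoopTrees m)) = true := by
  decide +kernel

lemma oneLoopTrees_perm : ∀ m ∈ [2, 3, 4], ∀ p ∈ oneLoopTrees m, ∀ q ∈ [((1 : ℤ), (id : ℕ → ℕ))],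
    wellFormed (p.2.map q.2) = true := by
  decide +kernel

/-! ### Coincidences of colours in the two-loop part -/

/-- The three families of elements of `betaImage H 2 6` from which the relations between trees with
two dotted edges are built. -/
inductive RelKind : Type
  | tripod
  | pair
  | chain

namespace RelKind

/-- The substitutions that give the terms of a relation, for a tree with the ends `8` and `9`. -/
def grafts : RelKind → List (List (ℕ × RTree))
  | tripod => [
      [(8, .node (.leaf 1) (.leaf 3)), (9, .leaf 0), (10, .leaf 2)],
      [(9, .node (.leaf 3) (.leaf 1)), (8, .leaf 0), (10, .leaf 2)],
      [(10, .node (.leaf 1) (.leaf 3)), (8, .leaf 0), (9, .leaf 2)]]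
  | pair => [
      [(8, .node (.leaf 1) (.leaf 6)), (9, .leaf 0), (10, .node (.leaf 3) (.leaf 7)), (11, .leaf 2)],
      [(8, .node (.leaf 1) (.leaf 6)), (9, .leaf 0), (11, .node (.leaf 7) (.leaf 3)), (10, .leaf 2)],
      [(9, .node (.leaf 6) (.leaf 1)), (8, .leaf 0), (10, .node (.leaf 3) (.leaf 7)), (11, .leaf 2)],
      [(9, .node (.leaf 6) (.leaf 1)), (8, .leaf 0), (11, .node (.leaf 7) (.leaf 3)), (10, .leaf 2)]]
  | chain => [
      [(8, .node (.leaf 1) (.node (.leaf 3) (.leaf 7))), (9, .leaf 0), (10, .leaf 2)],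
      [(8, .node (.leaf 1) (.leaf 2)), (9, .leaf 0), (10, .node (.leaf 7) (.leaf 3))],
      [(9, .node (.node (.leaf 3) (.leaf 7)) (.leaf 1)), (8, .leaf 0), (10, .leaf 2)],
      [(9, .node (.leaf 2) (.leaf 1)), (8, .leaf 0), (10, .node (.leaf 7) (.leaf 3))]]

/-- The leaves other than `8` and `9` of the tree in a relation. -/
def letters : RelKind → List ℕ
  | tripod => [10, 4, 5, 6, 7]
  | pair => [10, 11, 4, 5]
  | chain => [10, 4, 5, 6]

/-- The terms of the relation for the caterpillar with word `w`, relabelled by transpositions. -/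
def trees (k : RelKind) (w : List ℕ) (π : List (ℕ × ℕ)) : List JTree :=
  k.grafts.map fun ρ =>
    ((⟨RTree.comb (.leaf 8) w, .leaf 9⟩ : JTree).bind (graft ρ)).map (swaps π)

end RelKind

section

variable {H : Type*} [AddCommGroup H] [Module ℚ H]

lemma swaps_apply_eq {π : List (ℕ × ℕ)} {i : ℕ} (h : ∀ p ∈ π, p.1 ≠ i ∧ p.2 ≠ i) :
    swaps π i = i := by
  induction π with
  | nil => rfl
  | cons p π ih =>
    have h1 : swaps (p :: π) i = Equiv.swap p.1 p.2 (swaps π i) := by simp [swaps]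
    rw [h1, ih fun q hq => h q (List.mem_cons_of_mem _ hq),
      Equiv.swap_apply_of_ne_of_ne (h p (by simp)).1.symm (h p (by simp)).2.symm]

lemma RelKind.trees_mem (k : RelKind) {w : List ℕ} (hw : w.Perm k.letters) {π : List (ℕ × ℕ)}
    (hπ : ∀ p ∈ π, 4 ≤ p.1 ∧ 4 ≤ p.2) (c : ℕ → H) :
    ((k.trees w π).map (treeOf [] {(0, 1), (2, 3)} c)).sum ∈ betaImage H 2 6 := by
  have hfix : ∀ i < 4, swaps π i = i := fun i hi =>
    swaps_apply_eq fun p hp => ⟨by have := hπ p hp; omega, by have := hπ p hp; omega⟩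
  have hmap : ∀ T : JTree, treeOf [] {(0, 1), (2, 3)} c (T.map (swaps π)) =
      treeOf [] {(0, 1), (2, 3)} (c ∘ swaps π) T := fun T =>
    treeOf_map (swaps π) T (by simp [Finset.image_insert, hfix]) fun _ _ _ => rfl
  have hlegs : (⟨RTree.comb (.leaf 8) w, .leaf 9⟩ : JTree).legs.Perm (8 :: 9 :: w) := by
    simp only [JTree.legs, RTree.comb_legs, RTree.legs, List.cons_append, List.nil_append]
    exact List.Perm.cons _ List.perm_append_comm
  have hlegs' := hlegs.trans ((hw.cons 9).cons 8)
  rw [RelKind.trees, List.map_map]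
  simp only [Function.comp_def, hmap]
  cases k with
  | tripod => simpa [RelKind.grafts, add_assoc, Function.comp_def] using tripod_mem hlegs' (c ∘ swaps π)
  | pair => simpa [RelKind.grafts, add_assoc, Function.comp_def] using tripod_pair_mem hlegs' (c ∘ swaps π)
  | chain => simpa [RelKind.grafts, add_assoc, Function.comp_def] using tripod_chain_mem hlegs' (c ∘ swaps π)

end

/-- Antisymmetrisation in the leaves `a` and `b`. -/
def antisymTrees (a b : ℕ) (L : List (ℤ × JTree)) : List (ℤ × JTree) :=
  L ++ L.map fun p => (-p.1, p.2.map (transp a b))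

/-- The relations that express the coincidence of colours for `m` pairs, with coefficients: a
solution of the linear equations between the normalised expansions. The list gives the relations as
arguments of `RelKind.trees`. -/
def certificate : ℕ → List (ℤ × RelKind × List ℕ × List (ℕ × ℕ))
  | 3 => [
      (-12, .tripod, [4, 5, 10, 6, 7], []),
      (1, .tripod, [10, 4, 6, 7, 5], []),
      (4, .pair, [10, 4, 5, 11], []),
      (12, .tripod, [4, 5, 6, 10, 7], []),
      (-2, .tripod, [4, 6, 10, 7, 5], []),
      (-4, .chain, [4, 10, 5, 6], [(4, 5), (6, 7)]),
      (-12, .pair, [4, 10, 5, 11], [(6, 7)]),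
      (2, .pair, [10, 4, 5, 11], [(5, 6)]),
      (4, .chain, [4, 10, 5, 6], [(5, 7), (5, 6)])]
  | 4 => [
      (-8, .chain, [10, 4, 5, 6], [(6, 7)]),
      (-8, .pair, [4, 10, 11, 5], [(5, 6)]),
      (22, .pair, [4, 10, 5, 11], []),
      (8, .pair, [4, 10, 11, 5], []),
      (4, .chain, [4, 5, 10, 6], [(6, 7)]),
      (-2, .chain, [10, 4, 5, 6], [(5, 6)]),
      (2, .pair, [10, 4, 11, 5], [(5, 6)]),
      (21, .tripod, [4, 6, 5, 10, 7], []),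
      (-2, .tripod, [4, 5, 10, 7, 6], []),
      (16, .chain, [10, 4, 5, 6], [(4, 5), (6, 7)]),
      (6, .chain, [4, 5, 6, 10], [(5, 6)]),
      (-12, .pair, [10, 4, 5, 11], []),
      (-3, .tripod, [4, 6, 10, 5, 7], []),
      (-16, .tripod, [4, 5, 10, 6, 7], [])]
  | _ => []

/-- The linear combination of relations given by `certificate`. -/
def certTrees (m : ℕ) : List (ℤ × JTree) :=
  (certificate m).flatMap fun p => (p.2.1.trees p.2.2.1 p.2.2.2).map fun T => (p.1, T)

/-- The comparators for trees with two dotted edges in which the leaves `4` and `6`, and for `m = 4`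
also the leaves `5` and `7`, have the same colours. -/
def twoLoopNetwork (m : ℕ) : List Comparator :=
  ⟨2, 3, -1, transp 2 3⟩ :: ⟨4, 6, 1, transp 4 6⟩ ::
    if m = 4 then [⟨5, 7, 1, transp 5 7⟩] else []

/-- The sum of the trees with coinciding colours and of the relations that cancel it. -/
def coincidenceTrees (m : ℕ) : List (ℤ × JTree) :=
  ((antisymTrees 4 5 (antisymTrees 6 7 (twoLoopTrees m))).map fun p =>
    ((if m = 3 then 4 else 2) * p.1, p.2)) ++ certTrees m

lemma coincidenceTrees_vanish : ∀ m ∈ [3, 4],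
    vanishes 6 (expandTrees [(1, id), (1, pairTransp 0 1)] false (twoLoopNetwork m)
      (coincidenceTrees m)) = true := by
  decide +kernel

lemma coincidenceTrees_perm : ∀ m ∈ [3, 4], ∀ p ∈ coincidenceTrees m,
    ∀ q ∈ [((1 : ℤ), (id : ℕ → ℕ)), (1, pairTransp 0 1)],
    wellFormed (p.2.map q.2) = true := by
  decide +kernel

/-! ### Symmetries of trees with one or two dotted edges -/

section

variable {M N : Type*} [AddCommGroup M] [AddCommGroup N]

lemma IsTreeFun.sum {ι : Type*} (s : Finset ι) {G : ι → JTree → M} (hG : ∀ i ∈ s, IsTreeFun (G i)) :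
    IsTreeFun fun T => ∑ i ∈ s, G i T where
  swap A B := Finset.sum_congr rfl fun i hi => (hG i hi).swap A B
  rot A B C := Finset.sum_congr rfl fun i hi => (hG i hi).rot A B C
  antisymm A B C := by
    rw [← Finset.sum_neg_distrib]
    exact Finset.sum_congr rfl fun i hi => (hG i hi).antisymm A B C
  ihx A B C E := by
    simp only [← Finset.sum_add_distrib]
    exact Finset.sum_eq_zero fun i hi => (hG i hi).ihx A B C E

lemma map_treeSum (φ : M →+ N) (G : JTree → M) (L : List (ℤ × JTree)) :
    φ (treeSum G L) = treeSum (fun T => φ (G T)) L := by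
  simp [treeSum, map_list_sum, Function.comp_def]

lemma treeSum_congr {G G' : JTree → M} {L : List (ℤ × JTree)} (h : ∀ p ∈ L, G p.2 = G' p.2) :
    treeSum G L = treeSum G' L := by
  unfold treeSum
  congr 1
  exact List.map_congr_left fun p hp => by rw [h p hp]

end

section

variable {H : Type*} [AddCommGroup H] [Module ℚ H]

lemma isHairy_flip_iff {l : List JTree} {D D' : Finset (ℕ × ℕ)} {c : ℕ → H}
    (hm : IsMatching D ↔ IsMatching D') (he : endpoints D = endpoints D') :
    Graph.IsHairy ⟨l, D, c⟩ ↔ Graph.IsHairy ⟨l, D', c⟩ :=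
  ⟨fun h => ⟨h.nodup, h.tri, hm.1 h.matching, he ▸ h.sub⟩,
    fun h => ⟨h.nodup, h.tri, hm.2 h.matching, he ▸ h.sub⟩⟩

lemma treeOf_flip {D D' : Finset (ℕ × ℕ)} {e : ℕ × ℕ} (c : ℕ → H) (T : JTree) (he : e ∈ D)
    (hD : insert e.swap (D.erase e) = D') (hm : IsMatching D) (hm' : IsMatching D')
    (hE : endpoints D = endpoints D') :
    treeOf [] D' c T = -treeOf [] D c T := by
  have hiff := isHairy_flip_iff (l := [T]) (c := c) (iff_of_true hm hm') hE
  unfold treeOf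
  by_cases h : Graph.IsHairy ⟨[T], D, c⟩
  · rw [if_pos h, if_pos (hiff.1 h), ← hD, of_flip h he]
  · rw [if_neg h, if_neg (mt hiff.2 h), neg_zero]

instance (D : Finset (ℕ × ℕ)) : Decidable (IsMatching D) := by unfold IsMatching; infer_instance

lemma treeOf_one_flip (c : ℕ → H) (T : JTree) :
    treeOf [] {(0, 1)} c (T.map (transp 0 1)) = -treeOf [] {(0, 1)} c T := by
  rw [transp_eq_swap, treeOf_map (Equiv.swap 0 1) (D := {(1, 0)}) (c := c) T (by decide)]
  · exact treeOf_flip c T (e := (0, 1)) (by decide) (by decide) (by decide) (by decide) (by decide)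
  · intro i _ hi
    rw [Equiv.swap_apply_of_ne_of_ne] <;> rintro rfl <;> exact hi (by decide)

lemma treeOf_two_flip₁ (c : ℕ → H) (T : JTree) :
    treeOf [] {(0, 1), (2, 3)} c (T.map (transp 0 1)) = -treeOf [] {(0, 1), (2, 3)} c T := by
  rw [transp_eq_swap, treeOf_map (Equiv.swap 0 1) (D := {(1, 0), (2, 3)}) (c := c) T (by decide)]
  · exact treeOf_flip c T (e := (0, 1)) (by decide) (by decide) (by decide) (by decide) (by decide)
  · intro i _ hi
    rw [Equiv.swap_apply_of_ne_of_ne] <;> rintro rfl <;> exact hi (by decide)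

lemma treeOf_two_flip₂ (c : ℕ → H) (T : JTree) :
    treeOf [] {(0, 1), (2, 3)} c (T.map (transp 2 3)) = -treeOf [] {(0, 1), (2, 3)} c T := by
  rw [transp_eq_swap, treeOf_map (Equiv.swap 2 3) (D := {(0, 1), (3, 2)}) (c := c) T (by decide)]
  · exact treeOf_flip c T (e := (2, 3)) (by decide) (by decide) (by decide) (by decide) (by decide)
  · intro i _ hi
    rw [Equiv.swap_apply_of_ne_of_ne] <;> rintro rfl <;> exact hi (by decide)

lemma pairTransp_eq_swap (a b : ℕ) : pairTransp a b =
    ⇑(Equiv.swap (2 * a + 1) (2 * b + 1) * Equiv.swap (2 * a) (2 * b) : Equiv.Perm ℕ) := by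
  funext i
  simp [pairTransp, transp_eq_swap]

lemma treeOf_two_exchange (c : ℕ → H) (T : JTree) :
    treeOf [] {(0, 1), (2, 3)} c (T.map (pairTransp 0 1)) = treeOf [] {(0, 1), (2, 3)} c T := by
  rw [pairTransp_eq_swap,
    treeOf_map (Equiv.swap (2 * 0 + 1) (2 * 1 + 1) * Equiv.swap (2 * 0) (2 * 1)) (D := {(0, 1), (2, 3)}) (c := c) T (by decide)]
  intro i _ hi
  have : i ≠ 0 ∧ i ≠ 1 ∧ i ≠ 2 ∧ i ≠ 3 := by
    refine ⟨?_, ?_, ?_, ?_⟩ <;> rintro rfl <;> exact hi (by decide)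
  rw [Equiv.Perm.mul_apply, Equiv.swap_apply_of_ne_of_ne this.1 this.2.2.1,
    Equiv.swap_apply_of_ne_of_ne this.2.1 this.2.2.2]

/-- Rotating the word between the ends of the dotted edge does not change the class of a
caterpillar with one dotted edge. -/
lemma treeOf_one_rotate (c : ℕ → H) {u : List ℕ} (hu : u.Perm [2, 3, 4, 5, 6, 7]) (k : ℕ) :
    (betaImage H 1 6).mkQ (treeOf [] {(0, 1)} c ⟨RTree.comb (.leaf 0) (u.rotate k), .leaf 1⟩) =
      (betaImage H 1 6).mkQ (treeOf [] {(0, 1)} c ⟨RTree.comb (.leaf 0) u, .leaf 1⟩) := by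
  induction k with
  | zero => simp
  | succ k ih =>
    rw [← ih, ← List.rotate_rotate]
    have hv : (u.rotate k).Perm [2, 3, 4, 5, 6, 7] := (List.rotate_perm u k).trans hu
    generalize u.rotate k = v at hv
    match v, hv with
    | [], hv => rfl
    | z :: v, hv =>
      rw [List.rotate_cons_succ, List.rotate_zero, ← sub_eq_zero, ← map_sub, Submodule.mkQ_apply,
        Submodule.Quotient.mk_eq_zero]
      set σ := Equiv.swap z 7 with hσ
      have hz : 2 ≤ z := by
        have : z ∈ [2, 3, 4, 5, 6, 7] := hv.mem_iff.1 (by simp)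
        fin_cases this <;> simp
      have h0 : σ 0 = 0 := Equiv.swap_apply_of_ne_of_ne (by omega) (by omega)
      have h1 : σ 1 = 1 := Equiv.swap_apply_of_ne_of_ne (by omega) (by omega)
      have hσz : σ z = 7 := Equiv.swap_apply_left z 7
      have hmap : ∀ T : JTree, treeOf [] {(0, 1)} (c ∘ σ) (T.map σ) = treeOf [] {(0, 1)} c T :=
        fun T => treeOf_map σ T (by simp [h0, h1]) fun i _ _ => by simp [hσ]
      have hvσ : (v.map σ).Perm [2, 3, 4, 5, 6] := by
        have h2 : ((z :: v).map σ).Perm ([2, 3, 4, 5, 6, 7].map σ) := hv.map σ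
        have h3 : ([2, 3, 4, 5, 6, 7].map σ).Perm [7, 2, 3, 4, 5, 6] := by
          have : z ∈ [2, 3, 4, 5, 6, 7] := hv.mem_iff.1 (by simp)
          rw [hσ]
          clear_value σ
          clear hv h2 hz h0 h1 hσz hmap
          fin_cases this <;> decide
        have h4 := h2.trans h3
        rw [List.map_cons, hσz] at h4
        exact h4.cons_inv
      have hlegs : (⟨RTree.comb (.leaf 8) (v.map σ), .leaf 9⟩ : JTree).legs.Perm
          [8, 9, 2, 3, 4, 5, 6] := by
        simp only [JTree.legs, RTree.comb_legs, RTree.legs, List.cons_append, List.nil_append]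
        exact List.Perm.cons _ (List.perm_append_comm.trans (hvσ.cons 9))
      have key := slide_mem hlegs (c ∘ σ)
      have hbind : ∀ (ρ : List (ℕ × RTree)) (X : RTree), (∀ i ∈ [2, 3, 4, 5, 6], graft ρ i = .leaf i) →
          (X.comb (v.map σ)).bind (graft ρ) = (X.bind (graft ρ)).comb (v.map σ) := by
        intro ρ X hρ
        have : ∀ (w : List ℕ) (X : RTree), (∀ i ∈ w, graft ρ i = .leaf i) →
            (X.comb w).bind (graft ρ) = (X.bind (graft ρ)).comb w := by
          intro w
          induction w with
          | nil => intros; rfl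
          | cons a w ih =>
            intro X hw
            rw [RTree.comb, ih _ fun i hi => hw i (List.mem_cons_of_mem _ hi), RTree.bind,
              RTree.bind, hw a (by simp), RTree.comb]
        exact this _ _ fun i hi => hρ i (hvσ.mem_iff.1 hi)
      simp only [JTree.bind] at key
      rw [hbind _ _ (by decide), hbind _ _ (by decide)] at key
      have e1 : treeOf [] {(0, 1)} c ⟨RTree.comb (.leaf 0) (v ++ [z]), .leaf 1⟩ =
          treeOf [] {(0, 1)} (c ∘ σ) ⟨(RTree.leaf 0).comb (v.map σ), .node (.leaf 7) (.leaf 1)⟩ := by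
        rw [← (isTreeFun_treeOf _ _ _).rot, ← hmap]
        simp [JTree.map, RTree.map_comb, RTree.map, h0, h1, hσz, RTree.comb_append, RTree.comb]
      have e2 : treeOf [] {(0, 1)} c ⟨RTree.comb (.leaf 0) (z :: v), .leaf 1⟩ =
          -treeOf [] {(0, 1)} (c ∘ σ) ⟨(RTree.node (.leaf 1) (.leaf 7)).comb (v.map σ), .leaf 0⟩ := by
        rw [← treeOf_one_flip, ← hmap]
        have h5 : (v.map σ).map (transp 0 1) = v.map σ := by
          conv_rhs => rw [← List.map_id (v.map σ)]
          refine List.map_congr_left fun i hi => ?_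
          have := hvσ.mem_iff.1 hi
          fin_cases this <;> rfl
        simp only [JTree.map, RTree.map_comb, RTree.map, h0, h1, hσz, h5, RTree.comb]
        rfl
      rw [e1, e2, sub_neg_eq_add, add_comm]
      exact key

/-- If the sum of the trees with colours `c i` and coefficients `a i` has the symmetries by which
words are normalised, then it maps `oneLoopTrees m` to the image of `β ^ 5`. -/
lemma treeSum_oneLoopTrees_mem {ι : Type*} (s : Finset ι) (a : ι → ℤ) (c : ι → ℕ → H) {m : ℕ}
    (hm : m ∈ [2, 3, 4])
    (hN : ∀ n ∈ oneLoopNetwork m, ∀ T : JTree,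
      ∑ i ∈ s, a i • treeOf [] {(0, 1)} (c i) (T.map n.f) =
        n.sign • ∑ i ∈ s, a i • treeOf [] {(0, 1)} (c i) T) :
    treeSum (fun T => ∑ i ∈ s, a i • treeOf [] {(0, 1)} (c i) T) (oneLoopTrees m) ∈
      betaImage H 1 6 := by
  set G : JTree → HLG H := fun T => ∑ i ∈ s, a i • treeOf [] {(0, 1)} (c i) T with hGdef
  have hG : IsTreeFun fun T => (betaImage H 1 6).mkQ (G T) := by
    simp only [hGdef, map_sum]
    refine IsTreeFun.sum s fun i _ => ?_
    exact (isTreeFun_treeOf [] {(0, 1)} (c i)).comp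
      ((betaImage H 1 6).mkQ.toAddMonoidHom.comp (zsmulAddGroupHom (a i)))
  rw [← Submodule.Quotient.mk_eq_zero, ← Submodule.mkQ_apply]
  have := map_treeSum (betaImage H 1 6).mkQ.toAddMonoidHom G (oneLoopTrees m)
  refine this.trans (treeSum_eq_zero hG [(1, id)] true (oneLoopNetwork m) _ ?_ (by simp) (by simp)
    ?_ ?_ ?_ ?_ (oneLoopTrees_perm m hm) (oneLoopTrees_vanish m hm))
  · rintro q hq T
    rw [List.mem_singleton] at hq
    subst hq
    have : T.map id = T := by rw [JTree.map_eq_bind]; exact JTree.bind_leaf T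
    simp [this]
  · intro T
    simp only [hGdef, treeOf_one_flip, smul_neg, Finset.sum_neg_distrib, map_neg]
  · intro _ u hu k
    simp only [hGdef, map_sum]
    refine Finset.sum_congr rfl fun i _ => ?_
    rw [map_zsmul, map_zsmul, treeOf_one_rotate _ hu]
  · intro n hn T
    simp only [hGdef, hN n hn T, map_zsmul]
  · have : ∀ m ∈ [2, 3, 4], ∀ n ∈ oneLoopNetwork m, n.sign * n.sign = 1 ∧ n.f 0 = 0 ∧ n.f 1 = 1 := by
      decide +kernel
    exact this m hm

lemma treeSum_map_eq {M : Type*} [AddCommGroup M] (G : JTree → M) (k : ℤ) (L : List JTree) :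
    treeSum G (L.map fun T => (k, T)) = k • (L.map G).sum := by
  simp [treeSum, List.smul_sum, Function.comp_def]

lemma treeSum_scale {M : Type*} [AddCommGroup M] (G : JTree → M) (k : ℤ) (L : List (ℤ × JTree)) :
    treeSum G (L.map fun p => (k * p.1, p.2)) = k • treeSum G L := by
  simp [treeSum, List.smul_sum, Function.comp_def, mul_smul]

/-- Coincidence of colours kills the trees with two dotted edges and `m - 2` pairs of dual
colours. -/
lemma treeSum_coincidence_mem {m : ℕ} (hm : m ∈ [3, 4]) (c : ℕ → H) (h4 : c 4 = c 6)
    (h5 : m = 4 → c 5 = c 7) :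
    treeSum (treeOf [] {(0, 1), (2, 3)} c) (antisymTrees 4 5 (antisymTrees 6 7 (twoLoopTrees m))) ∈
      betaImage H 2 6 := by
  set G : JTree → HLG H := treeOf [] {(0, 1), (2, 3)} c with hGdef
  have hG : IsTreeFun fun T => (betaImage H 2 6).mkQ (G T) :=
    (isTreeFun_treeOf [] {(0, 1), (2, 3)} c).comp (betaImage H 2 6).mkQ.toAddMonoidHom
  have hcert : treeSum G (certTrees m) ∈ betaImage H 2 6 := by
    have hgood : ∀ m ∈ [3, 4], ∀ p ∈ certificate m, p.2.2.1.Perm p.2.1.letters ∧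
        ∀ q ∈ p.2.2.2, 4 ≤ q.1 ∧ 4 ≤ q.2 := by decide +kernel
    have hgood' := hgood m hm
    unfold certTrees
    generalize certificate m = C at hgood'
    induction C with
    | nil => simp
    | cons p C ih =>
      rw [List.flatMap_cons, treeSum_append, treeSum_map_eq]
      refine add_mem (zsmul_mem ?_ _) (ih fun q hq => hgood' q (List.mem_cons_of_mem _ hq))
      exact RelKind.trees_mem _ (hgood' p (by simp)).1 (hgood' p (by simp)).2 c
  have key : treeSum G (coincidenceTrees m) ∈ betaImage H 2 6 := by
    rw [← Submodule.Quotient.mk_eq_zero, ← Submodule.mkQ_apply]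
    have := map_treeSum (betaImage H 2 6).mkQ.toAddMonoidHom G (coincidenceTrees m)
    refine this.trans (treeSum_eq_zero hG [(1, id), (1, pairTransp 0 1)] false (twoLoopNetwork m) _
      ?_ (by simp) (by simp) ?_ (by simp) ?_ ?_ (coincidenceTrees_perm m hm)
      (coincidenceTrees_vanish m hm))
    · rintro q hq T
      simp only [List.mem_cons, List.not_mem_nil, or_false] at hq
      rcases hq with rfl | rfl
      · have : T.map id = T := by rw [JTree.map_eq_bind]; exact JTree.bind_leaf T
        simp [this]
      · simp [hGdef, treeOf_two_exchange]
    · intro T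
      simp [hGdef, treeOf_two_flip₁]
    · have hsw : ∀ a b, 4 ≤ a → 4 ≤ b → c a = c b → ∀ T : JTree,
          G (T.map (transp a b)) = (1 : ℤ) • G T := by
        intro a b ha hb hab T
        rw [one_smul, hGdef, transp_eq_swap]
        refine treeOf_map (Equiv.swap a b) T ?_ fun i _ _ => ?_
        · have : ∀ i < 4, Equiv.swap a b i = i := fun i hi =>
            Equiv.swap_apply_of_ne_of_ne (by omega) (by omega)
          simp [Finset.image_insert, this]
        · rw [Equiv.swap_apply_def]; split_ifs with h1 h2
          · rw [h1, hab]
          · rw [h2, hab]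
          · rfl
      intro n hn T
      have hn' : n = ⟨2, 3, -1, transp 2 3⟩ ∨ n = ⟨4, 6, 1, transp 4 6⟩ ∨
          (m = 4 ∧ n = ⟨5, 7, 1, transp 5 7⟩) := by
        unfold twoLoopNetwork at hn
        split_ifs at hn with hm4
        · simpa [hm4] using hn
        · simpa [hm4] using hn
      rcases hn' with rfl | rfl | ⟨hm4, rfl⟩
      · simp [hGdef, treeOf_two_flip₂]
      · simp only [hsw 4 6 (by omega) (by omega) h4 T, one_smul]
      · simp only [hsw 5 7 (by omega) (by omega) (h5 hm4) T, one_smul]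
    · have : ∀ m ∈ [3, 4], ∀ n ∈ twoLoopNetwork m, n.sign * n.sign = 1 ∧ n.f 0 = 0 ∧ n.f 1 = 1 := by
        decide +kernel
      exact this m hm
  rw [coincidenceTrees, treeSum_append, treeSum_scale] at key
  have h6 := (Submodule.add_mem_iff_left _ hcert).1 key
  set k : ℤ := if m = 3 then 4 else 2 with hk
  have hk0 : (k : ℚ) ≠ 0 := by rw [hk]; split_ifs <;> norm_num
  have h7 := Submodule.smul_mem _ (k : ℚ)⁻¹ h6
  rwa [← Int.cast_smul_eq_zsmul ℚ, smul_smul, inv_mul_cancel₀ hk0, one_smul] at h7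

end

/-! ### A functional on cyclic words -/

/-- The sum of `g (v ++ ctx ++ u)` over all decompositions `w = u ++ s :: v`: for empty `ctx`, a
function of the cyclic word `w`. -/
def cyclicSum (s : ℕ) (g : List ℕ → ℤ) : List ℕ → List ℕ → ℤ
  | [], _ => 0
  | x :: v, ctx => (if x = s then g (v ++ ctx) else 0) + cyclicSum s g v (ctx ++ [x])

lemma cyclicSum_append (s : ℕ) (g : List ℕ → ℤ) (u v ctx : List ℕ) :
    cyclicSum s g (u ++ v) ctx = cyclicSum s g u (v ++ ctx) + cyclicSum s g v (ctx ++ u) := by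
  induction u generalizing ctx with
  | nil => simp [cyclicSum]
  | cons x u ih => simp [cyclicSum, ih, add_assoc]

lemma cyclicSum_comm (s : ℕ) (g : List ℕ → ℤ) (u v : List ℕ) :
    cyclicSum s g (u ++ v) [] = cyclicSum s g (v ++ u) [] := by
  simp [cyclicSum_append, add_comm]

lemma exists_of_cyclicSum_ne_zero {s : ℕ} {g : List ℕ → ℤ} {w ctx : List ℕ}
    (h : cyclicSum s g w ctx ≠ 0) : ∃ u v, w = u ++ s :: v ∧ g (v ++ ctx ++ u) ≠ 0 := by
  induction w generalizing ctx with
  | nil => exact absurd rfl h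
  | cons x w ih =>
    rw [cyclicSum] at h
    by_cases h1 : cyclicSum s g w (ctx ++ [x]) = 0
    · rw [h1, add_zero] at h
      split_ifs at h with hx
      · exact ⟨[], w, by simp [hx], by simpa using h⟩
      · exact absurd rfl h
    · obtain ⟨u, v, rfl, hg⟩ := ih h1
      exact ⟨x :: u, v, rfl, by simpa using hg⟩

lemma cyclicSum_map {s : ℕ} {g g' : List ℕ → ℤ} {t : ℕ → ℕ} (hs : ∀ x, t x = s ↔ x = s)
    (hg : ∀ u : List ℕ, g (u.map t) = g' u) (w ctx : List ℕ) :
    cyclicSum s g (w.map t) (ctx.map t) = cyclicSum s g' w ctx := by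
  induction w generalizing ctx with
  | nil => rfl
  | cons x w ih =>
    have := ih (ctx ++ [x])
    rw [List.map_append, List.map_singleton] at this
    rw [List.map_cons, cyclicSum, cyclicSum, this, ← List.map_append, hg]
    simp only [hs]

lemma cyclicSum_neg (s : ℕ) (g : List ℕ → ℤ) (w ctx : List ℕ) :
    cyclicSum s (fun u => -g u) w ctx = -cyclicSum s g w ctx := by
  induction w generalizing ctx with
  | nil => rfl
  | cons x w ih => rw [cyclicSum, cyclicSum, ih]; split_ifs <;> ring

/-- The sign of an arrangement of the letters `4, 5, 6, 7`, and `0` for other words. -/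
def hairSign (a b c d : ℕ) : ℤ :=
  bif [4, 5, 6, 7].all fun i => [a, b, c, d].any fun j => Nat.beq i j then
    bif xor (Nat.blt b a) (xor (Nat.blt c a) (xor (Nat.blt d a) (xor (Nat.blt c b)
      (xor (Nat.blt d b) (Nat.blt d c))))) then Int.negSucc 0 else Int.ofNat 1
  else Int.ofNat 0

lemma perm_of_hairSign_ne_zero {a b c d : ℕ} (h : hairSign a b c d ≠ 0) :
    [a, b, c, d].Perm [4, 5, 6, 7] := by
  have h1 : ([4, 5, 6, 7].all fun i => [a, b, c, d].any fun j => Nat.beq i j) = true := by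
    by_contra h1
    rw [Bool.not_eq_true] at h1
    rw [hairSign, h1] at h
    exact h rfl
  simp only [List.all_eq_true, List.any_eq_true, Nat.beq_eq, exists_eq_right'] at h1
  have h2 : [4, 5, 6, 7].Subperm [a, b, c, d] := List.subperm_of_subset (by decide) h1
  exact (h2.perm_of_length_le (by simp)).symm

lemma hairSign_transp {i j : ℕ} (hi : i ∈ [4, 5, 6, 7]) (hj : j ∈ [4, 5, 6, 7]) (hij : i ≠ j)
    (a b c d : ℕ) :
    hairSign (transp i j a) (transp i j b) (transp i j c) (transp i j d) = -hairSign a b c d := by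
  have hfin : ∀ i ∈ [4, 5, 6, 7], ∀ j ∈ [4, 5, 6, 7], i ≠ j → ∀ a ∈ [4, 5, 6, 7],
      ∀ b ∈ [4, 5, 6, 7], ∀ c ∈ [4, 5, 6, 7], ∀ d ∈ [4, 5, 6, 7],
      hairSign (transp i j a) (transp i j b) (transp i j c) (transp i j d) =
        -hairSign a b c d := by decide +kernel
  have hmem : ∀ {a b c d : ℕ}, [a, b, c, d].Perm [4, 5, 6, 7] → a ∈ [4, 5, 6, 7] ∧
      b ∈ [4, 5, 6, 7] ∧ c ∈ [4, 5, 6, 7] ∧ d ∈ [4, 5, 6, 7] := fun h =>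
    ⟨h.mem_iff.1 (by simp), h.mem_iff.1 (by simp), h.mem_iff.1 (by simp), h.mem_iff.1 (by simp)⟩
  by_cases h : hairSign a b c d = 0
  · by_cases h' : hairSign (transp i j a) (transp i j b) (transp i j c) (transp i j d) = 0
    · rw [h, h', neg_zero]
    · have hp := hmem (perm_of_hairSign_ne_zero h')
      have hinv : ∀ x, transp i j (transp i j x) = x := fun x => by simp [transp_eq_swap]
      have := hfin i hi j hj hij _ hp.1 _ hp.2.1 _ hp.2.2.1 _ hp.2.2.2
      rw [hinv, hinv, hinv, hinv, h] at this
      exact absurd (neg_eq_zero.1 this.symm) h'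
  · have hp := hmem (perm_of_hairSign_ne_zero h)
    exact hfin i hi j hj hij _ hp.1 _ hp.2.1 _ hp.2.2.1 _ hp.2.2.2

/-- The function of the letters that follow `0, 2` in a cyclic word, in reverse order, from which
`loopWord` is obtained by symmetrisation. It is a solution of the linear equations expressing that the
functional vanishes on the image of `β`. -/
def seedTail : List ℕ → ℤ
  | [x₇, x₆, x₅, x₄, x₃, x₂] =>
    bif Nat.beq x₂ 1 then
      bif Nat.beq x₄ 3 then Int.neg (hairSign x₃ x₅ x₆ x₇) else Int.ofNat 0
    else bif Nat.beq x₃ 3 && Nat.beq x₆ 1 then hairSign x₂ x₄ x₅ x₇ else Int.ofNat 0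
  | _ => Int.ofNat 0

/-- The function of the letters that follow `0` in a cyclic word. -/
def loopSeed : List ℕ → ℤ
  | [] => 0
  | x :: u => if x = 2 then seedTail u.reverse else 0

lemma perm_of_seedTail_ne_zero {u : List ℕ} (h : seedTail u ≠ 0) :
    u.Perm [1, 3, 4, 5, 6, 7] := by
  match u, h with
  | [x₇, x₆, x₅, x₄, x₃, x₂], h =>
    rw [seedTail] at h
    cases h2 : Nat.beq x₂ 1
    · rw [h2, cond_false] at h
      cases h3 : (Nat.beq x₃ 3 && Nat.beq x₆ 1)
      · rw [h3] at h; exact absurd rfl h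
      · rw [h3, cond_true] at h
        simp only [Bool.and_eq_true, Nat.beq_eq] at h3
        obtain ⟨rfl, rfl⟩ := h3
        have := perm_of_hairSign_ne_zero h
        have h4 := (this.cons 3).cons 1
        refine List.Perm.trans ?_ h4
        simp only [← Multiset.coe_eq_coe, ← Multiset.cons_coe, ← Multiset.singleton_add]
        abel
    · rw [h2, cond_true] at h
      cases h3 : (Nat.beq x₄ 3)
      · rw [h3] at h; exact absurd rfl h
      · rw [h3, cond_true] at h
        simp only [Nat.beq_eq] at h2 h3
        subst h2 h3
        have := perm_of_hairSign_ne_zero fun h' => h (by rw [h']; rfl)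
        have h4 := (this.cons 3).cons 1
        refine List.Perm.trans ?_ h4
        simp only [← Multiset.coe_eq_coe, ← Multiset.cons_coe, ← Multiset.singleton_add]
        abel

lemma perm_of_loopSeed_ne_zero {u : List ℕ} (h : loopSeed u ≠ 0) :
    u.Perm [2, 1, 3, 4, 5, 6, 7] := by
  match u, h with
  | [], h => exact absurd rfl h
  | x :: u, h =>
    rw [loopSeed] at h
    split_ifs at h with hx
    · subst hx
      exact ((List.reverse_perm u).symm.trans (perm_of_seedTail_ne_zero h)).cons 2
    · exact absurd rfl h

lemma transp_eq_iff {i j k x : ℕ} (hi : k ≠ i) (hj : k ≠ j) : transp i j x = k ↔ x = k := by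
  rw [transp_eq_swap]
  constructor
  · intro h
    rw [← Equiv.swap_apply_self i j x, h, Equiv.swap_apply_of_ne_of_ne hi hj]
  · rintro rfl
    exact Equiv.swap_apply_of_ne_of_ne hi hj

lemma beq_transp {i j k x : ℕ} (hi : k ≠ i) (hj : k ≠ j) :
    Nat.beq (transp i j x) k = Nat.beq x k := by
  rw [Bool.eq_iff_iff, Nat.beq_eq, Nat.beq_eq, transp_eq_iff hi hj]

lemma seedTail_transp {i j : ℕ} (hi : i ∈ [4, 5, 6, 7]) (hj : j ∈ [4, 5, 6, 7]) (hij : i ≠ j)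
    (u : List ℕ) : seedTail (u.map (transp i j)) = -seedTail u := by
  have hk : ∀ {k}, k ∈ [4, 5, 6, 7] → 1 ≠ k ∧ 3 ≠ k := by decide
  have h1 : ∀ x, Nat.beq (transp i j x) 1 = Nat.beq x 1 := fun x =>
    beq_transp (hk hi).1 (hk hj).1
  have h3 : ∀ x, Nat.beq (transp i j x) 3 = Nat.beq x 3 := fun x =>
    beq_transp (hk hi).2 (hk hj).2
  by_cases hu : u.length = 6
  · match u, hu with
    | [x₇, x₆, x₅, x₄, x₃, x₂], _ =>
      simp only [List.map_cons, List.map_nil, seedTail, h1, h3, hairSign_transp hi hj hij]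
      cases Nat.beq x₂ 1 <;> cases Nat.beq x₄ 3 <;> cases Nat.beq x₃ 3 <;> cases Nat.beq x₆ 1 <;>
        rfl
  · have h0 : ∀ v : List ℕ, v.length ≠ 6 → seedTail v = 0 := by
      intro v hv
      by_contra h
      exact hv (perm_of_seedTail_ne_zero h).length_eq
    rw [h0 u hu, h0 _ (by simpa using hu), neg_zero]

lemma loopSeed_transp {i j : ℕ} (hi : i ∈ [4, 5, 6, 7]) (hj : j ∈ [4, 5, 6, 7]) (hij : i ≠ j)
    (u : List ℕ) : loopSeed (u.map (transp i j)) = -loopSeed u := by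
  have hk : ∀ {k}, k ∈ [4, 5, 6, 7] → 2 ≠ k := by decide
  cases u with
  | nil => rfl
  | cons x u =>
    simp only [List.map_cons, loopSeed, transp_eq_iff (hk hi) (hk hj), ← List.map_reverse,
      seedTail_transp hi hj hij]
    split_ifs <;> simp

/-- The functional on cyclic words before symmetrisation. -/
def preLoopWord (w : List ℕ) : ℤ := cyclicSum 0 loopSeed w []

lemma preLoopWord_comm (u v : List ℕ) : preLoopWord (u ++ v) = preLoopWord (v ++ u) :=
  cyclicSum_comm _ _ u v

lemma perm_of_preLoopWord_ne_zero {w : List ℕ} (h : preLoopWord w ≠ 0) :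
    w.Perm (List.range 8) := by
  obtain ⟨u, v, rfl, hg⟩ := exists_of_cyclicSum_ne_zero h
  have h1 := perm_of_loopSeed_ne_zero hg
  refine List.Perm.trans ?_ ((h1.cons 0).trans (by decide))
  simp only [List.append_nil, ← Multiset.coe_eq_coe, ← Multiset.coe_add, ← Multiset.cons_coe,
    ← Multiset.singleton_add]
  abel

lemma preLoopWord_transp {i j : ℕ} (hi : i ∈ [4, 5, 6, 7]) (hj : j ∈ [4, 5, 6, 7]) (hij : i ≠ j)
    (w : List ℕ) : preLoopWord (w.map (transp i j)) = -preLoopWord w := by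
  have hk : ∀ {k}, k ∈ [4, 5, 6, 7] → 0 ≠ k := by decide
  rw [preLoopWord, preLoopWord, ← cyclicSum_neg]
  exact cyclicSum_map (fun x => transp_eq_iff (hk hi) (hk hj)) (loopSeed_transp hi hj hij) w []

/-- The signed symmetries of two dotted edges with the ends `0, 1` and `2, 3`. -/
def chordSymms : List (ℤ × (ℕ → ℕ)) :=
  [(1, id), (-1, transp 0 1), (-1, transp 2 3), (1, transp 0 1 ∘ transp 2 3), (1, pairTransp 0 1),
    (-1, transp 0 1 ∘ pairTransp 0 1), (-1, transp 2 3 ∘ pairTransp 0 1),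
    (1, transp 0 1 ∘ transp 2 3 ∘ pairTransp 0 1)]

/-- The functional on cyclic words in the ends `0, 1` and `2, 3` of two dotted edges and the hairs
`4, 5, 6, 7`, with the symmetries of the dotted edges, which is alternating in the hairs. -/
def loopWord (w : List ℕ) : ℤ := (chordSymms.map fun q => q.1 * preLoopWord (w.map q.2)).sum

lemma loopWord_comm (u v : List ℕ) : loopWord (u ++ v) = loopWord (v ++ u) := by
  simp only [loopWord, List.map_append, preLoopWord_comm]

lemma fun_ext_of_le {f g : ℕ → ℕ} (h : ∀ i < 8, f i = g i) (h' : ∀ i, f (i + 8) = g (i + 8)) :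
    f = g := by
  funext i
  by_cases hi : i < 8
  · exact h i hi
  · obtain ⟨k, rfl⟩ := Nat.exists_eq_add_of_le (not_lt.1 hi)
    rw [add_comm]
    exact h' k

lemma chordSymms_add_eight {q : ℤ × (ℕ → ℕ)} (hq : q ∈ chordSymms) (x : ℕ) :
    q.2 (x + 8) = x + 8 := by
  simp only [chordSymms, List.mem_cons, List.not_mem_nil, or_false] at hq
  rcases hq with rfl | rfl | rfl | rfl | rfl | rfl | rfl | rfl <;> rfl

lemma loopWord_flip₁ (w : List ℕ) : loopWord (w.map (transp 0 1)) = -loopWord w := by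
  have e1 : transp 0 1 ∘ transp 0 1 = id := fun_ext_of_le (by decide) fun _ => rfl
  have e2 : transp 2 3 ∘ transp 0 1 = transp 0 1 ∘ transp 2 3 :=
    fun_ext_of_le (by decide) fun _ => rfl
  have e3 : (transp 0 1 ∘ transp 2 3) ∘ transp 0 1 = transp 2 3 :=
    fun_ext_of_le (by decide) fun _ => rfl
  have e4 : pairTransp 0 1 ∘ transp 0 1 = transp 2 3 ∘ pairTransp 0 1 :=
    fun_ext_of_le (by decide) fun _ => rfl
  have e5 : (transp 0 1 ∘ pairTransp 0 1) ∘ transp 0 1 =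
      transp 0 1 ∘ transp 2 3 ∘ pairTransp 0 1 := fun_ext_of_le (by decide) fun _ => rfl
  have e6 : (transp 2 3 ∘ pairTransp 0 1) ∘ transp 0 1 = pairTransp 0 1 :=
    fun_ext_of_le (by decide) fun _ => rfl
  have e7 : (transp 0 1 ∘ transp 2 3 ∘ pairTransp 0 1) ∘ transp 0 1 =
      transp 0 1 ∘ pairTransp 0 1 := fun_ext_of_le (by decide) fun _ => rfl
  simp only [loopWord, chordSymms, List.map_cons, List.map_nil, List.sum_cons, List.sum_nil,
    List.map_map, e1, e2, e3, e4, e5, e6, e7, Function.id_comp]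
  ring

lemma loopWord_exchange (w : List ℕ) : loopWord (w.map (pairTransp 0 1)) = loopWord w := by
  have e1 : (transp 0 1 ∘ transp 2 3) ∘ pairTransp 0 1 = transp 0 1 ∘ transp 2 3 ∘ pairTransp 0 1 :=
    rfl
  have e2 : pairTransp 0 1 ∘ pairTransp 0 1 = id := fun_ext_of_le (by decide) fun _ => rfl
  have e3 : (transp 0 1 ∘ pairTransp 0 1) ∘ pairTransp 0 1 = transp 0 1 :=
    fun_ext_of_le (by decide) fun _ => rfl
  have e4 : (transp 2 3 ∘ pairTransp 0 1) ∘ pairTransp 0 1 = transp 2 3 :=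
    fun_ext_of_le (by decide) fun _ => rfl
  have e5 : (transp 0 1 ∘ transp 2 3 ∘ pairTransp 0 1) ∘ pairTransp 0 1 =
      transp 0 1 ∘ transp 2 3 := fun_ext_of_le (by decide) fun _ => rfl
  simp only [loopWord, chordSymms, List.map_cons, List.map_nil, List.sum_cons, List.sum_nil,
    List.map_map, e1, e2, e3, e4, e5, Function.id_comp]
  ring

lemma loopWord_flip₂ (w : List ℕ) : loopWord (w.map (transp 2 3)) = -loopWord w := by
  have e : transp 2 3 = pairTransp 0 1 ∘ transp 0 1 ∘ pairTransp 0 1 :=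
    fun_ext_of_le (by decide) fun _ => rfl
  rw [e, ← List.map_map, loopWord_exchange, ← List.map_map, loopWord_flip₁, loopWord_exchange]

lemma loopWord_transp {i j : ℕ} (hi : i ∈ [4, 5, 6, 7]) (hj : j ∈ [4, 5, 6, 7]) (hij : i ≠ j)
    (w : List ℕ) : loopWord (w.map (transp i j)) = -loopWord w := by
  have hcomm : ∀ q ∈ chordSymms, q.2 ∘ transp i j = transp i j ∘ q.2 := by
    have hfin : ∀ i ∈ [4, 5, 6, 7], ∀ j ∈ [4, 5, 6, 7], ∀ q ∈ chordSymms, ∀ x < 8,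
      q.2 (transp i j x) = transp i j (q.2 x) := by decide +kernel
    have hge : ∀ i ∈ [4, 5, 6, 7], ∀ j ∈ [4, 5, 6, 7], ∀ x, transp i j (x + 8) = x + 8 := by
      intro i hi j hj x
      rw [transp_eq_swap]
      refine Equiv.swap_apply_of_ne_of_ne ?_ ?_ <;> rintro rfl <;>
        simp only [List.mem_cons, List.not_mem_nil, or_false] at hi hj <;> omega
    intro q hq
    refine fun_ext_of_le (fun x hx => hfin i hi j hj q hq x hx) fun x => ?_
    simp only [Function.comp, hge i hi j hj, chordSymms_add_eight hq]
  rw [loopWord, loopWord, neg_eq_neg_one_mul, ← List.sum_map_mul_left]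
  congr 1
  refine List.map_congr_left fun q hq => ?_
  rw [List.map_map, hcomm q hq, ← List.map_map, preLoopWord_transp hi hj hij]
  simp

lemma perm_of_loopWord_ne_zero {w : List ℕ} (h : loopWord w ≠ 0) : w.Perm (List.range 8) := by
  have : ∃ q ∈ chordSymms, preLoopWord (w.map q.2) ≠ 0 := by
    by_contra! hh
    refine h ?_
    rw [loopWord, List.sum_eq_zero]
    simp only [List.mem_map, forall_exists_index, and_imp]
    rintro _ q hq rfl
    rw [hh q hq, mul_zero]
  obtain ⟨q, hq, h1⟩ := this
  have h2 := perm_of_preLoopWord_ne_zero h1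
  have hinv : ∀ q ∈ chordSymms, ∃ q' ∈ chordSymms, ∀ i < 8, q'.2 (q.2 i) = i := by decide +kernel
  obtain ⟨q', hq', hqq⟩ := hinv q hq
  have hqq' : q'.2 ∘ q.2 = id := fun_ext_of_le hqq fun x => by
    simp only [Function.comp, chordSymms_add_eight hq, chordSymms_add_eight hq', id]
  have h3 := h2.map q'.2
  rw [List.map_map, hqq', List.map_id] at h3
  have hfin : ∀ q ∈ chordSymms, ((List.range 8).map q.2).Perm (List.range 8) := by decide +kernel
  exact h3.trans (hfin q' hq')

/-! ### Evaluation of trees in an associative algebra -/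

section

variable {A : Type*} [Ring A]

/-- The iterated commutator given by a rooted tree, for given values of the leaves. -/
def RTree.lie (c : ℕ → A) : RTree → A
  | leaf i => c i
  | node S T => S.lie c * T.lie c - T.lie c * S.lie c

lemma RTree.lie_congr {c d : ℕ → A} {S : RTree} (h : ∀ i ∈ S.legs, c i = d i) :
    S.lie c = S.lie d := by
  induction S with
  | leaf i => exact h i (by simp [legs])
  | node S T ihS ihT =>
    rw [lie, lie, ihS fun i hi => h i (by simp [legs, hi]), ihT fun i hi => h i (by simp [legs, hi])]

lemma RTree.lie_bind (c : ℕ → A) (ρ : ℕ → RTree) (S : RTree) :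
    (S.bind ρ).lie c = S.lie fun i => (ρ i).lie c := by
  induction S with
  | leaf i => rfl
  | node S T ihS ihT => simp only [bind, lie, ihS, ihT]

lemma RTree.map_lie {B : Type*} [Ring B] (φ : A →+* B) (c : ℕ → A) (S : RTree) :
    φ (S.lie c) = S.lie (φ ∘ c) := by
  induction S with
  | leaf i => rfl
  | node S T ihS ihT => simp only [lie, map_sub, map_mul, ihS, ihT]

/-- The left-normed commutator of `y` with the entries of a list. -/
def adList (L : List A) (y : A) : A := L.foldl (fun y x => y * x - x * y) y

lemma adList_append (L L' : List A) (y : A) : adList (L ++ L') y = adList L' (adList L y) :=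
  List.foldl_append

lemma adList_cons (x : A) (L : List A) (y : A) : adList (x :: L) y = adList L (y * x - x * y) :=
  rfl

lemma adList_singleton (x y : A) : adList [x] y = y * x - x * y := rfl

lemma map_adList {B : Type*} [Ring B] (φ : A →+* B) (L : List A) (y : A) :
    φ (adList L y) = adList (L.map φ) (φ y) := by
  induction L generalizing y with
  | nil => rfl
  | cons x L ih => rw [adList_cons, ih, List.map_cons, adList_cons, map_sub, map_mul, map_mul]

/-- The left-normed bracket of `X` and the trees of a list. -/
def RTree.combTrees (X : RTree) : List RTree → RTree
  | [] => X
  | S :: L => combTrees (node X S) L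

lemma RTree.combTrees_leaf (X : RTree) (w : List ℕ) : X.combTrees (w.map .leaf) = X.comb w := by
  induction w generalizing X with
  | nil => rfl
  | cons i w ih => exact ih _

lemma RTree.combTrees_legs (X : RTree) (L : List RTree) :
    (X.combTrees L).legs = X.legs ++ L.flatMap RTree.legs := by
  induction L generalizing X with
  | nil => simp [combTrees]
  | cons S L ih => rw [combTrees, ih]; simp [legs]

lemma RTree.map_combTrees (σ : ℕ → ℕ) (X : RTree) (L : List RTree) :
    (X.combTrees L).map σ = (X.map σ).combTrees (L.map (RTree.map σ)) := by
  induction L generalizing X with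
  | nil => rfl
  | cons S L ih => rw [combTrees, ih]; rfl

lemma RTree.lie_combTrees (c : ℕ → A) (X : RTree) (L : List RTree) :
    (X.combTrees L).lie c = adList (L.map (RTree.lie c)) (X.lie c) := by
  induction L generalizing X with
  | nil => rfl
  | cons S L ih => rw [combTrees, ih]; rfl

lemma RTree.lie_comb (c : ℕ → A) (X : RTree) (w : List ℕ) :
    (X.comb w).lie c = adList (w.map c) (X.lie c) := by
  rw [← combTrees_leaf, lie_combTrees, List.map_map]
  rfl

/-- The value of a linear functional on the product of the two halves of a tree. -/
def treePairing [Algebra ℚ A] (τ : A →ₗ[ℚ] ℚ) (c : ℕ → A) (T : JTree) : ℚ :=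
  τ (T.fst.lie c * T.snd.lie c)

lemma treePairing_congr [Algebra ℚ A] (τ : A →ₗ[ℚ] ℚ) {c d : ℕ → A} {T : JTree}
    (h : ∀ i ∈ T.legs, c i = d i) : treePairing τ c T = treePairing τ d T := by
  rw [treePairing, RTree.lie_congr fun i hi => h i (List.mem_append_left _ hi),
    RTree.lie_congr fun i hi => h i (List.mem_append_right _ hi), treePairing]

lemma treePairing_bind [Algebra ℚ A] (τ : A →ₗ[ℚ] ℚ) (c : ℕ → A) (ρ : ℕ → RTree) (T : JTree) :
    treePairing τ c (T.bind ρ) = treePairing τ (fun i => (ρ i).lie c) T := by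
  simp only [treePairing, JTree.bind, RTree.lie_bind]

lemma treePairing_map [Algebra ℚ A] (τ : A →ₗ[ℚ] ℚ) (c : ℕ → A) (σ : ℕ → ℕ) (T : JTree) :
    treePairing τ c (T.map σ) = treePairing τ (c ∘ σ) T := by
  rw [JTree.map_eq_bind, treePairing_bind]
  rfl

lemma treePairing_algHom {B : Type*} [Ring B] [Algebra ℚ A] [Algebra ℚ B] (τ : B →ₗ[ℚ] ℚ)
    (φ : A →ₐ[ℚ] B) (c : ℕ → A) (T : JTree) :
    treePairing τ (fun i => φ (c i)) T = τ (φ (T.fst.lie c * T.snd.lie c)) := by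
  rw [treePairing, map_mul φ]
  congr 2
  · exact (RTree.map_lie φ.toRingHom c T.fst).symm
  · exact (RTree.map_lie φ.toRingHom c T.snd).symm

lemma isTreeFun_treePairing [Algebra ℚ A] {τ : A →ₗ[ℚ] ℚ} (hτ : ∀ x y, τ (x * y) = τ (y * x))
    (c : ℕ → A) : IsTreeFun (treePairing τ c) where
  swap S T := hτ _ _
  rot S T U := by
    simp only [treePairing, RTree.lie, sub_mul, mul_sub, map_sub, mul_assoc]
    rw [hτ (T.lie c), mul_assoc, hτ (S.lie c) (U.lie c * T.lie c), mul_assoc, hτ (U.lie c),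
      mul_assoc]
  antisymm S T U := by
    simp only [treePairing, RTree.lie, ← map_neg]
    congr 1
    noncomm_ring
  ihx S T U V := by
    simp only [treePairing, RTree.lie, ← map_add]
    rw [← map_zero τ]
    congr 1
    noncomm_ring

end

/-! ### Functionals on the free algebra -/

/-- The free algebra on the letters `0, 1, 2, …`. -/
abbrev Letters : Type := FreeAlgebra ℚ ℕ

/-- A letter, as an element of the free algebra. -/
abbrev letter (n : ℕ) : Letters := FreeAlgebra.ι ℚ n

/-- A word, as an element of the free algebra. -/
def monomial (u : List ℕ) : Letters := (u.map letter).prod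

lemma monomial_append (u v : List ℕ) : monomial (u ++ v) = monomial u * monomial v := by
  simp [monomial]

lemma monomial_cons (a : ℕ) (u : List ℕ) : monomial (a :: u) = letter a * monomial u := by
  simp [monomial]

lemma monomial_singleton (a : ℕ) : monomial [a] = letter a := by simp [monomial]

lemma basisFreeMonoid_apply (u : FreeMonoid ℕ) :
    FreeAlgebra.basisFreeMonoid ℚ ℕ u = monomial (FreeMonoid.toList u) := by
  simp [FreeAlgebra.basisFreeMonoid, FreeAlgebra.equivMonoidAlgebraFreeMonoid, FreeMonoid.lift_apply]
  rfl

lemma linearMap_ext_monomial {M : Type*} [AddCommGroup M] [Module ℚ M] {φ ψ : Letters →ₗ[ℚ] M}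
    (h : ∀ u, φ (monomial u) = ψ (monomial u)) : φ = ψ :=
  (FreeAlgebra.basisFreeMonoid ℚ ℕ).ext fun u => by rw [basisFreeMonoid_apply, h]

/-- The linear extension of a function on words. -/
def wordFunctional (f : List ℕ → ℤ) : Letters →ₗ[ℚ] ℚ :=
  (FreeAlgebra.basisFreeMonoid ℚ ℕ).constr ℚ fun u => (f (FreeMonoid.toList u) : ℚ)

@[simp] lemma wordFunctional_monomial (f : List ℕ → ℤ) (u : List ℕ) :
    wordFunctional f (monomial u) = f u := by
  have h := basisFreeMonoid_apply (FreeMonoid.ofList u)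
  rw [FreeMonoid.toList_ofList] at h
  rw [← h, wordFunctional, Module.Basis.constr_basis, FreeMonoid.toList_ofList]

lemma wordFunctional_comm {f : List ℕ → ℤ} (hf : ∀ u v, f (u ++ v) = f (v ++ u)) (x y : Letters) :
    wordFunctional f (x * y) = wordFunctional f (y * x) := by
  have : (LinearMap.mul ℚ Letters).compr₂ (wordFunctional f) =
      (LinearMap.mul ℚ Letters).flip.compr₂ (wordFunctional f) := by
    refine linearMap_ext_monomial fun u => linearMap_ext_monomial fun v => ?_
    simp only [LinearMap.compr₂_apply, LinearMap.mul_apply', LinearMap.flip_apply,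
      ← monomial_append, wordFunctional_monomial, hf]
  exact LinearMap.congr_fun (LinearMap.congr_fun this x) y

lemma wordSum_monomial_mul (L L' : List (ℤ × List ℕ)) : wordSum monomial (mulWords L L') =
    wordSum monomial L * wordSum monomial L' := by
  rw [wordSum_mul]
  have h1 : ∀ u, wordSum (fun v => monomial (u ++ v)) L' = monomial u * wordSum monomial L' := by
    intro u
    simp only [monomial_append]
    exact (map_wordSum (AddMonoidHom.mulLeft (monomial u)) monomial L').symm
  simp only [h1]
  exact (map_wordSum (AddMonoidHom.mulRight (wordSum monomial L')) monomial L).symm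

lemma lie_eq_wordSum (S : RTree) : S.lie letter = wordSum monomial S.words := by
  induction S with
  | leaf i => simp [RTree.lie, RTree.words, wordSum, monomial_singleton]
  | node S T ihS ihT =>
    rw [RTree.lie, RTree.words, wordSum_append, wordSum_neg, wordSum_monomial_mul,
      wordSum_monomial_mul, ihS, ihT, sub_eq_add_neg]

lemma treePairing_letter (f : List ℕ → ℤ) (T : JTree) :
    treePairing (wordFunctional f) letter T =
      wordSum (fun u => (f u : ℚ)) (mulWords T.fst.words T.snd.words) := by
  rw [treePairing, lie_eq_wordSum, lie_eq_wordSum, ← wordSum_monomial_mul, map_wordSum]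
  simp only [wordFunctional_monomial]

lemma wordFunctional_algHom {f : List ℕ → ℤ} {φ : Letters →ₐ[ℚ] Letters} {k : ℚ}
    (h : ∀ u, wordFunctional f (φ (monomial u)) = k * f u) (x : Letters) :
    wordFunctional f (φ x) = k * wordFunctional f x := by
  have : wordFunctional f ∘ₗ φ.toLinearMap = k • wordFunctional f :=
    linearMap_ext_monomial fun u => by simpa using h u
  exact LinearMap.congr_fun this x

/-- The algebra endomorphism given by a map between letters. -/
def relabelHom (t : ℕ → ℕ) : Letters →ₐ[ℚ] Letters :=
  FreeAlgebra.lift ℚ fun n => letter (t n)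

@[simp] lemma relabelHom_letter (t : ℕ → ℕ) (n : ℕ) : relabelHom t (letter n) = letter (t n) :=
  FreeAlgebra.lift_ι_apply _ _

lemma relabelHom_monomial (t : ℕ → ℕ) (u : List ℕ) :
    relabelHom t (monomial u) = monomial (u.map t) := by
  rw [monomial, monomial, map_list_prod, List.map_map, List.map_map]
  congr 1
  exact List.map_congr_left fun n _ => relabelHom_letter t n

lemma wordFunctional_relabelHom {f : List ℕ → ℤ} {t : ℕ → ℕ} {k : ℤ}
    (h : ∀ u : List ℕ, f (u.map t) = k * f u) (x : Letters) :
    wordFunctional f (relabelHom t x) = k * wordFunctional f x :=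
  wordFunctional_algHom (fun u => by rw [relabelHom_monomial, wordFunctional_monomial, h]; simp) x

/-! ### The two-loop functional on trees with letters as leaves -/

/-- The linear extension of `loopWord`. -/
def loopFunctional : Letters →ₗ[ℚ] ℚ := wordFunctional loopWord

/-- The value of the two-loop functional on a tree whose leaves are letters. -/
def loopValue (T : JTree) : ℚ := treePairing loopFunctional letter T

lemma loopFunctional_comm (x y : Letters) : loopFunctional (x * y) = loopFunctional (y * x) :=
  wordFunctional_comm loopWord_comm x y

lemma mem_mulWords_perm {T : JTree} {p : ℤ × List ℕ} (hp : p ∈ mulWords T.fst.words T.snd.words) :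
    p.2.Perm T.legs := by
  simp only [mulWords, List.mem_flatMap, List.mem_map] at hp
  obtain ⟨a, ha, b, hb, rfl⟩ := hp
  exact (RTree.words_perm ha).append (RTree.words_perm hb)

lemma loopValue_eq_zero {T : JTree} (h : ¬T.legs.Perm (List.range 8)) : loopValue T = 0 := by
  rw [loopValue, loopFunctional, treePairing_letter,
    wordSum_congr (g := fun _ => (0 : ℚ)) _ fun p hp => ?_]
  · simp [wordSum]
  · rw [Int.cast_eq_zero]
    by_contra h'
    exact h ((mem_mulWords_perm hp).symm.trans (perm_of_loopWord_ne_zero h'))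

lemma treePairing_relabelHom {f : List ℕ → ℤ} {t : ℕ → ℕ} {k : ℤ}
    (h : ∀ u : List ℕ, f (u.map t) = k * f u) (c : ℕ → Letters) (T : JTree) :
    treePairing (wordFunctional f) (fun i => relabelHom t (c i)) T =
      k * treePairing (wordFunctional f) c T := by
  rw [treePairing_algHom, wordFunctional_relabelHom h, treePairing]

lemma treePairing_letter_map {f : List ℕ → ℤ} {t : ℕ → ℕ} {k : ℤ}
    (h : ∀ u : List ℕ, f (u.map t) = k * f u) (T : JTree) :
    treePairing (wordFunctional f) letter (T.map t) =
      k * treePairing (wordFunctional f) letter T := by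
  rw [← treePairing_relabelHom h, treePairing_map]
  simp only [relabelHom_letter, Function.comp_def]

lemma loopValue_transp {i j : ℕ} (hi : i ∈ [4, 5, 6, 7]) (hj : j ∈ [4, 5, 6, 7]) (hij : i ≠ j)
    (T : JTree) : loopValue (T.map (transp i j)) = -loopValue T := by
  have := treePairing_letter_map (f := loopWord) (t := transp i j) (k := -1)
    (fun u => by rw [loopWord_transp hi hj hij]; ring) T
  simpa [loopValue, loopFunctional] using this

/-- `A.act f u` is the value of `f` on the product of the word `u` and the commutator `A`, where
the words are written from right to left. -/
def RTree.act : RTree → (List ℕ → ℤ) → List ℕ → ℤ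
  | leaf i, f, u => f (i :: u)
  | node A B, f, u => Int.sub (A.act (B.act f) u) (B.act (A.act f) u)

/-- The value of `f` on the coefficients of a rooted tree with respect to the left-normed brackets
that start with `s`, where the words are written from right to left. -/
def RTree.firstAct (s : ℕ) : RTree → (List ℕ → ℤ) → List ℕ → ℤ
  | leaf _, f, u => f u
  | node A B, f, u =>
    bif A.hasLeg s then A.firstAct s (B.act f) u else Int.neg (B.firstAct s (A.act f) u)

lemma RTree.act_eq (S : RTree) (f : List ℕ → ℤ) (u : List ℕ) :
    S.act f u = wordSum (fun w => f (w.reverse ++ u)) S.words := by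
  induction S generalizing f u with
  | leaf i => simp [act, words, wordSum]
  | node S T ihS ihT =>
    rw [act, words, wordSum_append, wordSum_neg, wordSum_mul, wordSum_mul, ihS, ihT,
      ← sub_eq_add_neg]
    simp only [ihS, ihT, List.reverse_append, List.append_assoc]
    rfl

lemma RTree.firstAct_eq (s : ℕ) (S : RTree) (f : List ℕ → ℤ) (u : List ℕ) :
    S.firstAct s f u = wordSum (fun w => f (w.reverse ++ u)) (S.firstWords s) := by
  induction S generalizing f u with
  | leaf i => simp [firstAct, firstWords, wordSum]
  | node S T ihS ihT =>
    rw [firstAct, firstWords]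
    cases S.hasLeg s
    · rw [cond_false, cond_false, wordSum_neg, wordSum_mul, ihT]
      simp only [act_eq, List.reverse_append, List.append_assoc]
      rfl
    · rw [cond_true, cond_true, wordSum_mul, ihS]
      simp only [act_eq, List.reverse_append, List.append_assoc]

lemma preLoopWord_snoc {v : List ℕ} (h : 0 ∉ v) : preLoopWord (v ++ [0]) = loopSeed v := by
  have h0 : ∀ (v ctx : List ℕ), 0 ∉ v → cyclicSum 0 loopSeed v ctx = 0 := by
    intro v
    induction v with
    | nil => intros; rfl
    | cons x v ih =>
      intro ctx hv
      rw [List.mem_cons, not_or] at hv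
      rw [cyclicSum, ih _ hv.2, if_neg (Ne.symm hv.1), add_zero]
  rw [preLoopWord, cyclicSum_append, h0 _ _ h, zero_add, cyclicSum]
  simp [cyclicSum]

lemma treePairing_preLoopWord_comb {u : List ℕ} (h0 : 0 ∉ u) (h2 : 2 ∉ u) :
    treePairing (wordFunctional preLoopWord) letter ⟨RTree.comb (.leaf 2) u, .leaf 0⟩ =
      seedTail u.reverse := by
  have key : ∀ u a b : List ℕ, 0 ∉ u → 0 ∉ a → 0 ∉ b → 2 ∉ u → 2 ∉ a →
      wordFunctional preLoopWord (adList (u.map letter) (monomial (a ++ 2 :: b)) * letter 0) =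
        if a = [] then seedTail (b ++ u).reverse else 0 := by
    intro u
    induction u with
    | nil =>
      intro a b _ ha hb _ ha2
      rw [List.map_nil, adList, List.foldl_nil, ← monomial_singleton 0, ← monomial_append,
        wordFunctional_monomial, preLoopWord_snoc (by simp [ha, hb])]
      cases a with
      | nil => simp [loopSeed]
      | cons x a =>
        have : x ≠ 2 := fun h => ha2 (by simp [h])
        simp [loopSeed, this]
    | cons x u ih =>
      intro a b hu ha hb hu2 ha2
      rw [List.mem_cons, not_or] at hu hu2
      rw [List.map_cons, adList_cons, ← monomial_singleton x, ← monomial_append, ← monomial_append]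
      have hsub : ∀ y z : Letters, adList (u.map letter) (y - z) =
          adList (u.map letter) y - adList (u.map letter) z := by
        intro y z
        generalize u.map letter = L
        induction L generalizing y z with
        | nil => rfl
        | cons w L ih => rw [adList_cons, adList_cons, adList_cons, ← ih]; congr 1; noncomm_ring
      have e1 : (a ++ 2 :: b) ++ [x] = a ++ 2 :: (b ++ [x]) := by simp
      have e2 : [x] ++ (a ++ 2 :: b) = (x :: a) ++ 2 :: b := by simp
      rw [hsub, sub_mul, map_sub, e1, e2, ih a (b ++ [x]) hu.2 ha (by simp [hb, hu.1]) hu2.2 ha2,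
        ih (x :: a) b hu.2 (by simp [ha, hu.1]) hb hu2.2 (by simp [ha2, hu2.1])]
      simp
  have := key u [] [] h0 (by simp) (by simp) h2 (by simp)
  simpa [treePairing, RTree.lie_comb, RTree.lie, monomial_singleton] using this

/-- The value of `preLoopWord` on a tree, computed from the coefficients of its expansion into
caterpillars between `2` and `0`. -/
def preValue (T : JTree) : ℤ := (T.fastCutAt 0).firstAct 2 seedTail []

/-- The value of the two-loop functional on a tree, in a form that evaluates fast. -/
def fastLoopValue (T : JTree) : ℤ :=
  Int.add (Int.sub (Int.sub (preValue T) (preValue (T.map (transp 0 1))))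
      (Int.sub (preValue (T.map (transp 2 3))) (preValue ((T.map (transp 2 3)).map (transp 0 1)))))
    (Int.sub
      (Int.sub (preValue (T.map (pairTransp 0 1)))
        (preValue ((T.map (pairTransp 0 1)).map (transp 0 1))))
      (Int.sub (preValue ((T.map (pairTransp 0 1)).map (transp 2 3)))
        (preValue (((T.map (pairTransp 0 1)).map (transp 2 3)).map (transp 0 1)))))

lemma treePairing_preLoopWord {T : JTree} (h : T.legs.Perm (List.range 8)) :
    treePairing (wordFunctional preLoopWord) letter T = preValue T := by
  have h1 : T.legs.Perm [0, 2, 1, 3, 4, 5, 6, 7] := h.trans (by decide)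
  have h0 : 0 ∈ T.legs := h1.mem_iff.2 (by simp)
  have hcut : (T.cutAt 0).legs.Perm [2, 1, 3, 4, 5, 6, 7] :=
    ((JTree.cutAt_legs _ _ h0).trans h1).cons_inv
  have h2 : 2 ∈ (T.cutAt 0).legs := hcut.mem_iff.2 (by simp)
  rw [(isTreeFun_treePairing (wordFunctional_comm preLoopWord_comm) letter).expand h0 h2, preValue,
    RTree.firstAct_eq, JTree.fastCutAt_eq]
  have := map_wordSum (Int.castAddHom ℚ) (fun w => seedTail (w.reverse ++ []))
    ((T.cutAt 0).firstWords 2)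
  refine Eq.trans ?_ this.symm
  refine wordSum_congr _ fun p hp => ?_
  have hperm := ((RTree.firstWords_perm h2 hp).trans hcut).cons_inv
  rw [treePairing_preLoopWord_comb]
  · simp
  · rw [hperm.mem_iff]; decide
  · rw [hperm.mem_iff]; decide

lemma loopValue_eq_fastLoopValue {T : JTree} (h : T.legs.Perm (List.range 8)) :
    loopValue T = fastLoopValue T := by
  have hmap : ∀ q ∈ chordSymms, treePairing (wordFunctional preLoopWord) letter (T.map q.2) =
      preValue (T.map q.2) := by
    intro q hq
    refine treePairing_preLoopWord ?_
    rw [JTree.map_legs]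
    have hfin : ∀ q ∈ chordSymms, ((List.range 8).map q.2).Perm (List.range 8) := by
      decide +kernel
    exact (h.map q.2).trans (hfin q hq)
  have hsum : loopFunctional = (chordSymms.map fun q =>
      (q.1 : ℚ) • (wordFunctional preLoopWord ∘ₗ (relabelHom q.2).toLinearMap)).sum := by
    refine linearMap_ext_monomial fun u => ?_
    simp [loopFunctional, loopWord, chordSymms, relabelHom_monomial]
  have hterm : ∀ t : ℕ → ℕ, (wordFunctional preLoopWord ∘ₗ (relabelHom t).toLinearMap)
      (T.fst.lie letter * T.snd.lie letter) =
      treePairing (wordFunctional preLoopWord) letter (T.map t) := by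
    intro t
    rw [treePairing_map, LinearMap.comp_apply, AlgHom.toLinearMap_apply, ← treePairing_algHom]
    simp only [relabelHom_letter, Function.comp_def]
  have hfast : fastLoopValue T = (chordSymms.map fun q => q.1 * preValue (T.map q.2)).sum := by
    have hid : T.map id = T := by rw [JTree.map_eq_bind]; exact JTree.bind_leaf T
    have hcomp : ∀ f g : ℕ → ℕ, T.map (f ∘ g) = (T.map g).map f := fun f g =>
      (JTree.map_map g f T).symm
    simp only [chordSymms, List.map_cons, List.map_nil, List.sum_cons, List.sum_nil, hid, hcomp]
    change (preValue T - _ - (_ - _)) + (_ - _ - (_ - _)) = _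
    ring
  have hpush : (chordSymms.map fun q => (q.1 : ℚ) * (preValue (T.map q.2) : ℚ)).sum =
      (chordSymms.map fun q => (q.1 : ℚ) * treePairing (wordFunctional preLoopWord) letter
        (T.map q.2)).sum := by
    congr 1
    refine List.map_congr_left fun q hq => ?_
    rw [hmap q hq]
  rw [hfast, Int.cast_list_sum, List.map_map]
  simp only [Function.comp_def, Int.cast_mul]
  rw [hpush, loopValue, treePairing, hsum]
  simp only [chordSymms, List.map_cons, List.map_nil, List.sum_cons, List.sum_nil,
    LinearMap.add_apply, LinearMap.smul_apply, LinearMap.zero_apply, hterm, smul_eq_mul]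

/-! ### Relations between the values of the two-loop functional -/

lemma perm_induction {P : List ℕ → Prop} (h0 : P [4, 5, 6, 7])
    (ht : ∀ i ∈ [4, 5, 6, 7], ∀ j ∈ [4, 5, 6, 7], i ≠ j → ∀ l, P l → P (l.map (transp i j)))
    {l : List ℕ} (hl : l.Perm [4, 5, 6, 7]) : P l := by
  have hfin : ∀ a ∈ [4, 5, 6, 7], ∀ b ∈ [4, 5, 6, 7], ∀ c ∈ [4, 5, 6, 7], ∀ d ∈ [4, 5, 6, 7],
      [a, b, c, d].Perm [4, 5, 6, 7] → ∃ i ∈ [4, 5, 6, 7], ∃ j ∈ [4, 5, 6, 7],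
      ∃ k ∈ [4, 5, 6, 7], [a, b, c, d] =
        (([4, 5, 6, 7].map (transp 6 k)).map (transp 5 j)).map (transp 4 i) := by
    decide +kernel
  have ht' : ∀ i ∈ [4, 5, 6, 7], ∀ j ∈ [4, 5, 6, 7], ∀ l, P l → P (l.map (transp i j)) := by
    intro i hi j hj l hl
    by_cases hij : i = j
    · subst hij
      have : transp i i = id := by funext x; simp [transp_eq_swap]
      rwa [this, List.map_id]
    · exact ht i hi j hj hij l hl
  have hmem := fun x => hl.mem_iff (a := x)
  match l, hl.length_eq with
  | [a, b, c, d], _ =>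
    obtain ⟨i, hi, j, hj, k, hk, h⟩ := hfin a ((hmem a).1 (by simp)) b ((hmem b).1 (by simp))
      c ((hmem c).1 (by simp)) d ((hmem d).1 (by simp)) hl
    rw [h]
    exact ht' 4 (by simp) i hi _ (ht' 5 (by simp) j hj _ (ht' 6 (by simp) k hk _ h0))

/-- The value of the two-loop functional on a formal linear combination of trees. -/
def fastSum : List (ℤ × JTree) → ℤ
  | [] => 0
  | p :: L => Int.add (Int.mul p.1 (fastLoopValue p.2)) (fastSum L)

lemma treeSum_loopValue {L : List (ℤ × JTree)} (h : ∀ p ∈ L, p.2.legs.Perm (List.range 8)) :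
    treeSum loopValue L = fastSum L := by
  induction L with
  | nil => simp [fastSum]
  | cons p L ih =>
    rw [treeSum_cons, ih fun q hq => h q (List.mem_cons_of_mem _ hq),
      loopValue_eq_fastLoopValue (h p (by simp)), fastSum]
    change _ = ((p.1 * fastLoopValue p.2 + fastSum L : ℤ) : ℚ)
    push_cast
    simp

/-- A relation between the values of the two-loop functional on trees with the hairs `l` holds in
general if it holds for the hairs `4, 5, 6, 7`. -/
lemma treeSum_loopValue_eq_zero {F : List ℕ → List (ℤ × JTree)} {l : List ℕ}
    (hmap : ∀ t : ℕ → ℕ, (∀ i < 4, t i = i) → ∀ l, F (l.map t) = (F l).map fun p => (p.1, p.2.map t))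
    (hlegs : ∀ l, ∀ p ∈ F l, p.2.legs.Perm ([0, 1, 2, 3] ++ l))
    (h0 : l.length = 4 → fastSum (F [4, 5, 6, 7]) = 0) : treeSum loopValue (F l) = 0 := by
  by_cases hl : l.Perm [4, 5, 6, 7]
  · refine perm_induction (P := fun l => treeSum loopValue (F l) = 0) ?_ ?_ hl
    · rw [treeSum_loopValue fun p hp => (hlegs _ p hp).trans (by decide), h0 hl.length_eq,
        Int.cast_zero]
    · intro i hi j hj hij l h
      have hfix : ∀ k < 4, transp i j k = k := by
        intro k hk
        rw [transp_eq_swap]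
        refine Equiv.swap_apply_of_ne_of_ne ?_ ?_ <;> rintro rfl <;>
          simp only [List.mem_cons, List.not_mem_nil, or_false] at hi hj <;> omega
      have : treeSum loopValue ((F l).map fun p => (p.1, p.2.map (transp i j))) =
          -treeSum loopValue (F l) := by
        simp only [treeSum, List.map_map, Function.comp_def, loopValue_transp hi hj hij, smul_neg]
        have h5 := (List.sum_neg ((F l).map fun p => p.1 • loopValue p.2)).symm
        rwa [List.map_map] at h5
      rw [hmap _ hfix, this, h, neg_zero]
  · have : ∀ p ∈ F l, loopValue p.2 = 0 := fun p hp => loopValue_eq_zero fun h => hl (by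
      have h1 := (hlegs l p hp).symm.trans h
      exact (List.perm_append_left_iff [0, 1, 2, 3]).1 (h1.trans (by decide)))
    rw [treeSum, List.map_congr_left (g := fun _ => (0 : ℚ)) fun p hp => by rw [this p hp, smul_zero]]
    simp

/-- The three trees that arise by connecting a tripod to three leaves of a caterpillar. -/
def threeLinkTrees (x y : List ℕ) : List (ℤ × JTree) :=
  [(1, ⟨(RTree.node (.leaf 1) (.leaf 3)).comb (x ++ 2 :: y), .leaf 0⟩),
    (1, ⟨(RTree.leaf 0).comb (x ++ 2 :: y), .node (.leaf 3) (.leaf 1)⟩),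
    (1, ⟨(RTree.node ((RTree.leaf 0).comb x) (.node (.leaf 1) (.leaf 3))).comb y, .leaf 2⟩)]

lemma loopValue_threeLinkTrees (x y : List ℕ) : treeSum loopValue (threeLinkTrees x y) = 0 := by
  have hcheck : ∀ n ∈ List.range 5,
      fastSum (threeLinkTrees ([4, 5, 6, 7].take n) ([4, 5, 6, 7].drop n)) = 0 := by
    decide +kernel
  have := treeSum_loopValue_eq_zero
    (F := fun l => threeLinkTrees (l.take x.length) (l.drop x.length)) (l := x ++ y) ?_ ?_ ?_
  · simpa using this
  · intro t ht l
    simp [threeLinkTrees, JTree.map, RTree.map_comb, RTree.map, List.map_take, List.map_drop, ht]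
  · intro l p hp
    have h1 := List.take_append_drop x.length l
    simp only [threeLinkTrees, List.mem_cons, List.not_mem_nil, or_false] at hp
    conv_rhs => rw [← h1]
    rcases hp with rfl | rfl | rfl <;>
    · simp only [JTree.legs, RTree.comb_legs, RTree.legs, ← Multiset.coe_eq_coe,
        ← Multiset.coe_add, ← Multiset.cons_coe, ← Multiset.singleton_add, Multiset.coe_nil]
      abel
  · intro hl
    refine hcheck _ (List.mem_range.2 ?_)
    rw [List.length_append] at hl
    omega

/-- The tree with a dotted edge between two adjacent leaves. -/
def selfLinkTrees (x y : List ℕ) : List (ℤ × JTree) :=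
  [(1, ⟨(RTree.node ((RTree.leaf 0).comb x) (.node (.leaf 2) (.leaf 3))).comb y, .leaf 1⟩)]

lemma loopValue_selfLinkTrees (x y : List ℕ) : treeSum loopValue (selfLinkTrees x y) = 0 := by
  have hcheck : ∀ n ∈ List.range 5,
      fastSum (selfLinkTrees ([4, 5, 6, 7].take n) ([4, 5, 6, 7].drop n)) = 0 := by
    decide +kernel
  have := treeSum_loopValue_eq_zero
    (F := fun l => selfLinkTrees (l.take x.length) (l.drop x.length)) (l := x ++ y) ?_ ?_ ?_
  · simpa using this
  · intro t ht l
    simp [selfLinkTrees, JTree.map, RTree.map_comb, RTree.map, List.map_take, List.map_drop, ht]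
  · intro l p hp
    have h1 := List.take_append_drop x.length l
    simp only [selfLinkTrees, List.mem_singleton] at hp
    subst hp
    conv_rhs => rw [← h1]
    simp only [JTree.legs, RTree.comb_legs, RTree.legs, ← Multiset.coe_eq_coe,
      ← Multiset.coe_add, ← Multiset.cons_coe, ← Multiset.singleton_add, Multiset.coe_nil]
    abel
  · intro hl
    refine hcheck _ (List.mem_range.2 ?_)
    rw [List.length_append] at hl
    omega

/-- The entries of a caterpillar with the word `w₁`, `A`, `w₂`, `B`, `w₃`. -/
def slideWord (w₁ w₂ w₃ : List ℕ) (A B : RTree) : List RTree :=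
  w₁.map .leaf ++ A :: (w₂.map .leaf ++ B :: w₃.map .leaf)

/-- The two trees that arise by connecting a tripod, whose third leaf is replaced by the word `v`,
to two leaves of a caterpillar; if `b` holds, then the first of these leaves comes first in the
caterpillar. The word of the caterpillar is rotated by `k`. -/
def slideTrees (b : Bool) (k : ℕ) (w₁ w₂ w₃ v : List ℕ) : List (ℤ × JTree) :=
  bif b then
    [(1, ⟨(RTree.leaf 0).combTrees
        ((slideWord w₁ w₂ w₃ ((RTree.leaf 3).comb v) (.leaf 2)).rotate k), .leaf 1⟩),
      ((-1) ^ v.length, ⟨(RTree.leaf 0).combTrees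
        ((slideWord w₁ w₂ w₃ (.leaf 2) ((RTree.leaf 3).comb v.reverse)).rotate k), .leaf 1⟩)]
  else
    [(1, ⟨(RTree.leaf 0).combTrees
        ((slideWord w₁ w₂ w₃ (.leaf 2) ((RTree.leaf 3).comb v)).rotate k), .leaf 1⟩),
      ((-1) ^ v.length, ⟨(RTree.leaf 0).combTrees
        ((slideWord w₁ w₂ w₃ ((RTree.leaf 3).comb v.reverse) (.leaf 2)).rotate k), .leaf 1⟩)]

/-- The difference between `slideTrees` for a rotated and an unrotated caterpillar, for a list `l` of hairs
that is cut into words of the lengths `i`, `j`, `k` and a rest. -/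
def slideCheck (b : Bool) (i j k : ℕ) (l : List ℕ) : List (ℤ × JTree) :=
  slideTrees b 0 (l.take i) ((l.drop i).take j) (((l.drop i).drop j).take k)
      (((l.drop i).drop j).drop k) ++
    (slideTrees b 1 (l.take i) ((l.drop i).take j) (((l.drop i).drop j).take k)
      (((l.drop i).drop j).drop k)).map fun p => (-p.1, p.2)

lemma slideCheck_eq_zero : ∀ b : Bool, ∀ i ∈ List.range 5, ∀ j ∈ List.range 5,
    ∀ k ∈ List.range 5, i + j + k ≤ 4 → fastSum (slideCheck b i j k [4, 5, 6, 7]) = 0 := by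
  decide +kernel

lemma loopValue_slideTrees (b : Bool) (w₁ w₂ w₃ v : List ℕ) :
    treeSum loopValue (slideTrees b 1 w₁ w₂ w₃ v) = treeSum loopValue (slideTrees b 0 w₁ w₂ w₃ v) := by
  have := treeSum_loopValue_eq_zero
    (F := slideCheck b w₁.length w₂.length w₃.length) (l := w₁ ++ (w₂ ++ (w₃ ++ v))) ?_ ?_ ?_
  · rw [slideCheck, treeSum_append] at this
    simp only [List.take_left, List.drop_left] at this
    have hneg : ∀ L : List (ℤ × JTree), treeSum loopValue (L.map fun p => (-p.1, p.2)) =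
        -treeSum loopValue L := fun L => by
      have := treeSum_scale loopValue (-1) L
      simpa using this
    rw [hneg, ← sub_eq_add_neg, sub_eq_zero] at this
    exact this.symm
  · intro t ht l
    have hs : ∀ w₁ w₂ w₃ A B k, ((slideWord w₁ w₂ w₃ A B).rotate k).map (RTree.map t) =
        (slideWord (w₁.map t) (w₂.map t) (w₃.map t) (A.map t) (B.map t)).rotate k := by
      intro w₁ w₂ w₃ A B k
      rw [List.map_rotate]
      simp [slideWord, Function.comp_def, RTree.map]
    have h : ∀ k w₁ w₂ w₃ v, slideTrees b k (w₁.map t) (w₂.map t) (w₃.map t) (v.map t) =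
        (slideTrees b k w₁ w₂ w₃ v).map fun p => (p.1, p.2.map t) := by
      intro k w₁ w₂ w₃ v
      cases b <;> simp [slideTrees, JTree.map, RTree.map_combTrees, hs, RTree.map_comb, RTree.map, ht]
    simp only [slideCheck, List.map_append, List.map_map, ← List.map_take, ← List.map_drop, h,
      Function.comp_def]
  · intro l p hp
    have h1 := List.take_append_drop w₁.length l
    have h2 := List.take_append_drop w₂.length (l.drop w₁.length)
    have h3 := List.take_append_drop w₃.length ((l.drop w₁.length).drop w₂.length)
    conv_rhs => rw [← h1, ← h2, ← h3]
    simp only [slideCheck, List.mem_append, List.mem_map] at hp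
    have hlegs : ∀ k w₁ w₂ w₃ v, ∀ p ∈ slideTrees b k w₁ w₂ w₃ v,
        p.2.legs.Perm ([0, 1, 2, 3] ++ (w₁ ++ (w₂ ++ (w₃ ++ v)))) := by
      intro k w₁ w₂ w₃ v p hp
      have hr : ∀ A B, (((slideWord w₁ w₂ w₃ A B).rotate k).flatMap RTree.legs).Perm
          (w₁ ++ (w₂ ++ (w₃ ++ (A.legs ++ B.legs)))) := by
        intro A B
        refine ((List.rotate_perm _ k).flatMap_right _).trans ?_
        have hl : ∀ w : List ℕ, (w.map RTree.leaf).flatMap RTree.legs = w := by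
          intro w; induction w with
          | nil => rfl
          | cons a w ih => simp [RTree.legs, ih]
        simp only [slideWord, List.flatMap_append, List.flatMap_cons, hl, ← Multiset.coe_eq_coe,
          ← Multiset.coe_add]
        abel
      have hj : ∀ A B, (JTree.legs ⟨(RTree.leaf 0).combTrees ((slideWord w₁ w₂ w₃ A B).rotate k),
          .leaf 1⟩).Perm ([0, 1] ++ (w₁ ++ (w₂ ++ (w₃ ++ (A.legs ++ B.legs))))) := by
        intro A B
        simp only [JTree.legs, RTree.combTrees_legs]
        refine (List.Perm.append_right _ (List.Perm.append_left _ (hr A B))).trans ?_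
        simp only [RTree.legs, ← Multiset.coe_eq_coe, ← Multiset.coe_add, ← Multiset.cons_coe,
          ← Multiset.singleton_add, Multiset.coe_nil]
        abel
      have hv := List.reverse_perm v
      rw [← Multiset.coe_eq_coe] at hv
      have hp' : ∃ k' A B, p = (k', ⟨(RTree.leaf 0).combTrees
          ((slideWord w₁ w₂ w₃ A B).rotate k), .leaf 1⟩) ∧ (A.legs ++ B.legs).Perm (2 :: 3 :: v) := by
        cases b
        all_goals
          simp only [slideTrees, cond_true, cond_false, List.mem_cons, List.not_mem_nil,
            or_false] at hp
          rcases hp with rfl | rfl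
          all_goals
            refine ⟨_, _, _, rfl, ?_⟩
            simp only [RTree.comb_legs, RTree.legs, ← Multiset.coe_eq_coe, ← Multiset.coe_add,
              ← Multiset.cons_coe, ← Multiset.singleton_add, Multiset.coe_nil, hv]
            try abel
      obtain ⟨k', A, B, rfl, hAB⟩ := hp'
      refine (hj A B).trans ?_
      rw [← Multiset.coe_eq_coe, ← Multiset.coe_add] at hAB
      simp only [← Multiset.coe_eq_coe, ← Multiset.coe_add, ← Multiset.cons_coe,
        ← Multiset.singleton_add, Multiset.coe_nil, hAB]
      abel
    rcases hp with hp | ⟨q, hq, rfl⟩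
    · exact hlegs _ _ _ _ _ p hp
    · exact hlegs _ _ _ _ _ q hq
  · intro hl
    simp only [List.length_append] at hl
    exact slideCheck_eq_zero b _ (List.mem_range.2 (by omega)) _ (List.mem_range.2 (by omega)) _
      (List.mem_range.2 (by omega)) (by omega)

/-! ### Functionals on trees with dotted edges -/

section

variable {A : Type*} [Ring A] [Algebra ℚ A]

lemma RTree.exists_lie_update (d : ℕ → A) {i : ℕ} {S : RTree} (hi : i ∈ S.legs)
    (hS : S.legs.Nodup) : ∃ φ : A →ₗ[ℚ] A, ∀ y, S.lie (Function.update d i y) = φ y := by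
  induction S with
  | leaf j =>
    simp only [legs, List.mem_singleton] at hi
    subst hi
    exact ⟨LinearMap.id, fun y => by simp [lie]⟩
  | node S T ihS ihT =>
    rw [legs, List.nodup_append] at hS
    have hconst : ∀ U : RTree, i ∉ U.legs → ∀ y, U.lie (Function.update d i y) = U.lie d :=
      fun U hU y => lie_congr fun j hj => Function.update_of_ne (fun h => hU (by rw [← h]; exact hj)) _ _
    rcases List.mem_append.1 hi with hi | hi
    · obtain ⟨φ, hφ⟩ := ihS hi hS.1
      have hT : i ∉ T.legs := fun h => hS.2.2 i hi i h rfl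
      exact ⟨LinearMap.mulRight ℚ (T.lie d) ∘ₗ φ - LinearMap.mulLeft ℚ (T.lie d) ∘ₗ φ,
        fun y => by simp [lie, hφ, hconst T hT]⟩
    · obtain ⟨φ, hφ⟩ := ihT hi hS.2.1
      have hS' : i ∉ S.legs := fun h => hS.2.2 i h i hi rfl
      exact ⟨LinearMap.mulLeft ℚ (S.lie d) ∘ₗ φ - LinearMap.mulRight ℚ (S.lie d) ∘ₗ φ,
        fun y => by simp [lie, hφ, hconst S hS']⟩

lemma exists_treePairing_update (τ : A →ₗ[ℚ] ℚ) (d : ℕ → A) {i : ℕ} {T : JTree}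
    (hi : i ∈ T.legs) (hT : T.legs.Nodup) :
    ∃ φ : A →ₗ[ℚ] ℚ, ∀ y, treePairing τ (Function.update d i y) T = φ y := by
  rw [JTree.legs, List.nodup_append] at hT
  have hconst : ∀ U : RTree, i ∉ U.legs → ∀ y, U.lie (Function.update d i y) = U.lie d :=
    fun U hU y => RTree.lie_congr fun j hj => Function.update_of_ne (fun h => hU (by rw [← h]; exact hj)) _ _
  rcases List.mem_append.1 hi with hi | hi
  · obtain ⟨φ, hφ⟩ := RTree.exists_lie_update d hi hT.1
    have h2 : i ∉ T.snd.legs := fun h => hT.2.2 i hi i h rfl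
    exact ⟨τ ∘ₗ LinearMap.mulRight ℚ (T.snd.lie d) ∘ₗ φ,
      fun y => by simp [treePairing, hφ, hconst _ h2]⟩
  · obtain ⟨φ, hφ⟩ := RTree.exists_lie_update d hi hT.2.1
    have h2 : i ∉ T.fst.legs := fun h => hT.2.2 i h i hi rfl
    exact ⟨τ ∘ₗ LinearMap.mulLeft ℚ (T.fst.lie d) ∘ₗ φ,
      fun y => by simp [treePairing, hφ, hconst _ h2]⟩

end

/-- The endpoints of a list of directed edges, in order. -/
def ends (L : List (ℕ × ℕ)) : List ℕ := L.flatMap fun e => [e.1, e.2]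

lemma mem_ends {L : List (ℕ × ℕ)} {i : ℕ} : i ∈ ends L ↔ i ∈ endpoints L.toFinset := by
  simp only [ends, List.mem_flatMap, List.mem_cons, List.not_mem_nil, or_false, mem_endpoints,
    List.mem_toFinset]
  exact ⟨fun ⟨e, he, h⟩ => ⟨e, he, h.imp Eq.symm Eq.symm⟩,
    fun ⟨e, he, h⟩ => ⟨e, he, h.imp Eq.symm Eq.symm⟩⟩

lemma nodup_ends {L : List (ℕ × ℕ)} (hL : L.Nodup) (hD : IsMatching L.toFinset) :
    (ends L).Nodup := by
  rw [ends, List.nodup_flatMap]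
  refine ⟨fun e he => ?_, hL.imp_of_mem fun {e f} he hf hef => ?_⟩
  · have := hD.1 e (List.mem_toFinset.2 he)
    simp [this]
  · have := hD.2 e (List.mem_toFinset.2 he) f (List.mem_toFinset.2 hf) hef
    simp [Function.onFun]
    tauto

/-- The colours of the leaves of a tree with dotted edges `L`, for a map `s` from colours to the
free algebra: the endpoints of the dotted edges are coloured by the letters `0, 1, 2, …`. -/
def chordColor (s : Letters →ₐ[ℚ] Letters) (c : ℕ → Letters) (L : List (ℕ × ℕ)) (i : ℕ) : Letters :=
  if i ∈ ends L then letter ((ends L).idxOf i) else s (c i)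

/-- The value of the two-loop functional on a tree with dotted edges `L`. -/
def chordValue (s : Letters →ₐ[ℚ] Letters) (c : ℕ → Letters) (L : List (ℕ × ℕ))
    (T : JTree) : ℚ := treePairing loopFunctional (chordColor s c L) T

/-- The map `s` from colours to the free algebra is compatible with the symmetries of `r` dotted
edges. -/
structure IsChordMap (s : Letters →ₐ[ℚ] Letters) (r : ℕ) : Prop where
  perm : ∀ (c : ℕ → Letters) (T : JTree) (L L' : List (ℕ × ℕ)), L.length = r → (ends L).Nodup →
    L.Perm L' → chordValue s c L T = chordValue s c L' T
  flip : ∀ (c : ℕ → Letters) (T : JTree) (L₁ L₂ : List (ℕ × ℕ)) (e : ℕ × ℕ),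
    (L₁ ++ e :: L₂).length = r → (ends (L₁ ++ e :: L₂)).Nodup →
    chordValue s c (L₁ ++ e.swap :: L₂) T = -chordValue s c (L₁ ++ e :: L₂) T

/-- The functional that evaluates graphs that consist of a single tree with `r` dotted edges. -/
def chordGraph (s : Letters →ₐ[ℚ] Letters) (r : ℕ) (X : Graph Letters) : ℚ :=
  match X.trees with
  | [T] => if X.dots.card = r then chordValue s X.color X.dots.toList T else 0
  | _ => 0

section

variable {s : Letters →ₐ[ℚ] Letters} {r : ℕ}

lemma chordGraph_single {T : JTree} {D : Finset (ℕ × ℕ)} {c : ℕ → Letters} :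
    chordGraph s r ⟨[T], D, c⟩ = if D.card = r then chordValue s c D.toList T else 0 := rfl

lemma chordGraph_eq (hs : IsChordMap s r) {T : JTree} {D : Finset (ℕ × ℕ)} {c : ℕ → Letters}
    {L : List (ℕ × ℕ)} (hD : IsMatching D) (hL : L.Nodup) (hLD : L.toFinset = D)
    (hr : L.length = r) : chordGraph s r ⟨[T], D, c⟩ = chordValue s c L T := by
  have hcard : D.card = r := by rw [← hLD, List.toFinset_card_of_nodup hL, hr]
  have hp : L.Perm D.toList :=
    (List.perm_ext_iff_of_nodup hL (Finset.nodup_toList D)).2 fun e => by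
      rw [Finset.mem_toList, ← hLD, List.mem_toFinset]
  rw [chordGraph_single, if_pos hcard]
  exact (hs.perm c T L _ hr (nodup_ends hL (hLD ▸ hD)) hp).symm

lemma chordGraph_eq_zero {l : List JTree} {D : Finset (ℕ × ℕ)} {c : ℕ → Letters}
    (h : l.length ≠ 1) : chordGraph s r ⟨l, D, c⟩ = 0 := by
  match l, h with
  | [], _ => rfl
  | _ :: _ :: _, _ => rfl

lemma chordGraph_linear {l : List JTree} {D : Finset (ℕ × ℕ)} {c : ℕ → Letters} {i : ℕ}
    (h : Graph.IsHairy ⟨l, D, c⟩) (hi : i ∈ Graph.hairs ⟨l, D, c⟩) :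
    ∃ φ : Letters →ₗ[ℚ] ℚ, ∀ x, chordGraph s r ⟨l, D, Function.update c i x⟩ = φ x := by
  match l, h, hi with
  | [], _, _ => exact ⟨0, fun _ => rfl⟩
  | _ :: _ :: _, _, _ => exact ⟨0, fun _ => rfl⟩
  | [T], h, hi =>
    by_cases hr : D.card = r
    · simp only [Graph.hairs, Graph.legs, List.flatMap_cons, List.flatMap_nil, List.append_nil,
        Finset.mem_sdiff, List.mem_toFinset] at hi
      have hnd : T.legs.Nodup := by simpa [Graph.legs] using h.nodup
      obtain ⟨φ, hφ⟩ := exists_treePairing_update loopFunctional (chordColor s c D.toList) hi.1 hnd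
      refine ⟨φ ∘ₗ s.toLinearMap, fun x => ?_⟩
      rw [chordGraph_single, if_pos hr, LinearMap.comp_apply, AlgHom.toLinearMap_apply, ← hφ, chordValue]
      congr 1
      have hiE : i ∉ ends D.toList := by rw [mem_ends, Finset.toList_toFinset]; exact hi.2
      funext j
      by_cases hj : j = i
      · subst hj; simp [chordColor, hiE]
      · simp [chordColor, hj]
    · exact ⟨0, fun x => by rw [chordGraph_single, if_neg hr]; rfl⟩

lemma chordGraph_tree {k : ℕ} (q : Fin k → ℚ) (T : Fin k → JTree) (l₁ l₂ : List JTree)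
    (D : Finset (ℕ × ℕ)) (c : ℕ → Letters)
    (h : ∀ d : ℕ → Letters, ∑ a, q a * treePairing loopFunctional d (T a) = 0) :
    ∑ a, q a * chordGraph s r ⟨l₁ ++ T a :: l₂, D, c⟩ = 0 := by
  by_cases hl : l₁ = [] ∧ l₂ = []
  · obtain ⟨rfl, rfl⟩ := hl
    simp only [List.nil_append]
    by_cases hr : D.card = r
    · simp only [chordGraph_single, if_pos hr]; exact h _
    · simp [chordGraph_single, if_neg hr]
  · refine Finset.sum_eq_zero fun a _ => ?_
    rw [chordGraph_eq_zero, mul_zero]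
    simp only [List.length_append, List.length_cons]
    intro h'
    exact hl ⟨List.length_eq_zero_iff.1 (by omega), List.length_eq_zero_iff.1 (by omega)⟩

lemma ends_map (σ : ℕ → ℕ) (L : List (ℕ × ℕ)) :
    ends (L.map (Prod.map σ σ)) = (ends L).map σ := by
  simp [ends, List.flatMap_map, List.map_flatMap]

lemma chordColor_relabel (c : ℕ → Letters) (L : List (ℕ × ℕ)) (σ : Equiv.Perm ℕ) :
    chordColor s (c ∘ σ.symm) (L.map (Prod.map σ σ)) ∘ σ = chordColor s c L := by
  funext i
  have hidx : ∀ l : List ℕ, (l.map σ).idxOf (σ i) = l.idxOf i := by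
    intro l
    induction l with
    | nil => rfl
    | cons a l ih =>
      rw [List.map_cons, List.idxOf_cons, List.idxOf_cons, ih]
      by_cases h : a = i
      · simp [h]
      · have : (a == i) = false := by simpa using h
        have h' : (σ a == σ i) = false := by simpa using h
        rw [this, h']
  simp [chordColor, ends_map, hidx]

lemma chordGraph_rel (hs : IsChordMap s r) (z : Graph Letters →₀ ℚ) (hz : Rel z) :
    Finsupp.linearCombination ℚ (chordGraph s r) z = 0 := by
  cases hz with
  | swap l₁ l₂ D c A B h =>
    have := chordGraph_tree (s := s) (r := r) ![1, -1] ![⟨A, B⟩, ⟨B, A⟩] l₁ l₂ D c fun d => by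
      have := (isTreeFun_treePairing loopFunctional_comm d).swap A B
      simp [this]
    simpa [sub_eq_add_neg] using this
  | rot l₁ l₂ D c A B C h =>
    have := chordGraph_tree (s := s) (r := r) ![1, -1] ![⟨.node A B, C⟩, ⟨A, .node B C⟩] l₁ l₂ D c
      fun d => by
        have := (isTreeFun_treePairing loopFunctional_comm d).rot A B C
        simp [this]
    simpa [sub_eq_add_neg] using this
  | antisymm l₁ l₂ D c A B C h =>
    have := chordGraph_tree (s := s) (r := r) ![1, 1] ![⟨.node A B, C⟩, ⟨.node B A, C⟩] l₁ l₂ D c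
      fun d => by
        have := (isTreeFun_treePairing loopFunctional_comm d).antisymm A B C
        simp [this]
    simpa using this
  | ihx l₁ l₂ D c A B C E h =>
    have := chordGraph_tree (s := s) (r := r) ![1, 1, 1] ![⟨.node (.node A B) C, E⟩,
      ⟨.node (.node B C) A, E⟩, ⟨.node (.node C A) B, E⟩] l₁ l₂ D c fun d => by
        have := (isTreeFun_treePairing loopFunctional_comm d).ihx A B C E
        simpa [Fin.sum_univ_three] using this
    simpa [Fin.sum_univ_three] using this
  | add l D c i x y h hi =>
    obtain ⟨φ, hφ⟩ := chordGraph_linear (s := s) (r := r) h hi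
    simp [hφ]
  | smul l D c i a x h hi =>
    obtain ⟨φ, hφ⟩ := chordGraph_linear (s := s) (r := r) h hi
    simp [hφ]
  | color l D c d h hcd =>
    simp only [map_sub, Finsupp.linearCombination_single, one_smul, sub_eq_zero]
    match l, h, hcd with
    | [], _, _ => rfl
    | _ :: _ :: _, _, _ => rfl
    | [T], h, hcd =>
      simp only [chordGraph]
      split_ifs with hr
      · refine treePairing_congr _ fun i hi => ?_
        unfold chordColor
        split_ifs with hiE
        · rfl
        · rw [hcd i]
          simp only [Graph.hairs, Graph.legs, List.flatMap_cons, List.flatMap_nil, List.append_nil,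
            Finset.mem_sdiff, List.mem_toFinset]
          rw [mem_ends, Finset.toList_toFinset] at hiE
          exact ⟨hi, hiE⟩
      · rfl
  | flip l D c e h he =>
    simp only [map_add, Finsupp.linearCombination_single, one_smul]
    match l, h with
    | [], _ => simp [chordGraph]
    | _ :: _ :: _, _ => simp [chordGraph]
    | [T], h =>
      by_cases hr : D.card = r
      · have hh := h.flip he
        obtain ⟨L₁, L₂, hL⟩ := List.append_of_mem (Finset.mem_toList.2 he)
        have hnd := Finset.nodup_toList D
        rw [hL] at hnd
        have hlen : (L₁ ++ e :: L₂).length = r := by rw [← hL, Finset.length_toList, hr]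
        have hfin : (L₁ ++ e :: L₂).toFinset = D := by rw [← hL, Finset.toList_toFinset]
        rw [chordGraph_eq hs h.matching hnd hfin hlen]
        have hmem : ∀ f, f ∈ L₁ ++ e :: L₂ ↔ f ∈ D := fun f => by rw [← hL, Finset.mem_toList]
        have hfin' : (L₁ ++ e.swap :: L₂).toFinset = insert e.swap (D.erase e) := by
          ext f
          have h1 := hmem f
          have h2 : f ∈ L₁ ++ L₂ → f ≠ e := by
            rintro h3 rfl
            have := List.nodup_middle.1 hnd
            exact (List.nodup_cons.1 this).1 h3
          simp only [List.mem_append, List.mem_cons] at h1 h2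
          simp only [List.mem_toFinset, List.mem_append, List.mem_cons, Finset.mem_insert,
            Finset.mem_erase, ← h1]
          tauto
        have hsw : e.swap ∉ L₁ ++ L₂ := by
          intro h3
          have h4 : e.swap ∈ D := (hmem _).1 (by
            simp only [List.mem_append, List.mem_cons] at h3 ⊢; tauto)
          have h5 : e.swap ≠ e := fun h6 => h.matching.1 e he (congrArg Prod.snd h6)
          exact (h.matching.2 _ h4 e he h5).2.1 rfl
        have hnd' : (L₁ ++ e.swap :: L₂).Nodup := by
          rw [List.nodup_middle, List.nodup_cons]
          exact ⟨hsw, (List.nodup_cons.1 (List.nodup_middle.1 hnd)).2⟩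
        rw [chordGraph_eq hs hh.matching hnd' hfin' (by simpa using hlen),
          hs.flip c T L₁ L₂ e hlen (nodup_ends hnd (hfin ▸ h.matching)), add_neg_cancel]
      · have hr' : (insert e.swap (D.erase e)).card ≠ r := by
          rw [Finset.card_insert_of_notMem, Finset.card_erase_add_one he]
          · exact hr
          · intro h1
            have h2 := Finset.mem_erase.1 h1
            exact (h.matching.2 _ h2.2 e he h2.1).2.1 rfl
        simp [chordGraph, hr, hr']
  | relabel σ X h =>
    simp only [map_sub, Finsupp.linearCombination_single, one_smul, sub_eq_zero]
    obtain ⟨l, D, c⟩ := X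
    match l, h with
    | [], _ => rfl
    | _ :: _ :: _, _ => rfl
    | [T], h =>
      have hinj := (σ.injective.prodMap σ.injective)
      have hcard : (D.image (Prod.map σ σ)).card = D.card := Finset.card_image_of_injective _ hinj
      by_cases hr : D.card = r
      · have hh := Graph.isHairy_relabel σ h
        have hm := hh.matching
        simp only [Graph.relabel, List.map_cons, List.map_nil] at hm ⊢
        rw [chordGraph_eq hs hm (L := D.toList.map (Prod.map σ σ))
          ((Finset.nodup_toList D).map hinj) (by
            ext f; simp [List.mem_toFinset]) (by simp [hr])]
        rw [chordGraph_single, if_pos hr, chordValue, chordValue, treePairing_map, chordColor_relabel]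
      · simp [chordGraph, Graph.relabel, hcard, hr]

/-- The functional on the space of hairy Lie graphs that evaluates trees with `r` dotted edges. -/
def chordFunctional (hs : IsChordMap s r) : HLG Letters →ₗ[ℚ] ℚ :=
  lift (chordGraph s r) (chordGraph_rel hs)

@[simp] lemma chordFunctional_of (hs : IsChordMap s r) (X : Graph Letters) :
    chordFunctional hs (of X) = chordGraph s r X := lift_of _ _ _

end

/-! ### Removing the last tripod -/

section

variable {H : Type*} [AddCommGroup H] [Module ℚ H]

lemma IsHairy.of_append {l l' : List JTree} {D E : Finset (ℕ × ℕ)} {c : ℕ → H} (d : ℕ → H)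
    (h : Graph.IsHairy ⟨l ++ l', D ∪ E, c⟩)
    (hD : ∀ i ∈ endpoints D, i ∉ l'.flatMap JTree.legs) : Graph.IsHairy ⟨l, D, d⟩ := by
  refine ⟨?_, fun T hT => h.tri T (List.mem_append_left _ hT),
    h.matching.mono Finset.subset_union_left, fun i hi => ?_⟩
  · have := h.nodup
    simp only [Graph.legs, List.flatMap_append] at this
    exact this.of_append_left
  · have := endpoints_subset_legs h (endpoints_mono Finset.subset_union_left hi)
    rw [List.flatMap_append, List.mem_append] at this
    exact List.mem_toFinset.2 (this.resolve_right (hD i hi))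

/-- If the functional `Φ'` on graphs without the last tree `U` describes the effect of `Φ ∘ β` in
the case of one further tree, then it does so for any number of further trees. -/
lemma beta_pow_transfer {Φ Φ' : HLG H →ₗ[ℚ] ℚ} {U : JTree} {E : Finset (ℕ × ℕ)} {c c' : ℕ → H}
    (hE : ∀ e ∈ E, e.2 ∈ U.legs)
    (h0 : ∀ T D, Graph.IsHairy ⟨[T, U], D ∪ E, c⟩ → (∀ i ∈ endpoints D, i ∉ U.legs) →
      Φ (beta (of ⟨[T, U], D ∪ E, c⟩)) = Φ' (of ⟨[T], D, c'⟩)) (n : ℕ) :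
    ∀ l D, l.length = n + 1 → Graph.IsHairy ⟨l ++ [U], D ∪ E, c⟩ →
      (∀ i ∈ endpoints D, i ∉ U.legs) →
      Φ ((beta ^ (n + 1)) (of ⟨l ++ [U], D ∪ E, c⟩)) = Φ' ((beta ^ n) (of ⟨l, D, c'⟩)) := by
  induction n with
  | zero =>
    intro l D hl h hD
    obtain ⟨T, rfl⟩ := List.length_eq_one_iff.1 hl
    simpa using h0 T D h hD
  | succ n ih =>
    intro l D hl h hD
    obtain ⟨T, V, l, rfl⟩ : ∃ T V l', l = T :: V :: l' := by
      match l, hl with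
      | T :: V :: l, _ => exact ⟨T, V, l, rfl⟩
    have hnd := h.nodup
    simp only [Graph.legs, List.cons_append, List.flatMap_cons, List.flatMap_append,
      List.flatMap_nil, List.append_nil, List.nodup_append, List.mem_append] at hnd
    have hTU : ∀ i ∈ U.legs, i ∉ T.legs ∧ i ∉ V.legs := fun i hi =>
      ⟨fun h' => hnd.2.2 i h' i (.inr (.inr hi)) rfl,
        fun h' => hnd.2.1.2.2 i h' i (.inr hi) rfl⟩
    have hpow : ∀ (m : ℕ) (x : HLG H), (beta ^ (m + 1)) x = (beta ^ m) (beta x) := fun m x => by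
      rw [pow_succ, Module.End.mul_apply]
    rw [hpow (n + 1), hpow n (of _), beta_of, beta_of,
      List.cons_append, List.cons_append, betaGraph_cons, betaGraph_cons, map_sum, map_sum, map_sum,
      map_sum, ← Finset.sum_subset Finset.subset_union_left]
    · refine Finset.sum_congr rfl fun e he => ?_
      have he1 := hD e.1 (mem_endpoints.2 ⟨e, he, .inl rfl⟩)
      have he2 := hD e.2 (mem_endpoints.2 ⟨e, he, .inr rfl⟩)
      have heE : e ∉ E := fun h' => he2 (hE e h')
      have hD' : ∀ i ∈ endpoints (D.erase e), i ∉ U.legs := fun i hi =>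
        hD i (endpoints_mono (Finset.erase_subset _ _) hi)
      have hun : (D ∪ E).erase e = D.erase e ∪ E := by
        rw [Finset.erase_union_distrib, Finset.erase_eq_of_notMem heE]
      have heU : e ∈ D ∪ E := Finset.mem_union_left _ he
      unfold betaTerm
      split_ifs with h1 h2
      · have := (Graph.IsHairy.join h heU h1.1 h1.2 (.inl rfl)).1
        rw [hun] at this ⊢
        exact ih (_ :: l) _ (by simpa using hl) this hD'
      · have := (Graph.IsHairy.join h heU h2.2 h2.1 (.inr rfl)).1
        rw [hun] at this ⊢
        simp only [map_neg, neg_inj]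
        exact ih (_ :: l) _ (by simpa using hl) this hD'
      · simp
    · intro e _ he'
      have heE : e ∈ E := by simp_all
      have := hTU _ (hE e heE)
      rw [show e = (e.1, e.2) from rfl, betaTerm_eq_zero (fun h' => this.2 h'.2)
        (fun h' => this.1 h'.2)]
      simp

/-- Only the dotted edges on the second tree contribute to `β`. -/
lemma beta_pair {T U : JTree} {D E : Finset (ℕ × ℕ)} {c : ℕ → H}
    (hD : ∀ i ∈ endpoints D, i ∉ U.legs) :
    beta (of ⟨[T, U], D ∪ E, c⟩) = ∑ e ∈ E, betaTerm T U [] (D ∪ E) c e := by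
  rw [beta_of, betaGraph_cons]
  refine (Finset.sum_subset Finset.subset_union_right fun e he he' => ?_).symm
  have heD : e ∈ D := (Finset.mem_union.1 he).resolve_right he'
  exact betaTerm_eq_zero (i := e.1) (j := e.2)
    (fun h => hD _ (mem_endpoints.2 ⟨e, heD, .inr rfl⟩) h.2)
    (fun h => hD _ (mem_endpoints.2 ⟨e, heD, .inl rfl⟩) h.1)

/-- Orienting a dotted edge towards its endpoint `u`. -/
lemma vanish_of_oriented {f : HLG H →ₗ[ℚ] ℚ} {l : List JTree} {c : ℕ → H} {D E : Finset (ℕ × ℕ)}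
    {u : ℕ} (h : Graph.IsHairy ⟨l, D ∪ E, c⟩) (hDE : Disjoint D E) (hu : u ∈ endpoints D)
    (H' : ∀ i D', i ∈ endpoints D → i ≠ u → endpoints D' = endpoints D \ {i, u} →
      Disjoint D' (insert (i, u) E) → Graph.IsHairy ⟨l, D' ∪ insert (i, u) E, c⟩ →
      f (of ⟨l, D' ∪ insert (i, u) E, c⟩) = 0) : f (of ⟨l, D ∪ E, c⟩) = 0 := by
  obtain ⟨e, he, hue⟩ := mem_endpoints.1 hu
  have hm : IsMatching D := h.matching.mono Finset.subset_union_left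
  have hne := hm.1 e he
  have heE : e ∉ E := Finset.disjoint_left.1 hDE he
  have hun : (D ∪ E).erase e = D.erase e ∪ E := by
    rw [Finset.erase_union_distrib, Finset.erase_eq_of_notMem heE]
  have hdisj : ∀ a : ℕ × ℕ, a ∉ D.erase e → Disjoint (D.erase e) (insert a E) := fun a ha => by
    rw [Finset.disjoint_insert_right]
    exact ⟨ha, hDE.mono_left (Finset.erase_subset _ _)⟩
  have hmem : ∀ a, D.erase e ∪ insert a E = insert a ((D ∪ E).erase e) := fun a => by
    rw [Finset.union_insert, hun]
  rcases hue with rfl | rfl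
  · have hsw : e.swap ∉ D.erase e := fun h1 => by
      have h2 := Finset.mem_erase.1 h1
      exact (hm.2 _ h2.2 e he h2.1).2.1 rfl
    have := H' e.2 (D.erase e) (mem_endpoints.2 ⟨e, he, .inr rfl⟩) hne.symm
      (by rw [endpoints_erase hm he, Finset.pair_comm]) (hdisj _ hsw)
    rw [hmem] at this
    have hf := of_flip h (Finset.mem_union_left E he)
    have := this (h.flip (Finset.mem_union_left _ he))
    rw [← Prod.swap, hf, map_neg, neg_eq_zero] at this
    exact this
  · have := H' e.1 (D.erase e) (mem_endpoints.2 ⟨e, he, .inl rfl⟩) hne (endpoints_erase hm he)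
      (hdisj _ (Finset.notMem_erase _ _))
    rw [hmem, show (e.1, e.2) = e from rfl, Finset.insert_erase (Finset.mem_union_left _ he)] at this
    exact this h

/-- Reversing a dotted edge. -/
lemma vanish_of_flip {f : HLG H →ₗ[ℚ] ℚ} {l : List JTree} {c : ℕ → H} {D E : Finset (ℕ × ℕ)}
    {i u : ℕ} (h : Graph.IsHairy ⟨l, D ∪ insert (i, u) E, c⟩) (hd : Disjoint D (insert (i, u) E))
    (hE : (i, u) ∉ E)
    (H' : Disjoint D (insert (u, i) E) → Graph.IsHairy ⟨l, D ∪ insert (u, i) E, c⟩ →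
      f (of ⟨l, D ∪ insert (u, i) E, c⟩) = 0) : f (of ⟨l, D ∪ insert (i, u) E, c⟩) = 0 := by
  rw [Finset.disjoint_insert_right] at hd
  have he : (i, u) ∈ D ∪ insert (i, u) E := by simp
  have hsw : (u, i) ∉ D ∪ insert (i, u) E := h.matching.swap_notMem he
  have heq : insert (i, u).swap ((D ∪ insert (i, u) E).erase (i, u)) = D ∪ insert (u, i) E := by
    rw [Finset.union_insert, Finset.union_insert, Finset.erase_insert (by simp [hd.1, hE])]
    rfl
  have hfl := of_flip h he
  have hh := h.flip he
  rw [heq] at hfl hh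
  have := H' (Finset.disjoint_insert_right.2
    ⟨fun h' => hsw (Finset.mem_union_left _ h'), hd.2⟩) hh
  rwa [hfl, map_neg, neg_eq_zero] at this

lemma isHairy_tripod_rot {l : List JTree} {x y z : ℕ} {D : Finset (ℕ × ℕ)} {c : ℕ → H}
    (h : Graph.IsHairy ⟨l ++ [tripod x y z], D, c⟩) :
    Graph.IsHairy ⟨l ++ [tripod y z x], D, c⟩ ∧
      of ⟨l ++ [tripod x y z], D, c⟩ = of ⟨l ++ [tripod y z x], D, c⟩ := by
  have h1 : Graph.IsHairy ⟨l ++ [⟨.leaf x, .node (.leaf y) (.leaf z)⟩], D, c⟩ :=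
    h.replace (l₁ := l) (l₂ := []) (T := tripod x y z) (List.Perm.refl _) (by simp [tripod, JTree.numTri, RTree.numTri])
  have h2 : Graph.IsHairy ⟨l ++ [tripod y z x], D, c⟩ :=
    h1.replace (l₁ := l) (l₂ := []) (by
      simp only [JTree.legs, tripod, RTree.legs]; exact List.perm_append_comm)
      (by simp [tripod, JTree.numTri, RTree.numTri])
  exact ⟨h2, (of_rot (l₁ := l) (l₂ := []) h).trans (of_swap (l₁ := l) (l₂ := []) h1)⟩

lemma nodup_of_isHairy_tripod {l : List JTree} {x y z : ℕ} {D : Finset (ℕ × ℕ)} {c : ℕ → H}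
    (h : Graph.IsHairy ⟨l ++ [tripod x y z], D, c⟩) : x ≠ y ∧ x ≠ z ∧ y ≠ z := by
  have := h.nodup
  simp only [Graph.legs, List.flatMap_append, List.nodup_append] at this
  have := this.2.1
  simp at this
  tauto

/-- The normal forms of the set `E` of the dotted edges at a tripod with the leaves `x`, `y`, `z`. -/
def IsTripodLink (x y z : ℕ) (E : Finset (ℕ × ℕ)) : Prop :=
  E = ∅ ∨ E = {(y, z)} ∨ (∃ i, i ∉ [x, y, z] ∧ E = {(i, x)}) ∨
    (∃ i, i ∉ [x, y, z] ∧ E = {(i, x), (y, z)}) ∨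
    (∃ i j, i ∉ [x, y, z] ∧ j ∉ [x, y, z] ∧ E = {(i, x), (j, y)}) ∨
    ∃ i j k, i ∉ [x, y, z] ∧ j ∉ [x, y, z] ∧ k ∉ [x, y, z] ∧ E = {(i, x), (j, y), (k, z)}

/-- A functional vanishes on the graphs whose last tree is a tripod if it does so on those in which
the dotted edges at the tripod are in a normal form. -/
lemma vanish_of_tripod {f : HLG H →ₗ[ℚ] ℚ} {l : List JTree} {c : ℕ → H}
    (hf : ∀ x y z D E, Graph.IsHairy ⟨l ++ [tripod x y z], D ∪ E, c⟩ →
      (∀ i ∈ endpoints D, i ∉ [x, y, z]) → Disjoint D E →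
      IsTripodLink x y z E → f (of ⟨l ++ [tripod x y z], D ∪ E, c⟩) = 0)
    {U : JTree} {D : Finset (ℕ × ℕ)} (hU : U.numTri = 1) (h : Graph.IsHairy ⟨l ++ [U], D, c⟩) :
    f (of ⟨l ++ [U], D, c⟩) = 0 := by
  have hp : ∀ {i x y z : ℕ}, i ∉ [x, y, z] → i ∉ [y, z, x] := fun {i x y z} => by
    simp only [List.mem_cons, List.not_mem_nil, or_false]; tauto
  have hrot : ∀ x y z D E, Graph.IsHairy ⟨l ++ [tripod x y z], D ∪ E, c⟩ →
      (∀ i ∈ endpoints D, i ∉ [x, y, z]) → Disjoint D E →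
      IsTripodLink y z x E → f (of ⟨l ++ [tripod x y z], D ∪ E, c⟩) = 0 := by
    intro x y z D E h hD hdis hE
    obtain ⟨h', he⟩ := isHairy_tripod_rot h
    rw [he]
    exact hf y z x D E h' (fun i hi => hp (hD i hi)) hdis hE
  have hrot' : ∀ x y z D E, Graph.IsHairy ⟨l ++ [tripod x y z], D ∪ E, c⟩ →
      (∀ i ∈ endpoints D, i ∉ [x, y, z]) → Disjoint D E →
      IsTripodLink z x y E → f (of ⟨l ++ [tripod x y z], D ∪ E, c⟩) = 0 := by
    intro x y z D E h hD hdis hE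
    obtain ⟨h', he⟩ := isHairy_tripod_rot h
    rw [he]
    exact hrot y z x D E h' (fun i hi => hp (hD i hi)) hdis hE
  have hmain : ∀ x y z D, Graph.IsHairy ⟨l ++ [tripod x y z], D, c⟩ →
      f (of ⟨l ++ [tripod x y z], D, c⟩) = 0 := by
    intro x y z D h
    obtain ⟨hxy, hxz, hyz⟩ := nodup_of_isHairy_tripod h
    have hun : D = D ∪ ∅ := (Finset.union_empty D).symm
    have hnot : ∀ {D' : Finset (ℕ × ℕ)}, x ∉ endpoints D' →
        y ∉ endpoints D' → z ∉ endpoints D' → ∀ i ∈ endpoints D', i ∉ [x, y, z] := by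
      intro D' h1 h2 h3 i hi hi'
      simp only [List.mem_cons, List.not_mem_nil, or_false] at hi'
      rcases hi' with rfl | rfl | rfl
      exacts [h1 hi, h2 hi, h3 hi]
    have hout : ∀ {i x y z : ℕ}, i ≠ x → i ≠ y → i ≠ z → i ∉ [x, y, z] := fun h1 h2 h3 => by
      simp [h1, h2, h3]
    have hs : ∀ e : ℕ × ℕ, insert e ∅ = ({e} : Finset (ℕ × ℕ)) := fun e => rfl
    rw [hun] at h ⊢
    by_cases hx : x ∈ endpoints D
    · refine vanish_of_oriented h (Finset.disjoint_empty_right _) hx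
        fun i D₁ hi hix he₁ hd₁ h₁ => ?_
      by_cases hiy : i = y
      · subst hiy
        refine vanish_of_flip h₁ hd₁ (by simp) fun hd₁ h₁ => ?_
        by_cases hz : z ∈ endpoints D₁
        · refine vanish_of_oriented h₁ hd₁ hz fun j D₂ hj hjz he₂ hd₂ h₂ => ?_
          simp only [he₁, Finset.mem_sdiff, Finset.mem_insert, Finset.mem_singleton, not_or] at hj
          exact hrot' x i z D₂ _ h₂ (hnot (by simp [he₁, he₂]) (by simp [he₁, he₂])
            (by simp [he₁, he₂])) hd₂ (.inr (.inr (.inr (.inl ⟨j, hout hjz hj.2.2 hj.2.1, rfl⟩))))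
        · exact hrot' x i z D₁ _ h₁ (hnot (by simp [he₁]) (by simp [he₁]) hz) hd₁ (.inr (.inl rfl))
      by_cases hiz : i = z
      · subst hiz
        by_cases hy : y ∈ endpoints D₁
        · refine vanish_of_oriented h₁ hd₁ hy fun j D₂ hj hjy he₂ hd₂ h₂ => ?_
          simp only [he₁, Finset.mem_sdiff, Finset.mem_insert, Finset.mem_singleton, not_or] at hj
          exact hrot x y i D₂ _ h₂ (hnot (by simp [he₁, he₂]) (by simp [he₁, he₂])
            (by simp [he₁, he₂])) hd₂ (.inr (.inr (.inr (.inl ⟨j, hout hjy hj.2.1 hj.2.2, rfl⟩))))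
        · exact hrot x y i D₁ _ h₁ (hnot (by simp [he₁]) hy (by simp [he₁])) hd₁ (.inr (.inl rfl))
      by_cases hy : y ∈ endpoints D₁
      · refine vanish_of_oriented h₁ hd₁ hy fun j D₂ hj hjy he₂ hd₂ h₂ => ?_
        have hj' := hj
        simp only [he₁, Finset.mem_sdiff, Finset.mem_insert, Finset.mem_singleton, not_or] at hj'
        by_cases hjz : j = z
        · subst hjz
          refine vanish_of_flip h₂ hd₂ (by simp [hxy.symm]) fun hd₂ h₂ => ?_
          exact hf x y j D₂ _ h₂ (hnot (by simp [he₁, he₂]) (by simp [he₁, he₂])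
            (by simp [he₁, he₂])) hd₂ (.inr (.inr (.inr (.inl
              ⟨i, hout hix hiy hiz, Finset.pair_comm _ _⟩))))
        by_cases hz : z ∈ endpoints D₂
        · refine vanish_of_oriented h₂ hd₂ hz fun k D₃ hk hkz he₃ hd₃ h₃ => ?_
          simp only [he₂, he₁, Finset.mem_sdiff, Finset.mem_insert, Finset.mem_singleton,
            not_or] at hk
          refine hf x y z D₃ _ h₃ (hnot (by simp [he₁, he₂, he₃]) (by simp [he₁, he₂, he₃])
            (by simp [he₁, he₂, he₃])) hd₃ (.inr (.inr (.inr (.inr (.inr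
              ⟨i, j, k, hout hix hiy hiz, hout hj'.2.2 hjy hjz, hout hk.1.2.2 hk.2.2 hkz, ?_⟩)))))
          ext e
          simp only [Finset.mem_insert, Finset.mem_singleton, hs]
          tauto
        · exact hf x y z D₂ _ h₂ (hnot (by simp [he₁, he₂]) (by simp [he₁, he₂]) hz) hd₂
            (.inr (.inr (.inr (.inr (.inl ⟨i, j, hout hix hiy hiz, hout hj'.2.2 hjy hjz,
              Finset.pair_comm _ _⟩)))))
      · by_cases hz : z ∈ endpoints D₁
        · refine vanish_of_oriented h₁ hd₁ hz fun k D₂ hk hkz he₂ hd₂ h₂ => ?_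
          have hky : k ≠ y := fun h' => hy (h' ▸ hk)
          simp only [he₁, Finset.mem_sdiff, Finset.mem_insert, Finset.mem_singleton, not_or] at hk
          exact hrot' x y z D₂ _ h₂ (hnot (by simp [he₁, he₂]) (by simp [he₂, hy])
            (by simp [he₁, he₂])) hd₂ (.inr (.inr (.inr (.inr (.inl
              ⟨k, i, hout hkz hk.2.2 hky, hout hiz hix hiy, rfl⟩)))))
        · exact hf x y z D₁ _ h₁ (hnot (by simp [he₁]) hy hz) hd₁
            (.inr (.inr (.inl ⟨i, hout hix hiy hiz, rfl⟩)))
    · by_cases hy : y ∈ endpoints D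
      · refine vanish_of_oriented h (Finset.disjoint_empty_right _) hy
          fun i D₁ hi hiy he₁ hd₁ h₁ => ?_
        have hix : i ≠ x := fun h' => hx (h' ▸ hi)
        by_cases hiz : i = z
        · subst hiz
          refine vanish_of_flip h₁ hd₁ (by simp) fun hd₁ h₁ => ?_
          exact hf x y i D₁ _ h₁ (hnot (by simp [he₁, hx]) (by simp [he₁]) (by simp [he₁])) hd₁
            (.inr (.inl rfl))
        by_cases hz : z ∈ endpoints D₁
        · refine vanish_of_oriented h₁ hd₁ hz fun k D₂ hk hkz he₂ hd₂ h₂ => ?_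
          simp only [he₁, Finset.mem_sdiff, Finset.mem_insert, Finset.mem_singleton, not_or] at hk
          have hkx : k ≠ x := fun h' => hx (h' ▸ hk.1)
          exact hrot x y z D₂ _ h₂ (hnot (by simp [he₁, he₂, hx]) (by simp [he₁, he₂])
            (by simp [he₁, he₂])) hd₂ (.inr (.inr (.inr (.inr (.inl
              ⟨i, k, hout hiy hiz hix, hout hk.2.2 hkz hkx, Finset.pair_comm _ _⟩)))))
        · exact hrot x y z D₁ _ h₁ (hnot (by simp [he₁, hx]) (by simp [he₁]) hz) hd₁
            (.inr (.inr (.inl ⟨i, hout hiy hiz hix, rfl⟩)))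
      · by_cases hz : z ∈ endpoints D
        · refine vanish_of_oriented h (Finset.disjoint_empty_right _) hz
            fun i D₁ hi hiz he₁ hd₁ h₁ => ?_
          have hix : i ≠ x := fun h' => hx (h' ▸ hi)
          have hiy : i ≠ y := fun h' => hy (h' ▸ hi)
          exact hrot' x y z D₁ _ h₁ (hnot (by simp [he₁, hx]) (by simp [he₁, hy]) (by simp [he₁]))
            hd₁ (.inr (.inr (.inl ⟨i, hout hiz hix hiy, rfl⟩)))
        · exact hf x y z D _ h (hnot hx hy hz) (Finset.disjoint_empty_right _) (.inl rfl)
  obtain ⟨A, B⟩ := U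
  have hcases : (∃ x y z, A = .node (.leaf x) (.leaf y) ∧ B = .leaf z) ∨
      ∃ x y z, B = .node (.leaf x) (.leaf y) ∧ A = .leaf z := by
    have hleaf : ∀ S : RTree, S.numTri = 0 → ∃ x, S = .leaf x := fun S hS => by
      cases S with
      | leaf x => exact ⟨x, rfl⟩
      | node S T => simp [RTree.numTri] at hS
    have hnode : ∀ S : RTree, S.numTri = 1 → ∃ x y, S = .node (.leaf x) (.leaf y) := fun S hS => by
      cases S with
      | leaf x => simp [RTree.numTri] at hS
      | node S T =>
        simp only [RTree.numTri] at hS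
        obtain ⟨x, rfl⟩ := hleaf S (by omega)
        obtain ⟨y, rfl⟩ := hleaf T (by omega)
        exact ⟨x, y, rfl⟩
    simp only [JTree.numTri] at hU
    rcases Nat.eq_zero_or_pos B.numTri with hB | hB
    · obtain ⟨x, y, rfl⟩ := hnode A (by omega)
      obtain ⟨z, rfl⟩ := hleaf B hB
      exact .inl ⟨x, y, z, rfl, rfl⟩
    · obtain ⟨x, y, rfl⟩ := hnode B (by omega)
      obtain ⟨z, rfl⟩ := hleaf A (by omega)
      exact .inr ⟨x, y, z, rfl, rfl⟩
  rcases hcases with ⟨x, y, z, rfl, rfl⟩ | ⟨x, y, z, rfl, rfl⟩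
  · exact hmain x y z D h
  · rw [of_swap (l₁ := l) (l₂ := []) h]
    exact hmain x y z D (h.replace (l₁ := l) (l₂ := []) List.perm_append_comm (add_comm _ _))

end

/-! ### Adjoint actions of the free algebra -/

/-- The elements of the free Lie algebra inside the free algebra. -/
inductive IsLie : Letters → Prop
  | zero : IsLie 0
  | letter (n : ℕ) : IsLie (letter n)
  | add {x y : Letters} : IsLie x → IsLie y → IsLie (x + y)
  | smul (a : ℚ) {x : Letters} : IsLie x → IsLie (a • x)
  | bracket {x y : Letters} : IsLie x → IsLie y → IsLie (x * y - y * x)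

lemma isLie_lie {c : ℕ → Letters} (hc : ∀ i, IsLie (c i)) (S : RTree) : IsLie (S.lie c) := by
  induction S with
  | leaf i => exact hc i
  | node S T ihS ihT => exact ihS.bracket ihT

lemma IsLie.map {φ : Letters →ₐ[ℚ] Letters} (hφ : ∀ n, IsLie (φ (HairyLie.letter n)))
    {x : Letters} (hx : IsLie x) : IsLie (φ x) := by
  induction hx with
  | zero => rw [map_zero]; exact .zero
  | letter n => exact hφ n
  | add _ _ hx hy => rw [map_add]; exact hx.add hy
  | smul a _ hx => rw [map_smul]; exact hx.smul a
  | bracket _ _ hx hy => rw [map_sub, map_mul, map_mul]; exact hx.bracket hy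

lemma algHom_ext_letter {A : Type*} [Semiring A] [Algebra ℚ A] {φ ψ : Letters →ₐ[ℚ] A}
    (h : ∀ n, φ (letter n) = ψ (letter n)) : φ = ψ := FreeAlgebra.hom_ext (funext h)

/-- The right action of the free algebra on itself in which a letter `n` acts by the commutator with
`s n` on the right. -/
def rad (s : Letters →ₐ[ℚ] Letters) : Letters →ₐ[ℚ] (Module.End ℚ Letters)ᵐᵒᵖ :=
  FreeAlgebra.lift ℚ fun n =>
    .op (LinearMap.mulRight ℚ (s (letter n)) - LinearMap.mulLeft ℚ (s (letter n)))

/-- The right adjoint action, as a bilinear map. -/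
def radL (s : Letters →ₐ[ℚ] Letters) : Letters →ₗ[ℚ] Letters →ₗ[ℚ] Letters :=
  (MulOpposite.opLinearEquiv ℚ).symm.toLinearMap ∘ₗ (rad s).toLinearMap

/-- The left action of the free algebra on itself in which a letter `n` acts by the commutator with
`s n` on the left. -/
def lad (s : Letters →ₐ[ℚ] Letters) : Letters →ₐ[ℚ] Module.End ℚ Letters :=
  FreeAlgebra.lift ℚ fun n =>
    LinearMap.mulLeft ℚ (s (letter n)) - LinearMap.mulRight ℚ (s (letter n))

section

variable (s : Letters →ₐ[ℚ] Letters)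

lemma radL_letter (n : ℕ) (y : Letters) :
    radL s (letter n) y = y * s (letter n) - s (letter n) * y := by
  simp [radL, rad]

lemma radL_one (y : Letters) : radL s 1 y = y := by simp [radL]

lemma radL_mul (u v y : Letters) : radL s (u * v) y = radL s v (radL s u y) := by simp [radL]

lemma lad_letter (n : ℕ) (y : Letters) :
    lad s (letter n) y = s (letter n) * y - y * s (letter n) := by
  simp [lad]

lemma radL_of_isLie {x : Letters} (hx : IsLie x) (y : Letters) :
    radL s x y = y * s x - s x * y := by
  induction hx generalizing y with
  | zero => simp
  | letter n => exact radL_letter s n y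
  | add _ _ h h' => rw [map_add, LinearMap.add_apply, h, h', map_add]; noncomm_ring
  | smul a _ h =>
    rw [map_smul, LinearMap.smul_apply, h, map_smul, smul_sub, mul_smul_comm, smul_mul_assoc]
  | bracket _ _ h h' =>
    rw [map_sub, LinearMap.sub_apply, radL_mul, radL_mul, h, h', h, h', map_sub, map_mul, map_mul]
    noncomm_ring

lemma lad_of_isLie {x : Letters} (hx : IsLie x) (y : Letters) :
    lad s x y = s x * y - y * s x := by
  induction hx generalizing y with
  | zero => simp
  | letter n => exact lad_letter s n y
  | add _ _ h h' => rw [map_add, LinearMap.add_apply, h, h', map_add]; noncomm_ring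
  | smul a _ h =>
    rw [map_smul, LinearMap.smul_apply, h, map_smul, smul_sub, mul_smul_comm, smul_mul_assoc]
  | bracket _ _ h h' =>
    rw [map_sub, LinearMap.sub_apply, map_mul, map_mul, Module.End.mul_apply, Module.End.mul_apply,
      h, h', h, h', map_sub, map_mul, map_mul]
    noncomm_ring

lemma radL_prod {L : List Letters} (hL : ∀ x ∈ L, IsLie x) (y : Letters) :
    radL s L.prod y = adList (L.map s) y := by
  induction L generalizing y with
  | nil => simp [radL_one, adList]
  | cons x L ih =>
    rw [List.prod_cons, radL_mul, ih fun z hz => hL z (by simp [hz]),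
      radL_of_isLie s (hL x (by simp)), List.map_cons, adList_cons]

lemma radL_monomial (u : List ℕ) (y : Letters) :
    radL s (monomial u) y = adList (u.map fun n => s (letter n)) y := by
  rw [monomial, radL_prod]
  · rw [List.map_map]; rfl
  · intro x hx
    obtain ⟨n, -, rfl⟩ := List.mem_map.1 hx
    exact .letter n

lemma lad_monomial (u : List ℕ) (y : Letters) :
    lad s (monomial u) y = (-1 : ℚ) ^ u.length • adList (u.reverse.map fun n => s (letter n)) y := by
  induction u with
  | nil => simp [monomial, adList]
  | cons n u ih =>
    rw [monomial_cons, map_mul, Module.End.mul_apply, ih, lad_letter, List.reverse_cons,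
      List.map_append, adList_append, List.map_singleton, adList_singleton, List.length_cons, pow_succ,
      mul_smul_comm, smul_mul_assoc, ← smul_sub, mul_neg_one, neg_smul, ← smul_neg, neg_sub]

lemma map_radL (φ : Letters →ₐ[ℚ] Letters) (u y : Letters) :
    φ (radL s u y) = radL (φ.comp s) u (φ y) := by
  have : φ.toLinearMap ∘ₗ (radL s).flip y = (radL (φ.comp s)).flip (φ y) := by
    refine linearMap_ext_monomial fun u => ?_
    have := map_adList (φ : Letters →+* Letters) (u.map fun n => s (letter n)) y
    simp only [LinearMap.comp_apply, LinearMap.flip_apply, radL_monomial, AlgHom.toLinearMap_apply]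
    simpa [Function.comp_def] using this
  exact LinearMap.congr_fun this u

lemma map_lad (φ : Letters →ₐ[ℚ] Letters) (u y : Letters) :
    φ (lad s u y) = lad (φ.comp s) u (φ y) := by
  have : φ.toLinearMap ∘ₗ (lad s).toLinearMap.flip y = (lad (φ.comp s)).toLinearMap.flip (φ y) := by
    refine linearMap_ext_monomial fun u => ?_
    have := map_adList (φ : Letters →+* Letters) (u.reverse.map fun n => s (letter n)) y
    simp only [LinearMap.comp_apply, LinearMap.flip_apply, lad_monomial, AlgHom.toLinearMap_apply,
      map_smul]
    congr 1
    simpa [Function.comp_def] using this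
  exact LinearMap.congr_fun this u

end

lemma adList_map_smul (u : List ℕ) (a : ℕ) (q : ℚ) (e : ℕ → Letters) (y : Letters) :
    adList (u.map fun n => (if n = a then q else 1) • e n) y = q ^ u.count a • adList (u.map e) y := by
  have hsm : ∀ (L : List Letters) (r : ℚ) (y : Letters), adList L (r • y) = r • adList L y := by
    intro L r
    induction L with
    | nil => intro y; rfl
    | cons x L ih =>
      intro y
      rw [adList_cons, adList_cons, smul_mul_assoc, mul_smul_comm, ← smul_sub, ih]
  induction u generalizing y with
  | nil => simp [adList]
  | cons n u ih =>
    rw [List.map_cons, List.map_cons, adList_cons, adList_cons, mul_smul_comm, smul_mul_assoc,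
      ← smul_sub, hsm, ih, List.count_cons, smul_smul]
    by_cases h : n = a
    · simp [h, pow_succ, mul_comm]
    · simp [h]

/-! ### The functional on words that is left after a tripod has been attached twice -/

/-- The algebra homomorphism that makes the letters into hairs. -/
def hairHom : Letters →ₐ[ℚ] Letters := relabelHom (· + 4)

/-- The first map that puts the attached tripod into the letters `0` and `1`. -/
def tripodHom₁ (h : Letters) : Letters →ₐ[ℚ] Letters :=
  FreeAlgebra.lift ℚ fun n =>
    match n with
    | 0 => radL hairHom h (letter 3)
    | 1 => letter 2
    | n + 2 => letter (n + 4)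

/-- The second map that puts the attached tripod into the letters `0` and `1`. -/
def tripodHom₂ (h : Letters) : Letters →ₐ[ℚ] Letters :=
  FreeAlgebra.lift ℚ fun n =>
    match n with
    | 0 => letter 2
    | 1 => lad hairHom h (letter 3)
    | n + 2 => letter (n + 4)

/-- The value of the two-loop functional on a loop with hairs. -/
def loopOf (s : Letters →ₐ[ℚ] Letters) : Letters →ₗ[ℚ] ℚ :=
  loopFunctional ∘ₗ LinearMap.mulRight ℚ (letter 1) ∘ₗ (radL s).flip (letter 0)

lemma loopOf_apply (s : Letters →ₐ[ℚ] Letters) (x : Letters) :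
    loopOf s x = loopFunctional (radL s x (letter 0) * letter 1) := rfl

/-- The value on a loop with hairs, to which a tripod is attached at the letters `0` and `1`. -/
def tripodLoop (h : Letters) : Letters →ₗ[ℚ] ℚ :=
  loopOf (tripodHom₁ h) + loopOf (tripodHom₂ h)

/-- Doubling the letter `k`, which detects the degree in this letter. -/
def scaleHom (k : ℕ) : Letters →ₐ[ℚ] Letters :=
  FreeAlgebra.lift ℚ fun n => (if n = k then (2 : ℚ) else 1) • letter n

lemma loopFunctional_scaleHom {k : ℕ} (hk : k < 8) (x : Letters) :
    loopFunctional (scaleHom k x) = 2 * loopFunctional x := by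
  refine wordFunctional_algHom (fun u => ?_) x
  have hu : ∀ u, scaleHom k (monomial u) = (2 : ℚ) ^ u.count k • monomial u := by
    intro u
    induction u with
    | nil => simp [monomial]
    | cons n u ih =>
      rw [monomial_cons, map_mul, ih, List.count_cons]
      have : scaleHom k (letter n) = (if n = k then (2 : ℚ) else 1) • letter n := by
        simp [scaleHom]
      rw [this, smul_mul_smul_comm]
      by_cases h : n = k
      · simp [h, pow_succ, mul_comm]
      · simp [h]
  rw [hu, map_smul, wordFunctional_monomial, smul_eq_mul]
  by_cases h : loopWord u = 0
  · simp [h]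
  · have hp := perm_of_loopWord_ne_zero h
    rw [hp.count_eq, List.count_range, if_pos hk, pow_one]

lemma loopOf_eq_zero {s : Letters →ₐ[ℚ] Letters} {k a : ℕ} (hk : k ∈ [2, 3])
    (hs : ∀ n, scaleHom k (s (letter n)) = (if n = a then (2 : ℚ) else 1) • s (letter n))
    {u : List ℕ} (hu : u.count a ≠ 1) : loopOf s (monomial u) = 0 := by
  have hk8 : k < 8 := by fin_cases hk <;> decide
  have hfix : ∀ i ∈ [0, 1], scaleHom k (letter i) = letter i := by
    intro i hi
    have : i ≠ k := by rintro rfl; fin_cases hk <;> simp at hi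
    simp [scaleHom, this]
  have h1 := loopFunctional_scaleHom hk8 (radL s (monomial u) (letter 0) * letter 1)
  rw [map_mul, map_radL, hfix 0 (by simp), hfix 1 (by simp), radL_monomial] at h1
  simp only [AlgHom.comp_apply, hs] at h1
  rw [adList_map_smul, smul_mul_assoc, map_smul, ← radL_monomial, ← loopOf_apply, smul_eq_mul] at h1
  have h2 : ((2 : ℚ) ^ u.count a - 2) * loopOf s (monomial u) = 0 := by linarith
  rcases mul_eq_zero.1 h2 with h3 | h3
  · exfalso
    rcases Nat.lt_or_gt_of_ne hu with h4 | h4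
    · have : u.count a = 0 := by omega
      rw [this] at h3; norm_num at h3
    · have : (2 : ℚ) ^ 2 ≤ 2 ^ u.count a := pow_le_pow_right₀ (by norm_num) h4
      linarith
  · exact h3

lemma hairHom_letter (n : ℕ) : hairHom (letter n) = letter (n + 4) := relabelHom_letter _ n

lemma tripodHom₁_zero (h : Letters) : tripodHom₁ h (letter 0) = radL hairHom h (letter 3) := by
  simp [tripodHom₁]

lemma tripodHom₁_one (h : Letters) : tripodHom₁ h (letter 1) = letter 2 := by simp [tripodHom₁]

lemma tripodHom₁_add_two (h : Letters) (n : ℕ) :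
    tripodHom₁ h (letter (n + 2)) = letter (n + 4) := by simp [tripodHom₁]

lemma tripodHom₂_zero (h : Letters) : tripodHom₂ h (letter 0) = letter 2 := by simp [tripodHom₂]

lemma tripodHom₂_one (h : Letters) : tripodHom₂ h (letter 1) = lad hairHom h (letter 3) := by
  simp [tripodHom₂]

lemma tripodHom₂_add_two (h : Letters) (n : ℕ) :
    tripodHom₂ h (letter (n + 2)) = letter (n + 4) := by simp [tripodHom₂]

lemma comp_hairHom {φ : Letters →ₐ[ℚ] Letters} (h : ∀ n, φ (letter (n + 4)) = letter (n + 4)) :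
    φ.comp hairHom = hairHom :=
  algHom_ext_letter fun n => by rw [AlgHom.comp_apply, hairHom_letter, h]

/-- A homomorphism acts on the images of the letters under `tripodHom₁` through the letters `2` and
`3`. -/
lemma map_tripodHom₁ {φ : Letters →ₐ[ℚ] Letters} (h : ∀ n, φ (letter (n + 4)) = letter (n + 4))
    {q : ℚ} {k a : ℕ} (hka : (k = 3 ∧ a = 0) ∨ (k = 2 ∧ a = 1))
    (h2 : φ (letter 2) = (if k = 2 then q else 1) • letter 2)
    (h3 : φ (letter 3) = (if k = 3 then q else 1) • letter 3) (x : Letters) (n : ℕ) :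
    φ (tripodHom₁ x (letter n)) = (if n = a then q else 1) • tripodHom₁ x (letter n) := by
  match n with
  | 0 =>
    rw [tripodHom₁_zero, map_radL, comp_hairHom h, h3, map_smul]
    rcases hka with ⟨rfl, rfl⟩ | ⟨rfl, rfl⟩ <;> simp
  | 1 => rw [tripodHom₁_one, h2]; rcases hka with ⟨rfl, rfl⟩ | ⟨rfl, rfl⟩ <;> simp
  | n + 2 =>
    rw [tripodHom₁_add_two, h, if_neg (by rcases hka with ⟨rfl, rfl⟩ | ⟨rfl, rfl⟩ <;> simp), one_smul]

/-- A homomorphism acts on the images of the letters under `tripodHom₂` through the letters `2` and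
`3`. -/
lemma map_tripodHom₂ {φ : Letters →ₐ[ℚ] Letters} (h : ∀ n, φ (letter (n + 4)) = letter (n + 4))
    {q : ℚ} {k a : ℕ} (hka : (k = 3 ∧ a = 1) ∨ (k = 2 ∧ a = 0))
    (h2 : φ (letter 2) = (if k = 2 then q else 1) • letter 2)
    (h3 : φ (letter 3) = (if k = 3 then q else 1) • letter 3) (x : Letters) (n : ℕ) :
    φ (tripodHom₂ x (letter n)) = (if n = a then q else 1) • tripodHom₂ x (letter n) := by
  match n with
  | 0 => rw [tripodHom₂_zero, h2]; rcases hka with ⟨rfl, rfl⟩ | ⟨rfl, rfl⟩ <;> simp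
  | 1 =>
    rw [tripodHom₂_one, map_lad, comp_hairHom h, h3, map_smul]
    rcases hka with ⟨rfl, rfl⟩ | ⟨rfl, rfl⟩ <;> simp
  | n + 2 =>
    rw [tripodHom₂_add_two, h, if_neg (by rcases hka with ⟨rfl, rfl⟩ | ⟨rfl, rfl⟩ <;> simp), one_smul]

lemma tripodLoop_eq_zero (h : Letters) {a : ℕ} (ha : a = 0 ∨ a = 1) {u : List ℕ}
    (hu : u.count a ≠ 1) : tripodLoop h (monomial u) = 0 := by
  have hs : ∀ k, k = 2 ∨ k = 3 → (∀ n, scaleHom k (letter (n + 4)) = letter (n + 4)) ∧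
      scaleHom k (letter 2) = (if k = 2 then (2 : ℚ) else 1) • letter 2 ∧
      scaleHom k (letter 3) = (if k = 3 then (2 : ℚ) else 1) • letter 3 := by
    rintro k (rfl | rfl) <;> simp [scaleHom]
  rw [tripodLoop, LinearMap.add_apply]
  rcases ha with rfl | rfl
  · obtain ⟨h1, h2, h3⟩ := hs 3 (.inr rfl)
    obtain ⟨h1', h2', h3'⟩ := hs 2 (.inl rfl)
    rw [loopOf_eq_zero (k := 3) (by simp) (map_tripodHom₁ h1 (.inl ⟨rfl, rfl⟩) h2 h3 h) hu,
      loopOf_eq_zero (k := 2) (by simp) (map_tripodHom₂ h1' (.inr ⟨rfl, rfl⟩) h2' h3' h) hu, add_zero]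
  · obtain ⟨h1, h2, h3⟩ := hs 3 (.inr rfl)
    obtain ⟨h1', h2', h3'⟩ := hs 2 (.inl rfl)
    rw [loopOf_eq_zero (k := 2) (by simp) (map_tripodHom₁ h1' (.inr ⟨rfl, rfl⟩) h2' h3' h) hu,
      loopOf_eq_zero (k := 3) (by simp) (map_tripodHom₂ h1 (.inl ⟨rfl, rfl⟩) h2 h3 h) hu, add_zero]

/-- The rooted trees that are inserted for the letters by `tripodHom₁ (monomial v)`. -/
def tripodTree₁ (v : List ℕ) (n : ℕ) : RTree :=
  match n with
  | 0 => (RTree.leaf 3).comb (v.map (· + 4))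
  | 1 => .leaf 2
  | n + 2 => .leaf (n + 4)

/-- The rooted trees that are inserted for the letters by `tripodHom₂ (monomial v)`, up to sign. -/
def tripodTree₂ (v : List ℕ) (n : ℕ) : RTree :=
  match n with
  | 0 => .leaf 2
  | 1 => (RTree.leaf 3).comb (v.map (· + 4)).reverse
  | n + 2 => .leaf (n + 4)

lemma tripodTree₁_lie (v : List ℕ) (n : ℕ) :
    (tripodTree₁ v n).lie letter = tripodHom₁ (monomial v) (letter n) := by
  match n with
  | 0 =>
    rw [tripodHom₁_zero, radL_monomial, tripodTree₁, RTree.lie_comb, List.map_map]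
    simp only [hairHom_letter]; rfl
  | 1 => rw [tripodHom₁_one]; rfl
  | n + 2 => rw [tripodHom₁_add_two]; rfl

lemma tripodTree₂_lie (v : List ℕ) (n : ℕ) : tripodHom₂ (monomial v) (letter n) =
    (if n = 1 then (-1 : ℚ) ^ v.length else 1) • (tripodTree₂ v n).lie letter := by
  match n with
  | 0 => rw [tripodHom₂_zero, if_neg (by simp), one_smul]; rfl
  | 1 =>
    rw [tripodHom₂_one, lad_monomial, tripodTree₂, RTree.lie_comb, if_pos rfl, ← List.map_reverse,
      List.map_map]
    simp only [hairHom_letter]; rfl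
  | n + 2 => rw [tripodHom₂_add_two, if_neg (by simp), one_smul]; rfl

lemma tripodLoop_monomial (v u : List ℕ) (hu : u.count 1 = 1) :
    tripodLoop (monomial v) (monomial u) =
      loopValue ⟨(RTree.leaf 0).combTrees (u.map (tripodTree₁ v)), .leaf 1⟩ +
        (-1 : ℚ) ^ v.length * loopValue ⟨(RTree.leaf 0).combTrees (u.map (tripodTree₂ v)), .leaf 1⟩ := by
  rw [tripodLoop, LinearMap.add_apply, loopOf_apply, loopOf_apply, radL_monomial, radL_monomial]
  simp only [tripodTree₂_lie, ← tripodTree₁_lie]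
  rw [adList_map_smul, hu, pow_one, smul_mul_assoc, map_smul, smul_eq_mul]
  simp only [loopValue, treePairing, RTree.lie_combTrees, List.map_map, RTree.lie]
  rfl

lemma exists_split {u : List ℕ} (h0 : u.count 0 = 1) (h1 : u.count 1 = 1) :
    ∃ w₁ w₂ w₃ : List ℕ, ∃ a b, ((a = 0 ∧ b = 1) ∨ (a = 1 ∧ b = 0)) ∧
      u = w₁.map (· + 2) ++ a :: (w₂.map (· + 2) ++ b :: w₃.map (· + 2)) := by
  have hmap : ∀ w : List ℕ, w.count 0 = 0 → w.count 1 = 0 → ∃ w' : List ℕ, w = w'.map (· + 2) := by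
    intro w
    induction w with
    | nil => exact fun _ _ => ⟨[], rfl⟩
    | cons n w ih =>
      intro h0 h1
      rw [List.count_cons] at h0 h1
      have hn0 : n ≠ 0 := by rintro rfl; simp at h0
      have hn1 : n ≠ 1 := by rintro rfl; simp at h1
      obtain ⟨w', rfl⟩ := ih (by omega) (by omega)
      exact ⟨(n - 2) :: w', by simp; omega⟩
  obtain ⟨p, q, rfl⟩ := List.append_of_mem (List.count_pos_iff.1 (by omega : 0 < u.count 0))
  simp only [List.count_append, List.count_cons, beq_self_eq_true, if_true] at h0 h1
  simp only [Nat.reduceBEq, Bool.false_eq_true, if_false, Nat.add_zero] at h1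
  by_cases hp : p.count 1 = 0
  · obtain ⟨q₁, q₂, rfl⟩ := List.append_of_mem (List.count_pos_iff.1 (by omega : 0 < q.count 1))
    simp [List.count_append] at h0 h1
    obtain ⟨w₁, rfl⟩ := hmap p (by omega) (by omega)
    obtain ⟨w₂, rfl⟩ := hmap q₁ (by omega) (by omega)
    obtain ⟨w₃, rfl⟩ := hmap q₂ (by omega) (by omega)
    exact ⟨w₁, w₂, w₃, 0, 1, .inl ⟨rfl, rfl⟩, rfl⟩
  · obtain ⟨p₁, p₂, rfl⟩ := List.append_of_mem (List.count_pos_iff.1 (by omega : 0 < p.count 1))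
    simp [List.count_append] at h0 h1
    obtain ⟨w₁, rfl⟩ := hmap p₁ (by omega) (by omega)
    obtain ⟨w₂, rfl⟩ := hmap p₂ (by omega) (by omega)
    obtain ⟨w₃, rfl⟩ := hmap q (by omega) (by omega)
    exact ⟨w₁, w₂, w₃, 1, 0, .inr ⟨rfl, rfl⟩, by simp⟩

lemma exists_adList_linear (L L' : List Letters) (y : Letters) :
    ∃ φ : Letters →ₗ[ℚ] Letters, ∀ x, adList (L ++ x :: L') y = φ x := by
  have h : ∀ L' : List Letters, ∃ φ : Letters →ₗ[ℚ] Letters, ∀ y, adList L' y = φ y := by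
    intro L'
    induction L' with
    | nil => exact ⟨LinearMap.id, fun y => rfl⟩
    | cons x L' ih =>
      obtain ⟨φ, hφ⟩ := ih
      exact ⟨φ ∘ₗ (LinearMap.mulRight ℚ x - LinearMap.mulLeft ℚ x), fun y => by
        rw [adList_cons, hφ]; rfl⟩
  obtain ⟨φ, hφ⟩ := h L'
  exact ⟨φ ∘ₗ (LinearMap.mulLeft ℚ (adList L y) - LinearMap.mulRight ℚ (adList L y)), fun x => by
    rw [adList_append, adList_cons, hφ]; rfl⟩

lemma exists_loopOf_linear {s : Letters → Letters →ₐ[ℚ] Letters} {a : ℕ} {u : List ℕ}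
    (hu : u.count a = 1) {ψ : Letters →ₗ[ℚ] Letters} (ha : ∀ h, s h (letter a) = ψ h)
    (hs : ∀ h n, n ≠ a → s h (letter n) = s 0 (letter n)) :
    ∃ φ : Letters →ₗ[ℚ] ℚ, ∀ h, loopOf (s h) (monomial u) = φ h := by
  obtain ⟨p, q, rfl⟩ := List.append_of_mem (List.count_pos_iff.1 (by omega : 0 < u.count a))
  simp only [List.count_append, List.count_cons, beq_self_eq_true, if_true] at hu
  have hp : a ∉ p := List.count_eq_zero.1 (by omega)
  have hq : a ∉ q := List.count_eq_zero.1 (by omega)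
  obtain ⟨φ, hφ⟩ := exists_adList_linear (p.map fun n => s 0 (letter n))
    (q.map fun n => s 0 (letter n)) (letter 0)
  refine ⟨loopFunctional ∘ₗ LinearMap.mulRight ℚ (letter 1) ∘ₗ φ ∘ₗ ψ, fun h => ?_⟩
  have hmap : ∀ w : List ℕ, a ∉ w → (w.map fun n => s h (letter n)) = w.map fun n => s 0 (letter n) :=
    fun w hw => List.map_congr_left fun n hn => hs h n (by rintro rfl; exact hw hn)
  rw [loopOf_apply, radL_monomial, List.map_append, List.map_cons, hmap p hp, hmap q hq, ha, hφ]
  rfl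

lemma tripodLoop_rotate (h : Letters) (u : List ℕ) :
    tripodLoop h (monomial (u.rotate 1)) = tripodLoop h (monomial u) := by
  have hc : ∀ a, (u.rotate 1).count a = u.count a := fun a => (u.rotate_perm 1).count_eq a
  by_cases h0 : u.count 0 = 1
  swap
  · rw [tripodLoop_eq_zero h (.inl rfl) h0, tripodLoop_eq_zero h (.inl rfl) (by rwa [hc])]
  by_cases h1 : u.count 1 = 1
  swap
  · rw [tripodLoop_eq_zero h (.inr rfl) h1, tripodLoop_eq_zero h (.inr rfl) (by rwa [hc])]
  have hlin : ∀ u : List ℕ, u.count 0 = 1 → u.count 1 = 1 →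
      ∃ φ : Letters →ₗ[ℚ] ℚ, ∀ h, tripodLoop h (monomial u) = φ h := by
    intro u h0 h1
    obtain ⟨φ, hφ⟩ := exists_loopOf_linear (s := tripodHom₁) h0 (ψ := (radL hairHom).flip (letter 3))
      tripodHom₁_zero fun h n hn => by
        match n, hn with
        | 1, _ => rw [tripodHom₁_one, tripodHom₁_one]
        | n + 2, _ => rw [tripodHom₁_add_two, tripodHom₁_add_two]
    obtain ⟨φ', hφ'⟩ := exists_loopOf_linear (s := tripodHom₂) h1
      (ψ := (lad hairHom).toLinearMap.flip (letter 3)) tripodHom₂_one fun h n hn => by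
        match n, hn with
        | 0, _ => rw [tripodHom₂_zero, tripodHom₂_zero]
        | n + 2, _ => rw [tripodHom₂_add_two, tripodHom₂_add_two]
    exact ⟨φ + φ', fun h => by rw [tripodLoop, LinearMap.add_apply, hφ, hφ']; rfl⟩
  obtain ⟨φ, hφ⟩ := hlin u h0 h1
  obtain ⟨φ', hφ'⟩ := hlin (u.rotate 1) (by rwa [hc]) (by rwa [hc])
  have : φ' = φ := by
    refine linearMap_ext_monomial fun v => ?_
    rw [← hφ, ← hφ', tripodLoop_monomial _ _ h1, tripodLoop_monomial _ _ (by rwa [hc]),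
      List.map_rotate, List.map_rotate]
    obtain ⟨w₁, w₂, w₃, a, b, hab, rfl⟩ := exists_split h0 h1
    have hT : ∀ w : List ℕ, (w.map (· + 2)).map (tripodTree₁ v) = (w.map (· + 4)).map .leaf ∧
        (w.map (· + 2)).map (tripodTree₂ v) = (w.map (· + 4)).map .leaf := fun w => by
      simp only [List.map_map]; exact ⟨rfl, rfl⟩
    rcases hab with ⟨rfl, rfl⟩ | ⟨rfl, rfl⟩
    · have := loopValue_slideTrees true (w₁.map (· + 4)) (w₂.map (· + 4)) (w₃.map (· + 4))
        (v.map (· + 4))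
      simp only [slideTrees, cond_true, treeSum_cons, treeSum_nil, List.rotate_zero, one_smul,
        List.length_map, add_zero, slideWord, zsmul_eq_mul, Int.cast_pow, Int.cast_neg,
        Int.cast_one] at this
      simp only [List.map_append, List.map_cons, hT]
      exact this
    · have := loopValue_slideTrees false (w₁.map (· + 4)) (w₂.map (· + 4)) (w₃.map (· + 4))
        (v.map (· + 4))
      simp only [slideTrees, cond_false, treeSum_cons, treeSum_nil, List.rotate_zero, one_smul,
        List.length_map, add_zero, slideWord, zsmul_eq_mul, Int.cast_pow, Int.cast_neg,
        Int.cast_one] at this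
      simp only [List.map_append, List.map_cons, hT]
      exact this
  rw [hφ, hφ', this]

lemma tripodLoop_comm (h x y : Letters) : tripodLoop h (x * y) = tripodLoop h (y * x) := by
  have hmon : ∀ u v : List ℕ, tripodLoop h (monomial (u ++ v)) = tripodLoop h (monomial (v ++ u)) := by
    intro u
    induction u with
    | nil => intro v; simp
    | cons n u ih =>
      intro v
      have := tripodLoop_rotate h (n :: (u ++ v))
      rw [List.rotate_cons_succ, List.rotate_zero] at this
      rw [List.cons_append, ← this, List.append_assoc, ih, List.append_assoc]
      rfl
  have : (LinearMap.mul ℚ Letters).compr₂ (tripodLoop h) =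
      (LinearMap.mul ℚ Letters).flip.compr₂ (tripodLoop h) := by
    refine linearMap_ext_monomial fun u => linearMap_ext_monomial fun v => ?_
    simpa [← monomial_append] using hmon u v
  exact LinearMap.congr_fun (LinearMap.congr_fun this x) y

lemma tripodLoop_of_isLie (h : Letters) {x : Letters} (hx : IsLie x) : tripodLoop h x = 0 := by
  induction hx with
  | zero => exact map_zero _
  | letter n =>
    have : letter n = monomial [n] := by simp [monomial]
    rw [this]
    by_cases hn : n = 0
    · exact tripodLoop_eq_zero h (a := 1) (.inr rfl) (by simp [hn])
    · exact tripodLoop_eq_zero h (a := 0) (.inl rfl) (by simp [hn])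
  | add _ _ hx hy => rw [map_add, hx, hy, add_zero]
  | smul a _ hx => rw [map_smul, hx, smul_zero]
  | bracket _ _ _ _ => rw [map_sub, tripodLoop_comm, sub_self]

/-! ### Compatibility with the symmetries of dotted edges -/

lemma chordValue_relabel {s : Letters →ₐ[ℚ] Letters} {t : ℕ → ℕ} {k : ℤ}
    (h : ∀ u : List ℕ, loopWord (u.map t) = k * loopWord u)
    (hs : ∀ n, relabelHom t (s (letter n)) = s (letter n)) (c : ℕ → Letters) (T : JTree)
    {L L' : List (ℕ × ℕ)} (hmem : ∀ i, i ∈ ends L' ↔ i ∈ ends L)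
    (hidx : ∀ i ∈ ends L, (ends L').idxOf i = t ((ends L).idxOf i)) :
    chordValue s c L' T = k * chordValue s c L T := by
  rw [chordValue, chordValue, loopFunctional, ← treePairing_relabelHom h]
  refine treePairing_congr _ fun i _ => ?_
  have hs' : ∀ x, relabelHom t (s x) = s x := fun x => by
    have : (relabelHom t).comp s = s := algHom_ext_letter hs
    exact DFunLike.congr_fun this x
  unfold chordColor
  by_cases hi : i ∈ ends L
  · rw [if_pos hi, if_pos ((hmem i).2 hi), hidx i hi, relabelHom_letter]
  · rw [if_neg hi, if_neg (mt (hmem i).1 hi), hs']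

lemma isChordMap_one {s : Letters →ₐ[ℚ] Letters}
    (hs : ∀ n, relabelHom (transp 0 1) (s (letter n)) = s (letter n)) : IsChordMap s 1 where
  perm c T L L' hL _ hp := by
    obtain ⟨e, rfl⟩ := List.length_eq_one_iff.1 hL
    rw [List.perm_singleton.1 hp.symm]
  flip c T L₁ L₂ e hL hnd := by
    obtain ⟨rfl, rfl⟩ : L₁ = [] ∧ L₂ = [] := by
      rw [List.length_append, List.length_cons] at hL
      exact ⟨List.length_eq_zero_iff.1 (by omega), List.length_eq_zero_iff.1 (by omega)⟩
    obtain ⟨p, q⟩ := e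
    have hpq : p ≠ q := by simpa [ends] using hnd
    have := chordValue_relabel (L := [(p, q)]) (L' := [(q, p)]) (k := -1)
      (fun u => by rw [loopWord_flip₁]; ring) hs c T (fun i => by simp [ends, or_comm]) fun i hi => by
        simp only [ends, List.flatMap_cons, List.flatMap_nil, List.append_nil, List.mem_cons,
          List.not_mem_nil, or_false] at hi
        rcases hi with rfl | rfl
        · simp [ends, hpq.symm]; rfl
        · simp [ends, hpq]; rfl
    simpa using this

lemma idxOf_of_nodup {a b c d : ℕ} (h : [a, b, c, d].Nodup) : [a, b, c, d].idxOf a = 0 ∧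
    [a, b, c, d].idxOf b = 1 ∧ [a, b, c, d].idxOf c = 2 ∧ [a, b, c, d].idxOf d = 3 :=
  ⟨h.idxOf_getElem 0 (by simp), h.idxOf_getElem 1 (by simp), h.idxOf_getElem 2 (by simp),
    h.idxOf_getElem 3 (by simp)⟩

lemma isChordMap_two {s : Letters →ₐ[ℚ] Letters}
    (hs : ∀ n, ∃ m, s (letter n) = letter (m + 4)) : IsChordMap s 2 := by
  have hs' : ∀ t : ℕ → ℕ, (∀ m, t (m + 4) = m + 4) →
      ∀ n, relabelHom t (s (letter n)) = s (letter n) := fun t ht n => by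
    obtain ⟨m, hm⟩ := hs n
    rw [hm, relabelHom_letter, ht]
  have hval : ∀ {t : ℕ → ℕ} {k : ℤ}, (∀ u : List ℕ, loopWord (u.map t) = k * loopWord u) →
      (∀ m, t (m + 4) = m + 4) → ∀ (c : ℕ → Letters) (T : JTree) (a b a' b' : ℕ × ℕ),
      (ends [a, b]).Nodup → (ends [a', b']).Perm (ends [a, b]) →
      ((ends [a, b]).map fun i => (ends [a', b']).idxOf i) = [t 0, t 1, t 2, t 3] →
      chordValue s c [a', b'] T = k * chordValue s c [a, b] T := by
    intro t k h ht c T a b a' b' hnd hp hidx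
    refine chordValue_relabel h (hs' t ht) c T (fun i => hp.mem_iff) fun i hi => ?_
    obtain ⟨j, hj, rfl⟩ := List.mem_iff_getElem.1 hi
    have hlen : (ends [a, b]).length = 4 := rfl
    rw [hnd.idxOf_getElem]
    have h1 : ((ends [a, b]).map fun i => (ends [a', b']).idxOf i)[j]'(by simpa using hj) =
      (ends [a', b']).idxOf (ends [a, b])[j] := List.getElem_map _
    rw [← h1]
    simp only [hidx]
    have : j < 4 := hlen ▸ hj
    interval_cases j <;> rfl
  constructor
  · intro c T L L' hL hnd hp
    obtain ⟨a, b, rfl⟩ := List.length_eq_two.1 hL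
    rcases List.pair_perm.1 hp with rfl | rfl
    · rfl
    · obtain ⟨p, q⟩ := a
      obtain ⟨p', q'⟩ := b
      have := hval (t := pairTransp 0 1) (k := 1) (fun u => by rw [loopWord_exchange]; ring)
        (fun _ => rfl) c T (p, q) (p', q') (p', q') (p, q) hnd
        (List.perm_append_comm (l₁ := [p', q']) (l₂ := [p, q])) (by
          obtain ⟨h1, h2, h3, h4⟩ := idxOf_of_nodup
            ((List.perm_append_comm (l₁ := [p, q]) (l₂ := [p', q'])).nodup_iff.1 hnd)
          simp [ends, h1, h2, h3, h4]; decide)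
      simpa using this.symm
  · intro c T L₁ L₂ e hL hnd
    have hcases : (L₁ = [] ∧ ∃ f, L₂ = [f]) ∨ ((∃ f, L₁ = [f]) ∧ L₂ = []) := by
      rw [List.length_append, List.length_cons] at hL
      rcases Nat.eq_zero_or_pos L₁.length with h | h
      · exact .inl ⟨List.length_eq_zero_iff.1 h, List.length_eq_one_iff.1 (by omega)⟩
      · exact .inr ⟨List.length_eq_one_iff.1 (by omega), List.length_eq_zero_iff.1 (by omega)⟩
    obtain ⟨p, q⟩ := e
    rcases hcases with ⟨rfl, ⟨p', q'⟩, rfl⟩ | ⟨⟨⟨p', q'⟩, rfl⟩, rfl⟩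
    · have := hval (t := transp 0 1) (k := -1) (fun u => by rw [loopWord_flip₁]; ring)
        (fun _ => rfl) c T (p, q) (p', q') (q, p) (p', q') hnd (.swap _ _ _) (by
          obtain ⟨h1, h2, h3, h4⟩ := idxOf_of_nodup ((List.Perm.swap q p [p', q']).nodup_iff.1 hnd)
          simp [ends, h1, h2, h3, h4]; decide)
      simpa using this
    · have := hval (t := transp 2 3) (k := -1) (fun u => by rw [loopWord_flip₂]; ring)
        (fun _ => rfl) c T (p', q') (p, q) (p', q') (q, p) hnd
        (.append_left [p', q'] (.swap _ _ _)) (by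
          obtain ⟨h1, h2, h3, h4⟩ := idxOf_of_nodup
            (((List.Perm.swap q p []).append_left [p', q']).nodup_iff.1 hnd)
          simp [ends, h1, h2, h3, h4]; decide)
      simpa using this

/-- The functional vanishes on everything that is obtained by `β` from tripods whose colours are in
the free Lie algebra. -/
def KillsTripods (Φ : HLG Letters →ₗ[ℚ] ℚ) : Prop :=
  ∀ (n : ℕ) (l : List JTree) (D : Finset (ℕ × ℕ)) (c : ℕ → Letters), (∀ i, IsLie (c i)) →
    l.length = n + 1 → (∀ T ∈ l, T.numTri = 1) → Graph.IsHairy ⟨l, D, c⟩ →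
    Φ ((beta ^ n) (of ⟨l, D, c⟩)) = 0

section

variable {H : Type*} [AddCommGroup H] [Module ℚ H]

lemma notMem_endpoints {D E : Finset (ℕ × ℕ)} (hm : IsMatching (D ∪ E)) {e : ℕ × ℕ} (he : e ∈ E)
    (heD : e ∉ D) : e.1 ∉ endpoints D ∧ e.2 ∉ endpoints D := by
  have h := fun f (hf : f ∈ D) => hm.2 e (Finset.mem_union_right _ he) f
    (Finset.mem_union_left _ hf) (by rintro rfl; exact heD hf)
  constructor
  · intro h1
    obtain ⟨f, hf, h2⟩ := mem_endpoints.1 h1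
    have := h f hf
    rcases h2 with h2 | h2
    · exact this.1 h2.symm
    · exact this.2.1 h2.symm
  · intro h1
    obtain ⟨f, hf, h2⟩ := mem_endpoints.1 h1
    have := h f hf
    rcases h2 with h2 | h2
    · exact this.2.2.1 h2.symm
    · exact this.2.2.2 h2.symm

lemma mem_fst_of_link {T U : JTree} {D : Finset (ℕ × ℕ)} {c : ℕ → H}
    (h : Graph.IsHairy ⟨[T, U], D, c⟩) {i u : ℕ} (he : (i, u) ∈ D) (hi : i ∉ U.legs) : i ∈ T.legs := by
  have := endpoints_subset_legs h (mem_endpoints.2 ⟨_, he, .inl rfl⟩)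
  simpa [hi] using this

lemma betaTerm_link {T U : JTree} {D : Finset (ℕ × ℕ)} {c : ℕ → H}
    (h : Graph.IsHairy ⟨[T, U], D, c⟩) {i u : ℕ} (he : (i, u) ∈ D) (hi : i ∉ U.legs)
    (hu : u ∈ U.legs) :
    betaTerm T U [] D c (i, u) = treeOf [] (D.erase (i, u)) c (T.subst i (U.cutAt u)) :=
  betaTerm_eq_treeOf h he (mem_fst_of_link h he hi) hu

lemma betaTerm_loop {T U : JTree} {D : Finset (ℕ × ℕ)} {c : ℕ → H}
    (h : Graph.IsHairy ⟨[T, U], D, c⟩) {y z : ℕ} (hy : y ∈ U.legs) (hz : z ∈ U.legs) :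
    betaTerm T U [] D c (y, z) = 0 :=
  betaTerm_eq_zero (fun h' => legs_disjoint h h'.1 hy) (fun h' => legs_disjoint h h'.2 hz)

end

section

variable {D : Finset (ℕ × ℕ)} {a b c : ℕ × ℕ}

lemma union_erase_one (h : a ∉ D) : (D ∪ {a}).erase a = D := by grind

lemma union_erase_two₁ (h : a ∉ D) (hab : a ≠ b) : (D ∪ {a, b}).erase a = insert b D := by grind

lemma union_erase_two₂ (h : b ∉ D) (hab : a ≠ b) : (D ∪ {a, b}).erase b = insert a D := by grind

lemma union_erase_three₁ (h : a ∉ D) (hab : a ≠ b) (hac : a ≠ c) :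
    (D ∪ {a, b, c}).erase a = insert b (insert c D) := by grind

lemma union_erase_three₂ (h : b ∉ D) (hab : a ≠ b) (hbc : b ≠ c) :
    (D ∪ {a, b, c}).erase b = insert a (insert c D) := by grind

lemma union_erase_three₃ (h : c ∉ D) (hac : a ≠ c) (hbc : b ≠ c) :
    (D ∪ {a, b, c}).erase c = insert a (insert b D) := by grind

end

/-- The conditions on a functional that ensure that it vanishes on the image of `β`: they concern
the attachment of a single tripod to a tree. -/
lemma killsTripods_of {Φ : HLG Letters →ₗ[ℚ] ℚ}
    (base : ∀ x y z E c, (∀ i, IsLie (c i)) → Graph.IsHairy ⟨[tripod x y z], E, c⟩ →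
      (E = ∅ ∨ E = {(y, z)}) → Φ (of ⟨[tripod x y z], E, c⟩) = 0)
    (h1 : ∀ T i x y z D c, (∀ i, IsLie (c i)) →
      Graph.IsHairy ⟨[T, tripod x y z], D ∪ {(i, x)}, c⟩ → i ∈ T.legs →
      (∀ i ∈ endpoints D, i ∉ [x, y, z]) →
      Φ (treeOf [] D c (T.subst i (.node (.leaf y) (.leaf z)))) =
        Φ (of ⟨[T], D, Function.update c i (c y * c z - c z * c y)⟩))
    (h1' : ∀ T i x y z D c, (∀ i, IsLie (c i)) →
      Graph.IsHairy ⟨[T, tripod x y z], D ∪ {(i, x), (y, z)}, c⟩ → i ∈ T.legs →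
      (∀ i ∈ endpoints D, i ∉ [x, y, z]) →
      Φ (treeOf [] (insert (y, z) D) c (T.subst i (.node (.leaf y) (.leaf z)))) = 0)
    (h2 : ∀ i j z c, (∀ i, IsLie (c i)) → i ≠ j → ∃ Φ' c', KillsTripods Φ' ∧ (∀ i, IsLie (c' i)) ∧
      ∀ T x y D, Graph.IsHairy ⟨[T, tripod x y z], D ∪ {(i, x), (j, y)}, c⟩ → i ∈ T.legs →
      j ∈ T.legs → (∀ i ∈ endpoints D, i ∉ [x, y, z]) →
      Φ (treeOf [] (insert (j, y) D) c (T.subst i (.node (.leaf y) (.leaf z))) +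
          treeOf [] (insert (i, x) D) c (T.subst j (.node (.leaf z) (.leaf x)))) =
        Φ' (of ⟨[T], D, c'⟩))
    (h3 : ∀ T i j k x y z D c, (∀ i, IsLie (c i)) →
      Graph.IsHairy ⟨[T, tripod x y z], D ∪ {(i, x), (j, y), (k, z)}, c⟩ → i ∈ T.legs →
      j ∈ T.legs → k ∈ T.legs → (∀ i ∈ endpoints D, i ∉ [x, y, z]) →
      Φ (treeOf [] (insert (j, y) (insert (k, z) D)) c (T.subst i (.node (.leaf y) (.leaf z))) +
        (treeOf [] (insert (i, x) (insert (k, z) D)) c (T.subst j (.node (.leaf z) (.leaf x))) +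
          treeOf [] (insert (i, x) (insert (j, y) D)) c (T.subst k (.node (.leaf x) (.leaf y))))) =
        0) : KillsTripods Φ := by
  intro n
  induction n with
  | zero =>
    intro l D c hc hl ht h
    obtain ⟨U, rfl⟩ := List.length_eq_one_iff.1 hl
    rw [pow_zero, Module.End.one_apply]
    refine vanish_of_tripod (l := []) ?_ (ht U (by simp)) h
    intro x y z D E h hD _ hE
    have hD0 : D = ∅ := by
      rw [Finset.eq_empty_iff_forall_notMem]
      intro e he
      have h1 := endpoints_subset_legs h (mem_endpoints.2 ⟨e, Finset.mem_union_left _ he, .inl rfl⟩)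
      exact hD _ (mem_endpoints.2 ⟨e, he, .inl rfl⟩) (by simpa using h1)
    have hno : ∀ i u, i ∉ [x, y, z] → (i, u) ∉ E := by
      intro i u hi hE
      have h1 := endpoints_subset_legs h
        (mem_endpoints.2 ⟨_, Finset.mem_union_right _ hE, .inl rfl⟩)
      exact hi (by simpa using h1)
    subst hD0
    rw [Finset.empty_union] at h ⊢
    refine base x y z E c hc h ?_
    rcases hE with hE | hE | ⟨i, hi, hE⟩ | ⟨i, hi, hE⟩ | ⟨i, j, hi, hj, hE⟩ | ⟨i, j, k, hi, hj, hk, hE⟩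
    · exact .inl hE
    · exact .inr hE
    all_goals exact absurd (show (i, x) ∈ E by simp [hE]) (hno _ _ hi)
  | succ n ih =>
    intro l D c hc hl ht h
    obtain ⟨l, U, rfl⟩ : ∃ l' U, l = l' ++ [U] := by
      rcases List.eq_nil_or_concat l with rfl | ⟨l', U, rfl⟩
      · simp at hl
      · exact ⟨l', U, by simp⟩
    have hl' : l.length = n + 1 := by simpa using hl
    have ht' : ∀ T ∈ l, T.numTri = 1 := fun T hT => ht T (List.mem_append_left _ hT)
    refine vanish_of_tripod (f := Φ ∘ₗ (beta ^ (n + 1))) ?_ (ht U (by simp)) h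
    intro x y z D E h hD hdis hE
    rw [LinearMap.comp_apply]
    have hDU : ∀ i ∈ endpoints D, i ∉ (tripod x y z).legs := hD
    obtain ⟨hxy, hxz, hyz⟩ := nodup_of_isHairy_tripod h
    have hx : x ∈ (tripod x y z).legs := by simp
    have hy : y ∈ (tripod x y z).legs := by simp
    have hz : z ∈ (tripod x y z).legs := by simp
    have hnotD : ∀ {D i u}, u ∈ [x, y, z] → (∀ i ∈ endpoints D, i ∉ [x, y, z]) → (i, u) ∉ D :=
      fun hu hD h' => hD _ (mem_endpoints.2 ⟨_, h', .inr rfl⟩) hu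
    -- the case in which the term with the last tripod vanishes
    have hzero : (∀ e ∈ E, e.2 ∈ (tripod x y z).legs) →
        (∀ T D, Graph.IsHairy ⟨[T, tripod x y z], D ∪ E, c⟩ →
          (∀ i ∈ endpoints D, i ∉ (tripod x y z).legs) →
          Φ (beta (of ⟨[T, tripod x y z], D ∪ E, c⟩)) = 0) →
        Φ ((beta ^ (n + 1)) (of ⟨l ++ [tripod x y z], D ∪ E, c⟩)) = 0 := fun hE2 h0 =>
      beta_pow_transfer (Φ' := 0) (c' := c) hE2 h0 n l D hl' h hDU
    rcases hE with rfl | rfl | ⟨i, hi, rfl⟩ | ⟨i, hi, rfl⟩ | ⟨i, j, hi, hj, rfl⟩ |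
      ⟨i, j, k, hi, hj, hk, rfl⟩
    · refine hzero (by simp) fun T D h hD => ?_
      rw [beta_pair hD, Finset.sum_empty, map_zero]
    · refine hzero (by simp) fun T D h hD => ?_
      rw [beta_pair hD, Finset.sum_singleton, betaTerm_loop h hy hz, map_zero]
    · rw [beta_pow_transfer (Φ' := Φ) (c' := Function.update c i (c y * c z - c z * c y))
        (by simp) (fun T D h hD => ?_) n l D hl' h hDU]
      · refine ih l D _ (fun j => ?_) hl' ht' (IsHairy.of_append _ h (by simpa using hDU))
        by_cases hj : j = i
        · subst hj; rw [Function.update_self]; exact (hc y).bracket (hc z)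
        · rw [Function.update_of_ne hj]; exact hc j
      · have hxD := hnotD (i := i) hx hD
        have hiT : i ∈ T.legs := mem_fst_of_link h (u := x) (by simp) hi
        rw [beta_pair hD, Finset.sum_singleton, betaTerm_link h (by simp) hi hx, tripod_cut₁,
          ← h1 T i x y z D c hc h hiT hD, union_erase_one hxD]
    · refine hzero (by simp) fun T D h hD => ?_
      have hxD := hnotD (i := i) hx hD
      have hiT : i ∈ T.legs := mem_fst_of_link h (u := x) (by simp) hi
      rw [beta_pair hD, Finset.sum_pair (by simp [hxz]), betaTerm_loop h hy hz, add_zero,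
        betaTerm_link h (by simp) hi hx, tripod_cut₁, ← h1' T i x y z D c hc h hiT hD,
        union_erase_two₁ hxD (by simp [hxz])]
    · have hij : i ≠ j := by
        rintro rfl
        exact (h.matching.2 (i, x) (by simp) (i, y) (by simp) (by simp [hxy])).1 rfl
      obtain ⟨Φ', c', hk, hc', h0⟩ := h2 i j z c hc hij
      rw [beta_pow_transfer (Φ' := Φ') (c' := c') (by simp) (fun T D h hD => ?_)
        n l D hl' h hDU]
      · exact hk n l D c' hc' hl' ht' (IsHairy.of_append _ h (by simpa using hDU))
      · have hxD := hnotD (i := i) hx hD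
        have hyD := hnotD (i := j) hy hD
        have hiT : i ∈ T.legs := mem_fst_of_link h (u := x) (by simp) hi
        have hjT : j ∈ T.legs := mem_fst_of_link h (u := y) (by simp) hj
        rw [beta_pair hD, Finset.sum_pair (by simp [hxy]), betaTerm_link h (by simp) hi hx,
          betaTerm_link h (by simp) hj hy, tripod_cut₁, tripod_cut₂ z hxy.symm,
          ← h0 T x y D h hiT hjT hD, union_erase_two₁ hxD (by simp [hxy]),
          union_erase_two₂ hyD (by simp [hxy])]
    · refine hzero (by simp) fun T D h hD => ?_
      have hxD := hnotD (i := i) hx hD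
      have hyD := hnotD (i := j) hy hD
      have hzD := hnotD (i := k) hz hD
      have hiT : i ∈ T.legs := mem_fst_of_link h (u := x) (by simp) hi
      have hjT : j ∈ T.legs := mem_fst_of_link h (u := y) (by simp) hj
      have hkT : k ∈ T.legs := mem_fst_of_link h (u := z) (by simp) hk
      rw [beta_pair hD, Finset.sum_insert (by simp [hxy, hxz]), Finset.sum_pair (by simp [hyz]),
        betaTerm_link h (by simp) hi hx, betaTerm_link h (by simp) hj hy,
        betaTerm_link h (by simp) hk hz, tripod_cut₁, tripod_cut₂ z hxy.symm,
        tripod_cut₃ hxz.symm hyz.symm, ← h3 T i j k x y z D c hc h hiT hjT hkT hD,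
        union_erase_three₁ hxD (by simp [hxy]) (by simp [hxz]),
        union_erase_three₂ hyD (by simp [hxy]) (by simp [hyz]),
        union_erase_three₃ hzD (by simp [hxz]) (by simp [hyz])]

/-! ### Tripods attached to a caterpillar -/

lemma IsTreeFun.eq_zero_of_comb {M : Type*} [AddCommGroup M] {F : JTree → M} (hF : IsTreeFun F)
    {T : JTree} {s e : ℕ} (hs : s ∈ T.legs) (he : e ∈ T.legs) (hse : s ≠ e)
    (h : ∀ w, (e :: s :: w).Perm T.legs → F ⟨RTree.comb (.leaf s) w, .leaf e⟩ = 0) : F T = 0 := by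
  have hp := T.cutAt_legs e he
  have hs' : s ∈ (T.cutAt e).legs := by
    have := hp.mem_iff.2 hs
    simpa [hse] using this
  rw [hF.expand he hs', wordSum_congr (g := fun _ => 0) _ fun p hp' => ?_]
  · simp [wordSum]
  · exact h _ (((RTree.firstWords_perm hs' hp').cons e).trans hp)

/-- The value of a caterpillar from `A`, with the word `X`, the entry `B` and the word `Y`. -/
def chain (s : Letters →ₐ[ℚ] Letters) (A X B Y : Letters) : Letters :=
  radL s Y (radL s X A * B - B * radL s X A)

lemma adList_map_eq_radL {s : Letters →ₐ[ℚ] Letters} {c d : ℕ → Letters} (hc : ∀ i, IsLie (c i))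
    {w : List ℕ} (hd : ∀ j ∈ w, d j = s (c j)) (A : Letters) :
    adList (w.map d) A = radL s (w.map c).prod A := by
  rw [radL_prod, List.map_map]
  · congr 1
    exact List.map_congr_left hd
  · intro x hx
    obtain ⟨i, -, rfl⟩ := List.mem_map.1 hx
    exact hc i

lemma treePairing_comb {s : Letters →ₐ[ℚ] Letters} {c d : ℕ → Letters} (hc : ∀ i, IsLie (c i))
    {w : List ℕ} {a e : ℕ} (hd : ∀ j ∈ w, d j = s (c j)) :
    treePairing loopFunctional d ⟨RTree.comb (.leaf a) w, .leaf e⟩ =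
      loopFunctional (radL s (w.map c).prod (d a) * d e) := by
  rw [treePairing, RTree.lie_comb, adList_map_eq_radL hc hd]
  rfl

lemma treePairing_comb_chain {s : Letters →ₐ[ℚ] Letters} {c d : ℕ → Letters}
    (hc : ∀ i, IsLie (c i)) {x y : List ℕ} {a i e : ℕ} (h : ∀ j ∈ x ++ y, d j = s (c j)) :
    treePairing loopFunctional d ⟨RTree.comb (.leaf a) (x ++ i :: y), .leaf e⟩ =
      loopFunctional (chain s (d a) (x.map c).prod (d i) (y.map c).prod * d e) := by
  rw [treePairing, RTree.lie_comb, List.map_append, List.map_cons, adList_append, adList_cons,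
    adList_map_eq_radL hc fun j hj => h j (List.mem_append_left _ hj),
    adList_map_eq_radL hc fun j hj => h j (List.mem_append_right _ hj)]
  rfl

lemma exists_chain_linear (s : Letters →ₐ[ℚ] Letters) (A B Z : Letters) :
    ∃ φ : Letters →ₗ[ℚ] Letters →ₗ[ℚ] ℚ, ∀ X Y, loopFunctional (chain s A X B Y * Z) = φ X Y := by
  refine ⟨LinearMap.mk₂ ℚ (fun X Y => loopFunctional (chain s A X B Y * Z)) ?_ ?_ ?_ ?_,
    fun X Y => rfl⟩ <;> intros <;>
    simp only [chain, map_add, LinearMap.add_apply, add_mul, mul_add, map_sub, map_smul,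
      LinearMap.smul_apply, smul_mul_assoc, mul_smul_comm, sub_mul, smul_eq_mul, mul_sub] <;>
    ring

lemma lie_comb_chain (B : RTree) (S : RTree) (u v : List ℕ) :
    ((RTree.node (B.comb (u.map (· + 4))) S).comb (v.map (· + 4))).lie letter =
      chain hairHom (B.lie letter) (monomial u) (S.lie letter) (monomial v) := by
  rw [RTree.lie_comb, RTree.lie, RTree.lie_comb, chain, radL_monomial, radL_monomial, List.map_map,
    List.map_map]
  simp only [hairHom_letter]
  rfl

lemma comb_append_cons (B : RTree) (x y : List ℕ) (i : ℕ) :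
    B.comb (x ++ i :: y) = (RTree.node (B.comb x) (.leaf i)).comb y := by
  induction x generalizing B with
  | nil => rfl
  | cons j x ih => exact ih _

lemma chain_selfLink (X Y : Letters) :
    loopFunctional (chain hairHom (letter 0) X (letter 2 * letter 3 - letter 3 * letter 2) Y *
      letter 1) = 0 := by
  obtain ⟨φ, hφ⟩ := exists_chain_linear hairHom (letter 0)
    (letter 2 * letter 3 - letter 3 * letter 2) (letter 1)
  rw [hφ]
  have : φ = 0 := by
    refine linearMap_ext_monomial fun u => linearMap_ext_monomial fun v => ?_
    rw [← hφ]
    have := loopValue_selfLinkTrees (u.map (· + 4)) (v.map (· + 4))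
    simp only [selfLinkTrees, treeSum_cons, treeSum_nil, one_smul, add_zero, loopValue, treePairing,
      lie_comb_chain, RTree.lie] at this
    exact this
  rw [this]; rfl

lemma chain_threeLink (X Y : Letters) :
    loopFunctional (chain hairHom (letter 1 * letter 3 - letter 3 * letter 1) X (letter 2) Y *
      letter 0) +
    (loopFunctional (chain hairHom (letter 0) X (letter 2) Y *
      (letter 3 * letter 1 - letter 1 * letter 3)) +
    loopFunctional (chain hairHom (letter 0) X (letter 1 * letter 3 - letter 3 * letter 1) Y *
      letter 2)) = 0 := by
  obtain ⟨φ₁, hφ₁⟩ := exists_chain_linear hairHom (letter 1 * letter 3 - letter 3 * letter 1)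
    (letter 2) (letter 0)
  obtain ⟨φ₂, hφ₂⟩ := exists_chain_linear hairHom (letter 0) (letter 2)
    (letter 3 * letter 1 - letter 1 * letter 3)
  obtain ⟨φ₃, hφ₃⟩ := exists_chain_linear hairHom (letter 0)
    (letter 1 * letter 3 - letter 3 * letter 1) (letter 2)
  rw [hφ₁, hφ₂, hφ₃]
  have : φ₁ + (φ₂ + φ₃) = 0 := by
    refine linearMap_ext_monomial fun u => linearMap_ext_monomial fun v => ?_
    simp only [LinearMap.add_apply, ← hφ₁, ← hφ₂, ← hφ₃]
    have := loopValue_threeLinkTrees (u.map (· + 4)) (v.map (· + 4))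
    simp only [threeLinkTrees, treeSum_cons, treeSum_nil, one_smul, add_zero, loopValue, treePairing,
      comb_append_cons, lie_comb_chain, RTree.lie] at this
    exact this
  exact LinearMap.congr_fun (LinearMap.congr_fun this X) Y

/-! ### Evaluation of graphs with a grafted tripod -/

section

variable {s : Letters →ₐ[ℚ] Letters} {r : ℕ}

lemma chordFunctional_treeOf (hs : IsChordMap s r) {T : JTree} {D : Finset (ℕ × ℕ)}
    {c : ℕ → Letters} {L : List (ℕ × ℕ)} (h : Graph.IsHairy ⟨[T], D, c⟩) (hnd : L.Nodup)
    (hL : L.toFinset = D) (hr : L.length = r) :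
    chordFunctional hs (treeOf [] D c T) = chordValue s c L T := by
  rw [treeOf_eq h, chordFunctional_of, chordGraph_eq hs h.matching hnd hL hr]

lemma chordFunctional_of_eq_zero (hs : IsChordMap s r) {T : JTree} {D : Finset (ℕ × ℕ)}
    {c : ℕ → Letters} (hr : D.card ≠ r) : chordFunctional hs (of ⟨[T], D, c⟩) = 0 := by
  rw [chordFunctional_of, chordGraph_single, if_neg hr]

lemma chordFunctional_treeOf_eq_zero (hs : IsChordMap s r) {T : JTree} {D : Finset (ℕ × ℕ)}
    {c : ℕ → Letters} (hr : D.card ≠ r) : chordFunctional hs (treeOf [] D c T) = 0 := by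
  unfold treeOf
  split_ifs
  · exact chordFunctional_of_eq_zero hs hr
  · exact map_zero _

lemma chordValue_subst (c : ℕ → Letters) (L : List (ℕ × ℕ)) (T : JTree) (i : ℕ) (S : RTree) :
    chordValue s c L (T.subst i S) =
      treePairing loopFunctional
        (Function.update (chordColor s c L) i (S.lie (chordColor s c L))) T := by
  rw [chordValue, JTree.subst_eq_bind, treePairing_bind]
  congr 1
  funext j
  by_cases h : j = i
  · subst h; simp
  · simp [h, RTree.lie]

lemma chordColor_of_notMem (c : ℕ → Letters) {L : List (ℕ × ℕ)} {i : ℕ} (h : i ∉ ends L) :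
    chordColor s c L i = s (c i) := if_neg h

lemma chordColor_one (c : ℕ → Letters) {p q : ℕ} (h : p ≠ q) :
    chordColor s c [(p, q)] p = letter 0 ∧ chordColor s c [(p, q)] q = letter 1 := by
  simp [chordColor, ends, h]

lemma chordColor_two (c : ℕ → Letters) {p q p' q' : ℕ} (h : [p, q, p', q'].Nodup) :
    chordColor s c [(p, q), (p', q')] p = letter 0 ∧
      chordColor s c [(p, q), (p', q')] q = letter 1 ∧
      chordColor s c [(p, q), (p', q')] p' = letter 2 ∧
      chordColor s c [(p, q), (p', q')] q' = letter 3 := by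
  obtain ⟨h1, h2, h3, h4⟩ := idxOf_of_nodup h
  simp [chordColor, ends, h1, h2, h3, h4]

/-- A tripod with two leaves amounts to a leaf that is coloured by the bracket of their colours. -/
lemma chordFunctional_cherry (hs : IsChordMap s r) {T : JTree} {i x y z : ℕ} {D : Finset (ℕ × ℕ)}
    {c : ℕ → Letters} (h : Graph.IsHairy ⟨[T, tripod x y z], D ∪ {(i, x)}, c⟩) (hi : i ∈ T.legs)
    (hD : ∀ i ∈ endpoints D, i ∉ [x, y, z]) :
    chordFunctional hs (treeOf [] D c (T.subst i (.node (.leaf y) (.leaf z)))) =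
      chordFunctional hs (of ⟨[T], D, Function.update c i (c y * c z - c z * c y)⟩) := by
  by_cases hr : D.card = r
  swap
  · rw [chordFunctional_treeOf_eq_zero hs hr, chordFunctional_of_eq_zero hs hr]
  have hxD : (i, x) ∉ D := fun h' => hD x (mem_endpoints.2 ⟨_, h', .inr rfl⟩) (by simp)
  have h1 := IsHairy.subst h (i := i) (j := x) (by simp) hi (by simp)
  rw [tripod_cut₁, union_erase_one hxD] at h1
  have h2 : Graph.IsHairy ⟨[T], D, Function.update c i (c y * c z - c z * c y)⟩ :=
    IsHairy.of_append (l' := [tripod x y z]) _ h (by simpa using hD)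
  have hends : ∀ j, j ∈ ends D.toList ↔ j ∈ endpoints D := fun j => by
    rw [mem_ends, Finset.toList_toFinset]
  have hiD : i ∉ endpoints D := (notMem_endpoints h.matching (e := (i, x)) (by simp) hxD).1
  rw [chordFunctional_treeOf hs h1 (Finset.nodup_toList D) (Finset.toList_toFinset D) (by simpa),
    ← treeOf_eq h2, chordFunctional_treeOf hs h2 (Finset.nodup_toList D) (Finset.toList_toFinset D)
      (by simpa), chordValue_subst, chordValue]
  congr 1
  funext j
  by_cases hj : j = i
  · subst hj
    have hy : y ∉ ends D.toList := fun h' => hD y ((hends y).1 h') (by simp)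
    have hz : z ∉ ends D.toList := fun h' => hD z ((hends z).1 h') (by simp)
    rw [Function.update_self, chordColor_of_notMem _ (by rwa [hends]), Function.update_self, RTree.lie,
      RTree.lie, RTree.lie, chordColor_of_notMem _ hy, chordColor_of_notMem _ hz, map_sub, map_mul,
      map_mul]
  · rw [Function.update_of_ne hj]
    unfold chordColor
    rw [Function.update_of_ne hj]

end

/-! ### Vanishing on the image of `β` -/

lemma relabel_tripodHom₁ (h : Letters) (n : ℕ) :
    relabelHom (transp 0 1) (tripodHom₁ h (letter n)) = tripodHom₁ h (letter n) := by
  have := map_tripodHom₁ (φ := relabelHom (transp 0 1)) (q := 1) (k := 3) (a := 0)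
    (fun n => by rw [relabelHom_letter]; rfl) (.inl ⟨rfl, rfl⟩) (by rw [relabelHom_letter]; simp; rfl)
    (by rw [relabelHom_letter]; simp; rfl) h n
  simpa using this

lemma relabel_tripodHom₂ (h : Letters) (n : ℕ) :
    relabelHom (transp 0 1) (tripodHom₂ h (letter n)) = tripodHom₂ h (letter n) := by
  have := map_tripodHom₂ (φ := relabelHom (transp 0 1)) (q := 1) (k := 3) (a := 1)
    (fun n => by rw [relabelHom_letter]; rfl) (.inl ⟨rfl, rfl⟩) (by rw [relabelHom_letter]; simp; rfl)
    (by rw [relabelHom_letter]; simp; rfl) h n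
  simpa using this

lemma isChordMap_tripodHom₁ (h : Letters) : IsChordMap (tripodHom₁ h) 1 :=
  isChordMap_one (relabel_tripodHom₁ h)

lemma isChordMap_tripodHom₂ (h : Letters) : IsChordMap (tripodHom₂ h) 1 :=
  isChordMap_one (relabel_tripodHom₂ h)

lemma isChordMap_hairHom : IsChordMap hairHom 2 := isChordMap_two fun n => ⟨n, hairHom_letter n⟩

lemma loopOf_flip {s : Letters →ₐ[ℚ] Letters}
    (hs : ∀ n, relabelHom (transp 0 1) (s (letter n)) = s (letter n)) (x : Letters) :
    loopFunctional (radL s x (letter 1) * letter 0) = -loopOf s x := by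
  have h := wordFunctional_relabelHom (f := loopWord) (t := transp 0 1) (k := -1)
    (fun u => by rw [loopWord_flip₁]; ring) (radL s x (letter 0) * letter 1)
  have hcomp : (relabelHom (transp 0 1)).comp s = s := algHom_ext_letter hs
  rw [map_mul, map_radL, hcomp, relabelHom_letter, relabelHom_letter] at h
  rw [show transp 0 1 0 = 1 from rfl, show transp 0 1 1 = 0 from rfl] at h
  rw [loopOf_apply, loopFunctional, h]
  simp

lemma IsTreeFun.add {M : Type*} [AddCommGroup M] {F G : JTree → M} (hF : IsTreeFun F)
    (hG : IsTreeFun G) : IsTreeFun fun T => F T + G T := by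
  simpa using IsTreeFun.sum Finset.univ (G := ![F, G]) (by simp [hF, hG])

section

variable {s : Letters →ₐ[ℚ] Letters}

/-- The value of a tree to which a tripod with a dotted edge between its other two leaves has been attached:
the rest of the tree enters only through an element `X` of the free Lie algebra. -/
lemma exists_selfLink_value {T : JTree} {i x y z : ℕ} {D : Finset (ℕ × ℕ)} {c : ℕ → Letters}
    (hc : ∀ i, IsLie (c i)) (h : Graph.IsHairy ⟨[T, tripod x y z], D ∪ {(i, x), (y, z)}, c⟩)
    (hi : i ∈ T.legs) (hD : ∀ i ∈ endpoints D, i ∉ [x, y, z]) :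
    ∃ X, IsLie X ∧ ∀ (s : Letters →ₐ[ℚ] Letters) (hs : IsChordMap s 1),
      chordFunctional hs (treeOf [] (insert (y, z) D) c (T.subst i (.node (.leaf y) (.leaf z)))) =
        -loopOf s X := by
  obtain ⟨hxy, hxz, hyz⟩ := nodup_of_isHairy_tripod (l := [T]) h
  have hnotD : ∀ {i u}, u ∈ [x, y, z] → (i, u) ∉ D :=
    fun hu h' => hD _ (mem_endpoints.2 ⟨_, h', .inr rfl⟩) hu
  by_cases hD0 : D = ∅
  swap
  · refine ⟨0, .zero, fun s hs => ?_⟩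
    rw [map_zero, neg_zero, chordFunctional_treeOf_eq_zero hs]
    rw [Finset.card_insert_of_notMem (hnotD (by simp))]
    have := Finset.card_pos.2 (Finset.nonempty_iff_ne_empty.2 hD0)
    omega
  subst hD0
  have h1 := IsHairy.subst h (i := i) (j := x) (by simp) hi (by simp)
  rw [tripod_cut₁, union_erase_two₁ (by simp) (by simp [hxz])] at h1
  have hyT : y ∉ T.legs := fun h' => legs_disjoint h h' (by simp)
  have hzT : z ∉ T.legs := fun h' => legs_disjoint h h' (by simp)
  have hT := (T.cutAt_legs i hi)
  have hTi : ∀ j ∈ (T.cutAt i).legs, j ∈ T.legs ∧ j ≠ i := fun j hj =>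
    ⟨hT.mem_iff.1 (List.mem_cons_of_mem _ hj), by
      rintro rfl
      exact (List.nodup_cons.1 (hT.nodup_iff.2 (legs_nodup_fst h))).1 hj⟩
  refine ⟨(T.cutAt i).lie c, isLie_lie hc _, fun s hs => ?_⟩
  rw [chordFunctional_treeOf hs h1 (L := [(y, z)]) (by simp) (by simp) rfl, chordValue_subst,
    ← (isTreeFun_treePairing loopFunctional_comm _).cutAt hi, treePairing]
  obtain ⟨hcy, hcz⟩ := chordColor_one (s := s) c hyz
  have hlie : (T.cutAt i).lie (Function.update (chordColor s c [(y, z)]) i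
      ((RTree.node (.leaf y) (.leaf z)).lie (chordColor s c [(y, z)]))) =
      s ((T.cutAt i).lie c) := by
    have := RTree.map_lie (s : Letters →+* Letters) c (T.cutAt i)
    rw [show s ((T.cutAt i).lie c) = (s : Letters →+* Letters) ((T.cutAt i).lie c) from rfl, this]
    refine RTree.lie_congr fun j hj => ?_
    obtain ⟨hj1, hj2⟩ := hTi j hj
    rw [Function.update_of_ne hj2, chordColor_of_notMem]
    · rfl
    · simp only [ends, List.flatMap_cons, List.flatMap_nil, List.append_nil, List.mem_cons,
        List.not_mem_nil, or_false, not_or]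
      exact ⟨fun h' => hyT (h' ▸ hj1), fun h' => hzT (h' ▸ hj1)⟩
  have hcyc : loopFunctional (s ((T.cutAt i).lie c) * (letter 1 * letter 0)) =
      loopFunctional (letter 0 * s ((T.cutAt i).lie c) * letter 1) := by
    rw [← mul_assoc, loopFunctional_comm, ← mul_assoc]
  rw [hlie]
  simp only [RTree.lie, Function.update_self]
  rw [hcy, hcz, loopOf_apply, radL_of_isLie s (isLie_lie hc _), mul_sub, sub_mul, map_sub, map_sub,
    hcyc, mul_assoc (s _)]
  ring

end

/-- The loop with hairs to which a tripod is attached at two places vanishes on the image of `β`. -/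
lemma killsTripods_tripodHom (a : Letters) :
    KillsTripods (chordFunctional (isChordMap_tripodHom₁ a) +
      chordFunctional (isChordMap_tripodHom₂ a)) := by
  have hsum : ∀ x, loopOf (tripodHom₁ a) x + loopOf (tripodHom₂ a) x = tripodLoop a x :=
    fun x => rfl
  refine killsTripods_of ?_ ?_ ?_ ?_ ?_
  · intro x y z E c hc h hE
    obtain ⟨hxy, hxz, hyz⟩ := nodup_of_isHairy_tripod (l := []) h
    rcases hE with rfl | rfl
    · rw [LinearMap.add_apply, chordFunctional_of_eq_zero _ (by simp),
        chordFunctional_of_eq_zero _ (by simp), add_zero]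
    · have hval : ∀ (s : Letters →ₐ[ℚ] Letters) (hs : IsChordMap s 1),
          chordFunctional hs (of ⟨[tripod x y z], {(y, z)}, c⟩) = -loopOf s (c x) := by
        intro s hs
        obtain ⟨hcy, hcz⟩ := chordColor_one (s := s) c hyz
        rw [← treeOf_eq h, chordFunctional_treeOf hs h (L := [(y, z)]) (by simp) (by simp) rfl,
          chordValue, treePairing, tripod, RTree.lie, RTree.lie, RTree.lie, RTree.lie, hcy, hcz,
          chordColor_of_notMem _ (by simp [ends, hxy, hxz]), loopOf_apply, radL_of_isLie s (hc x),
          sub_mul, sub_mul, map_sub, map_sub]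
        ring
      rw [LinearMap.add_apply, hval, hval, ← neg_add, hsum, tripodLoop_of_isLie a (hc x), neg_zero]
  · intro T i x y z D c hc h hi hD
    rw [LinearMap.add_apply, LinearMap.add_apply, chordFunctional_cherry _ h hi hD,
      chordFunctional_cherry _ h hi hD]
  · intro T i x y z D c hc h hi hD
    obtain ⟨X, hX, hval⟩ := exists_selfLink_value hc h hi hD
    rw [LinearMap.add_apply, hval, hval, ← neg_add, hsum, tripodLoop_of_isLie a hX, neg_zero]
  · intro i j z c hc hij
    refine ⟨0, fun _ => 0, fun _ _ _ _ _ _ _ _ => rfl, fun _ => .zero, fun T x y D h hi hj hD => ?_⟩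
    rw [LinearMap.zero_apply]
    obtain ⟨hxy, hxz, hyz⟩ := nodup_of_isHairy_tripod (l := [T]) h
    have hnotD : ∀ {i u}, u ∈ [x, y, z] → (i, u) ∉ D :=
      fun hu h' => hD _ (mem_endpoints.2 ⟨_, h', .inr rfl⟩) hu
    by_cases hD0 : D = ∅
    swap
    · have hcard : ∀ p : ℕ × ℕ, p ∉ D → (insert p D).card ≠ 1 := fun p hp => by
        rw [Finset.card_insert_of_notMem hp]
        have := Finset.card_pos.2 (Finset.nonempty_iff_ne_empty.2 hD0)
        omega
      rw [LinearMap.add_apply, map_add, map_add,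
        chordFunctional_treeOf_eq_zero _ (hcard _ (hnotD (by simp))),
        chordFunctional_treeOf_eq_zero _ (hcard _ (hnotD (by simp))),
        chordFunctional_treeOf_eq_zero _ (hcard _ (hnotD (by simp))),
        chordFunctional_treeOf_eq_zero _ (hcard _ (hnotD (by simp)))]
      simp
    subst hD0
    have h1 := IsHairy.subst h (i := i) (j := x) (by simp) hi (by simp)
    have h2 := IsHairy.subst h (i := j) (j := y) (by simp) hj (by simp)
    rw [tripod_cut₁, union_erase_two₁ (by simp) (by simp [hxy])] at h1
    rw [tripod_cut₂ z hxy.symm, union_erase_two₂ (by simp) (by simp [hxy])] at h2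
    have hnT : ∀ u ∈ [x, y, z], u ∉ T.legs := fun u hu h' => legs_disjoint h h' hu
    have hjy : j ≠ y := by rintro rfl; exact hnT j (by simp) hj
    have hix : i ≠ x := by rintro rfl; exact hnT i (by simp) hi
    have hval : ∀ (s : Letters →ₐ[ℚ] Letters) (hs : IsChordMap s 1),
        chordFunctional hs (treeOf [] (insert (j, y) ∅) c (T.subst i (.node (.leaf y) (.leaf z))) +
          treeOf [] (insert (i, x) ∅) c (T.subst j (.node (.leaf z) (.leaf x)))) =
        treePairing loopFunctional (Function.update (chordColor s c [(j, y)]) i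
          ((RTree.node (.leaf y) (.leaf z)).lie (chordColor s c [(j, y)]))) T +
        treePairing loopFunctional (Function.update (chordColor s c [(i, x)]) j
          ((RTree.node (.leaf z) (.leaf x)).lie (chordColor s c [(i, x)]))) T := by
      intro s hs
      rw [map_add, chordFunctional_treeOf hs h1 (L := [(j, y)]) (by simp) (by simp) rfl,
        chordFunctional_treeOf hs h2 (L := [(i, x)]) (by simp) (by simp) rfl, chordValue_subst,
        chordValue_subst]
    have hcomb : ∀ (s : Letters →ₐ[ℚ] Letters),
        (∀ n, relabelHom (transp 0 1) (s (letter n)) = s (letter n)) → ∀ w : List ℕ,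
        (j :: i :: w).Perm T.legs →
        treePairing loopFunctional (Function.update (chordColor s c [(j, y)]) i
          ((RTree.node (.leaf y) (.leaf z)).lie (chordColor s c [(j, y)])))
            ⟨RTree.comb (.leaf i) w, .leaf j⟩ +
        treePairing loopFunctional (Function.update (chordColor s c [(i, x)]) j
          ((RTree.node (.leaf z) (.leaf x)).lie (chordColor s c [(i, x)])))
            ⟨RTree.comb (.leaf i) w, .leaf j⟩ =
        loopOf s ((w.map c).prod * c z) - loopOf s (c z * (w.map c).prod) := by
      intro s hs w hw
      have hnd := hw.nodup_iff.2 (legs_nodup_fst h)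
      simp only [List.nodup_cons, List.mem_cons, not_or] at hnd
      have hwT : ∀ k ∈ w, k ∈ T.legs ∧ k ≠ i ∧ k ≠ j := fun k hk =>
        ⟨hw.mem_iff.1 (by simp [hk]), fun h' => hnd.2.1 (h' ▸ hk), fun h' => hnd.1.2 (h' ▸ hk)⟩
      obtain ⟨hc1, hc2⟩ := chordColor_one (s := s) c hjy
      obtain ⟨hc3, hc4⟩ := chordColor_one (s := s) c hix
      have hne : ∀ {k u}, k ∈ T.legs → u ∈ [x, y, z] → k ≠ u := fun hk hu h' =>
        hnT _ hu (h' ▸ hk)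
      rw [treePairing_comb hc (s := s) fun k hk => ?_, treePairing_comb hc (s := s) fun k hk => ?_]
      · simp only [RTree.lie]
        rw [Function.update_self, Function.update_of_ne hij.symm, Function.update_of_ne hij,
          Function.update_self, hc1, hc3, hc2, hc4, chordColor_of_notMem _ (by simp [ends, hyz.symm, (hne hj (u := z) (by simp)).symm]),
          chordColor_of_notMem _ (by simp [ends, hxz.symm, (hne hi (u := z) (by simp)).symm]),
          ← radL_of_isLie s (hc z), ← radL_mul, loopOf_flip hs, loopOf_apply s (_ * c z), radL_mul,
          radL_of_isLie s (hc z), mul_sub, ← mul_assoc, ← mul_assoc, map_sub,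
          loopFunctional_comm _ (s (c z)), sub_mul, map_sub, mul_assoc (s (c z))]
        ring
      · obtain ⟨h1, h2, h3⟩ := hwT k hk
        rw [Function.update_of_ne h3, chordColor_of_notMem]
        simp [ends, h2, hne h1 (u := x)]
      · obtain ⟨h1, h2, h3⟩ := hwT k hk
        rw [Function.update_of_ne h2, chordColor_of_notMem]
        simp [ends, h3, hne h1 (u := y)]
    rw [LinearMap.add_apply, hval, hval]
    set d₁ : (Letters →ₐ[ℚ] Letters) → ℕ → Letters := fun s => Function.update
      (chordColor s c [(j, y)]) i ((RTree.node (.leaf y) (.leaf z)).lie (chordColor s c [(j, y)]))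
    set d₂ : (Letters →ₐ[ℚ] Letters) → ℕ → Letters := fun s => Function.update
      (chordColor s c [(i, x)]) j ((RTree.node (.leaf z) (.leaf x)).lie (chordColor s c [(i, x)]))
    have htree := fun (d : ℕ → Letters) => isTreeFun_treePairing loopFunctional_comm d
    have hF := ((htree (d₁ (tripodHom₁ a))).add (htree (d₂ (tripodHom₁ a)))).add
      ((htree (d₁ (tripodHom₂ a))).add (htree (d₂ (tripodHom₂ a))))
    refine hF.eq_zero_of_comb hi hj hij fun w hw => ?_
    rw [hcomb _ (relabel_tripodHom₁ a) w hw, hcomb _ (relabel_tripodHom₂ a) w hw]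
    have := tripodLoop_comm a (w.map c).prod (c z)
    rw [← hsum, ← hsum] at this
    linarith
  · intro T i j k x y z D c hc h hi hj hk hD
    obtain ⟨hxy, hxz, hyz⟩ := nodup_of_isHairy_tripod (l := [T]) h
    have hnotD : ∀ {i u}, u ∈ [x, y, z] → (i, u) ∉ D :=
      fun hu h' => hD _ (mem_endpoints.2 ⟨_, h', .inr rfl⟩) hu
    have hcard : ∀ (s : Letters →ₐ[ℚ] Letters) (hs : IsChordMap s 1) (T : JTree) (p q u v : ℕ),
        u ∈ [x, y, z] → v ∈ [x, y, z] → u ≠ v →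
        chordFunctional hs (treeOf [] (insert (p, u) (insert (q, v) D)) c T) = 0 := by
      intro s hs T p q u v hu hv huv
      refine chordFunctional_treeOf_eq_zero hs ?_
      rw [Finset.card_insert_of_notMem (by simp [huv, hnotD hu]),
        Finset.card_insert_of_notMem (hnotD hv)]
      omega
    simp only [LinearMap.add_apply, map_add]
    simp [hcard, hxy, hxz, hyz]

/-- Colours for which the letters `0` and `1` are free. -/
def shiftHom : Letters →ₐ[ℚ] Letters := relabelHom (· + 2)

lemma isLie_shiftHom {x : Letters} (hx : IsLie x) : IsLie (shiftHom x) :=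
  hx.map fun n => by rw [shiftHom, relabelHom_letter]; exact .letter _

lemma tripodHom₁_shiftHom (a x : Letters) : tripodHom₁ a (shiftHom x) = hairHom x := by
  have : (tripodHom₁ a).comp shiftHom = hairHom := algHom_ext_letter fun n => by
    rw [AlgHom.comp_apply, shiftHom, relabelHom_letter, tripodHom₁_add_two, hairHom_letter]
  exact DFunLike.congr_fun this x

lemma tripodHom₂_shiftHom (a x : Letters) : tripodHom₂ a (shiftHom x) = hairHom x := by
  have : (tripodHom₂ a).comp shiftHom = hairHom := algHom_ext_letter fun n => by
    rw [AlgHom.comp_apply, shiftHom, relabelHom_letter, tripodHom₂_add_two, hairHom_letter]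
  exact DFunLike.congr_fun this x

lemma ne_of_mem_legs {T : JTree} {x y z k : ℕ} {D : Finset (ℕ × ℕ)} {c : ℕ → Letters}
    (h : Graph.IsHairy ⟨[T, tripod x y z], D, c⟩) (hk : k ∈ T.legs) : k ≠ x ∧ k ≠ y ∧ k ≠ z := by
  refine ⟨?_, ?_, ?_⟩ <;> rintro rfl <;> exact legs_disjoint h hk (by simp)

lemma mem_legs_of_dot {T U : JTree} {D E : Finset (ℕ × ℕ)} {c : ℕ → Letters}
    (h : Graph.IsHairy ⟨[T, U], D ∪ E, c⟩) (hD : ∀ i ∈ endpoints D, i ∉ U.legs) {i : ℕ}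
    (hi : i ∈ endpoints D) : i ∈ T.legs := by
  have := endpoints_subset_legs h (endpoints_mono Finset.subset_union_left hi)
  simpa [hD i hi] using this

/-- The two-loop functional vanishes on the image of `β`. -/
lemma killsTripods_hairHom : KillsTripods (chordFunctional isChordMap_hairHom) := by
  refine killsTripods_of ?_ ?_ ?_ ?_ ?_
  · intro x y z E c _ _ hE
    refine chordFunctional_of_eq_zero _ ?_
    rcases hE with rfl | rfl <;> simp
  · intro T i x y z D c _ h hi hD
    exact chordFunctional_cherry _ h hi hD
  · intro T i x y z D c hc h hi hD
    obtain ⟨hxy, hxz, hyz⟩ := nodup_of_isHairy_tripod (l := [T]) h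
    have hnotD : ∀ {i u}, u ∈ [x, y, z] → (i, u) ∉ D :=
      fun hu h' => hD _ (mem_endpoints.2 ⟨_, h', .inr rfl⟩) hu
    have hcard : (insert (y, z) D).card = D.card + 1 :=
      Finset.card_insert_of_notMem (hnotD (by simp))
    by_cases hD1 : D.card = 1
    swap
    · exact chordFunctional_treeOf_eq_zero _ (by omega)
    obtain ⟨⟨p, q⟩, rfl⟩ := Finset.card_eq_one.1 hD1
    have h1 := IsHairy.subst h (i := i) (j := x) (by simp) hi (by simp)
    rw [tripod_cut₁, union_erase_two₁ (hnotD (by simp)) (by simp [hxz])] at h1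
    have hpe : p ∈ endpoints {(p, q)} := mem_endpoints.2 ⟨(p, q), by simp, .inl rfl⟩
    have hqe : q ∈ endpoints {(p, q)} := mem_endpoints.2 ⟨(p, q), by simp, .inr rfl⟩
    have hp : p ∈ T.legs := mem_legs_of_dot h (by simpa using hD) hpe
    have hq : q ∈ T.legs := mem_legs_of_dot h (by simpa using hD) hqe
    have hpq : p ≠ q := h.matching.1 (p, q) (by simp)
    have hie := (notMem_endpoints h.matching (e := (i, x)) (by simp) (hnotD (by simp))).1
    have hip : i ≠ p := fun h' => hie (h' ▸ hpe)
    have hiq : i ≠ q := fun h' => hie (h' ▸ hqe)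
    obtain ⟨-, hpy, hpz⟩ := ne_of_mem_legs h hp
    obtain ⟨-, hqy, hqz⟩ := ne_of_mem_legs h hq
    obtain ⟨c1, c2, c3, c4⟩ := chordColor_two (s := hairHom) c (p := p) (q := q) (p' := y) (q' := z)
      (by simp [hpq, hpy, hpz, hqy, hqz, hyz])
    rw [chordFunctional_treeOf _ h1 (L := [(p, q), (y, z)]) (by simp [hpy])
      (by simp [Finset.pair_comm]) rfl, chordValue_subst]
    refine (isTreeFun_treePairing loopFunctional_comm _).eq_zero_of_comb hp hq hpq fun w hw => ?_
    have hnd := hw.nodup_iff.2 (legs_nodup_fst h)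
    simp only [List.nodup_cons, List.mem_cons, not_or] at hnd
    have hiw : i ∈ w := by
      have := hw.mem_iff.2 hi
      simpa [hip, hiq] using this
    obtain ⟨u, v, rfl⟩ := List.append_of_mem hiw
    have hnd' := hnd.2.2
    rw [List.nodup_middle, List.nodup_cons] at hnd'
    have hd : ∀ k ∈ u ++ v, Function.update (chordColor hairHom c [(p, q), (y, z)]) i
        ((RTree.node (.leaf y) (.leaf z)).lie (chordColor hairHom c [(p, q), (y, z)])) k =
        hairHom (c k) := by
      intro k hk
      have hkw : k ∈ u ++ i :: v := by
        simp only [List.mem_append, List.mem_cons] at hk ⊢; tauto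
      have hkT : k ∈ T.legs := hw.mem_iff.1 (List.mem_cons_of_mem _ (List.mem_cons_of_mem _ hkw))
      have hki : k ≠ i := fun h' => hnd'.1 (h' ▸ hk)
      have hkp : k ≠ p := fun h' => hnd.2.1 (h' ▸ hkw)
      have hkq : k ≠ q := fun h' => hnd.1.2 (h' ▸ hkw)
      rw [Function.update_of_ne hki, chordColor_of_notMem]
      simp [ends, hkp, hkq, ne_of_mem_legs h hkT]
    rw [treePairing_comb_chain hc hd, Function.update_self,
      Function.update_of_ne hip.symm, Function.update_of_ne hiq.symm]
    simp only [RTree.lie]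
    rw [c1, c2, c3, c4]
    exact chain_selfLink _ _
  · intro i j z c hc hij
    refine ⟨_, Function.update (Function.update (fun k => shiftHom (c k)) i (letter 0)) j (letter 1),
      killsTripods_tripodHom (c z), fun k => ?_, fun T x y D h hi hj hD => ?_⟩
    · by_cases h1 : k = j
      · subst h1; rw [Function.update_self]; exact .letter 1
      · rw [Function.update_of_ne h1]
        by_cases h2 : k = i
        · subst h2; rw [Function.update_self]; exact .letter 0
        · rw [Function.update_of_ne h2]; exact isLie_shiftHom (hc k)
    obtain ⟨hxy, hxz, hyz⟩ := nodup_of_isHairy_tripod (l := [T]) h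
    have hnotD : ∀ {i u}, u ∈ [x, y, z] → (i, u) ∉ D :=
      fun hu h' => hD _ (mem_endpoints.2 ⟨_, h', .inr rfl⟩) hu
    rw [LinearMap.add_apply, map_add]
    by_cases hD1 : D.card = 1
    swap
    · have hcard : ∀ p : ℕ × ℕ, p ∉ D → (insert p D).card ≠ 2 := fun p hp => by
        rw [Finset.card_insert_of_notMem hp]; omega
      rw [chordFunctional_treeOf_eq_zero _ (hcard _ (hnotD (by simp))),
        chordFunctional_treeOf_eq_zero _ (hcard _ (hnotD (by simp))),
        chordFunctional_of_eq_zero _ hD1, chordFunctional_of_eq_zero _ hD1]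
    obtain ⟨⟨p, q⟩, rfl⟩ := Finset.card_eq_one.1 hD1
    have h1 := IsHairy.subst h (i := i) (j := x) (by simp) hi (by simp)
    have h2 := IsHairy.subst h (i := j) (j := y) (by simp) hj (by simp)
    rw [tripod_cut₁, union_erase_two₁ (hnotD (by simp)) (by simp [hxy])] at h1
    rw [tripod_cut₂ z hxy.symm, union_erase_two₂ (hnotD (by simp)) (by simp [hxy])] at h2
    have h3 : ∀ d : ℕ → Letters, Graph.IsHairy ⟨[T], {(p, q)}, d⟩ := fun d =>
      IsHairy.of_append (l' := [tripod x y z]) d h (by simpa using hD)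
    have hpe : p ∈ endpoints {(p, q)} := mem_endpoints.2 ⟨(p, q), by simp, .inl rfl⟩
    have hqe : q ∈ endpoints {(p, q)} := mem_endpoints.2 ⟨(p, q), by simp, .inr rfl⟩
    have hp : p ∈ T.legs := mem_legs_of_dot h (by simpa using hD) hpe
    have hq : q ∈ T.legs := mem_legs_of_dot h (by simpa using hD) hqe
    have hpq : p ≠ q := h.matching.1 (p, q) (by simp)
    have hie := (notMem_endpoints h.matching (e := (i, x)) (by simp) (hnotD (by simp))).1
    have hje := (notMem_endpoints h.matching (e := (j, y)) (by simp) (hnotD (by simp))).1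
    have hip : i ≠ p := fun h' => hie (h' ▸ hpe)
    have hiq : i ≠ q := fun h' => hie (h' ▸ hqe)
    have hjp : j ≠ p := fun h' => hje (h' ▸ hpe)
    have hjq : j ≠ q := fun h' => hje (h' ▸ hqe)
    obtain ⟨hpx, hpy, hpz⟩ := ne_of_mem_legs h hp
    obtain ⟨hqx, hqy, hqz⟩ := ne_of_mem_legs h hq
    obtain ⟨hix, -, hiz⟩ := ne_of_mem_legs h hi
    obtain ⟨-, hjy, hjz⟩ := ne_of_mem_legs h hj
    obtain ⟨c1, c2, c3, c4⟩ := chordColor_two (s := hairHom) c (p := p) (q := q) (p' := j) (q' := y)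
      (by simp [hpq, hjp.symm, hpy, hjq.symm, hqy, hjy])
    obtain ⟨e1, e2, e3, e4⟩ := chordColor_two (s := hairHom) c (p := p) (q := q) (p' := i) (q' := x)
      (by simp [hpq, hip.symm, hpx, hiq.symm, hqx, hix])
    have hz1 : chordColor hairHom c [(p, q), (j, y)] z = hairHom (c z) :=
      chordColor_of_notMem _ (by simp [ends, hpz.symm, hqz.symm, hjz.symm, hyz.symm])
    have hz2 : chordColor hairHom c [(p, q), (i, x)] z = hairHom (c z) :=
      chordColor_of_notMem _ (by simp [ends, hpz.symm, hqz.symm, hiz.symm, hxz.symm])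
    rw [chordFunctional_treeOf _ h1 (L := [(p, q), (j, y)]) (by simp [hjp.symm])
      (by simp [Finset.pair_comm]) rfl, chordFunctional_treeOf _ h2 (L := [(p, q), (i, x)])
      (by simp [hip.symm]) (by simp [Finset.pair_comm]) rfl, chordValue_subst, chordValue_subst,
      ← treeOf_eq (h3 _), chordFunctional_treeOf _ (h3 _) (L := [(p, q)]) (by simp) (by simp) rfl,
      chordFunctional_treeOf _ (h3 _) (L := [(p, q)]) (by simp) (by simp) rfl, chordValue, chordValue]
    congr 1
    · refine treePairing_congr _ fun k hk => ?_
      by_cases hki : k = i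
      · subst hki
        rw [Function.update_self, chordColor_of_notMem _ (by simp [ends, hip, hiq]),
          Function.update_of_ne hij, Function.update_self, tripodHom₁_zero,
          radL_of_isLie _ (hc z)]
        simp only [RTree.lie]
        rw [c4, hz1]
      rw [Function.update_of_ne hki]
      by_cases hkj : k = j
      · subst hkj
        rw [c3, chordColor_of_notMem _ (by simp [ends, hjp, hjq]), Function.update_self,
          tripodHom₁_one]
      obtain ⟨f1, f2⟩ := chordColor_one (s := tripodHom₁ (c z)) (Function.update (Function.update
        (fun k => shiftHom (c k)) i (letter 0)) j (letter 1)) hpq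
      by_cases hkp : k = p
      · subst hkp; rw [c1, f1]
      by_cases hkq : k = q
      · subst hkq; rw [c2, f2]
      rw [chordColor_of_notMem _ (by simp [ends, hkp, hkq, hkj, ne_of_mem_legs h hk]),
        chordColor_of_notMem _ (by simp [ends, hkp, hkq]), Function.update_of_ne hkj,
        Function.update_of_ne hki, tripodHom₁_shiftHom]
    · refine treePairing_congr _ fun k hk => ?_
      by_cases hkj : k = j
      · subst hkj
        rw [Function.update_self, chordColor_of_notMem _ (by simp [ends, hjp, hjq]),
          Function.update_self, tripodHom₂_one, lad_of_isLie _ (hc z)]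
        simp only [RTree.lie]
        rw [e4, hz2]
      rw [Function.update_of_ne hkj]
      by_cases hki : k = i
      · subst hki
        rw [e3, chordColor_of_notMem _ (by simp [ends, hip, hiq]), Function.update_of_ne hij,
          Function.update_self, tripodHom₂_zero]
      obtain ⟨f1, f2⟩ := chordColor_one (s := tripodHom₂ (c z)) (Function.update (Function.update
        (fun k => shiftHom (c k)) i (letter 0)) j (letter 1)) hpq
      by_cases hkp : k = p
      · subst hkp; rw [e1, f1]
      by_cases hkq : k = q
      · subst hkq; rw [e2, f2]
      rw [chordColor_of_notMem _ (by simp [ends, hkp, hkq, hki, ne_of_mem_legs h hk]),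
        chordColor_of_notMem _ (by simp [ends, hkp, hkq]), Function.update_of_ne hkj,
        Function.update_of_ne hki, tripodHom₂_shiftHom]
  · intro T i j k x y z D c hc h hi hj hk hD
    obtain ⟨hxy, hxz, hyz⟩ := nodup_of_isHairy_tripod (l := [T]) h
    have hnotD : ∀ {i u}, u ∈ [x, y, z] → (i, u) ∉ D :=
      fun hu h' => hD _ (mem_endpoints.2 ⟨_, h', .inr rfl⟩) hu
    have hcard : ∀ (p q u v : ℕ), u ∈ [x, y, z] → v ∈ [x, y, z] → u ≠ v →
        (insert (p, u) (insert (q, v) D)).card = D.card + 2 := by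
      intro p q u v hu hv huv
      rw [Finset.card_insert_of_notMem (by simp [huv, hnotD hu]),
        Finset.card_insert_of_notMem (hnotD hv)]
    by_cases hD0 : D = ∅
    swap
    · have hpos := Finset.card_pos.2 (Finset.nonempty_iff_ne_empty.2 hD0)
      rw [map_add, map_add, chordFunctional_treeOf_eq_zero, chordFunctional_treeOf_eq_zero,
        chordFunctional_treeOf_eq_zero, add_zero, add_zero]
      all_goals
        rw [hcard _ _ _ _ (by simp) (by simp) (by assumption)]
        omega
    subst hD0
    have h1 := IsHairy.subst h (i := i) (j := x) (by simp) hi (by simp)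
    have h2 := IsHairy.subst h (i := j) (j := y) (by simp) hj (by simp)
    have h3 := IsHairy.subst h (i := k) (j := z) (by simp) hk (by simp)
    rw [tripod_cut₁, union_erase_three₁ (by simp) (by simp [hxy]) (by simp [hxz])] at h1
    rw [tripod_cut₂ z hxy.symm, union_erase_three₂ (by simp) (by simp [hxy]) (by simp [hyz])] at h2
    rw [tripod_cut₃ hxz.symm hyz.symm,
      union_erase_three₃ (by simp) (by simp [hxz]) (by simp [hyz])] at h3
    have hne : ∀ {k u}, k ∈ T.legs → u ∈ [x, y, z] → k ≠ u := fun hk hu h' =>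
      legs_disjoint h (h' ▸ hk) hu
    have hij : i ≠ j := (h.matching.2 (i, x) (by simp) (j, y) (by simp) (by simp [hxy])).1
    have hik : i ≠ k := (h.matching.2 (i, x) (by simp) (k, z) (by simp) (by simp [hxz])).1
    have hjk : j ≠ k := (h.matching.2 (j, y) (by simp) (k, z) (by simp) (by simp [hyz])).1
    obtain ⟨hix, hiy, hiz⟩ := ne_of_mem_legs h hi
    obtain ⟨hjx, hjy, hjz⟩ := ne_of_mem_legs h hj
    obtain ⟨hkx, hky, hkz⟩ := ne_of_mem_legs h hk
    obtain ⟨c1, c2, c3, c4⟩ := chordColor_two (s := hairHom) c (p := j) (q := y) (p' := k) (q' := z)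
      (by simp [hjy, hjk, hjz, hky.symm, hyz, hkz])
    obtain ⟨d1, d2, d3, d4⟩ := chordColor_two (s := hairHom) c (p := i) (q := x) (p' := k) (q' := z)
      (by simp [hix, hik, hiz, hkx.symm, hxz, hkz])
    obtain ⟨e1, e2, e3, e4⟩ := chordColor_two (s := hairHom) c (p := i) (q := x) (p' := j) (q' := y)
      (by simp [hix, hij, hiy, hjx.symm, hxy, hjy])
    rw [map_add, map_add, chordFunctional_treeOf _ h1 (L := [(j, y), (k, z)]) (by simp [hjk])
      (by simp) rfl, chordFunctional_treeOf _ h2 (L := [(i, x), (k, z)]) (by simp [hik])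
      (by simp) rfl, chordFunctional_treeOf _ h3 (L := [(i, x), (j, y)]) (by simp [hij])
      (by simp) rfl, chordValue_subst, chordValue_subst, chordValue_subst]
    have htree := fun (d : ℕ → Letters) => isTreeFun_treePairing loopFunctional_comm d
    refine ((htree _).add ((htree _).add (htree _))).eq_zero_of_comb hi hj hij fun w hw => ?_
    have hnd := hw.nodup_iff.2 (legs_nodup_fst h)
    simp only [List.nodup_cons, List.mem_cons, not_or] at hnd
    have hkw : k ∈ w := by
      have := hw.mem_iff.2 hk
      simpa [hik.symm, hjk.symm] using this
    obtain ⟨u, v, rfl⟩ := List.append_of_mem hkw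
    have hnd' := hnd.2.2
    rw [List.nodup_middle, List.nodup_cons] at hnd'
    have hcol : ∀ (a b a' b' e : ℕ) (Y : Letters), [a, a', e].Perm [i, j, k] → b ∈ [x, y, z] →
        b' ∈ [x, y, z] → ∀ m ∈ u ++ v,
        Function.update (chordColor hairHom c [(a, b), (a', b')]) e Y m = hairHom (c m) := by
      intro a b a' b' e Y hp hb hb' m hm
      have hmw : m ∈ u ++ k :: v := by
        simp only [List.mem_append, List.mem_cons] at hm ⊢; tauto
      have hmT : m ∈ T.legs := hw.mem_iff.1 (List.mem_cons_of_mem _ (List.mem_cons_of_mem _ hmw))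
      have hm' : m ∉ [a, a', e] := by
        rw [hp.mem_iff]
        simp only [List.mem_cons, List.not_mem_nil, or_false, not_or]
        exact ⟨fun h' => hnd.2.1 (h' ▸ hmw), fun h' => hnd.1.2 (h' ▸ hmw),
          fun h' => hnd'.1 (h' ▸ hm)⟩
      simp only [List.mem_cons, List.not_mem_nil, or_false, not_or] at hm'
      rw [Function.update_of_ne hm'.2.2, chordColor_of_notMem]
      simp [ends, hm', hne hmT hb, hne hmT hb']
    have hp1 : [j, k, i].Perm [i, j, k] := (List.perm_append_comm (l₁ := [j, k]) (l₂ := [i]))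
    have hp2 : [i, k, j].Perm [i, j, k] := .cons _ (.swap _ _ _)
    have l1 := hcol j y k z i
      ((RTree.node (.leaf y) (.leaf z)).lie (chordColor hairHom c [(j, y), (k, z)])) hp1
      (by simp) (by simp)
    have l2 := hcol i x k z j
      ((RTree.node (.leaf z) (.leaf x)).lie (chordColor hairHom c [(i, x), (k, z)])) hp2
      (by simp) (by simp)
    have l3 := hcol i x j y k
      ((RTree.node (.leaf x) (.leaf y)).lie (chordColor hairHom c [(i, x), (j, y)])) (.refl _)
      (by simp) (by simp)
    rw [treePairing_comb_chain hc l1, treePairing_comb_chain hc l2, treePairing_comb_chain hc l3]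
    simp only [Function.update_self, Function.update_of_ne hij, Function.update_of_ne hij.symm,
      Function.update_of_ne hik, Function.update_of_ne hik.symm, Function.update_of_ne hjk,
      Function.update_of_ne hjk.symm, RTree.lie, c1, c2, c3, c4, d1, d2, d3, d4, e1, e2, e3, e4]
    exact chain_threeLink _ _

/-! ### Trees with two dotted edges and four hairs -/

/-- The colouring of the leaves `4, 5, 6, 7` by the components of `y`. -/
def hairColor {M : Type*} [Zero M] (y : Fin 4 → M) : ℕ → M
  | 4 => y 0
  | 5 => y 1
  | 6 => y 2
  | 7 => y 3
  | _ => 0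

lemma hairColor_add {M : Type*} [Zero M] (y : Fin 4 → M) (i : Fin 4) : hairColor y (i + 4) = y i := by
  fin_cases i <;> rfl

lemma hairColor_update {M : Type*} [Zero M] (y : Fin 4 → M) (i : Fin 4) (x : M) :
    hairColor (Function.update y i x) = Function.update (hairColor y) (i + 4) x := by
  funext j
  by_cases hj : j < 8
  · interval_cases j <;> fin_cases i <;> simp [hairColor, Function.update]
  · obtain ⟨j, rfl⟩ := Nat.exists_eq_add_of_le' (not_lt.1 hj)
    rw [Function.update_of_ne (by omega)]
    simp [hairColor]

lemma map_hairColor {M N : Type*} [AddCommGroup M] [Module ℚ M] [AddCommGroup N] [Module ℚ N]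
    (φ : M →ₗ[ℚ] N) (y : Fin 4 → M) (i : ℕ) : φ (hairColor y i) = hairColor (φ ∘ y) i := by
  unfold hairColor
  split <;> simp

section

variable {H : Type*} [AddCommGroup H] [Module ℚ H]

lemma isHairy_of_legs_perm {T : JTree} (hT : T.legs.Perm (List.range 8)) {D : Finset (ℕ × ℕ)}
    (hD : IsMatching D) (hD' : endpoints D ⊆ Finset.range 8) (c : ℕ → H) :
    Graph.IsHairy ⟨[T], D, c⟩ where
  nodup := by simpa [Graph.legs] using hT.nodup_iff.2 List.nodup_range
  tri U hU := by
    rw [List.mem_singleton.1 hU]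
    have := T.length_legs
    rw [hT.length_eq, List.length_range] at this
    omega
  matching := hD
  sub i hi := by
    have := hD' hi
    simpa [Graph.legs, hT.mem_iff] using this

lemma isHairy_two_of_legs_perm {T : JTree} (hT : T.legs.Perm (List.range 8)) (c : ℕ → H) :
    Graph.IsHairy ⟨[T], {(0, 1), (2, 3)}, c⟩ :=
  isHairy_of_legs_perm hT (by decide) (by decide) c

lemma mem_hairs_of_legs_perm {T : JTree} (hT : T.legs.Perm (List.range 8)) (c : ℕ → H) (i : Fin 4) :
    (i : ℕ) + 4 ∈ Graph.hairs ⟨[T], {(0, 1), (2, 3)}, c⟩ := by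
  simp only [Graph.hairs, Graph.legs, List.flatMap_cons, List.flatMap_nil, List.append_nil,
    Finset.mem_sdiff, List.mem_toFinset, hT.mem_iff, List.mem_range]
  refine ⟨by omega, ?_⟩
  fin_cases i <;> decide

/-- A linear combination of trees with two dotted edges as a function of the colours of the four
hairs. -/
def hairMap (L : List (ℤ × JTree)) (hL : ∀ p ∈ L, p.2.legs.Perm (List.range 8)) :
    MultilinearMap ℚ (fun _ : Fin 4 => H) (HLG H) where
  toFun y := treeSum (treeOf [] {(0, 1), (2, 3)} (hairColor y)) L
  map_update_add' {inst} y i x x' := by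
    rw [Subsingleton.elim inst (instDecidableEqFin 4)]
    simp only [hairColor_update, treeSum, ← List.sum_map_add]
    congr 1
    refine List.map_congr_left fun p hp => ?_
    have h : ∀ c : ℕ → H, _ := fun c => isHairy_two_of_legs_perm (hL p hp) c
    rw [← smul_add, treeOf_eq (h _), treeOf_eq (h _), treeOf_eq (h _)]
    congr 1
    have := rel_zero (Rel.add [p.2] {(0, 1), (2, 3)} (hairColor y) (i + 4) x x' (h _)
      (mem_hairs_of_legs_perm (hL p hp) _ i))
    rw [← sub_eq_zero]
    simpa [sub_sub] using this
  map_update_smul' {inst} y i a x := by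
    rw [Subsingleton.elim inst (instDecidableEqFin 4)]
    simp only [hairColor_update, treeSum, List.smul_sum, List.map_map]
    congr 1
    refine List.map_congr_left fun p hp => ?_
    have h : ∀ c : ℕ → H, _ := fun c => isHairy_two_of_legs_perm (hL p hp) c
    rw [Function.comp_apply, treeOf_eq (h _), treeOf_eq (h _), smul_comm]
    congr 1
    have := rel_zero (Rel.smul [p.2] {(0, 1), (2, 3)} (hairColor y) (i + 4) a x (h _)
      (mem_hairs_of_legs_perm (hL p hp) _ i))
    rw [← sub_eq_zero]
    simpa using this

lemma hairMap_apply (L : List (ℤ × JTree)) (hL : ∀ p ∈ L, p.2.legs.Perm (List.range 8)) (y : Fin 4 → H) :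
    hairMap L hL y = treeSum (treeOf [] {(0, 1), (2, 3)} (hairColor y)) L := rfl

lemma hairMap_mem_C (L : List (ℤ × JTree)) (hL : ∀ p ∈ L, p.2.legs.Perm (List.range 8)) (y : Fin 4 → H) :
    hairMap L hL y ∈ C H 1 2 6 := by
  rw [hairMap_apply, treeSum]
  refine list_sum_mem fun z hz => ?_
  obtain ⟨p, hp, rfl⟩ := List.mem_map.1 hz
  have h := isHairy_two_of_legs_perm (hL p hp) (hairColor y)
  rw [treeOf_eq h]
  have hn := p.2.length_legs
  rw [(hL p hp).length_eq, List.length_range] at hn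
  have hmem : of ⟨[p.2], {(0, 1), (2, 3)}, hairColor y⟩ ∈ C H 1 2 6 :=
    Submodule.subset_span ⟨_, ⟨h, rfl, rfl, by simp [Graph.lieDegree]; omega⟩, rfl⟩
  exact zsmul_mem hmem _

lemma mapHLG_hairMap {H' : Type*} [AddCommGroup H'] [Module ℚ H'] (φ : H →ₗ[ℚ] H')
    (L : List (ℤ × JTree)) (hL : ∀ p ∈ L, p.2.legs.Perm (List.range 8)) (y : Fin 4 → H) :
    mapHLG φ (hairMap L hL y) = hairMap L hL (φ ∘ y) := by
  have := map_treeSum (mapHLG φ).toAddMonoidHom (treeOf [] {(0, 1), (2, 3)} (hairColor y)) L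
  rw [hairMap_apply, hairMap_apply]
  refine this.trans (treeSum_congr fun p hp => ?_)
  have h : ∀ c : ℕ → H, _ := fun c => isHairy_two_of_legs_perm (hL p hp) c
  have h' : ∀ c : ℕ → H', _ := fun c => isHairy_two_of_legs_perm (hL p hp) c
  rw [treeOf_eq (h _), treeOf_eq (h' _)]
  change mapHLG φ (of _) = _
  rw [mapHLG_of]
  rw [Graph.recolor, show φ ∘ hairColor y = hairColor (φ ∘ y) from funext (map_hairColor φ y)]

end

/-! ### The two-loop functional on coloured trees -/

/-- The value of a tree with permuted hairs. -/
lemma loopValue_map_hairs (T : JTree) (σ : Equiv.Perm (Fin 4)) {t : ℕ → ℕ} (ht : ∀ i < 4, t i = i)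
    (ht' : ∀ i : Fin 4, t (i + 4) = σ i + 4) (hT : T.legs.Perm (List.range 8)) :
    loopValue (T.map t) = Equiv.Perm.sign σ * loopValue T := by
  induction σ using Equiv.Perm.swap_induction_on' generalizing t T with
  | one =>
    have : loopValue (T.map t) = loopValue T := by
      rw [loopValue, loopValue, treePairing_map]
      refine treePairing_congr _ fun i hi => ?_
      have hi8 : i < 8 := by simpa using hT.mem_iff.1 hi
      by_cases h4 : i < 4
      · simp [ht i h4]
      · have := ht' ⟨i - 4, by omega⟩
        simp only [Equiv.Perm.coe_one, id, Nat.sub_add_cancel (not_lt.1 h4)] at this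
        simp [this]
    simp [this]
  | mul_swap σ x y hxy ih =>
    have hx : (x : ℕ) + 4 ∈ [4, 5, 6, 7] := by fin_cases x <;> decide
    have hy : (y : ℕ) + 4 ∈ [4, 5, 6, 7] := by fin_cases y <;> decide
    have hxy' : (x : ℕ) + 4 ≠ y + 4 := by simpa [Fin.ext_iff] using hxy
    set τ := transp (x + 4) (y + 4) with hτ
    have hτ4 : ∀ i < 4, τ i = i := fun i hi => by
      rw [hτ, transp_eq_swap, Equiv.swap_apply_of_ne_of_ne] <;> omega
    have hττ : ∀ i, τ (τ i) = i := fun i => by rw [hτ, transp_eq_swap, Equiv.swap_apply_self]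
    have hτi : ∀ i : Fin 4, τ (i + 4) = Equiv.swap x y i + 4 := by
      intro i
      rw [hτ, transp_eq_swap, Equiv.swap_apply_def, Equiv.swap_apply_def]
      simp only [add_left_inj, Fin.val_inj]
      split_ifs <;> rfl
    have hperm : ∀ a ∈ [4, 5, 6, 7], ∀ b ∈ [4, 5, 6, 7],
        ((List.range 8).map (transp a b)).Perm (List.range 8) := by decide +kernel
    have hTτ : (T.map τ).legs.Perm (List.range 8) := by
      rw [JTree.map_legs]
      exact (hT.map τ).trans (hperm _ hx _ hy)
    have := ih (t := t ∘ τ) (T := T.map τ) (fun i hi => by simp [hτ4 i hi, ht i hi])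
      (fun i => by simp [hτi, ht']) hTτ
    rw [loopValue_transp hx hy hxy'] at this
    rw [Equiv.Perm.sign_mul, Equiv.Perm.sign_swap hxy]
    have hmap : (T.map τ).map (t ∘ τ) = T.map t := by
      simp only [JTree.map_eq_bind, JTree.bind_bind, RTree.bind, Function.comp, hττ]
    rw [hmap] at this
    simp [this]

/-- The value of a coloured tree is the value of the tree times a determinant. -/
lemma treePairing_hairColor (T : JTree) (hT : T.legs.Perm (List.range 8)) (y : Fin 4 → Fin 4 → ℚ) :
    treePairing loopFunctional (fun i => if i < 4 then letter i else
      hairColor (fun j => ∑ d, y j d • letter (d + 4)) i) T = Matrix.det y * loopValue T := by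
  have hnd : T.legs.Nodup := hT.nodup_iff.2 List.nodup_range
  set color : (Fin 4 → Fin 4 → ℚ) → ℕ → Letters := fun y i => if i < 4 then letter i else
    hairColor (fun j => ∑ d, y j d • letter (d + 4)) i with hcolor
  have hup : ∀ y (i : Fin 4) v, color (Function.update y i v) =
      Function.update (color y) (i + 4) (∑ d, v d • letter (d + 4)) := by
    intro y i v
    have h1 : (fun j => ∑ d, Function.update y i v j d • letter (d + 4)) =
        Function.update (fun j => ∑ d, y j d • letter (d + 4)) i (∑ d, v d • letter (d + 4)) := by
      funext j
      by_cases hj : j = i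
      · subst hj; simp
      · simp [hj]
    funext j
    rw [hcolor]
    simp only [h1, hairColor_update]
    by_cases hj : j = i + 4
    · subst hj; simp
    · simp [hj]
  have hlin : ∀ y (i : Fin 4), ∃ ψ : Letters →ₗ[ℚ] ℚ, ∀ v,
      treePairing loopFunctional (color (Function.update y i v)) T = ψ (∑ d, v d • letter (d + 4)) := by
    intro y i
    obtain ⟨ψ, hψ⟩ := exists_treePairing_update loopFunctional (color y) (i := i + 4)
      (by simp [hT.mem_iff]; omega) hnd
    exact ⟨ψ, fun v => by rw [hup, hψ]⟩
  let G : MultilinearMap ℚ (fun _ : Fin 4 => Fin 4 → ℚ) ℚ :=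
    { toFun := fun y => treePairing loopFunctional (color y) T
      map_update_add' := fun {inst} y i v w => by
        rw [Subsingleton.elim inst (instDecidableEqFin 4)]
        obtain ⟨ψ, hψ⟩ := hlin y i
        simp only [hψ, Pi.add_apply, add_smul, Finset.sum_add_distrib, map_add]
      map_update_smul' := fun {inst} y i a v => by
        rw [Subsingleton.elim inst (instDecidableEqFin 4)]
        obtain ⟨ψ, hψ⟩ := hlin y i
        simp only [hψ, Pi.smul_apply, smul_assoc, ← Finset.smul_sum, map_smul] }
  suffices h : G = loopValue T • (Matrix.detRowAlternating (R := ℚ) (n := Fin 4)).toMultilinearMap by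
    have := congrArg (fun F => F y) h
    rw [mul_comm]
    exact this
  refine Module.Basis.ext_multilinear (fun _ => Pi.basisFun ℚ (Fin 4)) fun f => ?_
  simp only [Pi.basisFun_apply]
  have hcol : ∀ i < 8, color (fun j => Pi.single (f j) 1) i =
      letter (if i < 4 then i else hairColor (fun j => (f j : ℕ) + 4) i) := by
    intro i hi
    simp only [hcolor]
    split_ifs with h4
    · rfl
    · interval_cases i <;> simp_all [hairColor, Pi.single_apply]
  set t : ℕ → ℕ := fun i => if i < 4 then i else hairColor (fun j => (f j : ℕ) + 4) i with ht
  have ht4 : ∀ i < 4, t i = i := fun i hi => by simp [ht, hi]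
  have htf : ∀ i : Fin 4, t (i + 4) = f i + 4 := fun i => by simp [ht, hairColor_add]
  have hG : G (fun j => Pi.single (f j) 1) = loopValue (T.map t) := by
    rw [loopValue, treePairing_map]
    change treePairing loopFunctional (color _) T = _
    exact treePairing_congr _ fun i hi => hcol i (by simpa using hT.mem_iff.1 hi)
  rw [hG, smul_apply]
  by_cases hf : Function.Injective f
  · obtain ⟨σ, rfl⟩ : ∃ σ : Equiv.Perm (Fin 4), ⇑σ = f :=
      ⟨Equiv.ofBijective f (Finite.injective_iff_bijective.1 hf), rfl⟩
    rw [loopValue_map_hairs T σ ht4 htf hT, smul_eq_mul, mul_comm]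
    congr 1
    change _ = Matrix.det _
    rw [← Matrix.det_permutation]
    congr 1
    ext i j
    simp [Pi.single_apply, Equiv.toPEquiv_apply, PEquiv.toMatrix_apply, eq_comm]
  · have h1 : loopValue (T.map t) = 0 := by
      refine loopValue_eq_zero fun hp => hf fun i j hij => ?_
      have hnd' := hp.nodup_iff.2 List.nodup_range
      rw [JTree.map_legs] at hnd'
      have := List.inj_on_of_nodup_map hnd' (x := i + 4) (hT.mem_iff.2 (by simp; omega))
        (y := j + 4) (hT.mem_iff.2 (by simp; omega)) (by rw [htf, htf, hij])
      simpa [Fin.ext_iff] using this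
    rw [h1]
    symm
    obtain ⟨i, j, hij, hne⟩ : ∃ i j, f i = f j ∧ i ≠ j := by
      simpa [Function.Injective] using hf
    refine smul_eq_zero_of_right _ ?_
    exact AlternatingMap.map_eq_zero_of_eq _ _ (by simp [hij]) hne

section

variable {H : Type*} [AddCommGroup H] [Module ℚ H]

/-- The map to the free Lie algebra with the given four coordinates. -/
def letterMap (φ : Fin 4 → Module.Dual ℚ H) : H →ₗ[ℚ] Letters :=
  ∑ d, (φ d).smulRight (letter d)

lemma letterMap_apply (φ : Fin 4 → Module.Dual ℚ H) (x : H) :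
    letterMap φ x = ∑ d, φ d x • letter d := by simp [letterMap]

lemma isLie_letterMap (φ : Fin 4 → Module.Dual ℚ H) (x : H) : IsLie (letterMap φ x) := by
  rw [letterMap_apply, Fin.sum_univ_four]
  exact .add (.add (.add (.smul _ (.letter _)) (.smul _ (.letter _))) (.smul _ (.letter _)))
    (.smul _ (.letter _))

/-- The functional on hairy Lie graphs given by four linear forms on the colours. -/
def detector (φ : Fin 4 → Module.Dual ℚ H) : HLG H →ₗ[ℚ] ℚ :=
  chordFunctional isChordMap_hairHom ∘ₗ mapHLG (letterMap φ)

lemma mapHLG_beta_pow {H' : Type*} [AddCommGroup H'] [Module ℚ H'] (φ : H →ₗ[ℚ] H') (m : ℕ)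
    (z : HLG H) : mapHLG φ ((beta ^ m) z) = (beta ^ m) (mapHLG φ z) := by
  induction m generalizing z with
  | zero => simp
  | succ m ih => rw [pow_succ, pow_succ, Module.End.mul_apply, Module.End.mul_apply, ih, mapHLG_beta]

lemma detector_eq_zero (φ : Fin 4 → Module.Dual ℚ H) {z : HLG H} (hz : z ∈ betaImage H 2 6) :
    detector φ z = 0 := by
  obtain ⟨z, hz, rfl⟩ := hz
  suffices h : C H 6 (2 + 6 - 1) 6 ≤ LinearMap.ker (detector φ ∘ₗ (beta ^ (6 - 1))) from h hz
  refine Submodule.span_le.2 ?_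
  rintro _ ⟨⟨l, D, c⟩, ⟨hX, h1, h2, h3⟩, rfl⟩
  rw [SetLike.mem_coe, LinearMap.mem_ker, LinearMap.comp_apply, detector, LinearMap.comp_apply,
    mapHLG_beta_pow, mapHLG_of]
  refine killsTripods_hairHom 5 l D _ (fun i => isLie_letterMap φ _) h1 ?_ (Graph.isHairy_recolor hX)
  have h4 : ∀ l : List JTree, (∀ T ∈ l, 1 ≤ T.numTri) → (l.map JTree.numTri).sum ≤ l.length →
      ∀ T ∈ l, T.numTri = 1 := by
    intro l hl hs
    have hge : ∀ l : List JTree, (∀ T ∈ l, 1 ≤ T.numTri) → l.length ≤ (l.map JTree.numTri).sum := by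
      intro l hl
      simpa using List.card_nsmul_le_sum (l.map JTree.numTri) 1 (by simpa using hl)
    induction l with
    | nil => simp
    | cons T l ih =>
      have h5 := hge l fun U hU => hl U (List.mem_cons_of_mem _ hU)
      have h6 := hl T (by simp)
      simp only [List.map_cons, List.sum_cons, List.length_cons] at hs
      intro U hU
      rcases List.mem_cons.1 hU with rfl | hU
      · omega
      · exact ih (fun V hV => hl V (List.mem_cons_of_mem _ hV)) (by omega) U hU
  exact h4 l hX.tri (le_of_eq (h3.trans h1.symm))

lemma detector_hairMap (φ : Fin 4 → Module.Dual ℚ H) (L : List (ℤ × JTree))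
    (hL : ∀ p ∈ L, p.2.legs.Perm (List.range 8)) (y : Fin 4 → H) :
    detector φ (hairMap L hL y) = fastSum L * Matrix.det fun i d => φ d (y i) := by
  rw [detector, LinearMap.comp_apply, mapHLG_hairMap, hairMap_apply, ← treeSum_loopValue hL]
  have := map_treeSum (chordFunctional isChordMap_hairHom).toAddMonoidHom
    (treeOf [] {(0, 1), (2, 3)} (hairColor (letterMap φ ∘ y))) L
  refine this.trans ?_
  rw [treeSum, treeSum, ← List.sum_map_mul_right]
  congr 1
  refine List.map_congr_left fun p hp => ?_
  have h := isHairy_two_of_legs_perm (hL p hp) (hairColor (letterMap φ ∘ y))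
  change p.1 • chordFunctional isChordMap_hairHom _ = p.1 • loopValue p.2 * _
  rw [chordFunctional_treeOf _ h (L := [(0, 1), (2, 3)]) (by simp) (by simp) rfl, smul_mul_assoc,
    mul_comm (loopValue p.2), ← treePairing_hairColor p.2 (hL p hp), chordValue]
  congr 1
  refine treePairing_congr _ fun i hi => ?_
  have hi8 : i < 8 := by simpa using (hL p hp).mem_iff.1 hi
  interval_cases i <;>
    simp [chordColor, ends, hairColor, letterMap_apply, hairHom_letter]

end

/-! ### Colourings by dual pairs -/

/-- The sign of the first element of a pair of dual vectors. -/
def dualSign : Bool → ℤ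
  | false => 1
  | true => -1

lemma dualSign_mul_self (b : Bool) : dualSign b * dualSign b = 1 := by cases b <;> rfl

/-- The other element of a pair of dual vectors. -/
def partner {ι : Type*} (p : ι × Bool) : ι × Bool := (p.1, !p.2)

lemma partner_partner {ι : Type*} (p : ι × Bool) : partner (partner p) = p := by
  simp [partner]

section

variable {H : Type*} [AddCommGroup H] [Module ℚ H] {ι : Type*} [DecidableEq ι]

/-- The vectors `e (i, false)`, `e (i, true)` for varying `i` span pairwise orthogonal hyperbolic
planes, of which they are symplectic bases. -/
def IsHyperbolic (ω : LinearMap.BilinForm ℚ H) (e : ι × Bool → H) : Prop :=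
  ∀ p q, ω (e p) (e q) = if q = partner p then (dualSign p.2 : ℚ) else 0

/-- The colouring of the leaves `2 * i` and `2 * i + 1`, for `i < m`, by dual pairs of vectors, and of
the following leaves by the components of `y`. -/
def pairColor {m k : ℕ} (e : ι × Bool → H) (κ : Fin m → ι × Bool) (y : Fin k → H) (i : ℕ) : H :=
  if h : i / 2 < m then e (if i % 2 = 0 then κ ⟨i / 2, h⟩ else partner (κ ⟨i / 2, h⟩))
  else if h : i - 2 * m < k then y ⟨i - 2 * m, h⟩ else 0

variable {m k : ℕ} (e : ι × Bool → H) (κ : Fin m → ι × Bool) (y : Fin k → H)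

lemma pairColor_two_mul (i : Fin m) : pairColor e κ y (2 * i) = e (κ i) := by
  simp [pairColor]

lemma pairColor_two_mul_add_one (i : Fin m) : pairColor e κ y (2 * i + 1) = e (partner (κ i)) := by
  have h : (2 * (i : ℕ) + 1) / 2 = i := by omega
  have h' : (2 * (i : ℕ) + 1) % 2 = 1 := by omega
  simp [pairColor, h, h']

lemma pairColor_add (i : Fin k) : pairColor e κ y (2 * m + i) = y i := by
  have h : ¬(2 * m + (i : ℕ)) / 2 < m := by omega
  simp [pairColor, h]

lemma pairColor_eq_zero {i : ℕ} (hi : 2 * m + k ≤ i) : pairColor e κ y i = 0 := by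
  rw [pairColor, dif_neg (by omega), dif_neg (by omega)]

/-- Leaves are the first or second elements of pairs, or coloured by a component of `y`. -/
lemma pairColor_cases (i : ℕ) : (∃ l : Fin m, i = 2 * l) ∨ (∃ l : Fin m, i = 2 * l + 1) ∨
    (∃ l : Fin k, i = 2 * m + l) ∨ 2 * m + k ≤ i := by
  rcases lt_or_ge i (2 * m) with h | h
  · rcases Nat.even_or_odd' i with ⟨l, rfl | rfl⟩
    · exact .inl ⟨⟨l, by omega⟩, rfl⟩
    · exact .inr (.inl ⟨⟨l, by omega⟩, rfl⟩)
  · rcases lt_or_ge i (2 * m + k) with h' | h'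
    · exact .inr (.inr (.inl ⟨⟨i - 2 * m, by omega⟩, by simp; omega⟩))
    · exact .inr (.inr (.inr h'))

lemma pairColor_flip (l : Fin m) (i : ℕ) : pairColor e κ y (transp (2 * l) (2 * l + 1) i) =
    pairColor e (Function.update κ l (partner (κ l))) y i := by
  rw [transp_eq_swap]
  rcases pairColor_cases (m := m) (k := k) i with ⟨j, rfl⟩ | ⟨j, rfl⟩ | ⟨j, rfl⟩ | h
  · rw [pairColor_two_mul]
    by_cases hj : j = l
    · subst hj; simp [pairColor_two_mul_add_one]
    · have : (j : ℕ) ≠ l := fun h => hj (Fin.ext h)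
      rw [Equiv.swap_apply_of_ne_of_ne (by omega) (by omega), pairColor_two_mul,
        Function.update_of_ne hj]
  · rw [pairColor_two_mul_add_one]
    by_cases hj : j = l
    · subst hj; simp [pairColor_two_mul, partner_partner]
    · have : (j : ℕ) ≠ l := fun h => hj (Fin.ext h)
      rw [Equiv.swap_apply_of_ne_of_ne (by omega) (by omega), pairColor_two_mul_add_one,
        Function.update_of_ne hj]
  · rw [Equiv.swap_apply_of_ne_of_ne (by omega) (by omega), pairColor_add, pairColor_add]
  · rw [Equiv.swap_apply_of_ne_of_ne (by omega) (by omega), pairColor_eq_zero _ _ _ h,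
      pairColor_eq_zero _ _ _ h]

lemma pairTransp_two_mul (a b j : ℕ) : pairTransp a b (2 * j) = 2 * Equiv.swap a b j ∧
    pairTransp a b (2 * j + 1) = 2 * Equiv.swap a b j + 1 := by
  simp only [pairTransp, transp_eq_swap, Equiv.swap_apply_def]
  split_ifs <;> omega

lemma pairTransp_of_le {a b i : ℕ} (ha : 2 * a + 2 ≤ i) (hb : 2 * b + 2 ≤ i) : pairTransp a b i = i := by
  simp only [pairTransp, transp_eq_swap, Equiv.swap_apply_def]
  split_ifs <;> omega

lemma pairColor_exchange (a b : Fin m) (i : ℕ) :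
    pairColor e κ y (pairTransp a b i) = pairColor e (κ ∘ Equiv.swap a b) y i := by
  have hsw : ∀ j : Fin m, Equiv.swap (a : ℕ) b j = (Equiv.swap a b j : Fin m) := by
    intro j
    simp only [Equiv.swap_apply_def, Fin.val_inj]
    split_ifs <;> rfl
  rcases pairColor_cases (m := m) (k := k) i with ⟨j, rfl⟩ | ⟨j, rfl⟩ | ⟨j, rfl⟩ | h
  · rw [(pairTransp_two_mul _ _ _).1, hsw, pairColor_two_mul, pairColor_two_mul]; rfl
  · rw [(pairTransp_two_mul _ _ _).2, hsw, pairColor_two_mul_add_one, pairColor_two_mul_add_one]; rfl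
  · rw [pairTransp_of_le (by omega) (by omega), pairColor_add, pairColor_add]
  · rw [pairTransp_of_le (by omega) (by omega), pairColor_eq_zero _ _ _ h, pairColor_eq_zero _ _ _ h]

lemma pairColor_transp (a b : Fin k) (i : ℕ) : pairColor e κ y (transp (2 * m + a) (2 * m + b) i) =
    pairColor e κ (y ∘ Equiv.swap a b) i := by
  have hsw : ∀ j : Fin k, Equiv.swap (2 * m + (a : ℕ)) (2 * m + b) (2 * m + j) =
      2 * m + (Equiv.swap a b j : Fin k) := by
    intro j
    simp only [Equiv.swap_apply_def, add_right_inj, Fin.val_inj]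
    split_ifs <;> rfl
  rw [transp_eq_swap]
  rcases pairColor_cases (m := m) (k := k) i with ⟨j, rfl⟩ | ⟨j, rfl⟩ | ⟨j, rfl⟩ | h
  · rw [Equiv.swap_apply_of_ne_of_ne (by omega) (by omega), pairColor_two_mul, pairColor_two_mul]
  · rw [Equiv.swap_apply_of_ne_of_ne (by omega) (by omega), pairColor_two_mul_add_one,
      pairColor_two_mul_add_one]
  · rw [hsw, pairColor_add, pairColor_add]; rfl
  · rw [Equiv.swap_apply_of_ne_of_ne (by omega) (by omega), pairColor_eq_zero _ _ _ h,
      pairColor_eq_zero _ _ _ h]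

variable {e κ y}

/-- Only the dual pairs contribute to the traces. -/
lemma form_pairColor {ω : LinearMap.BilinForm ℚ H} (he : IsHyperbolic ω e)
    (hκ : Function.Injective fun i => (κ i).1) (hy : ∀ i j, ω (y i) (y j) = 0)
    (hey : ∀ p i, ω (e p) (y i) = 0) {i j : ℕ} (hij : i < j) (hne : ¬∃ l : Fin m, (i, j) = (2 * (l : ℕ), 2 * (l : ℕ) + 1)) :
    ω (pairColor e κ y i) (pairColor e κ y j) = 0 := by
  have hfst : ∀ a b : Fin m, (κ b).1 = (κ a).1 → b = a := fun a b h => hκ h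
  rcases pairColor_cases (m := m) (k := k) j with ⟨b, rfl⟩ | ⟨b, rfl⟩ | ⟨b, rfl⟩ | h
  · rcases pairColor_cases (m := m) (k := k) i with ⟨a, rfl⟩ | ⟨a, rfl⟩ | ⟨a, rfl⟩ | h
    · rw [pairColor_two_mul, pairColor_two_mul, he, if_neg]
      intro h
      have := hfst a b (by rw [h]; rfl)
      subst this; omega
    · rw [pairColor_two_mul, pairColor_two_mul_add_one, he, if_neg]
      intro h
      have := hfst a b (by rw [h]; rfl)
      subst this; omega
    · omega
    · omega
  · rcases pairColor_cases (m := m) (k := k) i with ⟨a, rfl⟩ | ⟨a, rfl⟩ | ⟨a, rfl⟩ | h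
    · rw [pairColor_two_mul, pairColor_two_mul_add_one, he, if_neg]
      intro h
      have := hfst a b (by simpa [partner] using congrArg Prod.fst h)
      subst this
      exact hne ⟨b, rfl⟩
    · rw [pairColor_two_mul_add_one, pairColor_two_mul_add_one, he, if_neg]
      intro h
      have := hfst a b (by simpa [partner] using congrArg Prod.fst h)
      subst this; omega
    · omega
    · omega
  · rcases pairColor_cases (m := m) (k := k) i with ⟨a, rfl⟩ | ⟨a, rfl⟩ | ⟨a, rfl⟩ | h
    · rw [pairColor_two_mul, pairColor_add, hey]
    · rw [pairColor_two_mul_add_one, pairColor_add, hey]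
    · rw [pairColor_add, pairColor_add, hy]
    · omega
  · rw [pairColor_eq_zero _ _ _ h, map_zero]

lemma form_pairColor_pair {ω : LinearMap.BilinForm ℚ H} (he : IsHyperbolic ω e) (l : Fin m) :
    ω (pairColor e κ y (2 * l)) (pairColor e κ y (2 * l + 1)) = (dualSign (κ l).2 : ℚ) := by
  rw [pairColor_two_mul, pairColor_two_mul_add_one, he, if_pos rfl]

/-! ### Traces of trees that are coloured by dual pairs -/

/-- The pair of leaves with number `i`. -/
def leafPair (i : ℕ) : ℕ × ℕ := (2 * i, 2 * i + 1)

lemma leafPair_injective : Function.Injective leafPair := fun i j h => by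
  have := congrArg Prod.fst h
  simp only [leafPair] at this
  omega

lemma isMatching_leafPair (s : Finset ℕ) : IsMatching (s.image leafPair) := by
  constructor
  · intro e he
    obtain ⟨i, -, rfl⟩ := Finset.mem_image.1 he
    simp [leafPair]
  · intro e he f hf hef
    obtain ⟨i, -, rfl⟩ := Finset.mem_image.1 he
    obtain ⟨j, -, rfl⟩ := Finset.mem_image.1 hf
    have : i ≠ j := fun h => hef (h ▸ rfl)
    simp only [leafPair]
    omega

lemma sum_matchings {M : Type*} [AddCommGroup M] [Module ℚ M] {ω : LinearMap.BilinForm ℚ H}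
    {c : ℕ → H} (hm : m ≤ 4) (r : ℕ)
    (hc : ∀ i j, i < j → j < 8 → (¬∃ l < m, (i, j) = leafPair l) → ω (c i) (c j) = 0)
    (F : Finset (ℕ × ℕ) → M) :
    ∑ D ∈ matchings r (Finset.range 8), weight ω c D • F D =
      ∑ s ∈ (Finset.range m).powersetCard r, weight ω c (s.image leafPair) • F (s.image leafPair) := by
  have hinj : Set.InjOn (fun s : Finset ℕ => s.image leafPair) ((Finset.range m).powersetCard r) :=
    (Finset.image_injective leafPair_injective).injOn
  rw [← Finset.sum_image hinj (f := fun D => weight ω c D • F D)]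
  symm
  refine Finset.sum_subset ?_ fun D hD hD' => ?_
  · intro D hD
    obtain ⟨s, hs, rfl⟩ := Finset.mem_image.1 hD
    obtain ⟨hs, hr⟩ := Finset.mem_powersetCard.1 hs
    refine mem_matchings.2 ⟨⟨?_, ?_⟩, isMatching_leafPair s, ?_⟩
    · intro e he
      obtain ⟨i, hi, rfl⟩ := Finset.mem_image.1 he
      have := Finset.mem_range.1 (hs hi)
      simp only [leafPair, Finset.mem_range]
      omega
    · rw [Finset.card_image_of_injective _ leafPair_injective, hr]
    · intro e he
      obtain ⟨i, hi, rfl⟩ := Finset.mem_image.1 he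
      simp [leafPair]
  · obtain ⟨⟨h1, h2⟩, -, h4⟩ := mem_matchings.1 hD
    suffices h : ∃ e ∈ D, ¬∃ l < m, e = leafPair l by
      obtain ⟨e, he, hl⟩ := h
      rw [weight, Finset.prod_eq_zero he (hc _ _ (h4 e he) (Finset.mem_range.1 (h1 e he).2) hl),
        zero_smul]
    by_contra! hcon
    have himg : ((Finset.range m).filter fun l => leafPair l ∈ D).image leafPair = D := by
      ext e
      simp only [Finset.mem_image, Finset.mem_filter, Finset.mem_range]
      constructor
      · rintro ⟨l, ⟨-, h⟩, rfl⟩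
        exact h
      · intro he
        obtain ⟨l, hl, rfl⟩ := hcon e he
        exact ⟨l, ⟨hl, he⟩, rfl⟩
    refine hD' (Finset.mem_image.2 ⟨_, Finset.mem_powersetCard.2 ⟨Finset.filter_subset _ _, ?_⟩, himg⟩)
    rw [← h2, ← Finset.card_image_of_injective _ leafPair_injective, himg]

lemma sum_powersetCard_two {M : Type*} [AddCommMonoid M] (F : Finset ℕ → M) (m : ℕ) :
    ∑ s ∈ (Finset.range m).powersetCard 2, F s = ∑ j ∈ Finset.range m, ∑ i ∈ Finset.range j, F {i, j} := by
  induction m with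
  | zero => rfl
  | succ m ih =>
    rw [Finset.sum_range_succ, ← ih, Finset.range_add_one, Finset.powersetCard_succ_insert (by simp),
      Finset.sum_union, Finset.powersetCard_one, Finset.sum_image]
    · simp [Finset.pair_comm]
    · intro s hs t ht hst
      simp only [Finset.coe_map, Set.mem_image, Finset.mem_coe, Finset.mem_range] at hs ht
      obtain ⟨i, hi, rfl⟩ := hs
      obtain ⟨j, hj, rfl⟩ := ht
      have hst : insert m ({i} : Finset ℕ) = insert m {j} := hst
      have : i ∈ insert m ({j} : Finset ℕ) := hst ▸ Finset.mem_insert_of_mem (Finset.mem_singleton_self i)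
      have : i = j := by simpa [hi.ne] using this
      rw [this]
    · rw [Finset.disjoint_left]
      intro s hs hs'
      obtain ⟨t, -, rfl⟩ := Finset.mem_image.1 hs'
      have := (Finset.mem_powersetCard.1 hs).1 (Finset.mem_insert_self m t)
      simp at this

lemma hairs_of_legs_perm {T : JTree} (hT : T.legs.Perm (List.range 8)) (c : ℕ → H) :
    Graph.hairs ⟨[T], ∅, c⟩ = Finset.range 8 := by
  ext i
  simp [Graph.hairs, Graph.legs, hT.mem_iff, endpoints]

lemma treeOf_map_perm {f : ℕ → ℕ} {σ : Equiv.Perm ℕ} (hf : f = σ) {D D' : Finset (ℕ × ℕ)} (c : ℕ → H)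
    (T : JTree) (hD : D.image (Prod.map f f) = D') :
    treeOf [] D' c (T.map f) = treeOf [] D (fun i => c (f i)) T := by
  subst hf
  exact treeOf_map σ T hD fun _ _ _ => rfl

lemma pairTransp_pairTransp (a b i : ℕ) : pairTransp a b (pairTransp a b i) = i := by
  rcases Nat.even_or_odd' i with ⟨l, rfl | rfl⟩ <;>
    simp [(pairTransp_two_mul _ _ _).1, (pairTransp_two_mul _ _ _).2]

lemma map_pairTransp_leafPair (a b i : ℕ) :
    Prod.map (pairTransp a b) (pairTransp a b) (leafPair i) = leafPair (Equiv.swap a b i) := by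
  simp [leafPair, pairTransp_two_mul]

lemma of_leafPair {T : JTree} (hT : T.legs.Perm (List.range 8)) (c : ℕ → H) {i : ℕ} (hi : i < 4) :
    of ⟨[T], {leafPair i}, c⟩ =
      treeOf [] {(0, 1)} (fun j => c (pairTransp 0 i j)) (T.map (pairTransp 0 i)) := by
  have h : Graph.IsHairy ⟨[T], {leafPair i}, c⟩ := by
    refine isHairy_of_legs_perm hT (by simpa using isMatching_leafPair {i}) ?_ c
    simp [endpoints, leafPair, Finset.insert_subset_iff]
    omega
  rw [treeOf_map_perm (pairTransp_eq_swap 0 i) (D := {leafPair i}) _ _ (by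
    rw [Finset.image_singleton, map_pairTransp_leafPair, Equiv.swap_apply_right]; rfl), ← treeOf_eq h]
  simp only [pairTransp_pairTransp]

lemma of_leafPairs {T : JTree} (hT : T.legs.Perm (List.range 8)) (c : ℕ → H) {i j : ℕ}
    (hij : i < j) (hj : j < 4) :
    of ⟨[T], {leafPair i, leafPair j}, c⟩ =
      treeOf [] {(0, 1), (2, 3)} (fun a => c (pairTransp 0 i (pairTransp 1 j a)))
        ((T.map (pairTransp 0 i)).map (pairTransp 1 j)) := by
  have h : Graph.IsHairy ⟨[T], {leafPair i, leafPair j}, c⟩ := by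
    refine isHairy_of_legs_perm hT (by simpa using isMatching_leafPair {i, j}) ?_ c
    simp [endpoints, leafPair, Finset.insert_subset_iff]
    omega
  have e1 : Equiv.swap 1 j 0 = 0 := Equiv.swap_apply_of_ne_of_ne (by omega) (by omega)
  have e2 : Equiv.swap 0 i j = j := Equiv.swap_apply_of_ne_of_ne (by omega) (by omega)
  rw [treeOf_map_perm (pairTransp_eq_swap 1 j) (D := {leafPair 0, leafPair j}) _ _ (by
      rw [Finset.image_insert, Finset.image_singleton, map_pairTransp_leafPair,
        map_pairTransp_leafPair, Equiv.swap_apply_right, e1]; rfl),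
    treeOf_map_perm (pairTransp_eq_swap 0 i) (D := {leafPair i, leafPair j}) _ _ (by
      rw [Finset.image_insert, Finset.image_singleton, map_pairTransp_leafPair,
        map_pairTransp_leafPair, Equiv.swap_apply_right, e2]), ← treeOf_eq h]
  simp only [pairTransp_pairTransp]

lemma treeSum_oneLoopTrees {M : Type*} [AddCommGroup M] (G : JTree → M) (m : ℕ) :
    treeSum G (oneLoopTrees m) =
      ((coreTrees m).map fun T => ∑ i ∈ Finset.range m, G (T.map (pairTransp 0 i))).sum := by
  have h : ∀ l : List ℕ, ∀ f : ℕ → List (ℤ × JTree),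
      treeSum G (l.flatMap f) = (l.map fun i => treeSum G (f i)).sum := by
    intro l f
    induction l with
    | nil => rfl
    | cons a l ih => rw [List.flatMap_cons, treeSum_append, ih]; rfl
  rw [oneLoopTrees, h]
  change ∑ i ∈ Finset.range m, _ = _
  unfold coreTrees
  split_ifs <;> simp [treeSum, Finset.sum_add_distrib]

lemma treeSum_twoLoopTrees {M : Type*} [AddCommGroup M] (G : JTree → M) (m : ℕ) :
    treeSum G (twoLoopTrees m) =
      ((coreTrees m).map fun T => ∑ j ∈ Finset.range m, ∑ i ∈ Finset.range j,
        G ((T.map (pairTransp 0 i)).map (pairTransp 1 j))).sum := by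
  have h : ∀ l : List ℕ, ∀ f : ℕ → List (ℤ × JTree),
      treeSum G (l.flatMap f) = (l.map fun i => treeSum G (f i)).sum := by
    intro l f
    induction l with
    | nil => rfl
    | cons a l ih => rw [List.flatMap_cons, treeSum_append, ih]; rfl
  simp only [twoLoopTrees, h]
  change ∑ j ∈ Finset.range m, ∑ i ∈ Finset.range j, _ = _
  unfold coreTrees
  split_ifs <;> simp [treeSum, Finset.sum_add_distrib]

/-- The product of the signs of the dual pairs from number `r` on. -/
def signCoeff (r : ℕ) (κ : Fin m → ι × Bool) : ℤ :=
  ∏ l : Fin m, if (l : ℕ) < r then 1 else dualSign (κ l).2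

lemma signCoeff_comp (κ : Fin m → ι × Bool) (σ : Equiv.Perm (Fin m)) :
    signCoeff 0 (κ ∘ σ) = signCoeff 0 κ := by
  simp only [signCoeff, not_lt_zero, if_false]
  exact Equiv.prod_comp σ fun l => dualSign (κ l).2

lemma signCoeff_one (κ : Fin m → ι × Bool) (i : Fin m) (h0 : 0 < m) :
    signCoeff 0 κ * dualSign (κ i).2 = signCoeff 1 (κ ∘ Equiv.swap ⟨0, h0⟩ i) := by
  have h2 : ∀ κ : Fin m → ι × Bool, signCoeff 0 κ = dualSign (κ ⟨0, h0⟩).2 * signCoeff 1 κ := by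
    intro κ
    rw [signCoeff, signCoeff, ← Finset.mul_prod_erase _ _ (Finset.mem_univ (⟨0, h0⟩ : Fin m)),
      ← Finset.mul_prod_erase _ (fun l : Fin m => if (l : ℕ) < 1 then 1 else dualSign (κ l).2)
        (Finset.mem_univ (⟨0, h0⟩ : Fin m))]
    simp only [not_lt_zero, if_false, zero_lt_one, if_true, one_mul]
    congr 1
    refine Finset.prod_congr rfl fun l hl => ?_
    have : (l : ℕ) ≠ 0 := fun h => (Finset.mem_erase.1 hl).1 (Fin.ext h)
    rw [if_neg (by omega)]
  rw [← signCoeff_comp κ (Equiv.swap ⟨0, h0⟩ i), h2, Function.comp_apply, Equiv.swap_apply_left, mul_right_comm, dualSign_mul_self, one_mul]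

lemma signCoeff_two (κ : Fin m → ι × Bool) {i j : Fin m} (hij : i < j) (h1 : 1 < m) :
    signCoeff 0 κ * (dualSign (κ i).2 * dualSign (κ j).2) =
      signCoeff 2 (κ ∘ Equiv.swap ⟨0, by omega⟩ i ∘ Equiv.swap ⟨1, h1⟩ j) := by
  set σ : Equiv.Perm (Fin m) := Equiv.swap ⟨0, by omega⟩ i * Equiv.swap ⟨1, h1⟩ j with hσ
  have hσ0 : σ ⟨0, by omega⟩ = i := by
    have h : Equiv.swap (⟨1, h1⟩ : Fin m) j ⟨0, by omega⟩ = ⟨0, by omega⟩ :=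
      Equiv.swap_apply_of_ne_of_ne (by simp) (by rw [ne_eq, Fin.ext_iff]; simp; omega)
    rw [hσ, Equiv.Perm.mul_apply, h, Equiv.swap_apply_left]
  have hσ1 : σ ⟨1, h1⟩ = j := by
    rw [hσ, Equiv.Perm.mul_apply, Equiv.swap_apply_left, Equiv.swap_apply_of_ne_of_ne] <;>
      simp [Fin.ext_iff] <;> omega
  have h2 : ∀ κ : Fin m → ι × Bool, signCoeff 0 κ =
      dualSign (κ ⟨0, by omega⟩).2 * (dualSign (κ ⟨1, h1⟩).2 * signCoeff 2 κ) := by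
    intro κ
    have hm : (⟨1, h1⟩ : Fin m) ∈ Finset.univ.erase (⟨0, by omega⟩ : Fin m) := by simp
    rw [signCoeff, signCoeff, ← Finset.mul_prod_erase _ _ (Finset.mem_univ (⟨0, by omega⟩ : Fin m)),
      ← Finset.mul_prod_erase _ _ hm,
      ← Finset.mul_prod_erase _ (fun l : Fin m => if (l : ℕ) < 2 then 1 else dualSign (κ l).2)
        (Finset.mem_univ (⟨0, by omega⟩ : Fin m)),
      ← Finset.mul_prod_erase _ (fun l : Fin m => if (l : ℕ) < 2 then 1 else dualSign (κ l).2) hm]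
    simp only [not_lt_zero, if_false, zero_lt_two, one_lt_two, if_true, one_mul]
    congr 2
    refine Finset.prod_congr rfl fun l hl => ?_
    simp only [Finset.mem_erase, Fin.ext_iff, ne_eq, Finset.mem_univ, and_true] at hl
    rw [if_neg (by omega)]
  change _ = signCoeff 2 (κ ∘ σ)
  rw [← signCoeff_comp κ σ, h2, Function.comp_apply, Function.comp_apply, hσ0, hσ1]
  have e1 := dualSign_mul_self (κ i).2
  have e2 := dualSign_mul_self (κ j).2
  linear_combination (signCoeff 2 (κ ∘ σ)) * (dualSign (κ j).2 * dualSign (κ j).2) * e1 +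
    (signCoeff 2 (κ ∘ σ)) * e2

end

section

variable {H : Type*} [AddCommGroup H] [Module ℚ H] {ι : Type*} [DecidableEq ι] [Fintype ι]

variable (ι) in
/-- The colourings of `m` pairs of leaves by dual pairs of vectors in different planes, together with
the permutations of the colours of `k` further leaves. -/
def colorings (m k : ℕ) : Finset ((Fin m → ι × Bool) × Equiv.Perm (Fin k)) :=
  Finset.univ.filter fun p => Function.Injective fun i => (p.1 i).1

variable {m k : ℕ}

lemma sum_colorings_comp {M : Type*} [AddCommMonoid M] (σ : Equiv.Perm (Fin m))
    (F : (Fin m → ι × Bool) × Equiv.Perm (Fin k) → M) :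
    ∑ p ∈ colorings ι m k, F (p.1 ∘ σ, p.2) = ∑ p ∈ colorings ι m k, F p := by
  refine Finset.sum_nbij' (fun p => (p.1 ∘ σ, p.2)) (fun p => (p.1 ∘ σ.symm, p.2)) ?_ ?_ ?_ ?_ ?_
  · intro p hp
    simp only [colorings, Finset.mem_filter, Finset.mem_univ, true_and] at hp ⊢
    exact hp.comp σ.injective
  · intro p hp
    simp only [colorings, Finset.mem_filter, Finset.mem_univ, true_and] at hp ⊢
    exact hp.comp σ.symm.injective
  · intro p _; simp [Function.comp_assoc]
  · intro p _; simp [Function.comp_assoc]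
  · intro p _; rfl

lemma sum_colorings_flip {M : Type*} [AddCommMonoid M] (l : Fin m)
    (F : (Fin m → ι × Bool) × Equiv.Perm (Fin k) → M) :
    ∑ p ∈ colorings ι m k, F (Function.update p.1 l (partner (p.1 l)), p.2) =
      ∑ p ∈ colorings ι m k, F p := by
  have h : ∀ p ∈ colorings ι m k, (Function.update p.1 l (partner (p.1 l)), p.2) ∈ colorings ι m k := by
    intro p hp
    simp only [colorings, Finset.mem_filter, Finset.mem_univ, true_and] at hp ⊢
    convert hp using 2 with i
    by_cases hi : i = l
    · subst hi; simp [partner]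
    · simp [hi]
  have h' : ∀ p ∈ colorings ι m k, (Function.update (Function.update p.1 l (partner (p.1 l))) l
      (partner (Function.update p.1 l (partner (p.1 l)) l)), p.2) = p := by
    intro p _
    simp [partner_partner]
  exact Finset.sum_nbij' (fun p => (Function.update p.1 l (partner (p.1 l)), p.2))
    (fun p => (Function.update p.1 l (partner (p.1 l)), p.2)) h h h' h' fun _ _ => rfl

lemma sum_colorings_mul {M : Type*} [AddCommMonoid M] (τ : Equiv.Perm (Fin k))
    (F : (Fin m → ι × Bool) × Equiv.Perm (Fin k) → M) :
    ∑ p ∈ colorings ι m k, F (p.1, p.2 * τ) = ∑ p ∈ colorings ι m k, F p := by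
  refine Finset.sum_nbij' (fun p => (p.1, p.2 * τ)) (fun p => (p.1, p.2 * τ⁻¹)) ?_ ?_ ?_ ?_ ?_
  · intro p hp; simpa [colorings] using hp
  · intro p hp; simpa [colorings] using hp
  · intro p _; simp
  · intro p _; simp
  · intro p _; rfl

/-- The coefficient of a colouring, in which the first `r` pairs are not oriented. -/
def colorCoeff (r : ℕ) (p : (Fin m → ι × Bool) × Equiv.Perm (Fin k)) : ℤ :=
  signCoeff r p.1 * Equiv.Perm.sign p.2

/-- The alternating sum over all colourings of a tree with dotted edges `D`. -/
def colorSum (m r : ℕ) (D : Finset (ℕ × ℕ)) (e : ι × Bool → H) (x : Fin k → H) (T : JTree) :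
    HLG H :=
  ∑ p ∈ colorings ι m k, colorCoeff r p • treeOf [] D (pairColor e p.1 (x ∘ p.2)) T

/-- The alternating sum over all colourings of the trees `coreTrees m`. -/
def coreElement (m : ℕ) (e : ι × Bool → H) (x : Fin k → H) : HLG H :=
  ((coreTrees m).map fun T =>
    ∑ p ∈ colorings ι m k, colorCoeff 0 p • of ⟨[T], ∅, pairColor e p.1 (x ∘ p.2)⟩).sum

lemma coreTrees_perm : ∀ m ∈ [2, 3, 4], ∀ T ∈ coreTrees m, T.legs.Perm (List.range 8) := by
  decide +kernel

lemma coreElement_mem_frakH (hm : m ∈ [2, 3, 4]) (e : ι × Bool → H) (x : Fin k → H) :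
    coreElement m e x ∈ frakH H 6 := by
  refine list_sum_mem fun z hz => ?_
  obtain ⟨T, hT, rfl⟩ := List.mem_map.1 hz
  have hp := coreTrees_perm m hm T hT
  have hn := T.length_legs
  rw [hp.length_eq, List.length_range] at hn
  refine sum_mem fun p _ => ?_
  have hmem : of ⟨[T], ∅, pairColor e p.1 (x ∘ p.2)⟩ ∈ C H 1 0 6 :=
    Submodule.subset_span ⟨_, ⟨isHairy_of_legs_perm hp (by decide) (by decide) _, rfl, rfl,
      by simp [Graph.lieDegree]; omega⟩, rfl⟩
  exact zsmul_mem hmem _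

variable {ω : LinearMap.BilinForm ℚ H} {e : ι × Bool → H} {x : Fin k → H}

/-- The contractions between the leaves of a tree that is coloured by dual pairs. -/
lemma traceGraph_pairColor (he : IsHyperbolic ω e) (hx : ∀ i j, ω (x i) (x j) = 0)
    (hex : ∀ p i, ω (e p) (x i) = 0) (hm : m ≤ 4) (r : ℕ) {T : JTree} (hT : T.legs.Perm (List.range 8))
    {p : (Fin m → ι × Bool) × Equiv.Perm (Fin k)} (hp : p ∈ colorings ι m k) :
    traceGraph ω r ⟨[T], ∅, pairColor e p.1 (x ∘ p.2)⟩ =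
      ∑ s ∈ (Finset.range m).powersetCard r, weight ω (pairColor e p.1 (x ∘ p.2)) (s.image leafPair) •
        of ⟨[T], s.image leafPair, pairColor e p.1 (x ∘ p.2)⟩ := by
  rw [traceGraph, hairs_of_legs_perm hT]
  simp only [Finset.empty_union]
  refine sum_matchings hm r (fun i j hij _ hne => ?_) _
  refine form_pairColor he (Finset.mem_filter.1 hp).2 (fun a b => hx _ _) (fun a b => hex _ _) hij ?_
  rintro ⟨l, hl⟩
  exact hne ⟨l, l.2, hl⟩

lemma trace_coreElement_one (hω : ω.IsAlt) (he : IsHyperbolic ω e) (hx : ∀ i j, ω (x i) (x j) = 0)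
    (hex : ∀ p i, ω (e p) (x i) = 0) (hm : m ∈ [2, 3, 4]) :
    trace ω hω 1 (coreElement m e x) = treeSum (colorSum m 1 {(0, 1)} e x) (oneLoopTrees m) := by
  have hm4 : 2 ≤ m ∧ m ≤ 4 := by simp at hm; omega
  rw [coreElement, map_list_sum, List.map_map, treeSum_oneLoopTrees]
  congr 1
  refine List.map_congr_left fun T hT => ?_
  have hp := coreTrees_perm m hm T hT
  rw [Function.comp_apply, map_sum]
  calc _ = ∑ p ∈ colorings ι m k, ∑ i ∈ Finset.range m,
        colorCoeff 0 p • weight ω (pairColor e p.1 (x ∘ p.2)) {leafPair i} •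
          of ⟨[T], {leafPair i}, pairColor e p.1 (x ∘ p.2)⟩ := by
        refine Finset.sum_congr rfl fun p hp' => ?_
        rw [map_zsmul, trace_of, traceGraph_pairColor he hx hex hm4.2 1 hp hp', Finset.smul_sum,
          Finset.powersetCard_one, Finset.sum_map]
        rfl
    _ = _ := by
        rw [Finset.sum_comm]
        refine Finset.sum_congr rfl fun i hi => ?_
        have him := Finset.mem_range.1 hi
        rw [colorSum]
        refine Eq.trans ?_ (sum_colorings_comp (Equiv.swap ⟨0, by omega⟩ ⟨i, him⟩) _)
        refine Finset.sum_congr rfl fun p _ => ?_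
        rw [weight, Finset.prod_singleton, leafPair, form_pairColor_pair he ⟨i, him⟩, ← leafPair,
          of_leafPair hp _ (by omega), colorCoeff, colorCoeff, ← signCoeff_one p.1 ⟨i, him⟩ (by omega),
          Int.cast_smul_eq_zsmul, smul_smul, mul_right_comm]
        congr 2
        funext j
        exact pairColor_exchange e p.1 _ ⟨0, by omega⟩ ⟨i, him⟩ j

lemma trace_coreElement_two (hω : ω.IsAlt) (he : IsHyperbolic ω e) (hx : ∀ i j, ω (x i) (x j) = 0)
    (hex : ∀ p i, ω (e p) (x i) = 0) (hm : m ∈ [2, 3, 4]) :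
    trace ω hω 2 (coreElement m e x) =
      treeSum (colorSum m 2 {(0, 1), (2, 3)} e x) (twoLoopTrees m) := by
  have hm4 : 2 ≤ m ∧ m ≤ 4 := by simp at hm; omega
  rw [coreElement, map_list_sum, List.map_map, treeSum_twoLoopTrees]
  congr 1
  refine List.map_congr_left fun T hT => ?_
  have hp := coreTrees_perm m hm T hT
  rw [Function.comp_apply, map_sum]
  calc _ = ∑ p ∈ colorings ι m k, ∑ j ∈ Finset.range m, ∑ i ∈ Finset.range j,
        colorCoeff 0 p • weight ω (pairColor e p.1 (x ∘ p.2)) {leafPair i, leafPair j} •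
          of ⟨[T], {leafPair i, leafPair j}, pairColor e p.1 (x ∘ p.2)⟩ := by
        refine Finset.sum_congr rfl fun p hp' => ?_
        rw [map_zsmul, trace_of, traceGraph_pairColor he hx hex hm4.2 2 hp hp', sum_powersetCard_two,
          Finset.smul_sum]
        simp only [Finset.smul_sum, Finset.image_insert, Finset.image_singleton]
    _ = _ := by
        rw [Finset.sum_comm]
        refine Finset.sum_congr rfl fun j hj => ?_
        rw [Finset.sum_comm]
        refine Finset.sum_congr rfl fun i hi => ?_
        have hjm := Finset.mem_range.1 hj
        have hij := Finset.mem_range.1 hi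
        have him : i < m := hij.trans hjm
        rw [colorSum]
        refine Eq.trans ?_ (sum_colorings_comp
          (Equiv.swap ⟨0, by omega⟩ ⟨i, him⟩ * Equiv.swap ⟨1, by omega⟩ ⟨j, hjm⟩) _)
        refine Finset.sum_congr rfl fun p _ => ?_
        have hne : leafPair i ≠ leafPair j := fun h => hij.ne (leafPair_injective h)
        have hsc := signCoeff_two p.1 (i := ⟨i, him⟩) (j := ⟨j, hjm⟩) hij (by omega)
        rw [weight, Finset.prod_pair hne, leafPair, leafPair, form_pairColor_pair he ⟨i, him⟩,
          form_pairColor_pair he ⟨j, hjm⟩, ← leafPair, ← leafPair,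
          of_leafPairs hp _ hij (by omega), colorCoeff, colorCoeff, Equiv.Perm.coe_mul, ← hsc,
          ← Int.cast_mul, Int.cast_smul_eq_zsmul, smul_smul, mul_right_comm]
        congr 2
        funext a
        rw [pairColor_exchange e p.1 _ ⟨0, by omega⟩ ⟨i, him⟩, pairColor_exchange e _ _ ⟨1, by omega⟩ ⟨j, hjm⟩]
        rfl

end

section

variable {H : Type*} [AddCommGroup H] [Module ℚ H] {ι : Type*} [DecidableEq ι] [Fintype ι] {m k : ℕ}

/-! ### The one-loop trace of the core element -/

lemma colorSum_map (m r : ℕ) {D : Finset (ℕ × ℕ)} (e : ι × Bool → H) (x : Fin k → H) (T : JTree)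
    {f : ℕ → ℕ} {σ : Equiv.Perm ℕ} (hf : f = σ) (hD : D.image (Prod.map f f) = D) (s : ℤ)
    (φ : (Fin m → ι × Bool) × Equiv.Perm (Fin k) → (Fin m → ι × Bool) × Equiv.Perm (Fin k))
    (hφ : ∀ F : (Fin m → ι × Bool) × Equiv.Perm (Fin k) → HLG H,
      ∑ p ∈ colorings ι m k, F (φ p) = ∑ p ∈ colorings ι m k, F p)
    (hc : ∀ p i, pairColor e p.1 (x ∘ p.2) (f i) = pairColor e (φ p).1 (x ∘ (φ p).2) i)
    (hs : ∀ p, colorCoeff r p = s * colorCoeff r (φ p)) :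
    colorSum m r D e x (T.map f) = s • colorSum m r D e x T := by
  rw [colorSum, colorSum, Finset.smul_sum]
  refine Eq.trans ?_ (hφ _)
  refine Finset.sum_congr rfl fun p _ => ?_
  rw [treeOf_map_perm hf _ _ hD, smul_smul, ← hs]
  simp only [hc]

lemma signCoeff_flip {r : ℕ} (κ : Fin m → ι × Bool) {l : Fin m} (hl : r ≤ l) :
    signCoeff r (Function.update κ l (partner (κ l))) = -signCoeff r κ := by
  rw [signCoeff, signCoeff, ← Finset.mul_prod_erase _ _ (Finset.mem_univ l),
    ← Finset.mul_prod_erase _ (fun l : Fin m => if (l : ℕ) < r then 1 else dualSign (κ l).2)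
      (Finset.mem_univ l), if_neg (by omega), if_neg (by omega), Function.update_self, ← neg_mul]
  congr 1
  · cases h : (κ l).2 <;> simp [partner, h, dualSign]
  · exact Finset.prod_congr rfl fun i hi => by rw [Function.update_of_ne (Finset.ne_of_mem_erase hi)]

lemma signCoeff_exchange {r : ℕ} (κ : Fin m → ι × Bool) {a b : Fin m} (ha : r ≤ a) (hb : r ≤ b) :
    signCoeff r (κ ∘ Equiv.swap a b) = signCoeff r κ := by
  rw [signCoeff, signCoeff, ← Equiv.prod_comp (Equiv.swap a b)
    fun l : Fin m => if (l : ℕ) < r then 1 else dualSign (κ l).2]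
  refine Finset.prod_congr rfl fun l _ => ?_
  have : ((Equiv.swap a b l : Fin m) : ℕ) < r ↔ (l : ℕ) < r := by
    rw [Equiv.swap_apply_def]
    split_ifs with h1 h2
    · subst h1; omega
    · subst h2; omega
    · rfl
  simp only [this, Function.comp_apply]

lemma image_pair_of_fix {f : ℕ → ℕ} (h0 : f 0 = 0) (h1 : f 1 = 1) :
    ({(0, 1)} : Finset (ℕ × ℕ)).image (Prod.map f f) = {(0, 1)} := by
  simp [h0, h1]

variable (e : ι × Bool → H) (x : Fin k → H) (T : JTree)

lemma colorSum_flip (l : Fin m) (hl : 1 ≤ (l : ℕ)) :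
    colorSum m 1 {(0, 1)} e x (T.map (transp (2 * l) (2 * l + 1))) =
      (-1 : ℤ) • colorSum m 1 {(0, 1)} e x T := by
  refine colorSum_map m 1 e x T (transp_eq_swap _ _) (image_pair_of_fix ?_ ?_) (-1)
    (fun p => (Function.update p.1 l (partner (p.1 l)), p.2)) (sum_colorings_flip l)
    (fun p i => pairColor_flip e p.1 _ l i) fun p => ?_
  · rw [transp_eq_swap, Equiv.swap_apply_of_ne_of_ne] <;> omega
  · rw [transp_eq_swap, Equiv.swap_apply_of_ne_of_ne] <;> omega
  · rw [colorCoeff, colorCoeff, signCoeff_flip _ hl]; ring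

lemma colorSum_exchange (a b : Fin m) (ha : 1 ≤ (a : ℕ)) (hb : 1 ≤ (b : ℕ)) :
    colorSum m 1 {(0, 1)} e x (T.map (pairTransp a b)) = (1 : ℤ) • colorSum m 1 {(0, 1)} e x T := by
  have h := pairTransp_two_mul a b 0
  rw [Equiv.swap_apply_of_ne_of_ne (by omega) (by omega)] at h
  refine colorSum_map m 1 e x T (pairTransp_eq_swap _ _) (image_pair_of_fix h.1 h.2) 1
    (fun p => (p.1 ∘ Equiv.swap a b, p.2)) (sum_colorings_comp _)
    (fun p i => pairColor_exchange e p.1 _ a b i) fun p => ?_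
  rw [colorCoeff, colorCoeff, signCoeff_exchange _ ha hb, one_mul]

lemma colorSum_transp (a b : Fin k) (hab : a ≠ b) (hm : 1 ≤ m) :
    colorSum m 1 {(0, 1)} e x (T.map (transp (2 * m + a) (2 * m + b))) =
      (-1 : ℤ) • colorSum m 1 {(0, 1)} e x T := by
  refine colorSum_map m 1 e x T (transp_eq_swap _ _) (image_pair_of_fix ?_ ?_) (-1)
    (fun p => (p.1, p.2 * Equiv.swap a b)) (sum_colorings_mul _)
    (fun p i => pairColor_transp e p.1 _ a b i) fun p => ?_
  · rw [transp_eq_swap, Equiv.swap_apply_of_ne_of_ne] <;> omega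
  · rw [transp_eq_swap, Equiv.swap_apply_of_ne_of_ne] <;> omega
  · rw [colorCoeff, colorCoeff, Equiv.Perm.sign_mul, Equiv.Perm.sign_swap hab]
    push_cast
    ring

lemma colorSum_oneLoopTrees_mem (hm : m ∈ [2, 3, 4]) (hk : 2 * m + k = 8) :
    treeSum (colorSum m 1 {(0, 1)} e x) (oneLoopTrees m) ∈ betaImage H 1 6 := by
  refine treeSum_oneLoopTrees_mem (colorings ι m k) (colorCoeff 1)
    (fun p => pairColor e p.1 (x ∘ p.2)) hm fun n hn T => ?_
  change colorSum m 1 {(0, 1)} e x (T.map n.f) = n.sign • colorSum m 1 {(0, 1)} e x T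
  have hf := fun l hl => colorSum_flip e x T (m := m) l hl
  have hx := fun a b ha hb => colorSum_exchange e x T (m := m) a b ha hb
  have ht := fun a b hab => colorSum_transp e x T (m := m) a b hab
  simp only [List.mem_cons, List.not_mem_nil, or_false] at hm
  rcases hm with rfl | rfl | rfl
  · obtain rfl : k = 4 := by omega
    simp only [oneLoopNetwork, List.mem_cons, List.not_mem_nil, or_false] at hn
    rcases hn with rfl | rfl | rfl | rfl | rfl | rfl | rfl
    · exact hf 1 le_rfl
    · exact ht 0 1 (by decide) (by decide)
    · exact ht 1 2 (by decide) (by decide)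
    · exact ht 2 3 (by decide) (by decide)
    · exact ht 0 1 (by decide) (by decide)
    · exact ht 1 2 (by decide) (by decide)
    · exact ht 0 1 (by decide) (by decide)
  · obtain rfl : k = 2 := by omega
    simp only [oneLoopNetwork, List.mem_cons, List.not_mem_nil, or_false] at hn
    rcases hn with rfl | rfl | rfl | rfl
    · exact hf 1 le_rfl
    · exact hf 2 (by decide)
    · exact hx 1 2 le_rfl (by decide)
    · exact ht 0 1 (by decide) (by decide)
  · simp only [oneLoopNetwork, List.mem_cons, List.not_mem_nil, or_false] at hn
    rcases hn with rfl | rfl | rfl | rfl | rfl | rfl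
    · exact hf 1 le_rfl
    · exact hf 2 (by decide)
    · exact hf 3 (by decide)
    · exact hx 1 2 le_rfl (by decide)
    · exact hx 2 3 (by decide) (by decide)
    · exact hx 1 2 le_rfl (by decide)

lemma treeSum_sum {M α : Type*} [AddCommGroup M] (s : Finset α) (a : α → ℤ) (G : α → JTree → M)
    (L : List (ℤ × JTree)) :
    treeSum (fun T => ∑ p ∈ s, a p • G p T) L = ∑ p ∈ s, a p • treeSum (G p) L := by
  induction L with
  | nil => simp [treeSum]
  | cons q L ih =>
    simp only [treeSum_cons, ih, smul_add, Finset.sum_add_distrib, Finset.smul_sum]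
    congr 1
    exact Finset.sum_congr rfl fun p _ => smul_comm _ _ _

/-! ### The two-loop trace of the core element -/

lemma twoLoopTrees_perm : ∀ m ∈ [2, 3, 4], ∀ p ∈ twoLoopTrees m, p.2.legs.Perm (List.range 8) := by
  decide +kernel

/-- The two-loop part of the trees with `m` pairs of dual colours, as a function of the colours of
the four hairs. -/
def twoLoopMap (H : Type*) [AddCommGroup H] [Module ℚ H] (m : ℕ) (hm : m ∈ [2, 3, 4]) :
    MultilinearMap ℚ (fun _ : Fin 4 => H) (HLG H) :=
  hairMap (twoLoopTrees m) (twoLoopTrees_perm m hm)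

/-- Only the colours of the hairs matter. -/
lemma colorSum_twoLoopTrees (hm : m ∈ [2, 3, 4]) :
    treeSum (colorSum m 2 {(0, 1), (2, 3)} e x) (twoLoopTrees m) =
      ∑ p ∈ colorings ι m k, colorCoeff 2 p •
        twoLoopMap H m hm fun j => pairColor e p.1 (x ∘ p.2) (j + 4) := by
  have hcol : ∀ c : ℕ → H, twoLoopMap H m hm (fun j => c (j + 4)) =
      treeSum (treeOf [] {(0, 1), (2, 3)} c) (twoLoopTrees m) := by
    intro c
    refine treeSum_congr fun q hq => ?_
    have hT := twoLoopTrees_perm m hm q hq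
    have h : ∀ c : ℕ → H, _ := fun c => isHairy_two_of_legs_perm hT c
    rw [treeOf_eq (h _), treeOf_eq (h _)]
    refine of_color (h _) fun i hi => ?_
    simp only [Graph.hairs, Graph.legs, List.flatMap_cons, List.flatMap_nil, List.append_nil,
      Finset.mem_sdiff, List.mem_toFinset, hT.mem_iff, List.mem_range] at hi
    obtain ⟨h8, hi⟩ := hi
    interval_cases i
    all_goals first | rfl | exact absurd (by decide) hi
  simp only [hcol]
  exact treeSum_sum _ _ _ _

end

/-! ### Contraction with the symplectic form -/

section

variable {H : Type*} [AddCommGroup H] [Module ℚ H] {J J' : Type*} [Fintype J] [Fintype J']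

/-- The families `v` and `w` are dual bases with respect to the form `ω`. -/
structure IsDualPair (ω : LinearMap.BilinForm ℚ H) (v w : J → H) : Prop where
  left : ∀ y, ∑ p, ω (v p) y • w p = y
  right : ∀ y, ∑ p, ω y (w p) • v p = y

/-- Insertion of the element `∑ p, v p ⊗ w p` into the first two arguments of a multilinear map. -/
def contract {M : Type*} [AddCommGroup M] [Module ℚ M] (v w : J → H) {n : ℕ}
    (F : MultilinearMap ℚ (fun _ : Fin (n + 2) => H) M) : MultilinearMap ℚ (fun _ : Fin n => H) M :=
  ∑ p, (F.curryLeft (v p)).curryLeft (w p)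

variable {M : Type*} [AddCommGroup M] [Module ℚ M] {n : ℕ}

lemma contract_apply (v w : J → H) (F : MultilinearMap ℚ (fun _ : Fin (n + 2) => H) M) (y : Fin n → H) :
    contract v w F y = ∑ p, F (Fin.cons (v p) (Fin.cons (w p) y)) := by
  rw [contract, sum_apply]
  rfl

variable {ω : LinearMap.BilinForm ℚ H}

/-- The element `∑ p, v p ⊗ w p` does not depend on the pair of dual bases. -/
lemma IsDualPair.contract_eq {v w : J → H} {v' w' : J' → H} (h : IsDualPair ω v w)
    (h' : IsDualPair ω v' w') (F : MultilinearMap ℚ (fun _ : Fin (n + 2) => H) M) :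
    contract v w F = contract v' w' F := by
  ext y
  rw [contract_apply, contract_apply]
  let B : H →ₗ[ℚ] H →ₗ[ℚ] M := LinearMap.mk₂ ℚ (fun a b => F (Fin.cons a (Fin.cons b y)))
    (fun a a' b => MultilinearMap.cons_add F _ a a') (fun c a b => MultilinearMap.cons_smul F _ c a)
    (fun a b b' => MultilinearMap.cons_add (F.curryLeft a) _ b b')
    (fun c a b => MultilinearMap.cons_smul (F.curryLeft a) _ c b)
  change ∑ p, B (v p) (w p) = ∑ q, B (v' q) (w' q)
  calc ∑ p, B (v p) (w p) = ∑ p, B (v p) (∑ q, ω (v' q) (w p) • w' q) := by simp only [h'.left]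
    _ = ∑ q, B (∑ p, ω (v' q) (w p) • v p) (w' q) := by
      simp only [map_sum, map_smul, LinearMap.sum_apply]
      exact Finset.sum_comm
    _ = _ := by simp only [h.right]

/-- A multilinear map with values in hairy Lie graphs that is compatible with linear maps of the
colours that preserve `ω`. -/
def IsEquivariant (ω : LinearMap.BilinForm ℚ H) (F : MultilinearMap ℚ (fun _ : Fin n => H) (HLG H)) : Prop :=
  ∀ (φ : Sp ω) (y : Fin n → H), mapHLG (φ : H ≃ₗ[ℚ] H).toLinearMap (F y) = F ((φ : H ≃ₗ[ℚ] H) ∘ y)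

lemma IsDualPair.map {v w : J → H} (h : IsDualPair ω v w) (φ : Sp ω) :
    IsDualPair ω ((φ : H ≃ₗ[ℚ] H) ∘ v) ((φ : H ≃ₗ[ℚ] H) ∘ w) := by
  have hφ : ∀ x y, ω ((φ : H ≃ₗ[ℚ] H) x) y = ω x ((φ : H ≃ₗ[ℚ] H).symm y) := fun x y => by
    conv_lhs => rw [← (φ : H ≃ₗ[ℚ] H).apply_symm_apply y]
    exact φ.2 _ _
  have hφ' : ∀ x y, ω x ((φ : H ≃ₗ[ℚ] H) y) = ω ((φ : H ≃ₗ[ℚ] H).symm x) y := fun x y => by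
    conv_lhs => rw [← (φ : H ≃ₗ[ℚ] H).apply_symm_apply x]
    exact φ.2 _ _
  constructor
  · intro y
    simpa [hφ] using congrArg (φ : H ≃ₗ[ℚ] H) (h.left ((φ : H ≃ₗ[ℚ] H).symm y))
  · intro y
    simpa [hφ'] using congrArg (φ : H ≃ₗ[ℚ] H) (h.right ((φ : H ≃ₗ[ℚ] H).symm y))

lemma IsEquivariant.contract {F : MultilinearMap ℚ (fun _ : Fin (n + 2) => H) (HLG H)}
    (hF : IsEquivariant ω F) {v w : J → H} (h : IsDualPair ω v w) :
    IsEquivariant ω (contract v w F) := by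
  intro φ y
  rw [contract_apply, map_sum, ← (h.map φ).contract_eq h F, contract_apply]
  refine Finset.sum_congr rfl fun p _ => ?_
  rw [hF φ, Fin.comp_cons, Fin.comp_cons]
  rfl

/-- The alternatization of a multilinear map, as a linear map on the exterior power. -/
def extMap (F : MultilinearMap ℚ (fun _ : Fin n => H) M) : ⋀[ℚ]^n H →ₗ[ℚ] M :=
  exteriorPower.alternatingMapLinearEquiv (MultilinearMap.alternatization F)

lemma extMap_ιMulti (F : MultilinearMap ℚ (fun _ : Fin n => H) M) (x : Fin n → H) :
    extMap F (exteriorPower.ιMulti ℚ n x) = ∑ σ : Equiv.Perm (Fin n), (Equiv.Perm.sign σ : ℤ) • F (x ∘ σ) := by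
  rw [extMap, exteriorPower.alternatingMapLinearEquiv_apply_ιMulti, MultilinearMap.alternatization_apply]
  rfl

lemma extMap_mem {F : MultilinearMap ℚ (fun _ : Fin n => H) M} {S : Submodule ℚ M}
    (hF : ∀ y, F y ∈ S) (t : ⋀[ℚ]^n H) : extMap F t ∈ S := by
  have ht : t ∈ Submodule.span ℚ (Set.range (exteriorPower.ιMulti ℚ n (M := H))) := by
    rw [exteriorPower.ιMulti_span]; trivial
  refine (Submodule.span_le (p := S.comap (extMap F))).2 ?_ ht
  rintro _ ⟨x, rfl⟩
  rw [SetLike.mem_coe, Submodule.mem_comap, extMap_ιMulti]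
  exact sum_mem fun σ _ => zsmul_mem (hF _) _

lemma contract_mem {F : MultilinearMap ℚ (fun _ : Fin (n + 2) => H) M} {S : Submodule ℚ M}
    (hF : ∀ y, F y ∈ S) (v w : J → H) (y : Fin n → H) : contract v w F y ∈ S := by
  rw [contract_apply]
  exact sum_mem fun p _ => hF _

lemma IsEquivariant.extMap {F : MultilinearMap ℚ (fun _ : Fin n => H) (HLG H)}
    (hF : IsEquivariant ω F) (φ : Sp ω) (t : ⋀[ℚ]^n H) :
    HairyLie.extMap F (extRep ω n φ t) = hlgRep ω φ (HairyLie.extMap F t) := by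
  suffices h : HairyLie.extMap F ∘ₗ exteriorPower.map n (φ : H ≃ₗ[ℚ] H).toLinearMap =
      mapHLG (φ : H ≃ₗ[ℚ] H).toLinearMap ∘ₗ HairyLie.extMap F from LinearMap.congr_fun h t
  refine exteriorPower.linearMap_ext ?_
  ext x
  simp only [LinearMap.compAlternatingMap_apply, LinearMap.comp_apply]
  rw [exteriorPower.map_apply_ιMulti, extMap_ιMulti, extMap_ιMulti, map_sum]
  refine Finset.sum_congr rfl fun σ _ => ?_
  rw [map_zsmul, hF φ]
  rfl

lemma isEquivariant_twoLoopMap {m : ℕ} (hm : m ∈ [2, 3, 4]) : IsEquivariant ω (twoLoopMap H m hm) :=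
  fun _ y => mapHLG_hairMap _ _ _ y

/-- The sum of the linear maps on the three fundamental representations that are given by three
multilinear maps. -/
def sumMap (ω : LinearMap.BilinForm ℚ H) (F₄ : MultilinearMap ℚ (fun _ : Fin 4 => H) M)
    (F₂ : MultilinearMap ℚ (fun _ : Fin 2 => H) M) (F₀ : MultilinearMap ℚ (fun _ : Fin 0 => H) M) :
    (fundSpace ω 4 × fundSpace ω 2 × fundSpace ω 0) →ₗ[ℚ] M :=
  LinearMap.coprod (extMap F₄ ∘ₗ (fundSpace ω 4).subtype)
    (LinearMap.coprod (extMap F₂ ∘ₗ (fundSpace ω 2).subtype) (extMap F₀ ∘ₗ (fundSpace ω 0).subtype))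

lemma sumMap_apply (F₄ : MultilinearMap ℚ (fun _ : Fin 4 => H) M)
    (F₂ : MultilinearMap ℚ (fun _ : Fin 2 => H) M) (F₀ : MultilinearMap ℚ (fun _ : Fin 0 => H) M)
    (t : fundSpace ω 4 × fundSpace ω 2 × fundSpace ω 0) :
    sumMap ω F₄ F₂ F₀ t = extMap F₄ t.1 + (extMap F₂ t.2.1 + extMap F₀ t.2.2) := rfl

section

variable {F₄ : MultilinearMap ℚ (fun _ : Fin 4 => H) (HLG H)}
  {F₂ : MultilinearMap ℚ (fun _ : Fin 2 => H) (HLG H)} {F₀ : MultilinearMap ℚ (fun _ : Fin 0 => H) (HLG H)}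

lemma sumMap_equivariant (h₄ : IsEquivariant ω F₄) (h₂ : IsEquivariant ω F₂) (h₀ : IsEquivariant ω F₀)
    (φ : Sp ω) (t : fundSpace ω 4 × fundSpace ω 2 × fundSpace ω 0) :
    sumMap ω F₄ F₂ F₀ (((fundRep ω 4).prod ((fundRep ω 2).prod (fundRep ω 0))) φ t) =
      hlgRep ω φ (sumMap ω F₄ F₂ F₀ t) := by
  rw [sumMap_apply, sumMap_apply, map_add, map_add, ← h₄.extMap, ← h₂.extMap, ← h₀.extMap]
  rfl

lemma sumMap_mem {S : Submodule ℚ (HLG H)} (m₄ : ∀ y, F₄ y ∈ S) (m₂ : ∀ y, F₂ y ∈ S) (m₀ : ∀ y, F₀ y ∈ S)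
    (t : fundSpace ω 4 × fundSpace ω 2 × fundSpace ω 0) : sumMap ω F₄ F₂ F₀ t ∈ S :=
  add_mem (extMap_mem m₄ _) (add_mem (extMap_mem m₂ _) (extMap_mem m₀ _))

/-- An equivariant map to the space of trees with two dotted edges gives a homomorphism of
representations. -/
lemma exists_intertwiningMap {V : Type*} [AddCommMonoid V] [Module ℚ V] (ρ : Representation ℚ (Sp ω) V)
    (f : V →ₗ[ℚ] HLG H) (hC : ∀ t, f t ∈ C H 1 2 6) (hf : ∀ φ t, f (ρ φ t) = hlgRep ω φ (f t)) :
    ∃ F : Representation.IntertwiningMap ρ (omegaRep ω 2 6), ∀ t,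
      F t = ((betaImage H 2 6).submoduleOf (C H 1 2 6)).mkQ ⟨f t, hC t⟩ := by
  refine ⟨⟨((betaImage H 2 6).submoduleOf (C H 1 2 6)).mkQ ∘ₗ LinearMap.codRestrict (C H 1 2 6) f hC,
    fun φ => LinearMap.ext fun t => ?_⟩, fun t => rfl⟩
  have key : ∀ z z' : C H 1 2 6, (z' : HLG H) = hlgRep ω φ z →
      ((betaImage H 2 6).submoduleOf (C H 1 2 6)).mkQ z' =
        omegaRep ω 2 6 φ (((betaImage H 2 6).submoduleOf (C H 1 2 6)).mkQ z) := by
    intro z z' h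
    have : z' = treeRep ω 2 6 φ z := Subtype.ext h
    rw [this]
    rfl
  exact key _ _ (hf φ t)

end

end

/-! ### Symplectic bases -/

section

variable {H : Type*} [AddCommGroup H] [Module ℚ H] {ω : LinearMap.BilinForm ℚ H}

lemma alt_swap (hω : ω.IsAlt) (x y : H) : ω x y = -ω y x := (hω.neg_eq y x).symm

/-- The basis vector that is dual to `e p`. -/
def dualVec {ι : Type*} (e : ι × Bool → H) (p : ι × Bool) : H := (dualSign p.2 : ℚ) • e (partner p)

lemma partner_injective {ι : Type*} : Function.Injective (partner (ι := ι)) :=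
  Function.Involutive.injective partner_partner

section

variable {ι : Type*} [DecidableEq ι] {e : ι × Bool → H}

lemma IsHyperbolic.apply_dualVec (he : IsHyperbolic ω e) (p q : ι × Bool) :
    ω (e p) (dualVec e q) = if q = p then 1 else 0 := by
  rw [dualVec, map_smul, he, smul_eq_mul]
  simp only [partner_injective.eq_iff]
  split_ifs with h
  · subst h
    exact_mod_cast dualSign_mul_self q.2
  · exact mul_zero _

variable [Fintype ι]

/-- The component of `y` that is orthogonal to a hyperbolic family. -/
def orthPart (ω : LinearMap.BilinForm ℚ H) (e : ι × Bool → H) (y : H) : H :=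
  y - ∑ p, ω y (dualVec e p) • e p

lemma IsHyperbolic.apply_orthPart (hω : ω.IsAlt) (he : IsHyperbolic ω e) (y : H) (p : ι × Bool) :
    ω (e p) (orthPart ω e y) = 0 := by
  have h : ∀ y, ω (orthPart ω e y) (dualVec e (partner p)) = 0 := fun y => by
    simp [orthPart, he.apply_dualVec, Finset.sum_ite_eq]
  have h' := h y
  rw [dualVec, partner_partner, map_smul, smul_eq_zero] at h'
  rcases h' with h' | h'
  · exfalso
    rcases p with ⟨i, _ | _⟩ <;> simp [partner, dualSign] at h'
  · rw [alt_swap hω, h', neg_zero]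

lemma IsHyperbolic.linearIndependent (he : IsHyperbolic ω e) : LinearIndependent ℚ e := by
  rw [Fintype.linearIndependent_iff]
  intro c hc p
  have := congrArg (fun y => ω y (dualVec e p)) hc
  simpa [he.apply_dualVec] using this

lemma isDualPair_dualVec (hω : ω.IsAlt) (h : ∀ y, orthPart ω e y = 0) :
    IsDualPair ω e (dualVec e) := by
  have hr : ∀ y, ∑ p, ω y (dualVec e p) • e p = y := fun y => (sub_eq_zero.1 (h y)).symm
  refine ⟨fun y => ?_, hr⟩
  conv_rhs => rw [← hr y]
  refine Finset.sum_nbij' partner partner (fun _ _ => Finset.mem_univ _) (fun _ _ => Finset.mem_univ _)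
    (fun p _ => partner_partner p) (fun p _ => partner_partner p) fun p _ => ?_
  rw [dualVec, dualVec, partner_partner, map_smul, smul_smul, alt_swap hω, smul_eq_mul]
  congr 1
  rcases p with ⟨i, _ | _⟩ <;> simp [partner, dualSign]

end

/-- The restriction of a family to the first `n` planes. -/
def firstPlanes (n : ℕ) (e : ℕ × Bool → H) (p : Fin n × Bool) : H := e (p.1, p.2)

lemma exists_hyperbolic_succ [FiniteDimensional ℚ H] (hω : ω.IsAlt) (hnd : ω.Nondegenerate) {n : ℕ}
    {e : ℕ × Bool → H} (he : IsHyperbolic ω (firstPlanes n e)) (hn : 2 * n < Module.finrank ℚ H) :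
    ∃ e' : ℕ × Bool → H, IsHyperbolic ω (firstPlanes (n + 1) e') ∧ ∀ p, p.1 < n → e' p = e p := by
  obtain ⟨u, w, huw⟩ : ∃ u w, ω (orthPart ω (firstPlanes n e) u) (orthPart ω (firstPlanes n e) w) ≠ 0 := by
    by_contra! hcon
    have h0 : ∀ u, orthPart ω (firstPlanes n e) u = 0 := by
      intro u
      refine hnd.1 _ fun w => ?_
      have : w = orthPart ω (firstPlanes n e) w + ∑ p, ω w (dualVec (firstPlanes n e) p) • firstPlanes n e p := by
        simp [orthPart]
      rw [this, map_add, hcon, zero_add, map_sum]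
      refine Finset.sum_eq_zero fun p _ => ?_
      rw [map_smul, alt_swap hω _ (firstPlanes n e p), he.apply_orthPart hω, neg_zero, smul_zero]
    have hspan : Submodule.span ℚ (Set.range (firstPlanes n e)) = ⊤ := by
      rw [eq_top_iff]
      intro y _
      rw [sub_eq_zero.1 (h0 y)]
      exact sum_mem fun p _ => Submodule.smul_mem _ _ (Submodule.subset_span ⟨p, rfl⟩)
    have := finrank_range_le_card (R := ℚ) (firstPlanes n e)
    rw [Set.finrank, hspan, finrank_top] at this
    simp at this
    omega
  set U := orthPart ω (firstPlanes n e) u with hU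
  set W := orthPart ω (firstPlanes n e) w with hW
  have hUo : ∀ i b, i < n → ω (e (i, b)) U = 0 := fun i b hi => he.apply_orthPart hω u (⟨i, hi⟩, b)
  have hWo : ∀ i b, i < n → ω (e (i, b)) W = 0 := fun i b hi => he.apply_orthPart hω w (⟨i, hi⟩, b)
  have hUo' : ∀ i b, i < n → ω U (e (i, b)) = 0 := fun i b hi => by rw [alt_swap hω, hUo i b hi, neg_zero]
  have hWo' : ∀ i b, i < n → ω W (e (i, b)) = 0 := fun i b hi => by rw [alt_swap hω, hWo i b hi, neg_zero]
  refine ⟨fun p => if p.1 < n then e p else if p.2 then (ω U W)⁻¹ • W else U, ?_, fun p hp => if_pos hp⟩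
  rintro ⟨⟨i, hi⟩, b⟩ ⟨⟨j, hj⟩, b'⟩
  simp only [firstPlanes, partner, Prod.mk.injEq, Fin.mk.injEq]
  have hWU : ω W U = -ω U W := alt_swap hω _ _
  by_cases hin : i < n <;> by_cases hjn : j < n
  · rw [if_pos hin, if_pos hjn]
    have := he (⟨i, hin⟩, b) (⟨j, hjn⟩, b')
    simpa [firstPlanes, partner] using this
  · have hne : j ≠ i := by omega
    cases b' <;> simp [hin, hjn, hne, hUo i b hin, hWo i b hin]
  · have hne : j ≠ i := by omega
    cases b <;> simp [hin, hjn, hne, hUo' j b' hjn, hWo' j b' hjn]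
  · rw [if_neg hin, if_neg hjn]
    obtain rfl : i = j := by omega
    cases b <;> cases b' <;> simp [dualSign, hω.self_eq_zero, hWU, huw]

lemma exists_hyperbolic_le [FiniteDimensional ℚ H] (hω : ω.IsAlt) (hnd : ω.Nondegenerate) {g k : ℕ}
    (hdim : Module.finrank ℚ H = 2 * g) {e : ℕ × Bool → H} (he : IsHyperbolic ω (firstPlanes k e)) (hk : k ≤ g) :
    ∃ e' : ℕ × Bool → H, IsHyperbolic ω (firstPlanes g e') ∧ ∀ p, p.1 < k → e' p = e p := by
  obtain ⟨d, rfl⟩ := Nat.exists_eq_add_of_le hk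
  suffices h : ∀ j ≤ d, ∃ e' : ℕ × Bool → H, IsHyperbolic ω (firstPlanes (k + j) e') ∧
      ∀ p, p.1 < k → e' p = e p from h d le_rfl
  intro j hj
  induction j with
  | zero => exact ⟨e, he, fun _ _ => rfl⟩
  | succ j ih =>
    obtain ⟨e₁, h₁, h₁'⟩ := ih (by omega)
    obtain ⟨e₂, h₂, h₂'⟩ := exists_hyperbolic_succ hω hnd h₁ (by omega)
    exact ⟨e₂, h₂, fun p hp => (h₂' p (by omega)).trans (h₁' p hp)⟩

lemma IsHyperbolic.isDualPair_of_finrank [FiniteDimensional ℚ H] (hω : ω.IsAlt) {g : ℕ}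
    (hdim : Module.finrank ℚ H = 2 * g) {e : Fin g × Bool → H} (he : IsHyperbolic ω e) :
    IsDualPair ω e (dualVec e) := by
  refine isDualPair_dualVec hω fun y => ?_
  have hspan : Submodule.span ℚ (Set.range e) = ⊤ := by
    refine he.linearIndependent.span_eq_top_of_card_eq_finrank' ?_
    simp [hdim, mul_comm]
  have hy : y ∈ Submodule.span ℚ (Set.range e) := hspan ▸ Submodule.mem_top
  induction hy using Submodule.span_induction with
  | mem y h =>
    obtain ⟨q, rfl⟩ := h
    simp [orthPart, he.apply_dualVec]
  | zero => simp [orthPart]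
  | add y z _ _ h1 h2 =>
    rw [orthPart, sub_eq_zero] at h1 h2 ⊢
    conv_lhs => rw [h1, h2]
    simp [add_smul, Finset.sum_add_distrib]
  | smul a y _ h1 =>
    rw [orthPart, sub_eq_zero] at h1 ⊢
    conv_lhs => rw [h1]
    simp [Finset.smul_sum, mul_smul]

/-- Linearly independent pairwise orthogonal vectors can be extended to a symplectic basis. -/
lemma exists_hyperbolic_extending [FiniteDimensional ℚ H] (hω : ω.IsAlt) (hnd : ω.Nondegenerate) {g k : ℕ}
    (hdim : Module.finrank ℚ H = 2 * g) (hk : k ≤ g) {x : Fin k → H} (hx : ∀ i j, ω (x i) (x j) = 0)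
    (hli : LinearIndependent ℚ x) :
    ∃ e : ℕ × Bool → H, IsHyperbolic ω (firstPlanes g e) ∧ ∀ i : Fin k, e (i, false) = x i := by
  obtain ⟨z, hz⟩ : ∃ z : Fin k → H, ∀ i j, ω (x i) (z j) = if i = j then 1 else 0 := by
    have : ∀ j, ∃ z, ∀ i, ω (x i) z = if i = j then 1 else 0 := by
      intro j
      obtain ⟨f, hf⟩ : ∃ f : Module.Dual ℚ H, ∀ i, f (x i) = if i = j then 1 else 0 := by
        obtain ⟨f, hf⟩ := LinearMap.exists_extend hli.repr
        refine ⟨(Finsupp.lapply j) ∘ₗ f, fun i => ?_⟩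
        have h1 : f (x i) = hli.repr ⟨x i, Submodule.subset_span ⟨i, rfl⟩⟩ :=
          LinearMap.congr_fun hf ⟨x i, Submodule.subset_span ⟨i, rfl⟩⟩
        rw [LinearMap.comp_apply, h1, hli.repr_eq_single i _ rfl, Finsupp.lapply_apply,
          Finsupp.single_apply]
      refine ⟨-(LinearMap.BilinForm.toDual ω hnd).symm f, fun i => ?_⟩
      rw [map_neg, alt_swap hω, neg_neg, LinearMap.BilinForm.apply_toDual_symm_apply, hf]
    choose z hz using this
    exact ⟨z, fun i j => hz j i⟩
  set y : Fin k → H := fun j => z j + (1 / 2 : ℚ) • ∑ i, ω (z i) (z j) • x i with hy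
  have hxy : ∀ i j, ω (x i) (y j) = if i = j then 1 else 0 := by
    intro i j
    simp [hy, hz, hx]
  have hyy : ∀ i j, ω (y i) (y j) = 0 := by
    intro i j
    have h1 : ∀ i j, ω (z i) (x j) = -if j = i then 1 else 0 := fun i j => by rw [alt_swap hω, hz]
    have h2 : ω (z j) (z i) = -ω (z i) (z j) := alt_swap hω _ _
    simp [hy, hz, hx, h1, h2]
    ring
  have hyx : ∀ i j, ω (y i) (x j) = -if j = i then 1 else 0 := fun i j => by rw [alt_swap hω, hxy]
  let e : ℕ × Bool → H := fun p => if h : p.1 < k then (if p.2 then y ⟨p.1, h⟩ else x ⟨p.1, h⟩) else 0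
  have he : IsHyperbolic ω (firstPlanes k e) := by
    rintro ⟨i, b⟩ ⟨j, b'⟩
    have h1 : ∀ i b, firstPlanes k e (i, b) = if b then y i else x i := fun i b => by
      simp [firstPlanes, e]
    rw [h1, h1]
    rcases eq_or_ne i j with rfl | hij
    · cases b <;> cases b' <;> simp [partner, hx, hxy, hyx, hyy, dualSign]
    · cases b <;> cases b' <;> simp [partner, hx, hxy, hyx, hyy, hij, hij.symm]
  obtain ⟨e', he', h'⟩ := exists_hyperbolic_le hω hnd hdim he hk
  exact ⟨e', he', fun i => by rw [h' _ i.2]; simp [e]⟩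

end

/-! ### The two-loop trace as a contraction -/

section

variable {H : Type*} [AddCommGroup H] [Module ℚ H] {ι : Type*} [DecidableEq ι] [Fintype ι] {n k : ℕ}

lemma card_notMem_planes {κ : Fin n → ι × Bool} (hκ : Function.Injective fun i => (κ i).1) :
    (Finset.univ.filter fun a : ι × Bool => ∀ i, (κ i).1 ≠ a.1).card = (Fintype.card ι - n) * 2 := by
  have : (Finset.univ.filter fun a : ι × Bool => ∀ i, (κ i).1 ≠ a.1) =
      (Finset.univ \ Finset.univ.image fun i => (κ i).1) ×ˢ Finset.univ := by
    ext a; simp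
  rw [this, Finset.card_product, Finset.card_univ_sdiff, Finset.card_image_of_injective _ hκ]
  simp

/-- The plane of the first pair can be chosen outside the planes of the other pairs. -/
lemma sum_colorings_tail {M : Type*} [AddCommMonoid M]
    (F : (Fin n → ι × Bool) × Equiv.Perm (Fin k) → M) :
    ∑ p ∈ colorings ι (n + 1) k, F (Fin.tail p.1, p.2) =
      ((Fintype.card ι - n) * 2) • ∑ p ∈ colorings ι n k, F p := by
  have hmap : ∀ p ∈ colorings ι (n + 1) k, (Fin.tail p.1, p.2) ∈ colorings ι n k := by
    intro p hp
    simp only [colorings, Finset.mem_filter, Finset.mem_univ, true_and] at hp ⊢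
    exact hp.comp (Fin.succ_injective n)
  rw [← Finset.sum_fiberwise_of_maps_to' hmap F, Finset.smul_sum]
  refine Finset.sum_congr rfl fun q hq => ?_
  have hq' := (Finset.mem_filter.1 hq).2
  rw [Finset.sum_const, ← card_notMem_planes hq']
  congr 1
  symm
  refine Finset.card_nbij' (fun a => (Fin.cons a q.1, q.2)) (fun p => p.1 0) ?_ ?_ ?_ ?_
  · intro a ha
    simp only [Finset.coe_filter, Finset.mem_univ, true_and, Set.mem_ofPred_eq] at ha
    simp only [colorings, Finset.coe_filter, Finset.mem_filter, Finset.mem_univ, true_and,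
      Set.mem_ofPred_eq, Fin.tail_cons, and_true]
    intro i j
    refine Fin.cases ?_ (fun i => ?_) i <;> refine Fin.cases ?_ (fun j => ?_) j
    · simp
    · intro h; exact absurd h.symm (ha j)
    · intro h; exact absurd h (ha i)
    · intro h; exact congrArg Fin.succ (hq' h)
  · intro p hp
    simp only [colorings, Finset.coe_filter, Finset.mem_filter, Finset.mem_univ, true_and,
      Set.mem_ofPred_eq] at hp ⊢
    intro i h
    rw [← hp.2] at h
    exact Fin.succ_ne_zero i (hp.1 h)
  · intro a _; rfl
  · intro p hp
    simp only [Finset.coe_filter, Set.mem_ofPred_eq] at hp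
    rw [← hp.2]
    exact Prod.ext (Fin.cons_self_tail p.1) rfl

lemma pairColor_add_two (e : ι × Bool → H) (κ : Fin (n + 1) → ι × Bool) (y : Fin k → H) (i : ℕ) :
    pairColor e κ y (i + 2) = pairColor e (Fin.tail κ) y i := by
  rcases pairColor_cases (m := n) (k := k) i with ⟨j, rfl⟩ | ⟨j, rfl⟩ | ⟨j, rfl⟩ | h
  · rw [pairColor_two_mul]
    exact pairColor_two_mul e κ y j.succ
  · rw [pairColor_two_mul_add_one]
    exact pairColor_two_mul_add_one e κ y j.succ
  · rw [pairColor_add, ← pairColor_add e κ y j]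
    congr 1; ring
  · rw [pairColor_eq_zero _ _ _ h, pairColor_eq_zero _ _ _ (by omega)]

lemma signCoeff_succ (r : ℕ) (κ : Fin (n + 1) → ι × Bool) :
    signCoeff (r + 1) κ = signCoeff r (Fin.tail κ) := by
  rw [signCoeff, Fin.prod_univ_succ]
  simp [signCoeff, Fin.tail]

/-- The colours of the two pairs on the dotted edges can be chosen arbitrarily. -/
lemma colorSum_two_eq (e : ι × Bool → H) (x : Fin k → H) (hm : n + 2 ∈ [2, 3, 4]) :
    treeSum (colorSum (n + 2) 2 {(0, 1), (2, 3)} e x) (twoLoopTrees (n + 2)) =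
      ((Fintype.card ι - (n + 1)) * 2 * ((Fintype.card ι - n) * 2)) • ∑ p ∈ colorings ι n k,
        colorCoeff 0 p • twoLoopMap H (n + 2) hm fun j => pairColor e p.1 (x ∘ p.2) j := by
  rw [colorSum_twoLoopTrees e x hm, mul_smul, ← sum_colorings_tail, ← sum_colorings_tail]
  refine Finset.sum_congr rfl fun p _ => ?_
  simp only [colorCoeff, signCoeff_succ]
  congr 2
  funext j
  rw [← pairColor_add_two, ← pairColor_add_two]

lemma signCoeff_zero (κ : Fin n → ι × Bool) : signCoeff 0 κ = ∏ i, dualSign (κ i).2 := by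
  simp [signCoeff]

lemma sum_colorings_zero {M : Type*} [AddCommMonoid M]
    (F : (Fin 0 → ι × Bool) × Equiv.Perm (Fin k) → M) :
    ∑ p ∈ colorings ι 0 k, F p = ∑ σ, F (![], σ) := by
  have : colorings ι 0 k = Finset.univ := by
    ext p
    simp [colorings, Function.injective_of_subsingleton]
  rw [this, Fintype.sum_prod_type, Fintype.sum_unique]
  exact Finset.sum_congr rfl fun σ _ => congrArg F (Prod.ext (Subsingleton.elim _ _) rfl)

lemma sum_colorings_one {M : Type*} [AddCommMonoid M]
    (F : (Fin 1 → ι × Bool) × Equiv.Perm (Fin k) → M) :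
    ∑ p ∈ colorings ι 1 k, F p = ∑ i, ∑ b, ∑ σ, F (![(i, b)], σ) := by
  have : colorings ι 1 k = Finset.univ := by
    ext p
    simp [colorings, Function.injective_of_subsingleton]
  rw [this, Fintype.sum_prod_type, ← (Equiv.funUnique (Fin 1) (ι × Bool)).symm.sum_comp, Fintype.sum_prod_type]
  refine Finset.sum_congr rfl fun i _ => Finset.sum_congr rfl fun b _ => Finset.sum_congr rfl fun σ _ => ?_
  exact congrArg F (Prod.ext (funext fun j => by simp) rfl)

lemma sum_colorings_two {M : Type*} [AddCommMonoid M]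
    (F : (Fin 2 → ι × Bool) × Equiv.Perm (Fin k) → M) :
    ∑ p ∈ colorings ι 2 k, F p =
      ∑ i, ∑ j ∈ Finset.univ.erase i, ∑ b, ∑ b', ∑ σ, F (![(i, b), (j, b')], σ) := by
  have hinj : ∀ (i j : ι) (b b' : Bool), (Function.Injective fun l => (![(i, b), (j, b')] l).1) ↔ j ≠ i := by
    intro i j b b'
    constructor
    · rintro h rfl
      exact absurd (h (a₁ := 0) (a₂ := 1) rfl) (by decide)
    · intro h a c hac
      fin_cases a <;> fin_cases c <;> simp_all
  rw [colorings, Finset.sum_filter, Fintype.sum_prod_type,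
    ← (finTwoArrowEquiv (ι × Bool)).symm.sum_comp, Fintype.sum_prod_type, Fintype.sum_prod_type]
  refine Finset.sum_congr rfl fun i _ => ?_
  simp only [Fintype.sum_prod_type, finTwoArrowEquiv_symm_apply, hinj]
  rw [Finset.sum_comm, ← Finset.filter_ne', Finset.sum_filter]
  refine Finset.sum_congr rfl fun j _ => ?_
  split_ifs with h
  · rfl
  · simp

end

section

variable {H : Type*} [AddCommGroup H] [Module ℚ H]

lemma treeSum_antisymTrees (c : ℕ → H) {a b : ℕ} (ha : 4 ≤ a) (hb : 4 ≤ b) (L : List (ℤ × JTree)) :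
    treeSum (treeOf [] {(0, 1), (2, 3)} c) (antisymTrees a b L) =
      treeSum (treeOf [] {(0, 1), (2, 3)} c) L -
        treeSum (treeOf [] {(0, 1), (2, 3)} fun i => c (transp a b i)) L := by
  have h : ∀ i < 4, transp a b i = i := fun i hi => by
    rw [transp_eq_swap, Equiv.swap_apply_of_ne_of_ne] <;> omega
  rw [antisymTrees, treeSum_append, sub_eq_add_neg]
  congr 1
  simp only [treeSum, List.map_map, List.sum_neg]
  congr 1
  refine List.map_congr_left fun p _ => ?_
  simp only [Function.comp_apply, neg_smul]
  rw [treeOf_map_perm (transp_eq_swap a b) (D := {(0, 1), (2, 3)}) _ _ (by simp [Finset.image_insert, h])]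

/-- The terms in which the colours of two pairs, or of a pair and a hair, coincide cancel. -/
lemma twoLoopMap_coincidence {m : ℕ} (hm : m ∈ [3, 4]) (hm' : m ∈ [2, 3, 4]) (a b c d : H) (h : c = a)
    (h' : m = 4 → d = b) :
    twoLoopMap H m hm' ![a, b, c, d] - twoLoopMap H m hm' ![b, a, c, d] -
      (twoLoopMap H m hm' ![a, b, d, c] - twoLoopMap H m hm' ![b, a, d, c]) ∈ betaImage H 2 6 := by
  have key := treeSum_coincidence_mem hm (hairColor ![a, b, c, d]) (by simp [hairColor, h])
    (fun hm4 => by simp [hairColor, h' hm4])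
  have h1 : ∀ (a b c d : H) (i : ℕ), hairColor ![a, b, c, d] (transp 4 5 i) = hairColor ![b, a, c, d] i := by
    intro a b c d i
    by_cases hi : i < 8
    · interval_cases i <;> rfl
    · rw [transp_eq_swap, Equiv.swap_apply_of_ne_of_ne (by omega) (by omega)]
      obtain ⟨j, rfl⟩ := Nat.exists_eq_add_of_le' (not_lt.1 hi)
      rfl
  have h2 : ∀ (a b c d : H) (i : ℕ), hairColor ![a, b, c, d] (transp 6 7 i) = hairColor ![a, b, d, c] i := by
    intro a b c d i
    by_cases hi : i < 8
    · interval_cases i <;> rfl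
    · rw [transp_eq_swap, Equiv.swap_apply_of_ne_of_ne (by omega) (by omega)]
      obtain ⟨j, rfl⟩ := Nat.exists_eq_add_of_le' (not_lt.1 hi)
      rfl
  rw [treeSum_antisymTrees _ (by omega) (by omega), treeSum_antisymTrees _ (by omega) (by omega),
    treeSum_antisymTrees _ (by omega) (by omega)] at key
  simp only [h1, h2] at key
  simp only [twoLoopMap, hairMap_apply]
  convert key using 1
  abel

end

section

variable {H : Type*} [AddCommGroup H] [Module ℚ H] {ω : LinearMap.BilinForm ℚ H} {n k g : ℕ}

lemma contract_dualVec_apply {ι M : Type*} [Fintype ι] [AddCommGroup M] [Module ℚ M] (e : ι × Bool → H)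
    (F : MultilinearMap ℚ (fun _ : Fin (n + 2) => H) M) (y : Fin n → H) :
    contract e (dualVec e) F y =
      ∑ i, ∑ b, dualSign b • F (Fin.cons (e (i, b)) (Fin.cons (e (i, !b)) y)) := by
  rw [contract_apply, Fintype.sum_prod_type]
  refine Finset.sum_congr rfl fun i _ => Finset.sum_congr rfl fun b _ => ?_
  rw [dualVec, ← Int.cast_smul_eq_zsmul ℚ]
  exact MultilinearMap.cons_smul (F.curryLeft (e (i, b))) y (dualSign b : ℚ) (e (i, !b))

/-- The planes of a family from number `k` on. -/
def laterPlanes (k n : ℕ) (e : ℕ × Bool → H) (p : Fin n × Bool) : H := e (k + p.1, p.2)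

lemma isHyperbolic_laterPlanes {e : ℕ × Bool → H} (he : IsHyperbolic ω (firstPlanes g e)) :
    IsHyperbolic ω (laterPlanes k (g - k) e) := by
  rintro ⟨⟨i, hi⟩, b⟩ ⟨⟨j, hj⟩, b'⟩
  have := he (⟨k + i, by omega⟩, b) (⟨k + j, by omega⟩, b')
  simpa [firstPlanes, laterPlanes, partner] using this

/-- An element of the kernel of the one-loop trace whose two-loop trace is the sum over all choices of
different planes, outside those of the isotropic vectors. -/
lemma exists_trace_eq (hω : ω.IsAlt) {e : ℕ × Bool → H} (he : IsHyperbolic ω (firstPlanes g e))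
    {x : Fin k → H} (hx : ∀ i j, ω (x i) (x j) = 0) (hex : ∀ i : Fin k, e (i, false) = x i)
    (hn : 2 * n + k = 4) (hm : n + 2 ∈ [2, 3, 4]) (hg : n + k + 2 ≤ g) :
    ∃ t ∈ frakH H 6, trace ω hω 1 t ∈ betaImage H 1 6 ∧ trace ω hω 2 t =
      ∑ p ∈ colorings (Fin (g - k)) n k, colorCoeff 0 p •
        twoLoopMap H (n + 2) hm fun j => pairColor (laterPlanes k (g - k) e) p.1 (x ∘ p.2) j := by
  have he' : IsHyperbolic ω (laterPlanes k (g - k) e) := isHyperbolic_laterPlanes he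
  have hex' : ∀ p i, ω (laterPlanes k (g - k) e p) (x i) = 0 := by
    rintro ⟨⟨i, hi⟩, b⟩ j
    have := he (⟨k + i, by omega⟩, b) (⟨j, by omega⟩, false)
    rw [if_neg (fun h => by have := congrArg (fun q => q.1.val) h; simp [partner] at this; omega)] at this
    rw [← hex]
    exact this
  set N : ℕ := (Fintype.card (Fin (g - k)) - (n + 1)) * 2 * ((Fintype.card (Fin (g - k)) - n) * 2) with hN
  have hN0 : (N : ℚ) ≠ 0 := by
    rw [Nat.cast_ne_zero, hN, Fintype.card_fin]
    refine Nat.mul_ne_zero (Nat.mul_ne_zero ?_ two_ne_zero) (Nat.mul_ne_zero ?_ two_ne_zero) <;> omega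
  refine ⟨(N : ℚ)⁻¹ • coreElement (n + 2) (laterPlanes k (g - k) e) x,
    Submodule.smul_mem _ _ (coreElement_mem_frakH hm _ _), ?_, ?_⟩
  · rw [map_smul, trace_coreElement_one hω he' hx hex' hm]
    exact Submodule.smul_mem _ _ (colorSum_oneLoopTrees_mem _ _ hm (by omega))
  · rw [map_smul, trace_coreElement_two hω he' hx hex' hm, colorSum_two_eq _ _ hm, ← hN,
      ← Nat.cast_smul_eq_nsmul ℚ, smul_smul, inv_mul_cancel₀ hN0, one_smul]

variable (ω) in
/-- The element `z` is, modulo the image of `β ^ 5`, the two-loop trace of an element of the kernel of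
the one-loop trace. -/
def IsTwoLoopTrace (hω : ω.IsAlt) (z : HLG H) : Prop :=
  ∃ t ∈ frakH H 6, trace ω hω 1 t ∈ betaImage H 1 6 ∧ z - trace ω hω 2 t ∈ betaImage H 2 6

lemma isTwoLoopTrace_zero (hω : ω.IsAlt) {e : ℕ × Bool → H} (he : IsHyperbolic ω (firstPlanes g e))
    {x : Fin 4 → H} (hx : ∀ i j, ω (x i) (x j) = 0) (hex : ∀ i : Fin 4, e (i, false) = x i) (hg : 6 ≤ g) :
    IsTwoLoopTrace ω hω (extMap (twoLoopMap H 2 (by simp)) (exteriorPower.ιMulti ℚ 4 x)) := by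
  obtain ⟨t, ht, h1, h2⟩ := exists_trace_eq (n := 0) hω he hx hex rfl (by simp) hg
  refine ⟨t, ht, h1, ?_⟩
  rw [h2, sum_colorings_zero, extMap_ιMulti, sub_eq_zero_of_eq (Finset.sum_congr rfl fun σ _ => ?_)]
  · exact zero_mem _
  · rw [colorCoeff, signCoeff_zero]
    simp only [Finset.univ_eq_empty, Finset.prod_empty, one_mul]
    congr 2
    funext j
    exact (pairColor_add (m := 0) (laterPlanes 4 (g - 4) e) ![] (x ∘ σ) j).symm.trans (by simp)

lemma sum_perm_two {M : Type*} [AddCommMonoid M] (F : Equiv.Perm (Fin 2) → M) :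
    ∑ σ, F σ = F 1 + F (Equiv.swap 0 1) := by
  rw [show (Finset.univ : Finset (Equiv.Perm (Fin 2))) = {1, Equiv.swap 0 1} by decide,
    Finset.sum_pair (by decide)]

lemma isTwoLoopTrace_one (hω : ω.IsAlt) {e : ℕ × Bool → H} (he : IsHyperbolic ω (firstPlanes g e))
    {x : Fin 2 → H} (hx : ∀ i j, ω (x i) (x j) = 0) (hex : ∀ i : Fin 2, e (i, false) = x i) (hg : 6 ≤ g) :
    IsTwoLoopTrace ω hω (extMap (contract (firstPlanes g e) (dualVec (firstPlanes g e))
      (twoLoopMap H 3 (by simp))) (exteriorPower.ιMulti ℚ 2 x)) := by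
  obtain ⟨t, ht, h1, h2⟩ := exists_trace_eq (n := 1) hω he hx hex rfl (by simp) (by omega)
  refine ⟨t, ht, h1, ?_⟩
  set W := twoLoopMap H 3 (by simp) with hW
  let T : ℕ → HLG H := fun i => ∑ b, ∑ σ : Equiv.Perm (Fin 2), (dualSign b * Equiv.Perm.sign σ : ℤ) •
    W ![e (i, b), e (i, !b), x (σ 0), x (σ 1)]
  have hT1 : trace ω hω 2 t = ∑ i ∈ Finset.range (g - 2), T (2 + i) := by
    rw [h2, sum_colorings_one, Finset.sum_range]
    refine Finset.sum_congr rfl fun i _ => Finset.sum_congr rfl fun b _ => Finset.sum_congr rfl fun σ _ => ?_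
    rw [colorCoeff, signCoeff_zero]
    simp only [Fin.prod_univ_one]
    congr 2
    funext j
    fin_cases j <;> rfl
  have hT2 : extMap (contract (firstPlanes g e) (dualVec (firstPlanes g e)) W)
      (exteriorPower.ιMulti ℚ 2 x) = ∑ i ∈ Finset.range g, T i := by
    rw [extMap_ιMulti, Finset.sum_range]
    simp only [contract_dualVec_apply, Finset.smul_sum, T]
    rw [Finset.sum_comm]
    refine Finset.sum_congr rfl fun i _ => ?_
    rw [Finset.sum_comm]
    refine Finset.sum_congr rfl fun b _ => Finset.sum_congr rfl fun σ _ => ?_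
    rw [smul_smul, mul_comm]
    congr 2
    funext j
    fin_cases j <;> rfl
  have hT : ∀ i, T i = W ![e (i, false), e (i, true), x 0, x 1] - W ![e (i, true), e (i, false), x 0, x 1] -
      (W ![e (i, false), e (i, true), x 1, x 0] - W ![e (i, true), e (i, false), x 1, x 0]) := by
    intro i
    simp only [T, Fintype.sum_bool, sum_perm_two]
    simp [dualSign]
    abel
  rw [hT1, hT2, show g = 2 + (g - 2) by omega, Finset.sum_range_add, Finset.sum_range_succ, Finset.sum_range_one]
  have h0 := hex 0
  have h1 := hex 1
  -- in the planes of the isotropic vectors, a colour of the pair coincides with that of a hair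
  have m0 : T 0 ∈ betaImage H 2 6 := by
    rw [hT]
    exact twoLoopMap_coincidence (by simp) (by simp) _ _ _ _ h0.symm (by simp)
  have m1 : T 1 ∈ betaImage H 2 6 := by
    rw [hT, ← neg_mem_iff, neg_sub]
    exact twoLoopMap_coincidence (by simp) (by simp) _ _ _ _ h1.symm (by simp)
  simpa using add_mem m0 m1

lemma isTwoLoopTrace_two (hω : ω.IsAlt) {e : ℕ × Bool → H} (he : IsHyperbolic ω (firstPlanes g e))
    (x : Fin 0 → H) (hg : 6 ≤ g) :
    IsTwoLoopTrace ω hω (extMap (contract (firstPlanes g e) (dualVec (firstPlanes g e))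
      (contract (firstPlanes g e) (dualVec (firstPlanes g e)) (twoLoopMap H 4 (by simp))))
        (exteriorPower.ιMulti ℚ 0 x)) := by
  obtain ⟨t, ht, h1, h2⟩ := exists_trace_eq (n := 2) hω he (x := x) (fun i => i.elim0) (fun i => i.elim0)
    rfl (by simp) (by omega)
  refine ⟨t, ht, h1, ?_⟩
  set W := twoLoopMap H 4 (by simp) with hW
  let T : Fin g → Fin g → HLG H := fun i j => ∑ b, ∑ b', (dualSign b * dualSign b') •
    W ![e (i, b), e (i, !b), e (j, b'), e (j, !b')]
  have hT1 : trace ω hω 2 t = ∑ i, ∑ j ∈ Finset.univ.erase i, T i j := by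
    rw [h2, sum_colorings_two]
    refine Finset.sum_congr rfl fun i _ => Finset.sum_congr rfl fun j _ => Finset.sum_congr rfl fun b _ =>
      Finset.sum_congr rfl fun b' _ => ?_
    rw [Fintype.sum_unique, colorCoeff, signCoeff_zero]
    simp only [Fin.prod_univ_two]
    rw [show Equiv.Perm.sign (default : Equiv.Perm (Fin 0)) = 1 from rfl, Units.val_one, mul_one]
    congr 2
    funext a
    fin_cases a <;> simp [pairColor, laterPlanes, partner]
  have hT2 : extMap (contract (firstPlanes g e) (dualVec (firstPlanes g e))
      (contract (firstPlanes g e) (dualVec (firstPlanes g e)) W)) (exteriorPower.ιMulti ℚ 0 x) =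
      ∑ i, ∑ j, T i j := by
    rw [extMap_ιMulti, Fintype.sum_unique,
      show Equiv.Perm.sign (default : Equiv.Perm (Fin 0)) = 1 from rfl, Units.val_one, one_smul, Finset.sum_comm]
    simp only [contract_dualVec_apply, Finset.smul_sum, T]
    refine Finset.sum_congr rfl fun j _ => ?_
    rw [Finset.sum_comm]
    refine Finset.sum_congr rfl fun i _ => ?_
    rw [Finset.sum_comm]
    refine Finset.sum_congr rfl fun b _ => Finset.sum_congr rfl fun b' _ => ?_
    rw [smul_smul, mul_comm]
    congr 2
    funext a
    fin_cases a <;> rfl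
  have hT : ∀ i, T i i ∈ betaImage H 2 6 := by
    intro i
    have := twoLoopMap_coincidence (m := 4) (by simp) (by simp) (e (i, false)) (e (i, true))
      (e (i, false)) (e (i, true)) rfl fun _ => rfl
    convert this using 1
    simp only [T, Fintype.sum_bool]
    simp [dualSign]
    abel
  rw [hT1, hT2, ← Finset.sum_sub_distrib]
  refine sum_mem fun i _ => ?_
  rw [← Finset.add_sum_erase _ _ (Finset.mem_univ i), add_sub_cancel_right]
  exact hT i

end

/-! ### Contractions of determinants -/

section

variable {H : Type*} [AddCommGroup H] [Module ℚ H] {ω : LinearMap.BilinForm ℚ H} {n : ℕ}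

/-- The determinant of the values of the linear forms `φ`, as a function of the vectors. -/
def detForm (φ : Fin n → Module.Dual ℚ H) : MultilinearMap ℚ (fun _ : Fin n => H) ℚ :=
  (Matrix.detRowAlternating.compLinearMap (LinearMap.pi φ)).toMultilinearMap

lemma detForm_apply (φ : Fin n → Module.Dual ℚ H) (y : Fin n → H) :
    detForm φ y = Matrix.det (Matrix.of fun i d => φ d (y i)) := rfl

lemma extMap_detForm (φ : Fin n → Module.Dual ℚ H) :
    extMap (detForm φ) = n.factorial • exteriorPower.pairingDual ℚ H n (exteriorPower.ιMulti ℚ n φ) := by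
  refine exteriorPower.linearMap_ext ?_
  ext x
  simp only [LinearMap.compAlternatingMap_apply, LinearMap.smul_apply]
  rw [exteriorPower.pairingDual_ιMulti_ιMulti, extMap, detForm, AlternatingMap.coe_alternatization,
    exteriorPower.alternatingMapLinearEquiv_apply_ιMulti, Fintype.card_fin]
  congr 1

/-- Determinants of linear forms separate the elements of an exterior power. -/
lemma eq_zero_of_extMap_detForm {t : ⋀[ℚ]^n H} (h : ∀ φ, extMap (detForm φ) t = 0) : t = 0 := by
  let b := Module.Free.chooseBasis ℚ H
  obtain ⟨hI, -⟩ := exists_wellFoundedLT (Module.Free.ChooseBasisIndex ℚ H)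
  refine (b.exteriorPower n).ext_elem fun s => ?_
  have := h fun i => b.coord (Set.powersetCard.ofFinEmbEquiv.symm s i)
  rw [extMap_detForm, LinearMap.smul_apply, smul_eq_zero] at this
  rw [exteriorPower.basis_repr_apply, map_zero, Finsupp.zero_apply]
  exact this.resolve_left n.factorial_ne_zero

/-- A linear relation between multilinear maps that holds on tuples of orthogonal vectors holds for the
induced maps on the fundamental representation. -/
lemma sum_extMap {J : Type*} [Fintype J] {F : J → MultilinearMap ℚ (fun _ : Fin n => H) ℚ}
    {G : MultilinearMap ℚ (fun _ : Fin n => H) ℚ} {c : ℚ}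
    (h : ∀ y, (∀ i j, ω (y i) (y j) = 0) → ∑ l, F l y = c * G y) {t : ⋀[ℚ]^n H} (ht : t ∈ fundSpace ω n) :
    ∑ l, extMap (F l) t = c * extMap G t := by
  induction ht using Submodule.span_induction with
  | mem t ht =>
    obtain ⟨x, hx, rfl⟩ := ht
    simp only [extMap_ιMulti, Finset.mul_sum]
    rw [Finset.sum_comm]
    refine Finset.sum_congr rfl fun σ _ => ?_
    rw [← Finset.smul_sum, h (x ∘ σ) fun i j => hx _ _, mul_smul_comm]
  | zero => simp
  | add t t' _ _ ht ht' => simp only [map_add, Finset.sum_add_distrib, ht, ht', mul_add]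
  | smul a t _ ht => simp only [map_smul, ← Finset.smul_sum, ht, mul_smul_comm]

lemma detForm_two (φ : Fin 2 → Module.Dual ℚ H) (y : Fin 2 → H) :
    detForm φ y = φ 0 (y 0) * φ 1 (y 1) - φ 0 (y 1) * φ 1 (y 0) := by
  rw [detForm_apply, Matrix.det_fin_two]
  simp only [Matrix.of_apply]
  ring

/-- The expansion of a determinant along its first two columns. -/
lemma detForm_four (φ : Fin 4 → Module.Dual ℚ H) (y : Fin 4 → H) :
    detForm φ y =
      let D := fun a b => φ 0 (y a) * φ 1 (y b) - φ 0 (y b) * φ 1 (y a)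
      let E := fun a b => φ 2 (y a) * φ 3 (y b) - φ 2 (y b) * φ 3 (y a)
      D 0 1 * E 2 3 - D 0 2 * E 1 3 + D 0 3 * E 1 2 + D 1 2 * E 0 3 - D 1 3 * E 0 2 + D 2 3 * E 0 1 := by
  rw [detForm_apply]
  simp [Matrix.det_succ_row_zero, Fin.sum_univ_succ, Fin.succAbove]
  ring

variable {J : Type*} [Fintype J] {v w : J → H}

lemma IsDualPair.sum_mul (h : IsDualPair ω v w) (x y : H) : ∑ l, ω (v l) x * ω (w l) y = ω x y := by
  conv_rhs => rw [← h.left x]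
  simp

/-- The contraction of a determinant in the linear forms. -/
lemma sum_detForm_two (hω : ω.IsAlt) (h : IsDualPair ω v w) (y : Fin 2 → H) :
    ∑ l, detForm ![ω (v l), ω (w l)] y = 2 * ω (y 0) (y 1) := by
  simp only [detForm_two, Finset.sum_sub_distrib]
  simp [h.sum_mul, alt_swap hω (y 1) (y 0)]
  ring

lemma sum_detForm_four (hω : ω.IsAlt) (h : IsDualPair ω v w) (φ : Fin 2 → Module.Dual ℚ H) (y : Fin 4 → H) :
    ∑ l, detForm ![φ 0, φ 1, ω (v l), ω (w l)] y =
      let D := fun a b => φ 0 (y a) * φ 1 (y b) - φ 0 (y b) * φ 1 (y a)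
      2 * (D 0 1 * ω (y 2) (y 3) - D 0 2 * ω (y 1) (y 3) + D 0 3 * ω (y 1) (y 2) + D 1 2 * ω (y 0) (y 3) -
        D 1 3 * ω (y 0) (y 2) + D 2 3 * ω (y 0) (y 1)) := by
  have hE : ∀ a b, ∑ l, (ω (v l) (y a) * ω (w l) (y b) - ω (v l) (y b) * ω (w l) (y a)) =
      2 * ω (y a) (y b) := fun a b => by
    rw [Finset.sum_sub_distrib, h.sum_mul, h.sum_mul, alt_swap hω (y b)]
    ring
  simp only [detForm_four, Finset.sum_sub_distrib, Finset.sum_add_distrib, Matrix.cons_val, ← Finset.mul_sum]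
  simp only [← Finset.sum_sub_distrib, hE]
  ring

/-- The contraction in the linear forms and in the vectors. The second term vanishes on orthogonal vectors. -/
lemma sum_contract_detForm (hω : ω.IsAlt) (h : IsDualPair ω v w) (h1 : ∀ p, ω (v p) (w p) = 1)
    (φ : Fin 2 → Module.Dual ℚ H) (y : Fin 2 → H) :
    ∑ l, contract v w (detForm ![φ 0, φ 1, ω (v l), ω (w l)]) y =
      2 * (Fintype.card J - 4) * detForm φ y + 2 * ω (y 0) (y 1) * ∑ p, detForm φ ![v p, w p] := by
  have hr : ∀ (ψ : Module.Dual ℚ H) (x : H), ∑ p, ψ (v p) * ω (w p) x = -ψ x := fun ψ x => by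
    conv_rhs => rw [← h.right x]
    simp [alt_swap hω _ x, mul_comm]
  have hl : ∀ (ψ : Module.Dual ℚ H) (x : H), ∑ p, ψ (w p) * ω (v p) x = ψ x := fun ψ x => by
    conv_rhs => rw [← h.left x]
    simp [mul_comm]
  simp only [contract_apply]
  rw [Finset.sum_comm]
  simp only [sum_detForm_four hω h]
  have : ∀ p, 2 * 
      (detForm φ ![v p, w p] * ω (y 0) (y 1) - (φ 1 (y 0) * (φ 0 (v p) * ω (w p) (y 1)) - φ 0 (y 0) * (φ 1 (v p) * ω (w p) (y 1)))
      + (φ 1 (y 1) * (φ 0 (v p) * ω (w p) (y 0)) - φ 0 (y 1) * (φ 1 (v p) * ω (w p) (y 0)))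
      + (φ 1 (y 0) * (φ 0 (w p) * ω (v p) (y 1)) - φ 0 (y 0) * (φ 1 (w p) * ω (v p) (y 1)))
      - (φ 1 (y 1) * (φ 0 (w p) * ω (v p) (y 0)) - φ 0 (y 1) * (φ 1 (w p) * ω (v p) (y 0)))
      + detForm φ y) = 
      2 *
      ((φ 0 (v p) * φ 1 (w p) - φ 0 (w p) * φ 1 (v p)) * ω (y 0) (y 1) -
              (φ 0 (v p) * φ 1 (y 0) - φ 0 (y 0) * φ 1 (v p)) * ω (w p) (y 1) +
            (φ 0 (v p) * φ 1 (y 1) - φ 0 (y 1) * φ 1 (v p)) * ω (w p) (y 0) +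
          (φ 0 (w p) * φ 1 (y 0) - φ 0 (y 0) * φ 1 (w p)) * ω (v p) (y 1) -
        (φ 0 (w p) * φ 1 (y 1) - φ 0 (y 1) * φ 1 (w p)) * ω (v p) (y 0) +
      (φ 0 (y 0) * φ 1 (y 1) - φ 0 (y 1) * φ 1 (y 0)) * ω (v p) (w p)) := fun p => by
    rw [h1, detForm_two, detForm_two]
    simp only [Matrix.cons_val]
    ring
  refine (Finset.sum_congr rfl fun p _ => (this p).symm).trans ?_
  simp only [Finset.sum_sub_distrib, Finset.sum_add_distrib, ← Finset.mul_sum, ← Finset.sum_mul, hr, hl,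
    Finset.sum_const, Finset.card_univ, nsmul_eq_mul]
  rw [detForm_two φ y]
  ring

lemma sum_contract_contract_detForm (hω : ω.IsAlt) (h : IsDualPair ω v w) (h1 : ∀ p, ω (v p) (w p) = 1)
    (φ : Fin 2 → Module.Dual ℚ H) (y : Fin 0 → H) :
    ∑ l, contract v w (contract v w (detForm ![φ 0, φ 1, ω (v l), ω (w l)])) y =
      (4 * Fintype.card J - 8) * ∑ p, detForm φ ![v p, w p] := by
  have hc : ∀ q, (Fin.cons (v q) (Fin.cons (w q) y) : Fin 2 → H) = ![v q, w q] := fun q => by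
    congr 2
    exact Subsingleton.elim _ _
  simp only [contract_apply v w _ y]
  rw [Finset.sum_comm]
  simp only [hc, sum_contract_detForm hω h h1, Finset.sum_add_distrib, ← Finset.mul_sum, ← Finset.sum_mul]
  simp [h1]
  ring

lemma sum_sum_detForm_two (hω : ω.IsAlt) (h : IsDualPair ω v w) (h1 : ∀ p, ω (v p) (w p) = 1) :
    ∑ l, ∑ p, detForm ![ω (v l), ω (w l)] ![v p, w p] = 2 * Fintype.card J := by
  rw [Finset.sum_comm]
  simp [sum_detForm_two hω h, h1]
  ring

/-- The contractions of the determinants separate the three fundamental representations. -/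
lemma eq_zero_of_relation (hω : ω.IsAlt) (h : IsDualPair ω v w) (h1 : ∀ p, ω (v p) (w p) = 1)
    (hJ : 4 < Fintype.card J) {a b c : ℚ} (ha : a ≠ 0) (hb : b ≠ 0) (hc : c ≠ 0) {t : ⋀[ℚ]^4 H}
    (ht : t ∈ fundSpace ω 4) {u : ⋀[ℚ]^2 H} (hu : u ∈ fundSpace ω 2) {s : ⋀[ℚ]^0 H} (hs : s ∈ fundSpace ω 0)
    (H0 : ∀ φ : Fin 4 → Module.Dual ℚ H, a * extMap (detForm φ) t + (b * extMap (contract v w (detForm φ)) u +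
      c * extMap (contract v w (contract v w (detForm φ))) s) = 0) : t = 0 ∧ u = 0 ∧ s = 0 := by
  have hJ' : (4 : ℚ) < Fintype.card J := by exact_mod_cast hJ
  have key : ∀ φ : Fin 2 → Module.Dual ℚ H, b * (2 * (Fintype.card J - 4) * extMap (detForm φ) u) +
      c * (((4 * Fintype.card J - 8) * ∑ p, detForm φ ![v p, w p]) *
        extMap (detForm (Fin.elim0 : Fin 0 → Module.Dual ℚ H)) s) = 0 := by
    intro φ
    -- contracting the last two forms kills the part in degree four
    let ψ : J → Fin 4 → Module.Dual ℚ H := fun l => ![φ 0, φ 1, ω (v l), ω (w l)]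
    have e4 : ∑ l, extMap (detForm (ψ l)) t = 0 * extMap (detForm 0) t :=
      sum_extMap (fun y hy => by rw [sum_detForm_four hω h]; simp [hy]) ht
    have e2 : ∑ l, extMap (contract v w (detForm (ψ l))) u =
        2 * (Fintype.card J - 4) * extMap (detForm φ) u :=
      sum_extMap (fun y hy => by rw [sum_contract_detForm hω h h1, hy]; ring) hu
    have e0 : ∑ l, extMap (contract v w (contract v w (detForm (ψ l)))) s =
        (4 * Fintype.card J - 8) * (∑ p, detForm φ ![v p, w p]) * extMap (detForm Fin.elim0) s :=
      sum_extMap (fun y hy => by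
        rw [sum_contract_contract_detForm hω h h1, detForm_apply, Matrix.det_isEmpty, mul_one]) hs
    have := Finset.sum_eq_zero fun l (_ : l ∈ Finset.univ) => H0 (ψ l)
    rwa [Finset.sum_add_distrib, Finset.sum_add_distrib, ← Finset.mul_sum, ← Finset.mul_sum, ← Finset.mul_sum,
      e4, e2, e0, zero_mul, mul_zero, zero_add] at this
  -- contracting the remaining two forms also kills the part in degree two
  have hs0 : extMap (detForm (Fin.elim0 : Fin 0 → Module.Dual ℚ H)) s = 0 := by
    have := Finset.sum_congr (rfl : (Finset.univ : Finset J) = _) fun l _ => key ![ω (v l), ω (w l)]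
    rw [Finset.sum_add_distrib, ← Finset.mul_sum, ← Finset.mul_sum, ← Finset.mul_sum, ← Finset.sum_mul,
      ← Finset.mul_sum, sum_sum_detForm_two hω h h1,
      sum_extMap (G := detForm ![0, 0]) (c := 0) (fun y hy => ?_) hu] at this
    · have h3 : (4 * Fintype.card J - 8 : ℚ) * (2 * Fintype.card J) ≠ 0 :=
        mul_ne_zero (by linarith) (by linarith)
      simpa [hc, h3] using this
    · rw [sum_detForm_two hω h, hy]
      simp
  have hs' : s = 0 := eq_zero_of_extMap_detForm fun φ => by rwa [Subsingleton.elim φ Fin.elim0]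
  have hu' : u = 0 := eq_zero_of_extMap_detForm fun φ => by
    have h3 : (2 * (Fintype.card J - 4) : ℚ) ≠ 0 := mul_ne_zero two_ne_zero (by linarith)
    have := key φ
    rw [hs0, mul_zero, mul_zero, add_zero] at this
    exact (mul_eq_zero.1 ((mul_eq_zero.1 this).resolve_left hb)).resolve_left h3
  refine ⟨eq_zero_of_extMap_detForm fun φ => ?_, hu', hs'⟩
  have := H0 φ
  rw [hs', hu', map_zero, map_zero, mul_zero, mul_zero, add_zero, add_zero] at this
  exact (mul_eq_zero.1 this).resolve_left ha

lemma fastSum_twoLoopTrees_ne_zero {m : ℕ} (hm : m ∈ [2, 3, 4]) : fastSum (twoLoopTrees m) ≠ 0 := by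
  revert m
  decide +kernel

lemma detector_twoLoopMap (φ : Fin 4 → Module.Dual ℚ H) {m : ℕ} (hm : m ∈ [2, 3, 4]) (y : Fin 4 → H) :
    detector φ (twoLoopMap H m hm y) = fastSum (twoLoopTrees m) * detForm φ y :=
  detector_hairMap φ _ _ y

end

/-! ### The map on the fundamental representations -/

section

variable {H : Type*} [AddCommGroup H] [Module ℚ H] {ω : LinearMap.BilinForm ℚ H} {g : ℕ}

lemma map_extMap {M : Type*} [AddCommGroup M] [Module ℚ M] {n : ℕ} (L : M →ₗ[ℚ] ℚ)
    {F : MultilinearMap ℚ (fun _ : Fin n => H) M} {G : MultilinearMap ℚ (fun _ : Fin n => H) ℚ} {c : ℚ}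
    (h : ∀ y, L (F y) = c * G y) (t : ⋀[ℚ]^n H) : L (extMap F t) = c * extMap G t := by
  suffices h' : L ∘ₗ extMap F = c • extMap G from LinearMap.congr_fun h' t
  refine exteriorPower.linearMap_ext ?_
  ext x
  simp only [LinearMap.compAlternatingMap_apply, LinearMap.comp_apply, LinearMap.smul_apply]
  rw [extMap_ιMulti, extMap_ιMulti, map_sum, Finset.smul_sum]
  refine Finset.sum_congr rfl fun σ _ => ?_
  rw [map_zsmul, h, smul_comm c, smul_eq_mul]

/-- The sum of the contracted two-loop maps on the three fundamental representations. -/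
def bottomMap (ω : LinearMap.BilinForm ℚ H) (e : Fin g × Bool → H) :
    (fundSpace ω 4 × fundSpace ω 2 × fundSpace ω 0) →ₗ[ℚ] HLG H :=
  sumMap ω (twoLoopMap H 2 (by simp)) (contract e (dualVec e) (twoLoopMap H 3 (by simp)))
    (contract e (dualVec e) (contract e (dualVec e) (twoLoopMap H 4 (by simp))))

lemma eq_zero_of_bottomMap_mem [FiniteDimensional ℚ H] (hω : ω.IsAlt) (hg : 6 ≤ g)
    (hdim : Module.finrank ℚ H = 2 * g) {e : Fin g × Bool → H} (he : IsHyperbolic ω e)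
    {t : fundSpace ω 4 × fundSpace ω 2 × fundSpace ω 0} (ht : bottomMap ω e t ∈ betaImage H 2 6) : t = 0 := by
  have hκ : ∀ {m : ℕ}, m ∈ [2, 3, 4] → (fastSum (twoLoopTrees m) : ℚ) ≠ 0 := fun hm =>
    Int.cast_ne_zero.2 (fastSum_twoLoopTrees_ne_zero hm)
  obtain ⟨t, u, s⟩ := t
  obtain ⟨h4, h2, h0⟩ := eq_zero_of_relation hω (he.isDualPair_of_finrank hω hdim)
    (fun p => by rw [he.apply_dualVec, if_pos rfl])
    (by rw [Fintype.card_prod, Fintype.card_fin, Fintype.card_bool]; omega)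
    (hκ (m := 2) (by simp)) (hκ (m := 3) (by simp)) (hκ (m := 4) (by simp)) t.2 u.2 s.2 fun φ => by
      have := detector_eq_zero φ ht
      rw [bottomMap, sumMap_apply, map_add, map_add, map_extMap _ (detector_twoLoopMap φ _),
        map_extMap (G := contract e (dualVec e) (detForm φ)) (c := fastSum (twoLoopTrees 3)) _ fun y => ?_,
        map_extMap (G := contract e (dualVec e) (contract e (dualVec e) (detForm φ)))
          (c := fastSum (twoLoopTrees 4)) _ fun y => ?_] at this
      · exact this
      · simp only [contract_apply, map_sum, Finset.mul_sum]
        exact Finset.sum_congr rfl fun p _ => Finset.sum_congr rfl fun q _ => detector_twoLoopMap φ _ _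
      · simp only [contract_apply, map_sum, Finset.mul_sum]
        exact Finset.sum_congr rfl fun p _ => detector_twoLoopMap φ _ _
  exact Prod.ext (Subtype.ext h4) (Prod.ext (Subtype.ext h2) (Subtype.ext h0))

lemma isTwoLoopTrace_zero_mem (hω : ω.IsAlt) : IsTwoLoopTrace ω hω 0 :=
  ⟨0, zero_mem _, by rw [map_zero]; exact zero_mem _, by rw [map_zero, sub_zero]; exact zero_mem _⟩

lemma IsTwoLoopTrace.add {hω : ω.IsAlt} {z z' : HLG H} (h : IsTwoLoopTrace ω hω z)
    (h' : IsTwoLoopTrace ω hω z') : IsTwoLoopTrace ω hω (z + z') := by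
  obtain ⟨t, ht, h1, h2⟩ := h
  obtain ⟨t', ht', h1', h2'⟩ := h'
  refine ⟨t + t', add_mem ht ht', by rw [map_add]; exact add_mem h1 h1', ?_⟩
  rw [map_add, add_sub_add_comm]
  exact add_mem h2 h2'

lemma IsTwoLoopTrace.smul {hω : ω.IsAlt} {z : HLG H} (h : IsTwoLoopTrace ω hω z) (c : ℚ) :
    IsTwoLoopTrace ω hω (c • z) := by
  obtain ⟨t, ht, h1, h2⟩ := h
  refine ⟨c • t, Submodule.smul_mem _ c ht, by rw [map_smul]; exact Submodule.smul_mem _ c h1, ?_⟩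
  rw [map_smul, ← smul_sub]
  exact Submodule.smul_mem _ c h2

/-- It is enough to test independent families of orthogonal vectors, which extend to hyperbolic bases. -/
lemma isTwoLoopTrace_extMap [FiniteDimensional ℚ H] (hω : ω.IsAlt) (hnd : ω.Nondegenerate)
    (hdim : Module.finrank ℚ H = 2 * g) {k : ℕ} (hk : k ≤ g) {F : MultilinearMap ℚ (fun _ : Fin k => H) (HLG H)}
    (hF : ∀ (e : ℕ × Bool → H) (x : Fin k → H), IsHyperbolic ω (firstPlanes g e) →
      (∀ i j, ω (x i) (x j) = 0) → (∀ i : Fin k, e (i, false) = x i) →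
      IsTwoLoopTrace ω hω (extMap F (exteriorPower.ιMulti ℚ k x)))
    {t : ⋀[ℚ]^k H} (ht : t ∈ fundSpace ω k) : IsTwoLoopTrace ω hω (extMap F t) := by
  induction ht using Submodule.span_induction with
  | mem t ht =>
    obtain ⟨x, hx, rfl⟩ := ht
    by_cases hli : LinearIndependent ℚ x
    · obtain ⟨e, he, hex⟩ := exists_hyperbolic_extending hω hnd hdim hk hx hli
      exact hF e x he hx hex
    · rw [AlternatingMap.map_linearDependent _ x hli, map_zero]
      exact isTwoLoopTrace_zero_mem hω
  | zero =>
    rw [map_zero]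
    exact isTwoLoopTrace_zero_mem hω
  | add t t' _ _ ht ht' =>
    rw [map_add]
    exact ht.add ht'
  | smul c t _ ht =>
    rw [map_smul]
    exact ht.smul c

lemma isTwoLoopTrace_bottomMap [FiniteDimensional ℚ H] (hω : ω.IsAlt) (hnd : ω.Nondegenerate) (hg : 6 ≤ g)
    (hdim : Module.finrank ℚ H = 2 * g) {e : Fin g × Bool → H} (he : IsHyperbolic ω e)
    (t : fundSpace ω 4 × fundSpace ω 2 × fundSpace ω 0) : IsTwoLoopTrace ω hω (bottomMap ω e t) := by
  have hd := he.isDualPair_of_finrank hω hdim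
  have hd' : ∀ {e' : ℕ × Bool → H}, IsHyperbolic ω (firstPlanes g e') →
      IsDualPair ω (firstPlanes g e') (dualVec (firstPlanes g e')) := fun he' =>
    he'.isDualPair_of_finrank hω hdim
  refine (isTwoLoopTrace_extMap hω hnd hdim (by omega) (fun e' x he' hx hex => ?_) t.1.2).add
    ((isTwoLoopTrace_extMap hω hnd hdim (by omega) (fun e' x he' hx hex => ?_) t.2.1.2).add
      (isTwoLoopTrace_extMap hω hnd hdim (by omega) (fun e' x he' hx hex => ?_) t.2.2.2))
  · exact isTwoLoopTrace_zero hω he' hx hex hg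
  · rw [hd.contract_eq (hd' he')]
    exact isTwoLoopTrace_one hω he' hx hex hg
  · rw [hd.contract_eq (hd' he'), hd.contract_eq (hd' he')]
    exact isTwoLoopTrace_two hω he' x hg

lemma bottomMap_mem_C (e : Fin g × Bool → H) (t : fundSpace ω 4 × fundSpace ω 2 × fundSpace ω 0) :
    bottomMap ω e t ∈ C H 1 2 6 :=
  sumMap_mem (fun y => hairMap_mem_C _ _ y) (contract_mem (fun y => hairMap_mem_C _ _ y) _ _)
    (contract_mem (contract_mem (fun y => hairMap_mem_C _ _ y) _ _) _ _) t

lemma bottomMap_equivariant {e : Fin g × Bool → H} (hd : IsDualPair ω e (dualVec e)) (φ : Sp ω)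
    (t : fundSpace ω 4 × fundSpace ω 2 × fundSpace ω 0) :
    bottomMap ω e (((fundRep ω 4).prod ((fundRep ω 2).prod (fundRep ω 0))) φ t) =
      hlgRep ω φ (bottomMap ω e t) :=
  sumMap_equivariant (isEquivariant_twoLoopMap _) ((isEquivariant_twoLoopMap _).contract hd)
    (((isEquivariant_twoLoopMap _).contract hd).contract hd) φ t

lemma IsTwoLoopTrace.mkQ_mem {hω : ω.IsAlt} {z : HLG H} (h : IsTwoLoopTrace ω hω z) (hz : z ∈ C H 1 2 6) :
    ((betaImage H 2 6).submoduleOf (C H 1 2 6)).mkQ ⟨z, hz⟩ ∈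
      (LinearMap.ker (loopTrace ω hω 1 6)).map (loopTrace ω hω 2 6) := by
  obtain ⟨t, ht, h1, h2⟩ := h
  refine ⟨⟨t, ht⟩, (Submodule.Quotient.mk_eq_zero _).2 h1, ?_⟩
  exact ((Submodule.Quotient.eq ((betaImage H 2 6).submoduleOf (C H 1 2 6))).2 h2).symm

end

end HairyLie

end

theorem proposition4p4 {H : Type*} [AddCommGroup H] [Module ℚ H]
    (ω : LinearMap.BilinForm ℚ H) (hω : ω.IsAlt) (hnd : ω.Nondegenerate)
    (g : ℕ) (hg : 6 ≤ g) (hdim : Module.finrank ℚ H = 2 * g) :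
    ∃ f : Representation.IntertwiningMap
        ((HairyLie.fundRep ω 4).prod ((HairyLie.fundRep ω 2).prod (HairyLie.fundRep ω 0)))
        (HairyLie.omegaRep ω 2 6),
      Function.Injective f ∧
        LinearMap.range f.toLinearMap ≤
          (LinearMap.ker (HairyLie.loopTrace ω hω 1 6)).map (HairyLie.loopTrace ω hω 2 6) := by
  have : FiniteDimensional ℚ H := Module.finite_of_finrank_pos (by omega)
  obtain ⟨e', he, -⟩ := HairyLie.exists_hyperbolic_extending hω hnd hdim (Nat.zero_le g)
    (x := Fin.elim0) (fun i => i.elim0) (linearIndependent_empty_type)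
  set e := HairyLie.firstPlanes g e'
  obtain ⟨f, hf⟩ := HairyLie.exists_intertwiningMap _ (HairyLie.bottomMap ω e)
    (HairyLie.bottomMap_mem_C e) (HairyLie.bottomMap_equivariant (he.isDualPair_of_finrank hω hdim))
  refine ⟨f, ?_, ?_⟩
  · intro t t' h
    have h' := (hf t).symm.trans (h.trans (hf t'))
    rw [Submodule.mkQ_apply, Submodule.mkQ_apply, Submodule.Quotient.eq] at h'
    refine sub_eq_zero.1 (HairyLie.eq_zero_of_bottomMap_mem hω hg hdim he ?_)
    rw [map_sub]
    exact h'
  · rintro _ ⟨t, rfl⟩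
    have := (HairyLie.isTwoLoopTrace_bottomMap hω hnd hg hdim he t).mkQ_mem (HairyLie.bottomMap_mem_C e t)
    rw [← hf] at this
    exact this
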